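/- Let $n\ge 1$, $s\in(0,1)$, $0<\lambda\le\Lambda$, $\alpha\in(0,s)$, and let $K$ satisfy, for $h\in\mathbb R^n\setminus\{0\}$, $$K(h)=|h|^{-n-2s}K(h/|h|),\qquad \lambda\le K(h/|h|)=K(-h/|h|)\le\Lambda,\qquad K\in C^{5+2\alpha}(\mathbb S^{n-1}).$$ For a kernel $I$ put $\mathcal L(I)(f)(x)=2\,\mathrm{p.v.}\!\int_{\mathbb R^n}(f(x)-f(y))I(x,y)\,dy$, where p.v. is the limit as $\varepsilon\downarrow0$ of the integrals over $\{|x-y|>\varepsilon\}$, and put $Lf(x)=2\,\mathrm{p.v.}\!\int_{\mathbb R^n}(f(x)-f(x+h))K(h)\,dh$. Write $x=(x',x_n)$, let $(x_n)_+^{s-1}$ be $x_n^{s-1}$ if $x_n>0$ and $0$ otherwise, and set $$c_s=\int_0^1 r^{s-1}\int_1^\infty t^{s-1}|r-t|^{-2s}\,dt\,dr,\qquad \theta_K=2c_s\int_{\mathbb R^{n-1}}(h',1)K((h',1))\,dh'\in\mathbb R^n .$$ Both integrals converge absolutely. For $\tau=k+\sigma$ with $k\in\mathbb N\cup\{0\}$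 and $\sigma\in(0,1]$, $C^\tau$ means $C^{k,\sigma}$; a function is $C^\tau$ up to the boundary of an open set if there its derivatives of order at most $k$ exist and are bounded and those of order $k$ are $\sigma$-Hölder continuous. **(1) Half-space.** Let $\gamma\in(\max\{0,2s-1\},s+1)$ and let $v:\mathbb R^n\to\mathbb R$ be locally of class $C^\gamma$ with $|v(x)|\le C(1+|x|^\gamma)$ for some $C$. Then for every $\eta\in C_c^\infty(\mathbb R^n)$ $$\int_{\mathbb R^n}\!\int_{\mathbb R^n}(v(x)-v(y))(\eta(x)-\eta(y))(x_n)_+^{s-1}(y_n)_+^{s-1}K(x-y)\,dy\,dx=\int_{\{x_n>0\}}v\,(x_n)_+^{s-1}L\big((x_n)_+^{s-1}\eta\big)\,dx-\int_{\{x_n=0\}}(\theta_K\cdot\nabla\eta)\,v\,dx'.$$ The principal value $L((x_n)_+^{s-1}\eta)(x)$ exists whenever $x_n>0$, and the three integrals converge absolutely. **(2) General domains.** Let $\delta\in(\max\{0,2s-1\},s)$, let $B_r$ be the open ball of radius $r$ centred at $0$, and let $\Omega\subset\mathbb R^n$ be open with $\partial\Omega$ of class $C^{1,\delta}$ in $B_2$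 (near each point of $\partial\Omega\cap B_2$, up to a linear isometry, $\Omega$ is the set above the graph of a $C^{1,\delta}$ function). Let $d$ be a regularized distance: $d>0$ in $\Omega$; $d$ is $C^\infty$ in $\Omega\cap B_2$ and $C^{1+\delta}$ up to the boundary of $\Omega\cap B_2$; $C^{-1}\mathrm{dist}(\cdot,\partial\Omega)\le d\le C\,\mathrm{dist}(\cdot,\partial\Omega)$ in $\Omega\cap B_2$ for some $C>0$; $d(x)/\mathrm{dist}(x,\partial\Omega)\to1$ as $\Omega\ni x\to x_0$ for each $x_0\in\partial\Omega\cap B_2$; and $|D^jd|\le C_jd^{1+\delta-j}$ in $\Omega\cap B_2$ for all $j\ge2$. Let $w\in L^\infty(\mathbb R^n)$ be of class $C^{1+\alpha+2s}_{1+\alpha}(\Omega|B_2)$: $w$ is locally $C^{1+\alpha+2s}$ in $\Omega\cap B_2$, it is $C^{1+\alpha}$ up to the boundary of $\Omega\cap B_2$, and $\sup r^{\rho-1-\alpha}[w]_{C^\rho(B_{r/2}(x_0))}<\infty$, the supremum over $\rho\in[1+\alpha,1+\alpha+2s]$ and $x_0\in\Omega$ such that $r=\mathrm{dist}(x_0,\partial\Omega)$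 satisfies $B_r(x_0)\subset\Omega\cap B_2$. Let $u$ be differentiable in $\Omega$ such that $d^{1-s}\nabla u$ is $C^{1+\delta}$ up to the boundary of $\Omega\cap B_2$ and vanishes in $\Omega$ outside a compact subset of $B_2$. Then for every $\eta\in C_c^\infty(B_1)$ $$\int_\Omega\!\int_\Omega(w(x)-w(y))(\eta(x)-\eta(y))\,\partial_nu(x)\,\partial_nu(y)K(x-y)\,dy\,dx=\int_\Omega\eta\,\mathcal L\big(\partial_nu(x)\partial_nu(y)K(x-y)\big)(w)\,dx-\int_{\partial\Omega\cap B_1}\eta\,\Theta_{K,\Omega}\cdot\nabla w\,d\mathcal H^{n-1},$$ where $\partial_nu$ is extended by $0$ outside $\Omega$, $\nu(x)$ is the inner unit normal, and, for $x\in\partial\Omega\cap B_1$, $$\Theta_{K,\Omega}(x)=2c_s\Big(\frac{\partial_nu}{d^{s-1}}(x)\Big)^2\int_{\mathbb S^{n-1}\cap\{\nu(x)\cdot\theta>0\}}(\nu(x)\cdot\theta)^{2s-1}\,\theta\,K(\theta)\,d\theta ;$$ the values of $\nabla w$ and $\partial_nu/d^{s-1}$ on $\partial\Omega\cap B_1$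 are their limits from inside $\Omega$. The principal value $\mathcal L(\partial_nu(x)\partial_nu(y)K(x-y))(w)(x)$ exists for $x\in\Omega\cap B_1$; the normals and these limits exist at every point of $\partial\Omega\cap B_1$; and all the integrals converge absolutely. -/

import Mathlib

open MeasureTheory Set Filter Topology
open scoped ContDiff

noncomputable section

namespace WeightedIBP

/-- Euclidean space `ℝⁿ` with `n = m + 1 ≥ 1`; a point is `x = (x', x_n)`. -/
abbrev Pt (m : ℕ) := EuclideanSpace ℝ (Fin (m + 1))

/-- The last coordinate `x_n`. -/
def lastC {m : ℕ} (x : Pt m) : ℝ := x (Fin.last m)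

/-- The first `n - 1` coordinates `x'`. -/
def initC {m : ℕ} (x : Pt m) : EuclideanSpace ℝ (Fin m) :=
  WithLp.toLp 2 (fun i : Fin m => x i.castSucc)

/-- The point `(x', t)`. -/
def mk {m : ℕ} (x' : EuclideanSpace ℝ (Fin m)) (t : ℝ) : Pt m :=
  WithLp.toLp 2 (Fin.snoc (α := fun _ => ℝ) (fun i => x' i) t)

/-! ### Hölder classes -/

section Holder

variable {F G : Type*} [NormedAddCommGroup F] [NormedSpace ℝ F]
  [NormedAddCommGroup G] [NormedSpace ℝ G]

/-- For `τ > 0` write `τ = k + σ` with `k ∈ ℕ` and `σ ∈ (0,1]`; this is `k`. -/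
def hdeg (τ : ℝ) : ℕ := ⌈τ⌉₊ - 1

/-- `[f]_{C^τ(U)} ≤ C`: the `k`-th derivative is `σ`-Hölder on `U` with constant `C`,
where `τ = k + σ`, `σ ∈ (0,1]` (used for open `U`). -/
def HolderSeminormLE (τ C : ℝ) (f : F → G) (U : Set F) : Prop :=
  ∀ x ∈ U, ∀ y ∈ U,
    ‖iteratedFDeriv ℝ (hdeg τ) f x - iteratedFDeriv ℝ (hdeg τ) f y‖
      ≤ C * ‖x - y‖ ^ (τ - (hdeg τ : ℝ))

/-- `f ∈ C^τ_loc(U)`, `U` open. -/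
def HolderLoc (τ : ℝ) (f : F → G) (U : Set F) : Prop :=
  ContDiffOn ℝ (hdeg τ) f U ∧
    ∀ x ∈ U, ∃ r > 0, ∃ C : ℝ, HolderSeminormLE τ C f (Metric.ball x r)

/-- `f ∈ C^τ` up to the boundary of the open set `U`, with finite norm: all derivatives up to
order `k` are bounded on `U` and the `k`-th one is `σ`-Hölder on `U`, `τ = k + σ`. -/
def HolderUpTo (τ : ℝ) (f : F → G) (U : Set F) : Prop :=
  ContDiffOn ℝ (hdeg τ) f U ∧
    ∃ C : ℝ, (∀ j ≤ hdeg τ, ∀ x ∈ U, ‖iteratedFDeriv ℝ j f x‖ ≤ C) ∧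
      HolderSeminormLE τ C f U

/-- The class `C^τ_σ(Ω | B)` for `σ ≤ τ`: `f` is `C^τ_loc` in `Ω ∩ B`, is `C^σ` up to the boundary
of `Ω ∩ B`, and, for all `ρ ∈ [σ, τ]` and all `x₀ ∈ Ω` with `r = dist(x₀, ∂Ω)` and
`B_r(x₀) ⊆ Ω ∩ B`, the quantity `r^{ρ-σ} [f]_{C^ρ(B_{r/2}(x₀))}` is bounded by one constant. -/
def HolderWeighted (τ σ : ℝ) (f : F → G) (Ω B : Set F) : Prop :=
  HolderLoc τ f (Ω ∩ B) ∧ HolderUpTo σ f (Ω ∩ B) ∧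
    ∃ C : ℝ, ∀ ρ ∈ Icc σ τ, ∀ x₀ ∈ Ω, ∀ r : ℝ, r = Metric.infDist x₀ (frontier Ω) →
      Metric.ball x₀ r ⊆ Ω ∩ B →
      HolderSeminormLE ρ (C * r ^ (σ - ρ)) f (Metric.ball x₀ (r / 2))

/-- `K ∈ C^τ(S^{n-1})`, expressed through the `0`-homogeneous extension of `K|_{S^{n-1}}`. -/
def HolderOnSphere (τ : ℝ) (K : F → ℝ) : Prop :=
  HolderLoc τ (fun x => K (‖x‖⁻¹ • x)) {(0 : F)}ᶜ

end Holder

/-! ### Kernels and operators -/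

/-- `K(h) = |h|^{-n-2s} K(h/|h|)` and `λ ≤ K(θ) = K(-θ) ≤ Λ` on the unit sphere. -/
structure IsKernel {m : ℕ} (s lam Lam : ℝ) (K : Pt m → ℝ) : Prop where
  homog : ∀ h, h ≠ 0 → K h = ‖h‖ ^ (-((m : ℝ) + 1) - 2 * s) * K (‖h‖⁻¹ • h)
  lower : ∀ θ, ‖θ‖ = 1 → lam ≤ K θ
  upper : ∀ θ, ‖θ‖ = 1 → K θ ≤ Lam
  even : ∀ θ, ‖θ‖ = 1 → K (-θ) = K θ

/-- Truncation of `𝓛(I)(f)(x)`: `2 ∫_{|x-y| > ε} (f(x) - f(y)) I(x,y) dy`. -/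
def opTrunc {m : ℕ} (I : Pt m → Pt m → ℝ) (f : Pt m → ℝ) (x : Pt m) (ε : ℝ) : ℝ :=
  2 * ∫ y in {y : Pt m | ε < ‖x - y‖}, (f x - f y) * I x y

/-- `𝓛(I)(f)(x) = 2 p.v. ∫ (f(x) - f(y)) I(x,y) dy`. -/
def op {m : ℕ} (I : Pt m → Pt m → ℝ) (f : Pt m → ℝ) (x : Pt m) : ℝ :=
  limUnder (𝓝[>] (0 : ℝ)) (opTrunc I f x)

/-- The principal value defining `𝓛(I)(f)(x)` exists: the truncated integrals converge absolutely
and have a finite limit. -/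
def OpExists {m : ℕ} (I : Pt m → Pt m → ℝ) (f : Pt m → ℝ) (x : Pt m) : Prop :=
  (∀ ε > 0, IntegrableOn (fun y => (f x - f y) * I x y) {y : Pt m | ε < ‖x - y‖}) ∧
    ∃ l : ℝ, Tendsto (opTrunc I f x) (𝓝[>] (0 : ℝ)) (𝓝 l)

/-- `L f(x) = 2 p.v. ∫ (f(x) - f(x+h)) K(h) dh`, written with `y = x + h`. -/
def opL {m : ℕ} (K : Pt m → ℝ) : (Pt m → ℝ) → Pt m → ℝ :=
  op (fun x y => K (y - x))

/-! ### The half-space -/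

/-- The weight `(x_n)_+^{s-1}`, equal to `0` for `x_n ≤ 0`. -/
def weight {m : ℕ} (s : ℝ) (x : Pt m) : ℝ :=
  if 0 < lastC x then lastC x ^ (s - 1) else 0

/-- `c_s = ∫_0^1 r^{s-1} ∫_1^∞ t^{s-1} |r-t|^{-2s} dt dr`. -/
def cs (s : ℝ) : ℝ :=
  ∫ r in Ioo (0 : ℝ) 1, r ^ (s - 1) * ∫ t in Ioi (1 : ℝ), t ^ (s - 1) * |r - t| ^ (-2 * s)

/-- `θ_K = 2 c_s ∫_{ℝ^{n-1}} (h',1) K((h',1)) dh'`. -/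
def thetaK {m : ℕ} (s : ℝ) (K : Pt m → ℝ) : Pt m :=
  (2 * cs s) • ∫ h' : EuclideanSpace ℝ (Fin m), K (mk h' 1) • mk h' 1

/-! ### General domains -/

/-- `∂Ω ∈ C^{1,δ}` in `B`: near each point of `∂Ω ∩ B`, up to a linear isometry, `Ω` is the set
above the graph of a `C^{1,δ}` function. -/
def BoundaryC1Holder {m : ℕ} (δ : ℝ) (Ω B : Set (Pt m)) : Prop :=
  ∀ x₀ ∈ frontier Ω ∩ B, ∃ r > 0, ∃ (A : Pt m ≃ₗᵢ[ℝ] Pt m) (g : EuclideanSpace ℝ (Fin m) → ℝ),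
    HolderLoc (1 + δ) g univ ∧
      ∀ x ∈ Metric.ball x₀ r, x ∈ Ω ↔ g (initC (A x)) < lastC (A x)

/-- `ν` is the unit normal of `Ω` at `x` pointing into `Ω`: the blow-ups of `Ω` at `x` are the
half-space `{z : z · ν > 0}`. -/
def IsInnerNormal {m : ℕ} (Ω : Set (Pt m)) (x ν : Pt m) : Prop :=
  ‖ν‖ = 1 ∧ ∀ c : ℝ, 0 < c → ∀ᶠ y in 𝓝 x,
    (c * ‖y - x‖ < inner ℝ (y - x) ν → y ∈ Ω) ∧
    (inner ℝ (y - x) ν < -(c * ‖y - x‖) → y ∉ Ω)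

open Classical in
/-- The inner unit normal `ν(x)` of `Ω` at `x` (and `0` where there is none). -/
def innerNormal {m : ℕ} (Ω : Set (Pt m)) (x : Pt m) : Pt m :=
  if h : ∃ ν, IsInnerNormal Ω x ν then h.choose else 0

/-- `d` is a regularized distance to `∂Ω` in `B`, for `∂Ω` of class `C^{1,δ}` in `B`: it is positive
in `Ω`, smooth in `Ω ∩ B`, of class `C^{1,δ}` up to the boundary, comparable to the distance,
asymptotically equal to it at `∂Ω`, and `|D^j d| ≤ C_j d^{1+δ-j}` for `j ≥ 2`. -/
structure IsRegDist {m : ℕ} (δ : ℝ) (Ω B : Set (Pt m)) (d : Pt m → ℝ) : Prop where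
  pos : ∀ x ∈ Ω, 0 < d x
  smooth : ContDiffOn ℝ ∞ d (Ω ∩ B)
  holder : HolderUpTo (1 + δ) d (Ω ∩ B)
  comparable : ∃ C > 0, ∀ x ∈ Ω ∩ B,
    C⁻¹ * Metric.infDist x (frontier Ω) ≤ d x ∧ d x ≤ C * Metric.infDist x (frontier Ω)
  asymp : ∀ x₀ ∈ frontier Ω ∩ B,
    Tendsto (fun x => d x / Metric.infDist x (frontier Ω)) (𝓝[Ω] x₀) (𝓝 1)
  deriv_bound : ∀ j : ℕ, 2 ≤ j → ∃ C : ℝ, ∀ x ∈ Ω ∩ B,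
    ‖iteratedFDeriv ℝ j d x‖ ≤ C * d x ^ (1 + δ - (j : ℝ))

/-- `f ∈ C_c^τ(closure (Ω ∩ B))`: `f` is `C^τ` up to the boundary of `Ω ∩ B`, and it vanishes in `Ω`
outside a compact subset of the open set `B` (it need not vanish on `∂Ω`). -/
def HolderCompact {m : ℕ} {G : Type*} [NormedAddCommGroup G] [NormedSpace ℝ G]
    (τ : ℝ) (f : Pt m → G) (Ω B : Set (Pt m)) : Prop :=
  HolderUpTo τ f (Ω ∩ B) ∧ ∃ S : Set (Pt m), IsCompact S ∧ S ⊆ B ∧ ∀ x ∈ Ω, x ∉ S → f x = 0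

/-- `∂_n u` in `Ω`, extended by `0` to the complement of `Ω`. -/
def dn {m : ℕ} (Ω : Set (Pt m)) (u : Pt m → ℝ) : Pt m → ℝ :=
  Ω.indicator (fun x => lastC (gradient u x))

/-- The kernel `∂_n u(x) ∂_n u(y) K(x-y)` on `Ω × Ω`, extended by `0`. -/
def kerU {m : ℕ} (Ω : Set (Pt m)) (u K : Pt m → ℝ) (x y : Pt m) : ℝ :=
  dn Ω u x * dn Ω u y * K (x - y)

/-- The integrand `(ν · θ)^{2s-1} K(θ) θ` on the half sphere `{θ ∈ S^{n-1} : ν · θ > 0}`. -/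
def sphereInt {m : ℕ} (s : ℝ) (K : Pt m → ℝ) (ν : Pt m)
    (θ : Metric.sphere (0 : Pt m) 1) : Pt m :=
  ((inner ℝ ν (θ : Pt m)) ^ (2 * s - 1) * K θ) • (θ : Pt m)

/-- The half sphere `{θ ∈ S^{n-1} : ν · θ > 0}`. -/
def halfSphere {m : ℕ} (ν : Pt m) : Set (Metric.sphere (0 : Pt m) 1) :=
  {θ | 0 < inner ℝ ν (θ : Pt m)}

/-- `Θ_{K,Ω}(x) = 2 c_s (∂_n u / d^{s-1})² ∫_{S^{n-1} ∩ {ν(x)·θ > 0}} (ν(x)·θ)^{2s-1} θ K(θ) dθ`, where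
the value of `∂_n u / d^{s-1}` at `x ∈ ∂Ω` is its limit from inside `Ω`. -/
def ThetaKΩ {m : ℕ} (s : ℝ) (K : Pt m → ℝ) (Ω : Set (Pt m)) (u d : Pt m → ℝ) (x : Pt m) : Pt m :=
  (2 * cs s * (extendFrom Ω (fun z => lastC (gradient u z) / d z ^ (s - 1)) x) ^ 2) •
    ∫ θ in halfSphere (innerNormal Ω x), sphereInt s K (innerNormal Ω x) θ
      ∂((volume : Measure (Pt m)).toSphere)

end WeightedIBP

end

noncomputable section

namespace WeightedIBP

open Metric Real
open scoped ENNReal NNReal Manifold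
open ENNReal (ofReal ofReal_add ofReal_add_le ofReal_coe_nnreal ofReal_le_ofReal ofReal_lt_top
  ofReal_mul ofReal_ne_top ofReal_one ofReal_pow)

set_option linter.unusedSectionVars false

variable {m : ℕ} {ρ ε a b c c0 c1 C0 C1 t τ r R A M q γ κ P0 ϱ s δ α lam Lam : ℝ} {C Cp : ℝ≥0}
  {x y z x0 N ν V : Pt m} {K p f d φ η w u : Pt m → ℝ} {Ω B B1 : Set (Pt m)}

/-- The unit sphere of `ℝⁿ`. -/
notation "𝕊" m:max => sphere (0 : Pt m) 1

/-- The complement of a closed ball. -/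
notation "𝔽" x:max ε:max => Set.ofPred fun y : Pt _ => ε < ‖x - y‖

/-- The pairs of points at distance more than `ε`. -/
notation "𝔾" ε:max => Set.ofPred fun z : Pt _ × Pt _ => ε < ‖Prod.fst z - Prod.snd z‖

/-- The energy density. -/
notation "𝓔" K:max p:max f:max μ:max z:max =>
  (μ (Prod.fst z) - μ (Prod.snd z)) * (f (Prod.fst z) - f (Prod.snd z)) * (p (Prod.fst z) * p (Prod.snd z) * K (Prod.fst z - Prod.snd z))

/-- The truncated operator. -/
notation "𝓣" K:max p:max f:max x:max ε:max =>
  integral (volume.restrict (𝔽 x ε)) fun y => (f x - f y) * (p y * K (x - y))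

/-- The space `ℝⁿ⁻¹`. -/
abbrev Hyp (m : ℕ) := EuclideanSpace ℝ (Fin m)

lemma _root_.Filter.Tendsto.congr_within {E : Type*} {f g : ℝ → E} {S : Set ℝ} {l : Filter E}
    (h : Tendsto f (𝓝[S] a) l) (he : ∀ x ∈ S, f x = g x) : Tendsto g (𝓝[S] a) l :=
  h.congr' (eventually_nhdsWithin_of_forall he)

lemma abs_setIntegral_le {X : Type*} [MeasurableSpace X] {μ : Measure X} {f : X → ℝ}
    (hf : Integrable f μ) (S : Set X) : |∫ x in S, f x ∂μ| ≤ ∫ x, |f x| ∂μ :=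
  abs_integral_le_integral_abs.trans
    (setIntegral_le_integral hf.abs (.of_forall fun _ => abs_nonneg _))

section Growth

variable {X : Type*} [NormedAddCommGroup X] [MeasurableSpace X] [BorelSpace X]
  {μ : Measure X}

/-- The density `q` has mass at most `C R^A` on every ball of radius `R`. -/
def GrowthBound (μ : Measure X) (q : X → ℝ≥0∞) (C : ℝ≥0) (A : ℝ) : Prop :=
  ∀ x : X, ∀ R : ℝ, 0 < R → ∫⁻ y in ball x R, q y ∂μ ≤ C * ofReal (R ^ A)

lemma lintegral_Ioi_rpow (hb : b < -1) (ht : 0 < t) :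
    ∫⁻ R in Ioi t, ofReal (R ^ b) = ofReal (-t ^ (b + 1) / (b + 1)) := by
  rw [← integral_Ioi_rpow_of_lt hb ht, ofReal_integral_eq_lintegral_ofReal
    (integrableOn_Ioi_rpow_of_lt hb ht)]
  filter_upwards [ae_restrict_mem measurableSet_Ioi] with R hR
  exact rpow_nonneg (ht.trans hR).le _

lemma lintegral_Ioc_rpow (hb : -1 < b) (hr : 0 < r) :
    ∫⁻ R in Ioc 0 r, ofReal (R ^ b) = ofReal (r ^ (b + 1) / (b + 1)) := by
  have h : IntegrableOn (fun R : ℝ => R ^ b) (Ioc 0 r) := by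
    rw [← intervalIntegrable_iff_integrableOn_Ioc_of_le hr.le]
    exact intervalIntegral.intervalIntegrable_rpow' hb
  have h2 : ∫ R in Ioc 0 r, R ^ b = r ^ (b + 1) / (b + 1) := by
    rw [← intervalIntegral.integral_of_le hr.le, integral_rpow (Or.inl hb),
      zero_rpow (by linarith), sub_zero]
  rw [← h2, ofReal_integral_eq_lintegral_ofReal h]
  filter_upwards [ae_restrict_mem measurableSet_Ioc] with R hR
  exact rpow_nonneg hR.1.le _

lemma lintegral_layer_le [SFinite μ] {q : X → ℝ≥0∞} (hq : Measurable q) (hb : b < 0)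
    (x : X) (S : Set X) :
    ∫⁻ y in S, ofReal (‖y - x‖ ^ b) * q y ∂μ ≤
      ∫⁻ R in Ioi (0 : ℝ), ofReal (-b * R ^ (b - 1)) * ∫⁻ y in ball x R ∩ S, q y ∂μ := by
  have h1 : ∀ y : X, ofReal (‖y - x‖ ^ b) * q y ≤ ∫⁻ R in Ioi (0 : ℝ),
      ofReal (-b * R ^ (b - 1)) * (ball x R).indicator q y := by
    intro y
    rcases eq_or_lt_of_le (norm_nonneg (y - x)) with h0 | h0
    · rw [← h0, zero_rpow hb.ne]; simp
    have : ofReal (‖y - x‖ ^ b) = ∫⁻ R in Ioi ‖y - x‖, ofReal (-b * R ^ (b - 1)) := by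
      simp_rw [ofReal_mul (neg_nonneg.2 hb.le)]
      rw [lintegral_const_mul _ (by fun_prop), lintegral_Ioi_rpow (by linarith) h0,
        ← ofReal_mul (neg_nonneg.2 hb.le)]
      congr 1
      have := hb.ne
      simp only [sub_add_cancel]
      field_simp
    rw [this, ← lintegral_mul_const _ (by fun_prop)]
    calc _ = ∫⁻ R in Ioi ‖y - x‖, ofReal (-b * R ^ (b - 1)) * (ball x R).indicator q y := by
            refine setLIntegral_congr_fun measurableSet_Ioi fun R hR => ?_
            have : y ∈ ball x R := by simpa [mem_ball, dist_eq_norm] using hR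
            simp [this]
      _ ≤ _ := lintegral_mono_set (Ioi_subset_Ioi h0.le)
  refine (lintegral_mono h1).trans ?_
  have hm : Measurable (fun p : X × ℝ => (ball x p.2).indicator q p.1) := by
    have : (fun p : X × ℝ => (ball x p.2).indicator q p.1)
        = {p : X × ℝ | dist p.1 x < p.2}.indicator (fun p => q p.1) := by
      ext p; simp [indicator, mem_ball]
    rw [this]
    refine (hq.comp measurable_fst).indicator ?_
    exact measurableSet_lt (by fun_prop) (by fun_prop)
  rw [lintegral_lintegral_swap]
  · refine lintegral_mono fun R => ?_
    rw [lintegral_const_mul' _ _ ofReal_ne_top, lintegral_indicator measurableSet_ball,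
      Measure.restrict_restrict measurableSet_ball]
  · exact (Measurable.mul (by fun_prop) hm).aemeasurable

lemma GrowthBound.tail [SFinite μ] {q : X → ℝ≥0∞} (hq : Measurable q)
    (h : GrowthBound μ q C A) (hA : 0 ≤ A) (hb : b < -A) (x : X) (hr : 0 < r) :
    ∫⁻ y in {y | r ≤ ‖y - x‖}, ofReal (‖y - x‖ ^ b) * q y ∂μ ≤
      C * ofReal (b / (b + A) * r ^ (b + A)) := by
  have hb0 : b < 0 := by linarith
  refine (lintegral_layer_le hq hb0 x _).trans ?_
  calc _ ≤ ∫⁻ R in Ioi (0 : ℝ), (Ioi r).indicator (fun R =>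
          ofReal (-b * R ^ (b - 1)) * (C * ofReal (R ^ A))) R := by
        refine lintegral_mono fun R => ?_
        by_cases hR : r < R
        · rw [indicator_of_mem (by exact hR)]
          gcongr
          exact (lintegral_mono_set inter_subset_left).trans (h x R (hr.trans hR))
        · have : ball x R ∩ {y | r ≤ ‖y - x‖} = ∅ := by
            ext y
            simp only [mem_inter_iff, mem_ball, dist_eq_norm, mem_ofPred_eq, mem_empty_iff_false,
              iff_false, not_and, not_le]
            intro h; linarith
          simp [this]
    _ = ∫⁻ R in Ioi r, C * ofReal (-b) * ofReal (R ^ (b + A - 1)) := by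
        rw [lintegral_indicator measurableSet_Ioi, Measure.restrict_restrict measurableSet_Ioi,
          inter_eq_self_of_subset_left (Ioi_subset_Ioi hr.le)]
        refine setLIntegral_congr_fun measurableSet_Ioi fun R hR => ?_
        have hR0 : 0 < R := hr.trans hR
        rw [ofReal_mul (by linarith), show b + A - 1 = (b - 1) + A by ring,
          rpow_add hR0, ofReal_mul (rpow_nonneg hR0.le _)]
        ring
    _ ≤ _ := by
        rw [lintegral_const_mul _ (by fun_prop), lintegral_Ioi_rpow (by linarith) hr, mul_assoc,
          ← ofReal_mul (by linarith)]
        apply le_of_eq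
        congr 2
        have : b + A ≠ 0 := by linarith
        simp only [sub_add_cancel]
        field_simp

lemma GrowthBound.near [SFinite μ] {q : X → ℝ≥0∞} (hq : Measurable q)
    (h : GrowthBound μ q C A) (hb : -A < b) (x : X) (hr : 0 < r) :
    ∫⁻ y in {y | ‖y - x‖ < r}, ofReal (‖y - x‖ ^ b) * q y ∂μ ≤
      C * ofReal ((|b| / (b + A) + 1) * r ^ (b + A)) := by
  have hball : {y | ‖y - x‖ < r} = ball x r := by
    ext y; simp [dist_eq_norm]
  rw [hball]
  have hpos : 0 ≤ |b| / (b + A) := div_nonneg (abs_nonneg _) (by linarith)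
  rcases le_or_gt 0 b with hb0 | hb0
  · calc _ ≤ ∫⁻ y in ball x r, ofReal (r ^ b) * q y ∂μ := by
          refine setLIntegral_mono' measurableSet_ball fun y hy => ?_
          rw [mem_ball, dist_eq_norm] at hy
          gcongr
      _ ≤ ofReal (r ^ b) * (C * ofReal (r ^ A)) := by
          rw [lintegral_const_mul' _ _ ofReal_ne_top]
          gcongr
          exact h x r hr
      _ = C * ofReal (r ^ (b + A)) := by
          rw [rpow_add hr, ofReal_mul (rpow_nonneg hr.le _)]; ring
      _ ≤ _ := by
          gcongr
          have := rpow_nonneg hr.le (b + A)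
          nlinarith
  refine (lintegral_layer_le hq hb0 x _).trans ?_
  have hsplit : Ioi (0 : ℝ) = Ioc 0 r ∪ Ioi r := (Ioc_union_Ioi_eq_Ioi hr.le).symm
  calc _ ≤ (∫⁻ R in Ioc 0 r, ofReal (-b * R ^ (b - 1)) * (C * ofReal (R ^ A)))
          + ∫⁻ R in Ioi r, ofReal (-b * R ^ (b - 1)) * (C * ofReal (r ^ A)) := by
        rw [hsplit]
        refine (lintegral_union_le _ _ _).trans (add_le_add ?_ ?_)
        · refine setLIntegral_mono' measurableSet_Ioc fun R hR => ?_
          gcongr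
          exact (lintegral_mono_set inter_subset_left).trans (h x R hR.1)
        · refine setLIntegral_mono' measurableSet_Ioi fun R hR => ?_
          gcongr
          exact (lintegral_mono_set inter_subset_right).trans (h x r hr)
    _ = C * ofReal (-b / (b + A) * r ^ (b + A)) + C * ofReal (r ^ (b + A)) := by
        congr 1
        · rw [show (∫⁻ R in Ioc 0 r, ofReal (-b * R ^ (b - 1)) * (C * ofReal (R ^ A)))
            = ∫⁻ R in Ioc 0 r, C * ofReal (-b) * ofReal (R ^ (b + A - 1)) from ?_]
          · rw [lintegral_const_mul _ (by fun_prop), lintegral_Ioc_rpow (by linarith) hr, mul_assoc,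
              ← ofReal_mul (by linarith)]
            congr 2
            simp only [sub_add_cancel]
            ring
          · refine setLIntegral_congr_fun measurableSet_Ioc fun R hR => ?_
            have hR0 : 0 < R := hR.1
            rw [ofReal_mul (by linarith), show b + A - 1 = (b - 1) + A by ring,
              rpow_add hR0, ofReal_mul (rpow_nonneg hR0.le _)]
            ring
        · rw [lintegral_mul_const _ (by fun_prop)]
          simp_rw [ofReal_mul (show 0 ≤ -b by linarith)]
          rw [lintegral_const_mul _ (by fun_prop), lintegral_Ioi_rpow (by linarith) hr,
            ← ofReal_mul (by linarith), mul_left_comm,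
            ← ofReal_mul (by
              simp only [sub_add_cancel]
              have := rpow_nonneg hr.le b
              rw [neg_div, mul_neg, neg_mul, neg_neg, mul_div_cancel₀ _ hb0.ne]; exact this)]
          congr 2
          simp only [sub_add_cancel]
          have := hb0.ne
          rw [rpow_add hr]
          field_simp
    _ ≤ _ := by
        rw [← mul_add, ← ofReal_add, add_mul, one_mul, abs_of_neg hb0]
        · exact mul_nonneg (div_nonneg (by linarith) (by linarith)) (rpow_nonneg hr.le _)
        · exact (rpow_nonneg hr.le _)

lemma GrowthBound.mono {q q' : X → ℝ≥0∞} (h : GrowthBound μ q C A)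
    (hle : ∀ y, q' y ≤ q y) : GrowthBound μ q' C A := fun x R hR =>
  (lintegral_mono fun y => hle y).trans (h x R hR)

lemma GrowthBound.const_mul {q : X → ℝ≥0∞} (h : GrowthBound μ q C A) (c : ℝ≥0) :
    GrowthBound μ (fun y => c * q y) (c * C) A := fun x R hR => by
  rw [lintegral_const_mul' _ _ ENNReal.coe_ne_top]
  push_cast
  rw [mul_assoc]
  gcongr
  exact h x R hR

end Growth

@[simp] lemma lastC_mk (x' : Hyp m) (t : ℝ) : lastC (mk x' t) = t := by
  simp [lastC, mk]

@[simp] lemma initC_mk (x' : Hyp m) (t : ℝ) : initC (mk x' t) = x' := by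
  ext i; simp [initC, mk]

@[simp] lemma mk_initC_lastC (x : Pt m) : mk (initC x) (lastC x) = x := by
  ext i
  refine Fin.lastCases ?_ (fun j => ?_) i <;> simp [initC, mk, lastC]

/-- The coordinates `(x', x_n) ↦ x` as a continuous linear equivalence. -/
def mkL : (Hyp m × ℝ) ≃L[ℝ] Pt m :=
  LinearEquiv.toContinuousLinearEquiv
    { toFun := fun p => mk p.1 p.2
      invFun := fun x => (initC x, lastC x)
      left_inv := fun p => by simp
      right_inv := fun x => by simp
      map_add' := fun p q => by
        ext i
        refine Fin.lastCases ?_ (fun j => ?_) i <;> simp [mk]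
      map_smul' := fun c p => by
        ext i
        refine Fin.lastCases ?_ (fun j => ?_) i <;> simp [mk] }

lemma continuous_mk : Continuous (fun p : Hyp m × ℝ => mk p.1 p.2) :=
  mkL.continuous

@[fun_prop] lemma continuous_initC : Continuous (initC : Pt m → _) :=
  (continuous_fst.comp (mkL (m := m)).symm.continuous)

@[fun_prop] lemma continuous_lastC : Continuous (lastC : Pt m → ℝ) :=
  (continuous_snd.comp (mkL (m := m)).symm.continuous)

@[fun_prop] lemma measurable_lastC : Measurable (lastC : Pt m → ℝ) := continuous_lastC.measurable

@[fun_prop] lemma measurable_initC : Measurable (initC : Pt m → _) := continuous_initC.measurable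

lemma inner_eq_initC_lastC (x y : Pt m) :
    inner ℝ x y = inner ℝ (initC x) (initC y) + lastC x * lastC y := by
  simp only [PiLp.inner_apply, Fin.sum_univ_castSucc, initC, lastC]
  simp [mul_comm]

lemma norm_sq_eq_initC_lastC (x : Pt m) : ‖x‖ ^ 2 = ‖initC x‖ ^ 2 + lastC x ^ 2 := by
  rw [← real_inner_self_eq_norm_sq, inner_eq_initC_lastC, real_inner_self_eq_norm_sq]; ring

lemma abs_lastC_le (x : Pt m) : |lastC x| ≤ ‖x‖ := by
  apply abs_le_of_sq_le_sq _ (norm_nonneg _)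
  nlinarith [norm_sq_eq_initC_lastC x, sq_nonneg ‖initC x‖]

lemma norm_initC_le (x : Pt m) : ‖initC x‖ ≤ ‖x‖ := by
  apply le_of_sq_le_sq _ (norm_nonneg _)
  nlinarith [norm_sq_eq_initC_lastC x, sq_nonneg (lastC x)]

lemma initC_sub (x y : Pt m) : initC (x - y) = initC x - initC y := by
  ext i; simp [initC]

lemma lastC_sub (x y : Pt m) : lastC (x - y) = lastC x - lastC y := by simp [lastC]

lemma lastC_add (x y : Pt m) : lastC (x + y) = lastC x + lastC y := by simp [lastC]

lemma initC_add (x y : Pt m) : initC (x + y) = initC x + initC y := by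
  ext i; simp [initC]

lemma lastC_smul (c : ℝ) (x : Pt m) : lastC (c • x) = c * lastC x := by simp [lastC]

lemma initC_smul (c : ℝ) (x : Pt m) : initC (c • x) = c • initC x := by
  ext i; simp [initC]

lemma measurePreserving_mk : MeasurePreserving (fun p : Hyp m × ℝ => mk p.1 p.2) := by
  have h1 := (PiLp.volume_preserving_ofLp (Fin m)).prod (MeasurePreserving.id (volume : Measure ℝ))
  have h2 := Measure.measurePreserving_swap (μ := (volume : Measure (Fin m → ℝ)))
    (ν := (volume : Measure ℝ))
  have h3 := (volume_preserving_piFinSuccAbove (fun _ : Fin (m + 1) => ℝ) (Fin.last m)).symm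
  have h4 := PiLp.volume_preserving_toLp (Fin (m + 1))
  have h5 := h4.comp (h3.comp (h2.comp h1))
  rw [← Measure.volume_eq_prod] at h5
  convert h5 using 1
  ext p i
  refine Fin.lastCases ?_ (fun j => ?_) i
  · simp [mk, MeasurableEquiv.piFinSuccAbove]
  · simp [mk, MeasurableEquiv.piFinSuccAbove]

lemma measurableEmbedding_mk : MeasurableEmbedding (fun p : Hyp m × ℝ => mk p.1 p.2) :=
  (mkL (m := m)).toHomeomorph.measurableEmbedding

lemma lintegral_eq_lintegral_mk {f : Pt m → ℝ≥0∞} (hf : Measurable f) :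
    ∫⁻ x, f x = ∫⁻ x' : Hyp m, ∫⁻ t : ℝ, f (mk x' t) := by
  rw [← measurePreserving_mk.lintegral_comp hf, Measure.volume_eq_prod, lintegral_prod]
  exact (hf.comp continuous_mk.measurable).aemeasurable

/-- `t_+^{a-1}`. -/
def posPow (a t : ℝ) : ℝ := if 0 < t then t ^ (a - 1) else 0

lemma posPow_of_pos (h : 0 < t) : posPow a t = t ^ (a - 1) := if_pos h

lemma posPow_of_nonpos (h : t ≤ 0) : posPow a t = 0 := if_neg h.not_gt

lemma posPow_nonneg (a t : ℝ) : 0 ≤ posPow a t := by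
  unfold posPow; split_ifs with h
  · exact rpow_nonneg h.le _
  · exact le_rfl

@[fun_prop] lemma measurable_posPow (a : ℝ) : Measurable (posPow a) :=
  Measurable.ite measurableSet_Ioi (by fun_prop) measurable_const

lemma posPow_mul (hc : 0 < c) : posPow a (c * t) = c ^ (a - 1) * posPow a t := by
  unfold posPow
  by_cases h : 0 < t
  · rw [if_pos h, if_pos (by positivity), mul_rpow hc.le h.le]
  · rw [if_neg h, if_neg (by rwa [mul_pos_iff_of_pos_left hc]), mul_zero]

lemma weight_eq (s : ℝ) (x : Pt m) : weight s x = posPow s (lastC x) := rfl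

lemma lintegral_posPow_le (ha : 0 < a) (ha1 : a ≤ 1) (b τ : ℝ) (hR : 0 < R) :
    ∫⁻ t in Ioo (τ - R) (τ + R), ofReal (posPow a (t - b)) ≤
      ofReal ((1 + 1 / a) * (2 * R) ^ a) := by
  have h2R : 0 < 2 * R := by positivity
  have key : ∀ t, ofReal (posPow a (t - b)) ≤
      (Ioc 0 (2 * R)).indicator (fun t => ofReal (t ^ (a - 1))) (t - b)
        + ofReal ((2 * R) ^ (a - 1)) := by
    intro t
    rcases le_or_gt (t - b) 0 with h | h
    · simp [posPow_of_nonpos h]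
    rw [posPow_of_pos h]
    rcases le_or_gt (t - b) (2 * R) with h' | h'
    · rw [indicator_of_mem (by exact ⟨h, h'⟩)]
      exact le_self_add
    · refine le_trans ?_ le_add_self
      exact ofReal_le_ofReal (rpow_le_rpow_of_nonpos h2R h'.le (by linarith))
  calc _ ≤ ∫⁻ t in Ioo (τ - R) (τ + R),
        ((Ioc 0 (2 * R)).indicator (fun t => ofReal (t ^ (a - 1))) (t - b)
        + ofReal ((2 * R) ^ (a - 1))) := lintegral_mono fun t => key t
    _ = (∫⁻ t in Ioo (τ - R) (τ + R),
        (Ioc 0 (2 * R)).indicator (fun t => ofReal (t ^ (a - 1))) (t - b))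
        + ofReal ((2 * R) ^ (a - 1)) * volume (Ioo (τ - R) (τ + R)) := by
        rw [lintegral_add_right _ measurable_const, setLIntegral_const]
    _ ≤ ofReal ((2 * R) ^ a / a) + ofReal ((2 * R) ^ a) := by
        refine add_le_add ?_ (le_of_eq ?_)
        · refine (setLIntegral_le_lintegral _ _).trans ?_
          rw [lintegral_sub_right_eq_self
            (fun t => (Ioc 0 (2 * R)).indicator (fun t => ofReal (t ^ (a - 1))) t) b,
            lintegral_indicator measurableSet_Ioc, lintegral_Ioc_rpow (by linarith) h2R]
          simp
        · rw [volume_Ioo, ← ofReal_mul (by positivity)]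
          congr 1
          rw [show τ + R - (τ - R) = 2 * R by ring, rpow_sub_one h2R.ne']
          field_simp
    _ = _ := by
        rw [← ofReal_add (by positivity) (by positivity)]
        congr 1; ring

/-- A constant for the growth of powers of the distance to a graph. -/
def fiberConst (m : ℕ) (a : ℝ) : ℝ≥0 :=
  (volume (ball (0 : Hyp m) 1)).toNNReal
    * toNNReal ((1 + 1 / a) * 2 ^ a)

lemma growthBound_graph (ha : 0 < a) (ha1 : a ≤ 1) (A : Pt m ≃ₗᵢ[ℝ] Pt m)
    {b : Hyp m → ℝ} (hb : Measurable b) :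
    GrowthBound volume (fun y : Pt m => ofReal (posPow a (lastC (A y) - b (initC (A y)))))
      (fiberConst m a) (m + a) := by
  intro x R hR
  set q : Pt m → ℝ≥0∞ := fun z => ofReal (posPow a (lastC z - b (initC z))) with hq
  have hqm : Measurable q := by
    have : Measurable fun z : Pt m => b (initC z) := hb.comp measurable_initC
    fun_prop
  have h1 : ∫⁻ y in ball x R, q (A y) = ∫⁻ z in ball (A x) R, q z := by
    have := (A.measurePreserving).setLIntegral_comp_preimage (s := ball (A x) R)
      measurableSet_ball hqm
    rw [← this]
    congr 2
    ext y; simp [mem_ball]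
  change ∫⁻ y in ball x R, q (A y) ≤ _
  rw [h1]
  set x1 := A x
  calc ∫⁻ z in ball x1 R, q z ≤ ∫⁻ z, (ball (initC x1) R).indicator 1 (initC z) *
          (Ioo (lastC x1 - R) (lastC x1 + R)).indicator
            (fun t => ofReal (posPow a (t - b (initC z)))) (lastC z) := by
        rw [← lintegral_indicator measurableSet_ball]
        refine lintegral_mono fun z => ?_
        by_cases hz : z ∈ ball x1 R
        · have hz' : ‖z - x1‖ < R := by simpa [dist_eq_norm] using hz
          have e1 : initC z ∈ ball (initC x1) R := by
            rw [mem_ball, dist_eq_norm, ← initC_sub]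
            exact (norm_initC_le _).trans_lt hz'
          have e2 : lastC z ∈ Ioo (lastC x1 - R) (lastC x1 + R) := by
            have := (abs_lastC_le (z - x1)).trans_lt hz'
            rw [lastC_sub, abs_lt] at this
            constructor <;> linarith
          simp only [indicator_of_mem hz, indicator_of_mem e1, indicator_of_mem e2]
          simp [hq]
        · simp [indicator_of_notMem hz]
    _ = ∫⁻ x' : Hyp m, ∫⁻ t : ℝ, (ball (initC x1) R).indicator 1 x' *
          (Ioo (lastC x1 - R) (lastC x1 + R)).indicator
            (fun t => ofReal (posPow a (t - b x'))) t := by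
        rw [lintegral_eq_lintegral_mk]
        · simp
        · refine Measurable.mul ((measurable_one.indicator measurableSet_ball).comp
            measurable_initC) ?_
          have : (fun z : Pt m => (Ioo (lastC x1 - R) (lastC x1 + R)).indicator
            (fun t => ofReal (posPow a (t - b (initC z)))) (lastC z))
            = (lastC ⁻¹' (Ioo (lastC x1 - R) (lastC x1 + R))).indicator q := by
            ext z; simp [indicator, hq]
          rw [this]
          exact hqm.indicator (measurable_lastC measurableSet_Ioo)
    _ ≤ ∫⁻ x' : Hyp m, (ball (initC x1) R).indicator 1 x' * ofReal ((1 + 1 / a) * (2 * R) ^ a) := by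
        refine lintegral_mono fun x' => ?_
        rw [lintegral_const_mul]
        · gcongr
          rw [lintegral_indicator measurableSet_Ioo]
          exact lintegral_posPow_le ha ha1 _ _ hR
        · exact (by fun_prop : Measurable fun t =>
            ofReal (posPow a (t - b x'))).indicator measurableSet_Ioo
    _ = _ := by
        rw [lintegral_mul_const' _ _ ofReal_ne_top, lintegral_indicator_one
          measurableSet_ball, Measure.addHaar_ball_of_pos _ _ hR]
        rw [fiberConst]
        push_cast
        rw [ENNReal.coe_toNNReal measure_ball_lt_top.ne, mul_rpow zero_le_two hR.le,
          rpow_add hR, rpow_natCast]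
        have e : (1 + 1 / a) * (2 ^ a * R ^ a) = ((1 + 1 / a) * 2 ^ a) * R ^ a := by ring
        rw [e, ofReal_mul (p := (1 + 1 / a) * 2 ^ a) (by positivity),
          ofReal_mul (p := R ^ m) (by positivity)]
        change _ = _ * ofReal _ * _
        simp only [finrank_euclideanSpace, Fintype.card_fin]
        ring

/-- A linear isometry sending a given unit vector to `e_n`. -/
lemma exists_isometry_lastC (hN : N ≠ 0) :
    ∃ A : Pt m ≃ₗᵢ[ℝ] Pt m, ∀ y, inner ℝ N y = ‖N‖ * lastC (A y) := by
  set e : Pt m := mk 0 1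
  have he : ‖e‖ = 1 := by
    have := norm_sq_eq_initC_lastC e
    simp only [e, initC_mk, lastC_mk] at this
    rw [← abs_of_nonneg (norm_nonneg (mk (0 : Hyp m) 1)), ← sq_eq_sq₀ (by positivity) zero_le_one, sq_abs]
    simpa using this
  have hv : ‖‖N‖⁻¹ • N‖ = ‖e‖ := by
    rw [he, norm_smul, norm_inv, norm_norm, inv_mul_cancel₀ (norm_ne_zero_iff.2 hN)]
  refine ⟨(ℝ ∙ (‖N‖⁻¹ • N - e))ᗮ.reflection, fun y => ?_⟩
  set A := (ℝ ∙ (‖N‖⁻¹ • N - e))ᗮ.reflection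
  have h1 : A (‖N‖⁻¹ • N) = e := Submodule.reflection_sub hv
  have h2 : inner ℝ (‖N‖⁻¹ • N) y = inner ℝ e (A y) := by
    rw [← h1, LinearIsometryEquiv.inner_map_map]
  have h3 : inner ℝ e (A y) = lastC (A y) := by
    rw [inner_eq_initC_lastC]; simp [e]
  rw [← h3, ← h2, inner_smul_left]
  simp only [map_inv₀, conj_trivial]
  rw [mul_inv_cancel_left₀ (norm_ne_zero_iff.2 hN)]

lemma growthBound_affine (ha : 0 < a) (ha1 : a ≤ 1) (hc0 : 0 < c0) (hN : c0 ≤ ‖N‖) (β : ℝ) :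
    GrowthBound volume (fun y : Pt m => ofReal (posPow a (β + inner ℝ N y)))
      (toNNReal (c0 ^ (a - 1)) * fiberConst m a) (m + a) := by
  have hN0 : 0 < ‖N‖ := hc0.trans_le hN
  obtain ⟨A, hA⟩ := exists_isometry_lastC (norm_pos_iff.1 hN0)
  have h := (growthBound_graph ha ha1 A (measurable_const (a := -(β / ‖N‖)))).const_mul
    (toNNReal (c0 ^ (a - 1)))
  refine h.mono fun y => ?_
  rw [hA, show β + ‖N‖ * lastC (A y) = ‖N‖ * (lastC (A y) - -(β / ‖N‖)) by field_simp; ring,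
    posPow_mul hN0, ofReal_mul (by positivity)]
  gcongr
  exact ofReal_le_ofReal (rpow_le_rpow_of_nonpos hc0 hN (by linarith))

/-- `t^{-2s} (1+t)^{s-1}`. -/
def gfun (s t : ℝ) : ℝ := t ^ (-2 * s) * (1 + t) ^ (s - 1)

/-- The interval `{ρ < t ≤ ρ (1 + t)}`. -/
def gset (ρ : ℝ) : Set ℝ := {t | ρ < t ∧ t ≤ ρ * (1 + t)}

/-- The tail `∫_ρ^∞ t^{-2s} ((1+t)^{s-1} - (1-t)_+^{s-1}) dt` in closed form. -/
def Psi (s ρ : ℝ) : ℝ := ∫ t in gset ρ, gfun s t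

lemma measurableSet_gset (ρ : ℝ) : MeasurableSet (gset ρ) :=
  (measurableSet_lt measurable_const measurable_id).inter
    (measurableSet_le measurable_id (by fun_prop))

@[fun_prop] lemma measurable_gfun (s : ℝ) : Measurable (gfun s) := by unfold gfun; fun_prop

lemma gfun_nonneg (ht : 0 ≤ t) : 0 ≤ gfun s t :=
  mul_nonneg (rpow_nonneg ht _) (rpow_nonneg (by linarith) _)

lemma gfun_le_rpow (hs : s ∈ Ioo 0 1) (ht : 0 < t) : gfun s t ≤ t ^ (-2 * s) := by
  have h := rpow_le_one_of_one_le_of_nonpos (show (1 : ℝ) ≤ 1 + t by linarith)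
    (show s - 1 ≤ 0 by linarith [hs.2])
  exact mul_le_of_le_one_right (rpow_nonneg ht.le _) h

lemma gfun_le_rpow' (hs : s ∈ Ioo 0 1) (ht : 0 < t) : gfun s t ≤ t ^ (-s - 1) := by
  have h := rpow_le_rpow_of_nonpos ht (show t ≤ 1 + t by linarith)
    (show s - 1 ≤ 0 by linarith [hs.2])
  calc gfun s t ≤ t ^ (-2 * s) * t ^ (s - 1) := by unfold gfun; gcongr
    _ = _ := by rw [← rpow_add ht]; congr 1; ring

lemma integrableOn_gfun (hs : s ∈ Ioo 0 1) (hρ : 0 < ρ) : IntegrableOn (gfun s) (Ioi ρ) := by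
  refine Integrable.mono' (integrableOn_Ioi_rpow_of_lt (a := -s - 1) (by linarith [hs.1]) hρ)
    (by fun_prop) ?_
  filter_upwards [ae_restrict_mem measurableSet_Ioi] with t ht
  have ht0 : 0 < t := hρ.trans ht
  rw [norm_of_nonneg (gfun_nonneg ht0.le)]
  exact gfun_le_rpow' hs ht0

lemma gset_subset_Ioi (ρ : ℝ) : gset ρ ⊆ Ioi ρ := fun _ h => h.1

lemma integrableOn_gfun_gset (hs : s ∈ Ioo 0 1) (hρ : 0 < ρ) :
    IntegrableOn (gfun s) (gset ρ) := (integrableOn_gfun hs hρ).mono_set (gset_subset_Ioi ρ)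

lemma Psi_nonneg (hρ : 0 < ρ) : 0 ≤ Psi s ρ :=
  setIntegral_nonneg (measurableSet_gset ρ) fun _ ht => gfun_nonneg (hρ.trans ht.1).le

lemma Psi_le_tail (hs : s ∈ Ioo 0 1) (hρ : 0 < ρ) : Psi s ρ ≤ ρ ^ (-s) / s := by
  calc Psi s ρ ≤ ∫ t in Ioi ρ, gfun s t := by
        refine setIntegral_mono_set (integrableOn_gfun hs hρ) ?_ (gset_subset_Ioi ρ).eventuallyLE
        filter_upwards [ae_restrict_mem measurableSet_Ioi] with t ht
        exact gfun_nonneg (hρ.trans ht).le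
    _ ≤ ∫ t in Ioi ρ, t ^ (-s - 1) := by
        refine setIntegral_mono_on (integrableOn_gfun hs hρ)
          (integrableOn_Ioi_rpow_of_lt (by linarith [hs.1]) hρ) measurableSet_Ioi fun t ht => ?_
        exact gfun_le_rpow' hs (hρ.trans ht)
    _ = _ := by
        rw [integral_Ioi_rpow_of_lt (by linarith [hs.1]) hρ]
        simp [neg_div_neg_eq]

lemma Psi_le (hs : s ∈ Ioo 0 1) (hρ : 0 < ρ) : Psi s ρ ≤ (2 + 4 / s) * ρ ^ (2 - 2 * s) := by
  have hs0 := hs.1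
  have hp : 0 < ρ ^ (2 - 2 * s) := rpow_pos_of_pos hρ _
  rcases le_or_gt ρ (1 / 2) with h | h
  · have hsub : gset ρ ⊆ Ioc ρ (ρ + 2 * ρ ^ 2) := by
      intro t ht
      refine ⟨ht.1, ?_⟩
      have h1 := ht.1; have h2 := ht.2
      by_contra hcon
      push Not at hcon
      nlinarith [mul_pos hρ hρ, mul_nonneg hρ.le (sub_nonneg.2 h)]
    have h1 : Psi s ρ ≤ ∫ t in gset ρ, ρ ^ (-2 * s) := by
      refine setIntegral_mono_on (integrableOn_gfun_gset hs hρ) ?_ (measurableSet_gset ρ)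
        fun t ht => ?_
      · refine (integrableOn_const (s := Ioc ρ (ρ + 2 * ρ ^ 2)) measure_Ioc_lt_top.ne).mono_set hsub
      · exact (gfun_le_rpow hs (hρ.trans ht.1)).trans
          (rpow_le_rpow_of_nonpos hρ ht.1.le (by linarith))
    have h2 : ∫ t in gset ρ, ρ ^ (-2 * s) ≤ 2 * ρ ^ 2 * ρ ^ (-2 * s) := by
      rw [setIntegral_const, smul_eq_mul]
      gcongr
      calc volume.real (gset ρ) ≤ volume.real (Ioc ρ (ρ + 2 * ρ ^ 2)) :=
            measureReal_mono hsub measure_Ioc_lt_top.ne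
        _ = 2 * ρ ^ 2 := by
            rw [volume_real_Ioc_of_le (by nlinarith)]; ring
    have h3 : ρ ^ (2 : ℕ) * ρ ^ (-2 * s) = ρ ^ (2 - 2 * s) := by
      rw [← rpow_natCast, ← rpow_add hρ]; congr 1; push_cast; ring
    have h4 : 0 ≤ 4 / s := by positivity
    nlinarith
  · refine (Psi_le_tail hs hρ).trans ?_
    have h3 : ρ ^ (-s) = ρ ^ (2 - 2 * s) * ρ ^ (s - 2) := by
      rw [← rpow_add hρ]; congr 1; ring
    have h4 : ρ ^ (s - 2) ≤ 4 := by
      calc ρ ^ (s - 2) ≤ (1 / 2 : ℝ) ^ (s - 2) :=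
            rpow_le_rpow_of_nonpos (by norm_num) h.le (by linarith [hs.2])
        _ ≤ (1 / 2 : ℝ) ^ (-2 : ℝ) :=
            rpow_le_rpow_of_exponent_ge (by norm_num) (by norm_num) (by linarith)
        _ = 4 := by
            rw [rpow_neg (by norm_num)]; norm_num
    rw [h3, div_eq_mul_inv, add_mul]
    have : ρ ^ (2 - 2 * s) * ρ ^ (s - 2) * s⁻¹ ≤ 4 / s * ρ ^ (2 - 2 * s) := by
      rw [div_eq_mul_inv]
      have : 0 < s⁻¹ := by positivity
      calc _ ≤ ρ ^ (2 - 2 * s) * 4 * s⁻¹ := by gcongr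
        _ = _ := by ring
    linarith

lemma continuousOn_Psi (hs : s ∈ Ioo 0 1) : ContinuousOn (Psi s) (Ioi 0) := by
  intro ρ0 (hρ0 : 0 < ρ0)
  refine ContinuousAt.continuousWithinAt ?_
  have hP : Psi s = fun ρ => ∫ t, (gset ρ).indicator (gfun s) t :=
    funext fun ρ => (integral_indicator (measurableSet_gset ρ)).symm
  rw [hP]
  refine continuousAt_of_dominated (bound := (Ioi (ρ0 / 2)).indicator (gfun s)) (.of_forall fun ρ =>
      ((measurable_gfun s).indicator (measurableSet_gset ρ)).aestronglyMeasurable) ?_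
    ((integrable_indicator_iff measurableSet_Ioi).2 (integrableOn_gfun hs (by linarith))) ?_
  · filter_upwards [lt_mem_nhds (half_lt_self hρ0)] with ρ hρ
    refine .of_forall fun t => ?_
    have hsub : gset ρ ⊆ Ioi (ρ0 / 2) := fun t h => hρ.trans h.1
    have h0 : ∀ t ∈ Ioi (ρ0 / 2), 0 ≤ gfun s t := fun t h =>
      gfun_nonneg ((half_pos hρ0).trans h).le
    by_cases ht : t ∈ gset ρ
    · rw [indicator_of_mem ht, indicator_of_mem (hsub ht), norm_of_nonneg (h0 t (hsub ht))]
    · rw [indicator_of_notMem ht, norm_zero]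
      exact indicator_nonneg h0 t
  · filter_upwards [Measure.ae_ne volume ρ0, Measure.ae_ne volume (ρ0 / (1 - ρ0))] with t h1 h2
    have hne : t ≠ ρ0 * (1 + t) := by
      intro h
      have h' : t * (1 - ρ0) = ρ0 := by linarith
      exact h2 (eq_div_of_mul_eq (fun h0 => by rw [h0, mul_zero] at h'; linarith) h')
    have c1 : ContinuousAt (fun ρ : ℝ => ρ * (1 + t)) ρ0 := by fun_prop
    by_cases hmem : t ∈ gset ρ0
    · refine (continuousAt_const (y := gfun s t)).congr ?_
      filter_upwards [gt_mem_nhds hmem.1, c1.eventually (lt_mem_nhds (hmem.2.lt_of_ne hne))]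
        with ρ h1 h2
      rw [indicator_of_mem (show t ∈ gset ρ from ⟨h1, h2.le⟩)]
    · refine (continuousAt_const (y := (0 : ℝ))).congr ?_
      rcases not_and_or.1 hmem with h | h
      · filter_upwards [lt_mem_nhds ((not_lt.1 h).lt_of_ne h1)] with ρ h1
        rw [indicator_of_notMem fun h2 => lt_asymm h1 h2.1]
      · filter_upwards [c1.eventually (gt_mem_nhds (not_le.1 h))] with ρ h1
        rw [indicator_of_notMem fun h2 => h1.not_ge h2.2]

lemma lintegral_inv_Ico (ha : 0 < a) (hab : a ≤ b) :
    ∫⁻ ρ in Ico a b, ofReal ρ⁻¹ = ofReal (log (b / a)) := by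
  rw [← integral_inv_of_pos ha (ha.trans_le hab), intervalIntegral.integral_of_le hab,
    ← integral_Ico_eq_integral_Ioc, ofReal_integral_eq_lintegral_ofReal]
  · have : IntervalIntegrable (fun x : ℝ => x⁻¹) volume a b :=
      intervalIntegral.intervalIntegrable_inv (fun x hx => by
        rw [uIcc_of_le hab] at hx; exact (ha.trans_le hx.1).ne') continuousOn_id
    rwa [intervalIntegrable_iff_integrableOn_Ico_of_le hab] at this
  · filter_upwards [ae_restrict_mem measurableSet_Ico] with x hx
    exact inv_nonneg.2 (ha.trans_le hx.1).le

/-- `∫_0^∞ t^{-2s} (1+t)^{s-1} log (1+t) dt`. -/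
def logInt (s : ℝ) : ℝ≥0∞ := ∫⁻ t in Ioi (0 : ℝ), ofReal (gfun s t) * ofReal (log (1 + t))

lemma lintegral_layer {b : ℝ → ℝ} (hb : Measurable b) (hb0 : ∀ t, 0 < t → 0 < b t) :
    ∫⁻ ρ in Ioi (0 : ℝ), ∫⁻ t in {t | 0 < t ∧ ρ < b t ∧ b t ≤ ρ * (1 + t)},
      ofReal (gfun s t) * ofReal ρ⁻¹ = logInt s := by
  have hA : MeasurableSet {p : ℝ × ℝ | 0 < p.2 ∧ p.1 < b p.2 ∧ b p.2 ≤ p.1 * (1 + p.2)} :=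
    (measurableSet_lt measurable_const measurable_snd).inter
      ((measurableSet_lt measurable_fst (hb.comp measurable_snd)).inter (measurableSet_le
        (hb.comp measurable_snd) (measurable_fst.mul (measurable_const.add measurable_snd))))
  have hS (ρ : ℝ) : MeasurableSet {t | 0 < t ∧ ρ < b t ∧ b t ≤ ρ * (1 + t)} :=
    measurable_prodMk_left hA
  simp_rw [← lintegral_indicator (hS _)]
  rw [lintegral_lintegral_swap, logInt, ← lintegral_indicator measurableSet_Ioi]
  · refine lintegral_congr fun t => ?_
    by_cases ht : 0 < t
    · have h1t : 0 < 1 + t := by linarith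
      have hl := lintegral_inv_Ico (div_pos (hb0 t ht) h1t)
        (div_le_self (hb0 t ht).le (by linarith : 1 ≤ 1 + t))
      rw [div_div_cancel₀ (hb0 t ht).ne'] at hl
      rw [indicator_of_mem (by exact ht), ← hl, ← lintegral_const_mul _ (by fun_prop),
        ← lintegral_indicator measurableSet_Ico, ← lintegral_indicator measurableSet_Ioi]
      refine lintegral_congr fun ρ => ?_
      have h0 : b t ≤ ρ * (1 + t) → 0 < ρ := fun h =>
        pos_of_mul_pos_left ((hb0 t ht).trans_le h) h1t.le
      simp only [indicator, mem_ofPred_eq, mem_Ioi, mem_Ico, div_le_iff₀ h1t, ht, true_and]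
      grind
    · simp [indicator, ht]
  · exact (Measurable.indicator (by fun_prop) hA).aemeasurable

lemma lintegral_Psi_div (hs : s ∈ Ioo 0 1) :
    ∫⁻ ρ in Ioi (0 : ℝ), ofReal (Psi s ρ * ρ⁻¹) = logInt s := by
  rw [← lintegral_layer measurable_id fun _ h => h]
  refine setLIntegral_congr_fun measurableSet_Ioi fun ρ (hρ : 0 < ρ) => ?_
  have hS : {t : ℝ | 0 < t ∧ ρ < id t ∧ id t ≤ ρ * (1 + t)} = gset ρ :=
    ext fun t => ⟨fun h => h.2, fun h => ⟨hρ.trans h.1, h⟩⟩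
  rw [hS, ofReal_mul (Psi_nonneg hρ), Psi, ofReal_integral_eq_lintegral_ofReal
    (integrableOn_gfun_gset hs hρ), lintegral_mul_const _ (by fun_prop)]
  filter_upwards [ae_restrict_mem (measurableSet_gset ρ)] with t ht
  exact gfun_nonneg (hρ.trans ht.1).le

lemma integrableOn_Psi_div (hs : s ∈ Ioo 0 1) : IntegrableOn (fun ρ => Psi s ρ * ρ⁻¹) (Ioi 0) := by
  have hm : AEStronglyMeasurable (fun ρ => Psi s ρ * ρ⁻¹) (volume.restrict (Ioi 0)) :=
    (((continuousOn_Psi hs).mul (continuousOn_inv₀.mono fun x hx => (ne_of_gt hx)))).aestronglyMeasurable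
      measurableSet_Ioi
  rw [← Ioc_union_Ioi_eq_Ioi zero_le_one]
  refine IntegrableOn.union ?_ ?_
  · have h : IntegrableOn (fun ρ : ℝ => (2 + 4 / s) * ρ ^ (1 - 2 * s)) (Ioc 0 1) := by
      refine Integrable.const_mul ?_ _
      rw [← IntegrableOn, ← intervalIntegrable_iff_integrableOn_Ioc_of_le zero_le_one]
      exact intervalIntegral.intervalIntegrable_rpow' (by linarith [hs.2])
    refine Integrable.mono' h (hm.mono_set Ioc_subset_Ioi_self) ?_
    filter_upwards [ae_restrict_mem measurableSet_Ioc] with ρ hρ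
    rw [norm_of_nonneg (mul_nonneg (Psi_nonneg hρ.1) (inv_nonneg.2 hρ.1.le))]
    calc Psi s ρ * ρ⁻¹ ≤ (2 + 4 / s) * ρ ^ (2 - 2 * s) * ρ⁻¹ := by
          gcongr
          · exact inv_nonneg.2 hρ.1.le
          · exact Psi_le hs hρ.1
      _ = _ := by
          rw [mul_assoc, ← rpow_neg_one ρ, ← rpow_add hρ.1]; congr 2; ring
  · have h : IntegrableOn (fun ρ : ℝ => s⁻¹ * ρ ^ (-s - 1)) (Ioi 1) :=
      (integrableOn_Ioi_rpow_of_lt (by linarith [hs.1]) one_pos).const_mul _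
    refine Integrable.mono' h (hm.mono_set (Ioi_subset_Ioi zero_le_one)) ?_
    filter_upwards [ae_restrict_mem measurableSet_Ioi] with ρ hρ
    have hρ0 : 0 < ρ := one_pos.trans hρ
    rw [norm_of_nonneg (mul_nonneg (Psi_nonneg hρ0) (inv_nonneg.2 hρ0.le))]
    calc Psi s ρ * ρ⁻¹ ≤ ρ ^ (-s) / s * ρ⁻¹ := by
          gcongr
          exact Psi_le_tail hs hρ0
      _ = _ := by
          rw [rpow_sub_one hρ0.ne']; field_simp

lemma logInt_lt_top (hs : s ∈ Ioo 0 1) : logInt s < ⊤ :=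
  lintegral_Psi_div hs ▸ (integrableOn_Psi_div hs).lintegral_lt_top

lemma lintegral_cs (s : ℝ) : ∫⁻ r in Ioo (0 : ℝ) 1, ∫⁻ t in Ioi (1 : ℝ),
      ofReal (r ^ (s - 1) * (t ^ (s - 1) * |r - t| ^ (-2 * s))) = logInt s := by
  rw [← lintegral_layer measurable_const fun _ _ => one_pos, ← Ioi_inter_Iio, inter_comm,
    ← setLIntegral_indicator measurableSet_Iio]
  refine setLIntegral_congr_fun measurableSet_Ioi fun r (hr : 0 < r) => ?_
  by_cases hr1 : r < 1
  · have hlt : 0 < 1 / r - 1 := sub_pos.2 (one_lt_one_div hr hr1)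
    have hS : {t : ℝ | 0 < t ∧ r < 1 ∧ 1 ≤ r * (1 + t)} = Ici (1 / r - 1) := by
      ext t
      simp only [mem_ofPred_eq, mem_Ici, sub_le_iff_le_add', div_le_iff₀' hr]
      exact ⟨fun h => h.2.2, fun h => ⟨hlt.trans_le (by rwa [sub_le_iff_le_add', div_le_iff₀' hr]),
        hr1, h⟩⟩
    have himg : Ici (1 : ℝ) = (fun τ => r * (1 + τ)) '' Ici (1 / r - 1) := by
      ext t
      refine ⟨fun ht => ⟨t / r - 1, ?_, by field_simp; ring⟩, ?_⟩
      · exact sub_le_sub_right (div_le_div_of_nonneg_right ht hr.le) _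
      · rintro ⟨τ, hτ, rfl⟩
        rwa [mem_Ici, sub_le_iff_le_add', div_le_iff₀' hr] at hτ
    rw [indicator_of_mem (by exact hr1), hS, setLIntegral_congr Ioi_ae_eq_Ici, himg,
      lintegral_image_eq_lintegral_abs_deriv_mul measurableSet_Ici (f' := fun _ => r)
        (fun τ _ => by simpa using
          (((hasDerivAt_id τ).const_add 1).const_mul r).hasDerivWithinAt)
        fun x _ y _ h => by simpa [hr.ne'] using h]
    refine setLIntegral_congr_fun measurableSet_Ici fun τ hτ => ?_
    have hτ0 : 0 < τ := hlt.trans_le hτ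
    rw [abs_of_pos hr, ← ofReal_mul hr.le, ← ofReal_mul (gfun_nonneg hτ0.le),
      show r - r * (1 + τ) = -(r * τ) by ring, abs_neg, abs_of_pos (mul_pos hr hτ0),
      mul_rpow hr.le (by linarith), mul_rpow hr.le hτ0.le, gfun]
    have e : r * (r ^ (s - 1) * (r ^ (s - 1) * r ^ (-2 * s))) = r⁻¹ := by
      rw [← rpow_add hr, ← rpow_add hr, ← rpow_neg_one r]
      nth_rewrite 1 [← rpow_one r]
      rw [← rpow_add hr]; congr 1; ring
    congr 1
    linear_combination (τ ^ (-2 * s) * (1 + τ) ^ (s - 1)) * e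
  · simp [indicator, hr1]

lemma measurable_cs : Measurable fun p : ℝ × ℝ =>
    p.1 ^ (s - 1) * (p.2 ^ (s - 1) * |p.1 - p.2| ^ (-2 * s)) := by
  have : Measurable fun p : ℝ × ℝ => |p.1 - p.2| :=
    (continuous_abs.comp (continuous_fst.sub continuous_snd)).measurable
  fun_prop

lemma cs_nonneg : 0 ≤ᵐ[(volume.restrict (Ioo (0 : ℝ) 1)).prod (volume.restrict (Ioi (1 : ℝ)))]
    fun p : ℝ × ℝ => p.1 ^ (s - 1) * (p.2 ^ (s - 1) * |p.1 - p.2| ^ (-2 * s)) := by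
  rw [Measure.prod_restrict]
  filter_upwards [ae_restrict_mem (measurableSet_Ioo.prod measurableSet_Ioi)] with p hp
  exact mul_nonneg (rpow_nonneg hp.1.1.le _) (mul_nonneg
    (rpow_nonneg (one_pos.trans hp.2).le _) (rpow_nonneg (abs_nonneg _) _))

lemma integrableOn_cs (hs : s ∈ Ioo 0 1) :
    IntegrableOn (fun p : ℝ × ℝ => p.1 ^ (s - 1) * (p.2 ^ (s - 1) * |p.1 - p.2| ^ (-2 * s)))
        (Ioo (0 : ℝ) 1 ×ˢ Ioi (1 : ℝ)) := by
  rw [IntegrableOn, Measure.volume_eq_prod, ← Measure.prod_restrict]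
  refine ⟨measurable_cs.aestronglyMeasurable, ?_⟩
  rw [hasFiniteIntegral_iff_ofReal cs_nonneg, lintegral_prod _ measurable_cs.ennreal_ofReal.aemeasurable,
    lintegral_cs]
  exact logInt_lt_top hs

lemma ofReal_cs (hs : s ∈ Ioo 0 1) : cs s = (logInt s).toReal := by
  have hI := integrableOn_cs hs
  rw [IntegrableOn, Measure.volume_eq_prod, ← Measure.prod_restrict] at hI
  rw [← lintegral_cs, ← lintegral_prod _ measurable_cs.ennreal_ofReal.aemeasurable,
    ← integral_eq_lintegral_of_nonneg_ae cs_nonneg hI.1, integral_prod _ hI, cs]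
  simp only [integral_const_mul]

lemma integral_Psi_div (hs : s ∈ Ioo 0 1) : ∫ ρ in Ioi (0 : ℝ), Psi s ρ * ρ⁻¹ = cs s := by
  rw [ofReal_cs hs, ← lintegral_Psi_div hs, integral_eq_lintegral_of_nonneg_ae _
    (integrableOn_Psi_div hs).1]
  filter_upwards [ae_restrict_mem measurableSet_Ioi] with ρ hρ
  exact mul_nonneg (Psi_nonneg hρ) (inv_nonneg.2 (le_of_lt hρ))

lemma image_Ioi_diff_gset (hρ : 0 < ρ) : (fun τ => τ / (1 + τ)) '' (Ioi ρ \ gset ρ) = Ioo ρ 1 := by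
  ext t
  constructor
  · rintro ⟨τ, ⟨h1, h2⟩, rfl⟩
    have h1' : ρ < τ := h1
    have h3 : ρ * (1 + τ) < τ := by
      by_contra h; exact h2 ⟨h1', not_lt.1 h⟩
    have : 0 < 1 + τ := by linarith
    exact ⟨(lt_div_iff₀ this).2 h3, (div_lt_one this).2 (by linarith)⟩
  · rintro ⟨h1, h2⟩
    have h3 : 0 < 1 - t := by linarith
    have h0 : 0 < t := hρ.trans h1
    refine ⟨t / (1 - t), ⟨?_, ?_⟩, ?_⟩
    · simp only [mem_Ioi, lt_div_iff₀ h3]; nlinarith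
    · rintro ⟨-, h⟩
      rw [div_le_iff₀ h3, mul_assoc, add_mul, div_mul_cancel₀ _ h3.ne'] at h
      linarith
    · have : 1 + t / (1 - t) = (1 - t)⁻¹ := by field_simp; ring
      simp only [this]; field_simp

lemma posPow_subst (hρ : 0 < ρ) : (IntegrableOn (fun t => t ^ b * posPow s (1 - t)) (Ioi ρ) ↔
      IntegrableOn (fun τ => τ ^ b * (1 + τ) ^ (-b - 1 - s)) (Ioi ρ \ gset ρ)) ∧
    ∫ t in Ioi ρ, t ^ b * posPow s (1 - t) =
      ∫ τ in Ioi ρ \ gset ρ, τ ^ b * (1 + τ) ^ (-b - 1 - s) := by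
  have hms : MeasurableSet (Ioi ρ \ gset ρ) := measurableSet_Ioi.diff (measurableSet_gset ρ)
  have hder : ∀ τ ∈ Ioi ρ \ gset ρ,
      HasDerivWithinAt (fun τ => τ / (1 + τ)) (1 / (1 + τ) ^ 2) (Ioi ρ \ gset ρ) τ := by
    intro τ hτ
    have h1 : ρ < τ := hτ.1
    have h0 : 1 + τ ≠ 0 := by linarith
    have := (hasDerivAt_id τ).div ((hasDerivAt_id τ).const_add 1) h0
    refine (this.congr_deriv ?_).hasDerivWithinAt
    simp
  have hinj : InjOn (fun τ : ℝ => τ / (1 + τ)) (Ioi ρ \ gset ρ) := by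
    intro x hx y hy h
    have h1 : ρ < x := hx.1
    have h2 : ρ < y := hy.1
    have h3 : 1 + x ≠ 0 := by linarith
    have h4 : 1 + y ≠ 0 := by linarith
    field_simp at h
    linarith
  have e1 : ∀ τ ∈ Ioi ρ \ gset ρ, |1 / (1 + τ) ^ 2| • ((τ / (1 + τ)) ^ b * posPow s (1 - τ / (1 + τ)))
      = τ ^ b * (1 + τ) ^ (-b - 1 - s) := by
    intro τ hτ
    have h1 : ρ < τ := hτ.1
    have h0 : 0 < τ := hρ.trans h1
    have h3 : 0 < 1 + τ := by linarith
    have h4 : 1 - τ / (1 + τ) = (1 + τ)⁻¹ := by field_simp; ring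
    rw [h4, posPow_of_pos (by positivity), abs_of_pos (by positivity), smul_eq_mul,
      div_rpow h0.le h3.le, inv_rpow h3.le, one_div, ← rpow_natCast,
      ← rpow_neg h3.le, ← rpow_neg h3.le, div_eq_mul_inv, ← rpow_neg h3.le]
    have : (1 + τ) ^ (-b - 1 - s) = (1 + τ) ^ (-((2 : ℕ) : ℝ)) * (1 + τ) ^ (-b) * (1 + τ) ^ (-(s - 1)) := by
      rw [← rpow_add h3, ← rpow_add h3]; congr 1; push_cast; ring
    rw [this]; ring
  have hz : ∀ t ∈ Ioi ρ \ Ioo ρ 1, t ^ b * posPow s (1 - t) = 0 := by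
    intro t ht
    have : 1 ≤ t := by
      by_contra h; exact ht.2 ⟨ht.1, not_le.1 h⟩
    rw [posPow_of_nonpos (by linarith), mul_zero]
  constructor
  · rw [← integrableOn_congr_fun e1 hms, ← integrableOn_image_iff_integrableOn_abs_deriv_smul hms hder hinj
      (fun t => t ^ b * posPow s (1 - t)), image_Ioi_diff_gset hρ]
    refine ⟨fun h => h.mono_set Ioo_subset_Ioi_self, fun h => ?_⟩
    exact h.of_forall_sdiff_eq_zero measurableSet_Ioi hz
  · rw [← setIntegral_congr_fun hms e1, ← integral_image_eq_integral_abs_deriv_smul hms hder hinj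
      (fun t => t ^ b * posPow s (1 - t)), image_Ioi_diff_gset hρ]
    exact setIntegral_eq_of_subset_of_forall_sdiff_eq_zero measurableSet_Ioi Ioo_subset_Ioi_self
      (fun t ht => hz t ht)

lemma integrableOn_posPow_one_sub (hs : s ∈ Ioo 0 1) (hρ : 0 < ρ) :
    IntegrableOn (fun t => t ^ (-2 * s) * posPow s (1 - t)) (Ioi ρ) := by
  rw [(posPow_subst hρ).1]
  refine ((integrableOn_gfun hs hρ).mono_set sdiff_subset).congr_fun ?_
    (measurableSet_Ioi.diff (measurableSet_gset ρ))
  intro t _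
  simp only [gfun]; congr 2; ring

lemma integral_sub_eq_Psi (hs : s ∈ Ioo 0 1) (hρ : 0 < ρ) :
    ∫ t in Ioi ρ, t ^ (-2 * s) * ((1 + t) ^ (s - 1) - posPow s (1 - t)) = Psi s ρ := by
  have h0 := integral_sub (integrableOn_gfun hs hρ) (integrableOn_posPow_one_sub hs hρ)
  rw [(posPow_subst hρ).2] at h0
  simp_rw [mul_sub]
  refine h0.trans ?_
  have h1 := setIntegral_union (f := gfun s) (μ := volume) (s := gset ρ) (t := Ioi ρ \ gset ρ)
    disjoint_sdiff_right (measurableSet_Ioi.diff (measurableSet_gset ρ))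
    (integrableOn_gfun_gset hs hρ) ((integrableOn_gfun hs hρ).mono_set sdiff_subset)
  rw [union_sdiff_cancel (gset_subset_Ioi ρ)] at h1
  have h2 : ∫ τ in Ioi ρ \ gset ρ, τ ^ (-2 * s) * (1 + τ) ^ (-(-2 * s) - 1 - s) =
      ∫ τ in Ioi ρ \ gset ρ, gfun s τ := by
    simp only [gfun]; congr 1; ext τ; congr 2; ring
  rw [h2]
  change (∫ t in Ioi ρ, gfun s t) - _ = _
  rw [h1, Psi]; ring

/-- `∫_ρ^∞ t^{-1-2s} (2 - (1+t)^{s-1} - (1-t)_+^{s-1}) dt`. -/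
def Phi (s ρ : ℝ) : ℝ :=
  ∫ t in Ioi ρ, t ^ (-1 - 2 * s) * (2 - (1 + t) ^ (s - 1) - posPow s (1 - t))

lemma rpow_neg_one_sub (ht : 0 < t) : t ^ (-2 * s) = t * t ^ (-1 - 2 * s) := by
  nth_rewrite 2 [← rpow_one t]
  rw [← rpow_add ht]; congr 1; ring

lemma integrableOn_rpow_mul_one_add (hs : s ∈ Ioo 0 1) (hρ : 0 < ρ) :
    IntegrableOn (fun t => t ^ (-1 - 2 * s) * (1 + t) ^ (s - 1)) (Ioi ρ) := by
  refine Integrable.mono' (integrableOn_Ioi_rpow_of_lt (a := -1 - 2 * s) (by linarith [hs.1]) hρ)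
    (by fun_prop) ?_
  filter_upwards [ae_restrict_mem measurableSet_Ioi] with t ht
  have ht0 : 0 < t := hρ.trans ht
  have h := rpow_le_one_of_one_le_of_nonpos (show (1 : ℝ) ≤ 1 + t by linarith)
    (show s - 1 ≤ 0 by linarith [hs.2])
  rw [norm_of_nonneg (mul_nonneg (rpow_nonneg ht0.le _) (rpow_nonneg (by linarith) _))]
  exact mul_le_of_le_one_right (rpow_nonneg ht0.le _) h

lemma integral_two_mul_add_gfun (hs : s ∈ Ioo 0 1) (hρ : 0 < ρ) :
    2 * (∫ t in Ioi ρ, t ^ (-1 - 2 * s) * (1 + t) ^ (s - 1)) + ∫ t in Ioi ρ, gfun s t =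
      ρ ^ (-2 * s) * (1 + ρ) ^ s / s := by
  have hs0 := hs.1
  rw [← integral_const_mul, ← integral_add ((integrableOn_rpow_mul_one_add hs hρ).const_mul 2)
    (integrableOn_gfun hs hρ)]
  have hd : ∀ t ∈ Ioi ρ, HasDerivAt (fun t => -(t ^ (-2 * s) * (1 + t) ^ s / s))
      (2 * (t ^ (-1 - 2 * s) * (1 + t) ^ (s - 1)) + gfun s t) t := by
    intro t ht
    have ht0 : 0 < t := hρ.trans ht
    have h1 : HasDerivAt (fun t : ℝ => t ^ (-2 * s)) (-2 * s * t ^ (-2 * s - 1)) t :=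
      hasDerivAt_rpow_const (Or.inl ht0.ne')
    have h2 : HasDerivAt (fun t : ℝ => (1 + t) ^ s) (1 * s * (1 + t) ^ (s - 1)) t :=
      ((hasDerivAt_id t).const_add 1).rpow_const (Or.inl (by simp; linarith))
    refine ((h1.mul h2).div_const s).neg.congr_deriv ?_
    have e : (1 + t) ^ s = (1 + t) * (1 + t) ^ (s - 1) := by
      rw [rpow_sub_one (by linarith)]
      have : (1 + t) ≠ 0 := by linarith
      field_simp
    rw [e, gfun, rpow_neg_one_sub ht0, show (-2 * s - 1) = -1 - 2 * s by ring]
    field_simp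
    ring
  rw [integral_Ioi_of_hasDerivAt_of_tendsto (m := 0) _ hd
    (((integrableOn_rpow_mul_one_add hs hρ).const_mul 2).add (integrableOn_gfun hs hρ))]
  · ring
  · rw [show (0 : ℝ) = -(0 / s) by simp]
    refine Tendsto.neg (Tendsto.div_const ?_ s)
    have hlim : Tendsto (fun t : ℝ => 2 ^ s * t ^ (-s)) atTop (𝓝 0) := by
      simpa using (tendsto_rpow_neg_atTop hs0).const_mul (2 ^ s)
    refine squeeze_zero' ?_ ?_ hlim
    · filter_upwards [eventually_gt_atTop 0] with t ht
      positivity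
    · filter_upwards [eventually_ge_atTop 1] with t ht
      have ht0 : 0 < t := by linarith
      calc t ^ (-2 * s) * (1 + t) ^ s ≤ t ^ (-2 * s) * (2 * t) ^ s := by
            gcongr; linarith
        _ = _ := by
            rw [mul_rpow zero_le_two ht0.le, show t ^ (-s) = t ^ (-2 * s) * t ^ s by
              rw [← rpow_add ht0]; congr 1; ring]
            ring
  · have : ContinuousAt (fun t => -(t ^ (-2 * s) * (1 + t) ^ s / s)) ρ := by
      have h1 : ContinuousAt (fun t : ℝ => t ^ (-2 * s)) ρ :=
        continuousAt_rpow_const _ _ (Or.inl hρ.ne')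
      have h2 : ContinuousAt (fun t : ℝ => (1 + t) ^ s) ρ :=
        ContinuousAt.rpow_const (by fun_prop) (Or.inl (by linarith))
      exact ((h1.mul h2).div_const s).neg
    exact this.continuousWithinAt

lemma integrableOn_rpow_mul_posPow_one_sub (hs : s ∈ Ioo 0 1) (hρ : 0 < ρ) :
    IntegrableOn (fun t => t ^ (-1 - 2 * s) * posPow s (1 - t)) (Ioi ρ) := by
  have h := (integrableOn_posPow_one_sub hs hρ).const_mul ρ⁻¹
  refine Integrable.mono' h (by fun_prop) ?_
  filter_upwards [ae_restrict_mem measurableSet_Ioi] with t ht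
  have ht' : ρ < t := ht
  have ht0 : 0 < t := hρ.trans ht
  rw [norm_of_nonneg (mul_nonneg (rpow_nonneg ht0.le _) (posPow_nonneg _ _)),
    rpow_neg_one_sub ht0, ← mul_assoc, ← mul_assoc]
  refine mul_le_mul_of_nonneg_right ?_ (posPow_nonneg _ _)
  refine le_mul_of_one_le_left (rpow_nonneg ht0.le _) ?_
  rw [inv_mul_eq_div, one_le_div hρ]; exact ht'.le

lemma Phi_eq (hs : s ∈ Ioo 0 1) (hρ : 0 < ρ) (hρ1 : ρ < 1) :
    Phi s ρ = Psi s ρ / 2 + ρ ^ (-2 * s) * (2 - (1 + ρ) ^ s - (1 - ρ) ^ s) / (2 * s) := by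
  have hs0 := hs.1
  unfold Phi
  have i1 : IntegrableOn (fun t : ℝ => t ^ (-1 - 2 * s) * 2) (Ioi ρ) :=
    (integrableOn_Ioi_rpow_of_lt (by linarith [hs.1]) hρ).mul_const 2
  have i2 : ∫ t in Ioi ρ, t ^ (-1 - 2 * s) * (2 - (1 + t) ^ (s - 1) - posPow s (1 - t)) =
      (∫ t in Ioi ρ, t ^ (-1 - 2 * s) * 2) - (∫ t in Ioi ρ, t ^ (-1 - 2 * s) * (1 + t) ^ (s - 1))
        - ∫ t in Ioi ρ, t ^ (-1 - 2 * s) * posPow s (1 - t) := by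
    have j1 := integral_sub i1 (integrableOn_rpow_mul_one_add hs hρ)
    have j2 := integral_sub (i1.sub (integrableOn_rpow_mul_one_add hs hρ))
      (integrableOn_rpow_mul_posPow_one_sub hs hρ)
    simp only [Pi.sub_apply] at j2
    rw [← j1, ← j2]
    congr 1; ext t; ring
  rw [i2, (posPow_subst hρ).2, integral_mul_const, integral_Ioi_rpow_of_lt (by linarith) hρ]
  set ρ' := ρ / (1 - ρ) with hρ'
  have h1ρ : 0 < 1 - ρ := by linarith
  have hρ'0 : 0 < ρ' := by positivity
  have hset : Ioi ρ \ gset ρ = Ioi ρ' := by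
    ext t
    rw [mem_Ioi, div_lt_iff₀ h1ρ]
    constructor
    · rintro ⟨h1, h2⟩
      by_contra h
      exact h2 ⟨h1, by linarith⟩
    · intro h
      have : ρ < t := by nlinarith
      exact ⟨this, fun h' => by have := h'.2; linarith⟩
  have hA := integral_two_mul_add_gfun hs hρ
  have hB := integral_two_mul_add_gfun hs hρ'0
  have hC : ∫ τ in Ioi ρ', τ ^ (-1 - 2 * s) * (1 + τ) ^ (-(-1 - 2 * s) - 1 - s) =
      (∫ t in Ioi ρ', t ^ (-1 - 2 * s) * (1 + t) ^ (s - 1)) + ∫ t in Ioi ρ', gfun s t := by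
    rw [← integral_add (integrableOn_rpow_mul_one_add hs hρ'0) (integrableOn_gfun hs hρ'0)]
    refine setIntegral_congr_fun measurableSet_Ioi fun t ht => ?_
    have ht0 : 0 < t := hρ'0.trans ht
    simp only [gfun]
    rw [rpow_neg_one_sub ht0, show -(-1 - 2 * s) - 1 - s = s by ring,
      rpow_sub_one (by linarith : (1 : ℝ) + t ≠ 0)]
    have : (1 + t) ≠ 0 := by linarith
    field_simp
  have hP : Psi s ρ = (∫ t in Ioi ρ, gfun s t) - ∫ t in Ioi ρ', gfun s t := by
    rw [← hset, Psi, setIntegral_sdiff (measurableSet_gset ρ) (integrableOn_gfun hs hρ)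
      (gset_subset_Ioi ρ)]; ring
  have hD : ρ' ^ (-2 * s) * (1 + ρ') ^ s = ρ ^ (-2 * s) * (1 - ρ) ^ s := by
    have : 1 + ρ' = (1 - ρ)⁻¹ := by rw [hρ']; field_simp; ring
    rw [this, hρ', div_rpow hρ.le h1ρ.le, inv_rpow h1ρ.le, div_eq_mul_inv,
      ← rpow_neg h1ρ.le, ← rpow_neg h1ρ.le, mul_assoc, ← rpow_add h1ρ]
    congr 2; ring
  rw [hset, hC, hP]
  rw [hD] at hB
  have e : -ρ ^ (-1 - 2 * s + 1) / (-1 - 2 * s + 1) * 2 = ρ ^ (-2 * s) / s := by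
    rw [show -1 - 2 * s + 1 = -2 * s by ring]; field_simp
  rw [e]
  have hA' : (∫ t in Ioi ρ, t ^ (-1 - 2 * s) * (1 + t) ^ (s - 1)) =
    (ρ ^ (-2 * s) * (1 + ρ) ^ s / s - ∫ t in Ioi ρ, gfun s t) / 2 := by linarith
  have hB' : (∫ t in Ioi ρ', t ^ (-1 - 2 * s) * (1 + t) ^ (s - 1)) =
    (ρ ^ (-2 * s) * (1 - ρ) ^ s / s - ∫ t in Ioi ρ', gfun s t) / 2 := by linarith
  rw [hA', hB']
  field_simp
  ring

lemma abs_Phi_le (hs : s ∈ Ioo 0 1) (hρ : 0 < ρ) (hρ1 : ρ < 1) :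
    |Phi s ρ| ≤ (1 + 3 / s) * ρ ^ (2 - 2 * s) := by
  have hs0 := hs.1
  rw [Phi_eq hs hρ hρ1]
  have h1 := Psi_le hs hρ
  have h0 := Psi_nonneg (s := s) hρ
  have u1 : (1 + ρ) ^ s ≤ 1 + s * ρ :=
    rpow_one_add_le_one_add_mul_self (by linarith) hs0.le hs.2.le
  have u2 : (1 - ρ) ^ s ≤ 1 - s * ρ := by
    have := rpow_one_add_le_one_add_mul_self (s := -ρ) (by linarith) hs0.le hs.2.le
    simpa [sub_eq_add_neg] using this
  have l1 : 2 - 2 * ρ ^ 2 ≤ (1 + ρ) ^ s + (1 - ρ) ^ s := by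
    have hx : 0 < (1 + ρ) ^ s := rpow_pos_of_pos (by linarith) _
    have hy : 0 < (1 - ρ) ^ s := rpow_pos_of_pos (by linarith) _
    have hxy : (1 + ρ) ^ s * (1 - ρ) ^ s ≥ 1 - ρ ^ 2 := by
      rw [← mul_rpow (by linarith) (by linarith), show (1 + ρ) * (1 - ρ) = 1 - ρ ^ 2 by ring]
      have hpos : 0 ≤ 1 - ρ ^ 2 := by nlinarith
      calc (1 - ρ ^ 2) = (1 - ρ ^ 2) ^ (1 : ℝ) := (rpow_one _).symm
        _ ≤ _ := rpow_le_rpow_of_exponent_ge' hpos (by nlinarith) hs0.le hs.2.le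
    have h4 : ((1 + ρ) ^ s + (1 - ρ) ^ s) ^ 2 ≥ (2 - 2 * ρ ^ 2) ^ 2 := by
      nlinarith [sq_nonneg ((1 + ρ) ^ s - (1 - ρ) ^ s), sq_nonneg ρ,
        show 0 ≤ 1 - ρ ^ 2 by nlinarith]
    exact le_of_sq_le_sq h4 (by positivity)
  have hr : ρ ^ (2 - 2 * s) = ρ ^ (-2 * s) * ρ ^ 2 := by
    rw [← rpow_natCast, ← rpow_add hρ]; congr 1; push_cast; ring
  have hp : 0 < ρ ^ (-2 * s) := rpow_pos_of_pos hρ _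
  have hb : 0 ≤ ρ ^ (-2 * s) * (2 - (1 + ρ) ^ s - (1 - ρ) ^ s) / (2 * s) := by
    apply div_nonneg (mul_nonneg hp.le (by linarith)) (by linarith)
  rw [abs_of_nonneg (by linarith)]
  have hb2 : ρ ^ (-2 * s) * (2 - (1 + ρ) ^ s - (1 - ρ) ^ s) / (2 * s) ≤ 1 / s * ρ ^ (2 - 2 * s) := by
    rw [hr, div_le_iff₀ (by linarith)]
    have : 1 / s * (ρ ^ (-2 * s) * ρ ^ 2) * (2 * s) = ρ ^ (-2 * s) * (2 * ρ ^ 2) := by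
      field_simp
    rw [this]
    gcongr
    linarith
  have : (1 + 3 / s) * ρ ^ (2 - 2 * s) = (2 + 4 / s) * ρ ^ (2 - 2 * s) / 2 + 1 / s * ρ ^ (2 - 2 * s) := by
    ring
  linarith

/-- The standing hypotheses on the order `s` and the kernel `K`. -/
structure Ker (s lam Lam : ℝ) (K : Pt m → ℝ) : Prop where
  hs : s ∈ Ioo (0 : ℝ) 1
  hlam : 0 < lam
  hK : IsKernel s lam Lam K
  hKm : Measurable K

lemma Ker.abs_le (k : Ker s lam Lam K) {h : Pt m} (hh : h ≠ 0) :
    |K h| ≤ Lam * ‖h‖ ^ (-((m : ℝ) + 1) - 2 * s) := by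
  have h1 : ‖‖h‖⁻¹ • h‖ = 1 := by
    rw [norm_smul, norm_inv, norm_norm, inv_mul_cancel₀ (norm_ne_zero_iff.2 hh)]
  have h2 := k.hK.lower _ h1
  have h3 := k.hK.upper _ h1
  have h4 : 0 ≤ ‖h‖ ^ (-((m : ℝ) + 1) - 2 * s) := rpow_nonneg (norm_nonneg _) _
  rw [k.hK.homog h hh, abs_of_nonneg (mul_nonneg h4 (by linarith [k.hlam])), mul_comm]
  gcongr

lemma IsKernel.neg (hK : IsKernel s lam Lam K) (h : Pt m) : K (-h) = K h := by
  rcases eq_or_ne h 0 with rfl | hh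
  · simp
  have h1 : ‖‖h‖⁻¹ • h‖ = 1 := by
    rw [norm_smul, norm_inv, norm_norm, inv_mul_cancel₀ (norm_ne_zero_iff.2 hh)]
  rw [hK.homog h hh, hK.homog (-h) (neg_ne_zero.2 hh), norm_neg, smul_neg, hK.even _ h1]

lemma IsKernel.smul (hK : IsKernel s lam Lam K) {θ : Pt m} (hθ : ‖θ‖ = 1) (hr : 0 < r) :
    K (r • θ) = r ^ (-((m : ℝ) + 1) - 2 * s) * K θ := by
  have h0 : r • θ ≠ 0 := by
    rw [← norm_ne_zero_iff, norm_smul, hθ]; simp [hr.ne']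
  rw [hK.homog _ h0, norm_smul, hθ, norm_of_nonneg hr.le, mul_one, smul_smul,
    inv_mul_cancel₀ hr.ne', one_smul]

lemma IsKernel.continuousOn (hK : IsKernel s lam Lam K) (hreg : HolderOnSphere τ K) :
    ContinuousOn K {0}ᶜ := by
  have h1 : ContinuousOn (fun x : Pt m => K (‖x‖⁻¹ • x)) {0}ᶜ := hreg.1.continuousOn
  have h2 : ContinuousOn (fun x : Pt m => ‖x‖ ^ (-((m : ℝ) + 1) - 2 * s)) {0}ᶜ :=
    fun x hx => (continuous_norm.continuousAt.rpow_const
      (Or.inl (norm_ne_zero_iff.2 hx))).continuousWithinAt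
  exact (h2.mul h1).congr fun x hx => hK.homog x hx

lemma IsKernel.measurable (hK : IsKernel s lam Lam K) (hreg : HolderOnSphere τ K) : Measurable K :=
  measurable_of_continuousOn_compl_singleton 0 (hK.continuousOn hreg)

lemma integrableOn_of_lintegral_le {X : Type*} [MeasurableSpace X] {μ : Measure X} {f : X → ℝ}
    {S : Set X} (hf : Measurable f) (h0 : ∀ x, 0 ≤ f x) {B : ℝ} (hB : 0 ≤ B)
    (h : ∫⁻ x in S, ofReal (f x) ∂μ ≤ ofReal B) :
    IntegrableOn f S μ ∧ ∫ x in S, f x ∂μ ≤ B := by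
  have hnn : 0 ≤ᵐ[μ.restrict S] f := Eventually.of_forall h0
  refine ⟨⟨hf.aestronglyMeasurable, ?_⟩, ?_⟩
  · rw [hasFiniteIntegral_iff_ofReal hnn]
    exact h.trans_lt ofReal_lt_top
  · rw [integral_eq_lintegral_of_nonneg_ae hnn hf.aestronglyMeasurable]
    exact ENNReal.toReal_le_of_le_ofReal hB h

/-- The growth bound for the weight `|p|`. -/
def AbsGrowth (p : Pt m → ℝ) (C : ℝ≥0) (A : ℝ) : Prop :=
  GrowthBound volume (fun y => ofReal |p y|) C A

lemma AbsGrowth.tail (hp : Measurable p) (h : AbsGrowth p C A) (hA : 0 ≤ A) (hb : b < -A) (x : Pt m) (hr : 0 < r) :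
    IntegrableOn (fun y => ‖y - x‖ ^ b * |p y|) {y | r ≤ ‖y - x‖} ∧
      ∫ y in {y | r ≤ ‖y - x‖}, ‖y - x‖ ^ b * |p y| ≤ C * (b / (b + A) * r ^ (b + A)) := by
  have hd : 0 ≤ b / (b + A) := div_nonneg_of_nonpos (by linarith) (by linarith)
  refine integrableOn_of_lintegral_le (by fun_prop) (fun y => by positivity) (by positivity) ?_
  rw [ofReal_mul (by positivity), ofReal_coe_nnreal]
  refine le_trans (le_of_eq ?_) (GrowthBound.tail (by fun_prop) h hA hb x hr)
  refine lintegral_congr fun y => ofReal_mul (by positivity)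

lemma AbsGrowth.near (hp : Measurable p) (h : AbsGrowth p C A) (hb : -A < b) (x : Pt m) (hr : 0 < r) :
    IntegrableOn (fun y => ‖y - x‖ ^ b * |p y|) {y | ‖y - x‖ < r} ∧
      ∫ y in {y | ‖y - x‖ < r}, ‖y - x‖ ^ b * |p y| ≤ C * ((|b| / (b + A) + 1) * r ^ (b + A)) := by
  have hd : 0 ≤ |b| / (b + A) := div_nonneg (abs_nonneg _) (by linarith)
  refine integrableOn_of_lintegral_le (by fun_prop) (fun y => by positivity) (by positivity) ?_
  rw [ofReal_mul (by positivity), ofReal_coe_nnreal]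
  refine le_trans (le_of_eq ?_) (GrowthBound.near (by fun_prop) h hb x hr)
  refine lintegral_congr fun y => ofReal_mul (by positivity)

lemma absGrowth_affine (ha : 0 < a) (ha1 : a ≤ 1) (hc0 : 0 < c0) (hN : c0 ≤ ‖N‖) (β : ℝ) :
    AbsGrowth (fun y : Pt m => posPow a (β + inner ℝ N y))
      (toNNReal (c0 ^ (a - 1)) * fiberConst m a) (m + a) := by
  unfold AbsGrowth
  simp_rw [abs_of_nonneg (posPow_nonneg _ _)]
  exact growthBound_affine ha ha1 hc0 hN β

lemma absGrowth_one : AbsGrowth (fun _ : Pt m => (1 : ℝ))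
    (volume (ball (0 : Pt m) 1)).toNNReal (m + 1) := by
  intro x R hR
  simp only [abs_one, ofReal_one, lintegral_one, Measure.restrict_apply_univ]
  rw [Measure.addHaar_ball _ _ hR.le, ENNReal.coe_toNNReal measure_ball_lt_top.ne, mul_comm]
  have : R ^ ((m : ℝ) + 1) = R ^ (m + 1) := by
    rw [← rpow_natCast]; push_cast; rfl
  rw [this]
  simp

section Polar

variable {G : Type*} [NormedAddCommGroup G] [NormedSpace ℝ G]

/-- The surface measure on the unit sphere. -/
abbrev sph (m : ℕ) : Measure (𝕊 m) := (volume : Measure (Pt m)).toSphere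

lemma finrank_Pt : Module.finrank ℝ (Pt m) = m + 1 := by simp

lemma integral_polar (F : Pt m → G) (hF : Integrable F) :
    ∫ x, F x = ∫ θ, (∫ r in Ioi (0 : ℝ), r ^ m • F (r • (θ : Pt m))) ∂sph m := by
  have hmp := (volume : Measure (Pt m)).measurePreserving_homeomorphUnitSphereProd
  have hemb := (homeomorphUnitSphereProd (Pt m)).measurableEmbedding
  set F' : 𝕊 m × Ioi (0 : ℝ) → G := fun p => F (p.2.1 • (p.1 : Pt m))
  have hcomp : ∀ x : ({0}ᶜ : Set (Pt m)), F' (homeomorphUnitSphereProd (Pt m) x) = F x := by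
    intro x
    have hx : ‖(x : Pt m)‖ ≠ 0 := norm_ne_zero_iff.2 x.2
    simp only [F', homeomorphUnitSphereProd_apply_fst_coe, homeomorphUnitSphereProd_apply_snd_coe]
    rw [smul_smul, mul_inv_cancel₀ hx, one_smul]
  have hms : MeasurableSet ({0}ᶜ : Set (Pt m)) := (measurableSet_singleton _).compl
  have h1 : ∫ x, F x = ∫ x : ({0}ᶜ : Set (Pt m)), F x ∂(volume.comap Subtype.val) := by
    rw [integral_subtype_comap hms, restrict_compl_singleton]
  have hint : Integrable (fun x : ({0}ᶜ : Set (Pt m)) => F x) (volume.comap Subtype.val) := by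
    have := (integrableOn_iff_comap_subtypeVal (μ := volume) (f := F) hms).1 hF.integrableOn
    exact this
  rw [finrank_Pt, Nat.add_sub_cancel] at hmp
  have h2 := hmp.integral_comp hemb F'
  simp_rw [hcomp] at h2
  have hint2 : Integrable F' ((sph m).prod (Measure.volumeIoiPow m)) := by
    rw [← hmp.integrable_comp_emb hemb]
    exact hint.congr (.of_forall fun x => (hcomp x).symm)
  rw [h1, h2, integral_prod _ hint2]
  refine integral_congr_ae (.of_forall fun θ => ?_)
  simp only [F', Measure.volumeIoiPow, ofReal]
  rw [integral_withDensity_eq_integral_smul (by fun_prop),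
    ← integral_subtype_comap measurableSet_Ioi fun a : ℝ ↦ a ^ m • F (a • (θ : Pt m))]
  refine integral_congr_ae (.of_forall fun r => ?_)
  simp only
  rw [NNReal.smul_def, coe_toNNReal _ (pow_nonneg (le_of_lt r.2) _)]

lemma lintegral_polar (F : Pt m → ℝ≥0∞) (hF : Measurable F) :
    ∫⁻ x, F x = ∫⁻ θ, (∫⁻ r in Ioi (0 : ℝ), ofReal (r ^ m) * F (r • (θ : Pt m))) ∂sph m := by
  have hmp := (volume : Measure (Pt m)).measurePreserving_homeomorphUnitSphereProd
  have hemb := (homeomorphUnitSphereProd (Pt m)).measurableEmbedding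
  set F' : 𝕊 m × Ioi (0 : ℝ) → ℝ≥0∞ := fun p => F (p.2.1 • (p.1 : Pt m))
  have hcomp : ∀ x : ({0}ᶜ : Set (Pt m)), F' (homeomorphUnitSphereProd (Pt m) x) = F x := by
    intro x
    have hx : ‖(x : Pt m)‖ ≠ 0 := norm_ne_zero_iff.2 x.2
    simp only [F', homeomorphUnitSphereProd_apply_fst_coe, homeomorphUnitSphereProd_apply_snd_coe]
    rw [smul_smul, mul_inv_cancel₀ hx, one_smul]
  have hms : MeasurableSet ({0}ᶜ : Set (Pt m)) := (measurableSet_singleton _).compl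
  have h1 : ∫⁻ x, F x = ∫⁻ x : ({0}ᶜ : Set (Pt m)), F x ∂(volume.comap Subtype.val) := by
    rw [lintegral_subtype_comap hms, restrict_compl_singleton]
  rw [finrank_Pt, Nat.add_sub_cancel] at hmp
  have hF' : Measurable F' := by
    have : Measurable fun p : 𝕊 m × Ioi (0 : ℝ) => p.2.1 • (p.1 : Pt m) := by
      fun_prop
    exact hF.comp this
  have h2 := hmp.lintegral_comp_emb hemb F'
  simp_rw [hcomp] at h2
  rw [h1, h2, lintegral_prod _ hF'.aemeasurable]
  refine lintegral_congr fun θ => ?_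
  simp only [F', Measure.volumeIoiPow]
  rw [lintegral_withDensity_eq_lintegral_mul _ (by fun_prop),
    ← lintegral_subtype_comap measurableSet_Ioi fun a : ℝ ↦ ofReal (a ^ m) * F (a • (θ : Pt m))]
  · rfl
  · have : Measurable fun r : Ioi (0 : ℝ) => r.1 • (θ : Pt m) := by fun_prop
    exact hF.comp this

lemma measurableSet_norm_gt (ε : ℝ) : MeasurableSet {h : Pt m | ε < ‖h‖} :=
  measurableSet_lt measurable_const measurable_norm

lemma measurableSet_halfSphere (N : Pt m) : MeasurableSet (halfSphere N) :=
  measurableSet_lt measurable_const (by fun_prop)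

/-- Symmetrization followed by polar coordinates. -/
lemma integral_half_polar (hε : 0 < ε) (N : Pt m) (F : Pt m → G)
    (hF : IntegrableOn F {h | ε < ‖h‖}) (h0 : ∀ h, inner ℝ N h = 0 → F h + F (-h) = 0) :
    ∫ h in {h : Pt m | ε < ‖h‖}, F h = ∫ θ in halfSphere N,
        (∫ r in Ioi ε, r ^ m • (F (r • (θ : Pt m)) + F (-(r • (θ : Pt m))))) ∂sph m := by
  set D : Set (Pt m) := {h | ε < ‖h‖}
  set P : Set (Pt m) := {h | 0 < inner ℝ N h}
  have hD : MeasurableSet D := measurableSet_norm_gt ε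
  have hP : MeasurableSet P := measurableSet_lt measurable_const (by fun_prop)
  set H : Pt m → G := D.indicator F
  have hH : Integrable H := (integrable_indicator_iff hD).2 hF
  have hHn : Integrable fun h => H (-h) := hH.comp_neg
  set S : Pt m → G := fun h => H h + H (-h)
  have hS : Integrable S := hH.add hHn
  have hSev : ∀ h, S (-h) = S h := fun h => by simp [S, add_comm]
  have hSz : ∀ h, inner ℝ N h = 0 → S h = 0 := by
    intro h hh
    by_cases hm : h ∈ D
    · have : -h ∈ D := by simpa [D] using hm
      simp [S, H, hm, this, h0 h hh]
    · have : -h ∉ D := by simpa [D] using hm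
      simp [S, H, hm, this]
  have h1 : ∫ h in D, F h = ∫ h in P, S h := by
    rw [← integral_indicator hD]
    change ∫ h, H h = _
    have e1 : ∫ h, S h = (∫ h, H h) + ∫ h, H h := by
      simp only [S]
      rw [integral_add hH hHn, integral_neg_eq_self]
    have e2 : ∫ h in Pᶜ, S h = ∫ h in P, S h := by
      rw [← integral_indicator hP.compl, ← integral_indicator hP, ← integral_neg_eq_self]
      refine integral_congr_ae (.of_forall fun h => ?_)
      have hneg : (-h ∈ P) ↔ inner ℝ N h < 0 := by simp [P]
      simp only [indicator, hSev, mem_compl_iff, hneg]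
      rcases lt_trichotomy (inner ℝ N h) 0 with hh | hh | hh
      · have : h ∉ P := by simp [P, hh.le]
        simp [hh, this]
      · have : h ∉ P := by simp [P, hh]
        simp [hh, this, hSz h hh]
      · have : h ∈ P := by simpa [P] using hh
        simp [not_lt.2 hh.le, this]
    have e3 := integral_add_compl hP hS
    rw [e2] at e3
    have : (2 : ℝ) • ∫ h, H h = (2 : ℝ) • ∫ h in P, S h := by
      rw [two_smul, two_smul, ← e1, ← e3]
    exact smul_right_injective G two_ne_zero this
  rw [h1, ← integral_indicator hP, integral_polar _ (hS.indicator hP),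
    ← integral_indicator (measurableSet_halfSphere N)]
  refine integral_congr_ae (.of_forall fun θ => ?_)
  have hθ : ‖(θ : Pt m)‖ = 1 := by simp
  by_cases hm : θ ∈ halfSphere N
  · have hm' : 0 < inner ℝ N (θ : Pt m) := hm
    simp only [indicator_of_mem hm]
    rw [← integral_indicator measurableSet_Ioi, ← integral_indicator measurableSet_Ioi]
    refine integral_congr_ae (.of_forall fun r => ?_)
    by_cases hr : 0 < r
    · have e1 : r • (θ : Pt m) ∈ P := by
        simp only [P, mem_ofPred_eq, inner_smul_right]; positivity
      have e2 : r • (θ : Pt m) ∈ D ↔ ε < r := by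
        simp [D, norm_smul, hθ, abs_of_pos hr]
      have e3 : -(r • (θ : Pt m)) ∈ D ↔ ε < r := by
        simp [D, norm_smul, hθ, abs_of_pos hr]
      by_cases hr2 : ε < r
      · simp [indicator, hr, hr2, e1, S, H, e2, e3]
      · simp [indicator, hr, hr2, e1, S, H, e2, e3]
    · have : ¬ ε < r := fun h => hr (hε.trans h)
      simp [indicator, hr, this]
  · simp only [indicator_of_notMem hm]
    rw [setIntegral_eq_zero_of_forall_eq_zero]
    intro r hr
    have hr' : 0 < r := hr
    have : r • (θ : Pt m) ∉ P := by
      intro h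
      simp only [P, mem_ofPred_eq, inner_smul_right] at h
      exact hm (pos_of_mul_pos_right h hr'.le |> fun h => by simpa [halfSphere] using h)
    simp [this]

end Polar

/-- `∫_{|h| > ε} (a + N · h)_+^{s-1} K(h) h dh`. -/
def modInt (s : ℝ) (K : Pt m → ℝ) (a : ℝ) (N : Pt m) (ε : ℝ) : Pt m :=
  ∫ h in {h : Pt m | ε < ‖h‖}, (posPow s (a + inner ℝ N h) * K h) • h

/-- `c_+^{2s-1} Ψ(ρ c)`. -/
def psiCore (s c ρ : ℝ) : ℝ := if 0 < c then c ^ (2 * s - 1) * Psi s (ρ * c) else 0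

/-- The profile of `modInt`. -/
def psi (s : ℝ) (K : Pt m → ℝ) (N : Pt m) (ρ : ℝ) : Pt m :=
  ∫ θ : 𝕊 m, (psiCore s (inner ℝ N (θ : Pt m)) ρ * K θ) • (θ : Pt m) ∂sph m

/-- `∫_{N · θ > 0} (N · θ)^{2s-1} K(θ) θ dθ`. -/
def halfVec (s : ℝ) (K : Pt m → ℝ) (N : Pt m) : Pt m :=
  ∫ θ in halfSphere N, sphereInt s K N θ ∂sph m

lemma norm_sphere_coe (θ : 𝕊 m) : ‖(θ : Pt m)‖ = 1 := by simp

lemma Ker.abs_le_sphere (k : Ker s lam Lam K) (θ : 𝕊 m) : |K θ| ≤ Lam := by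
  have h1 := k.hK.lower _ (norm_sphere_coe θ)
  have h2 := k.hK.upper _ (norm_sphere_coe θ)
  rwa [abs_of_nonneg (k.hlam.le.trans h1)]

lemma Ker.Lam_nonneg (k : Ker s lam Lam K) : 0 ≤ Lam := by
  have h1 : ‖(WeightedIBP.mk 0 1 : Pt m)‖ = 1 := by
    have := norm_sq_eq_initC_lastC (WeightedIBP.mk 0 1 : Pt m)
    simp only [initC_mk, lastC_mk, norm_zero] at this
    nlinarith [norm_nonneg (WeightedIBP.mk 0 1 : Pt m)]
  exact k.hlam.le.trans ((k.hK.lower _ h1).trans (k.hK.upper _ h1))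

lemma inner_sphere_le (N : Pt m) (θ : 𝕊 m) : inner ℝ N (θ : Pt m) ≤ ‖N‖ := by
  have := real_inner_le_norm N (θ : Pt m)
  rwa [norm_sphere_coe, mul_one] at this

lemma integrableOn_kernel_tail (k : Ker s lam Lam K) (hp : Measurable p) (hC : AbsGrowth p C (m + s)) (hε : 0 < ε) :
    IntegrableOn (fun h => (p h * K h) • h) {h : Pt m | ε < ‖h‖} := by
  have h1 := ((hC.tail hp (by have := k.hs.1; positivity) (b := -m - 2 * s) (by linarith [k.hs.1]) 0 hε).1)
  simp only [sub_zero] at h1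
  refine Integrable.mono' ((h1.mono_set fun h (hh : ε < ‖h‖) => hh.le).const_mul Lam) ?_ ?_
  · exact ((hp.mul k.hKm).smul measurable_id).aestronglyMeasurable
  filter_upwards [ae_restrict_mem (measurableSet_norm_gt ε)] with h hh
  have hh' : 0 < ‖h‖ := hε.trans hh
  rw [norm_smul, norm_mul, norm_eq_abs, norm_eq_abs]
  calc |p h| * |K h| * ‖h‖ ≤ |p h| * (Lam * ‖h‖ ^ (-((m : ℝ) + 1) - 2 * s)) * ‖h‖ := by
        gcongr
        exact k.abs_le (norm_pos_iff.1 hh')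
    _ = _ := by
        rw [show (-((m : ℝ) + 1) - 2 * s) = (-m - 2 * s) - 1 by ring, rpow_sub_one hh'.ne']
        field_simp

lemma integrableOn_modInt (k : Ker s lam Lam K) (a : ℝ) (hN : N ≠ 0) (hε : 0 < ε) :
    IntegrableOn (fun h => (posPow s (a + inner ℝ N h) * K h) • h) {h : Pt m | ε < ‖h‖} :=
  integrableOn_kernel_tail k (by fun_prop)
    (absGrowth_affine k.hs.1 k.hs.2.le (norm_pos_iff.2 hN) le_rfl a) hε

lemma integral_radial_scale (G : ℝ → ℝ) (ha : 0 < a) (hc : 0 < c) (hε : 0 < ε) :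
    ∫ r in Ioi ε, r ^ b * (a ^ (s - 1) * G (c / a * r)) =
      a ^ (s + b) * (c ^ (-b - 1) * ∫ t in Ioi (ε / a * c), t ^ b * G t) := by
  have hca : 0 < c / a := by positivity
  have h := integral_comp_mul_left_Ioi (fun t => t ^ b * G t) ε hca
  rw [smul_eq_mul, eq_inv_mul_iff_mul_eq₀ hca.ne'] at h
  rw [show ε / a * c = c / a * ε by ring, ← h]
  simp only [← integral_const_mul]
  refine setIntegral_congr_fun measurableSet_Ioi fun r hr => ?_
  rw [mul_rpow hca.le (hε.trans hr).le, div_rpow hc.le ha.le, show s + b = s - 1 + b + 1 by ring,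
    rpow_add_one ha.ne', rpow_add ha, show -b - 1 = -(b + 1) by ring, rpow_neg hc.le,
    rpow_add_one hc.ne']
  field_simp

lemma posPow_add_mul (ha : 0 < a) (c r : ℝ) :
    posPow s (a + r * c) = a ^ (s - 1) * posPow s (1 + c / a * r) := by
  rw [← posPow_mul ha]; congr 1; field_simp

lemma posPow_sub_mul (ha : 0 < a) (c r : ℝ) :
    posPow s (a - r * c) = a ^ (s - 1) * posPow s (1 - c / a * r) := by
  rw [← posPow_mul ha]; congr 1; field_simp

lemma integral_radial_diff (hs : s ∈ Ioo 0 1) (ha : 0 < a) (hc : 0 < c) (hε : 0 < ε) :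
    ∫ r in Ioi ε, r ^ (-2 * s) * (posPow s (a + r * c) - posPow s (a - r * c)) =
      a ^ (-s) * (c ^ (2 * s - 1) * Psi s (ε / a * c)) := by
  rw [← integral_sub_eq_Psi hs (by positivity), show -s = s + -2 * s by ring,
    show 2 * s - 1 = -(-2 * s) - 1 by ring, ← integral_radial_scale _ ha hc hε]
  refine setIntegral_congr_fun measurableSet_Ioi fun r hr => ?_
  have hr0 : 0 < r := hε.trans hr
  rw [posPow_add_mul ha, posPow_sub_mul ha, posPow_of_pos (by positivity), mul_sub (a ^ (s - 1))]

lemma radial_factor (hr : 0 < r) : r ^ m * r ^ (-((m : ℝ) + 1) - 2 * s) = r ^ (-1 - 2 * s) := by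
  rw [← rpow_natCast, ← rpow_add hr]; congr 1; ring

lemma modInt_eq (k : Ker s lam Lam K) (ha : 0 < a) (hN : N ≠ 0) (hε : 0 < ε) :
    modInt s K a N ε = a ^ (-s) • psi s K N (ε / a) := by
  rw [modInt, integral_half_polar hε N _ (integrableOn_modInt k a hN hε), psi,
    ← integral_smul, ← integral_indicator (measurableSet_halfSphere N)]
  · refine integral_congr_ae (.of_forall fun θ => ?_)
    by_cases hθ : θ ∈ halfSphere N
    · have hc : 0 < inner ℝ N (θ : Pt m) := hθ
      simp only [indicator_of_mem hθ, psiCore, if_pos hc]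
      set c := inner ℝ N (θ : Pt m)
      have e : ∀ r ∈ Ioi ε, r ^ m • ((posPow s (a + inner ℝ N (r • (θ : Pt m))) * K (r • (θ : Pt m))) • (r • (θ : Pt m))
          + (posPow s (a + inner ℝ N (-(r • (θ : Pt m)))) * K (-(r • (θ : Pt m)))) • (-(r • (θ : Pt m))))
          = (r ^ (-2 * s) * (posPow s (a + r * c) - posPow s (a - r * c))) • (K θ • (θ : Pt m)) := by
        intro r hr
        have hr0 : 0 < r := hε.trans hr
        rw [k.hK.neg, k.hK.smul (norm_sphere_coe θ) hr0, inner_neg_right, inner_smul_right,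
          ← sub_eq_add_neg, rpow_neg_one_sub hr0, ← radial_factor (m := m) hr0]
        simp only [smul_smul, smul_neg, ← sub_eq_add_neg, ← sub_smul]
        congr 1
        change _ = r * (r ^ m * r ^ (-((m : ℝ) + 1) - 2 * s)) * (posPow s (a + r * c) - posPow s (a - r * c)) * K θ
        ring
      rw [setIntegral_congr_fun measurableSet_Ioi e, integral_smul_const,
        integral_radial_diff k.hs ha hc hε, smul_smul, smul_smul]
      congr 1
      ring
    · have hc : ¬ 0 < inner ℝ N (θ : Pt m) := hθ
      simp [indicator_of_notMem hθ, psiCore, if_neg hc]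
  · intro h hh
    simp [k.hK.neg, hh]

lemma psiCore_nonneg (hρ : 0 < ρ) : 0 ≤ psiCore s c ρ := by
  unfold psiCore
  split_ifs with h
  · exact mul_nonneg (rpow_nonneg h.le _) (Psi_nonneg (by positivity))
  · exact le_rfl

lemma psiCore_le (hs : s ∈ Ioo 0 1) (hρ : 0 < ρ) :
    psiCore s c ρ ≤ (2 + 4 / s) * ρ ^ (2 - 2 * s) * |c| := by
  have := hs.1
  unfold psiCore
  split_ifs with h
  · calc c ^ (2 * s - 1) * Psi s (ρ * c) ≤ c ^ (2 * s - 1) * ((2 + 4 / s) * (ρ * c) ^ (2 - 2 * s)) := by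
          gcongr
          exact Psi_le hs (by positivity)
      _ = (2 + 4 / s) * ρ ^ (2 - 2 * s) * (c ^ (2 * s - 1) * c ^ (2 - 2 * s)) := by
          rw [mul_rpow hρ.le h.le]; ring
      _ = _ := by
          rw [← rpow_add h, show 2 * s - 1 + (2 - 2 * s) = 1 by ring, rpow_one, abs_of_pos h]
  · positivity

lemma psiCore_le_tail (hs : s ∈ Ioo 0 1) (hρ : 0 < ρ) :
    psiCore s c ρ ≤ ρ ^ (-s) / s * posPow s c := by
  have := hs.1
  unfold psiCore posPow
  split_ifs with h
  · calc c ^ (2 * s - 1) * Psi s (ρ * c) ≤ c ^ (2 * s - 1) * ((ρ * c) ^ (-s) / s) := by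
          gcongr
          exact Psi_le_tail hs (by positivity)
      _ = ρ ^ (-s) / s * (c ^ (2 * s - 1) * c ^ (-s)) := by
          rw [mul_rpow hρ.le h.le]; ring
      _ = _ := by
          rw [← rpow_add h]; congr 2; ring
  · simp

lemma continuousOn_psiCore (hs : s ∈ Ioo 0 1) :
    ContinuousOn (fun p : ℝ × ℝ => psiCore s p.1 p.2) (univ ×ˢ Ioi 0) := by
  rintro ⟨c, ρ⟩ ⟨-, hρ' : 0 < ρ⟩
  refine ContinuousAt.continuousWithinAt ?_
  rcases lt_trichotomy c 0 with h | h | h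
  · refine (continuousAt_const (y := (0 : ℝ))).congr ?_
    filter_upwards [continuousAt_fst.eventually (gt_mem_nhds h)] with p hp
    simp [psiCore, not_lt.2 (le_of_lt hp)]
  · subst h
    have h0 : psiCore s 0 ρ = 0 := by simp [psiCore]
    rw [ContinuousAt, h0]
    have hb : Tendsto (fun p : ℝ × ℝ => (2 + 4 / s) * p.2 ^ (2 - 2 * s) * |p.1|) (𝓝 (0, ρ)) (𝓝 0) := by
      have : ContinuousAt (fun p : ℝ × ℝ => (2 + 4 / s) * p.2 ^ (2 - 2 * s) * |p.1|) (0, ρ) := by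
        refine ContinuousAt.mul (ContinuousAt.mul continuousAt_const ?_) (by fun_prop)
        exact continuousAt_snd.rpow_const (Or.inl hρ'.ne')
      simpa [ContinuousAt] using this
    have hpos : ∀ᶠ p : ℝ × ℝ in 𝓝 (0, ρ), 0 < p.2 := continuousAt_snd.eventually (lt_mem_nhds hρ')
    refine squeeze_zero' ?_ ?_ hb
    · filter_upwards [hpos] with p hp using psiCore_nonneg hp
    · filter_upwards [hpos] with p hp using psiCore_le hs hp
  · have h1 : ContinuousAt (fun p : ℝ × ℝ => p.1 ^ (2 * s - 1) * Psi s (p.2 * p.1)) (c, ρ) := by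
      refine (continuousAt_fst.rpow_const (Or.inl h.ne')).mul ?_
      exact ContinuousAt.comp (f := fun p : ℝ × ℝ => p.2 * p.1) (g := Psi s)
        ((continuousOn_Psi hs).continuousAt (Ioi_mem_nhds (by positivity)))
        (continuousAt_snd.mul continuousAt_fst)
    refine h1.congr ?_
    filter_upwards [continuousAt_fst.eventually (lt_mem_nhds h)] with p hp
    rw [psiCore, if_pos hp]

lemma lintegral_sphere_posPow_le (hs : s ∈ Ioo 0 1) (hc0 : 0 < c0) (hN : c0 ≤ ‖N‖) :
    ∫⁻ θ : 𝕊 m, ofReal (posPow s (inner ℝ N (θ : Pt m))) ∂sph m ≤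
      ofReal ((m + s) * (toNNReal (c0 ^ (s - 1)) * fiberConst m s)) := by
  have hs0 := hs.1
  have h1 := growthBound_affine (m := m) hs.1 hs.2.le hc0 hN 0 0 1 one_pos
  simp only [zero_add, one_rpow, ofReal_one, mul_one] at h1
  rw [← lintegral_indicator measurableSet_ball, lintegral_polar _ (by
    exact (by fun_prop : Measurable fun y : Pt m =>
      ofReal (posPow s (inner ℝ N y))).indicator measurableSet_ball)] at h1
  have e : ∀ θ : 𝕊 m, ∫⁻ r in Ioi (0 : ℝ), ofReal (r ^ m) *
      (ball (0 : Pt m) 1).indicator (fun y => ofReal (posPow s (inner ℝ N y))) (r • (θ : Pt m))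
      = ofReal (1 / (m + s)) * ofReal (posPow s (inner ℝ N (θ : Pt m))) := by
    intro θ
    have h2 := lintegral_Ioc_rpow (b := m + s - 1) (r := 1) (by
      have : (0 : ℝ) ≤ m := by positivity
      linarith) one_pos
    rw [one_rpow, sub_add_cancel] at h2
    rw [← h2, ← lintegral_mul_const _ (by fun_prop), setLIntegral_congr Ioo_ae_eq_Ioc.symm,
      ← Iio_inter_Ioi, ← setLIntegral_indicator measurableSet_Iio]
    refine setLIntegral_congr_fun measurableSet_Ioi fun r (hr : 0 < r) => ?_
    simp only [indicator, mem_ball_zero_iff, norm_smul, norm_sphere_coe, mul_one, mem_Iio,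
      norm_of_nonneg hr.le, mul_ite, mul_zero]
    split_ifs
    · rw [inner_smul_right, posPow_mul hr, ofReal_mul (by positivity), ← mul_assoc,
        ← ofReal_mul (by positivity)]
      congr 2
      rw [← rpow_natCast, ← rpow_add hr]; congr 1; ring
    · rfl
  simp_rw [e] at h1
  rw [lintegral_const_mul' _ _ ofReal_ne_top] at h1
  have hpos : (0 : ℝ) < m + s := by positivity
  have h3 : ofReal (m + s) * ofReal (1 / (m + s)) = 1 := by
    rw [← ofReal_mul hpos.le, mul_one_div_cancel hpos.ne', ofReal_one]
  rw [ofReal_mul hpos.le]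
  calc _ = ofReal (m + s) * (ofReal (1 / (m + s)) *
        ∫⁻ θ : 𝕊 m, ofReal (posPow s (inner ℝ N (θ : Pt m))) ∂sph m) := by
        rw [← mul_assoc, h3, one_mul]
    _ ≤ _ := by
        gcongr
        refine h1.trans (le_of_eq ?_)
        rw [← NNReal.coe_mul, ofReal_coe_nnreal]

/-- A bound for `∫_{S} (N · θ)_+^{s-1} dθ` when `|N| ≥ c0`. -/
def sphereConst (m : ℕ) (s c0 : ℝ) : ℝ :=
  (m + s) * (toNNReal (c0 ^ (s - 1)) * fiberConst m s)

lemma sphere_posPow (hs : s ∈ Ioo 0 1) (hc0 : 0 < c0) (hN : c0 ≤ ‖N‖) :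
    Integrable (fun θ : 𝕊 m => posPow s (inner ℝ N (θ : Pt m))) (sph m) ∧
      ∫ θ : 𝕊 m, posPow s (inner ℝ N (θ : Pt m)) ∂sph m ≤ sphereConst m s c0 := by
  have hs0 := hs.1
  simpa using integrableOn_of_lintegral_le (μ := sph m) (S := univ)
    (f := fun θ : 𝕊 m => posPow s (inner ℝ N (θ : Pt m))) (by fun_prop)
    (fun θ => posPow_nonneg _ _) (B := sphereConst m s c0) (by unfold sphereConst; positivity)
    (by rw [Measure.restrict_univ]; exact lintegral_sphere_posPow_le hs hc0 hN)

lemma aestronglyMeasurable_psi_integrand (hs : s ∈ Ioo 0 1) (hKm : Measurable K) (N : Pt m) (hρ : 0 < ρ) :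
    AEStronglyMeasurable (fun θ : 𝕊 m =>
      (psiCore s (inner ℝ N (θ : Pt m)) ρ * K θ) • (θ : Pt m)) (sph m) := by
  have h1 : Continuous fun θ : 𝕊 m => psiCore s (inner ℝ N (θ : Pt m)) ρ := by
    refine (continuousOn_psiCore hs).comp_continuous
      (f := fun θ : 𝕊 m => ((inner ℝ N (θ : Pt m), ρ) : ℝ × ℝ)) (by fun_prop)
      fun θ => ⟨mem_univ _, hρ⟩
  exact ((h1.measurable.mul (hKm.comp measurable_subtype_coe)).smul
    measurable_subtype_coe).aestronglyMeasurable

lemma norm_psi_integrand_le (k : Ker s lam Lam K) (N : Pt m) (hρ : 0 < ρ) (θ : 𝕊 m) :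
    ‖(psiCore s (inner ℝ N (θ : Pt m)) ρ * K θ) • (θ : Pt m)‖ ≤
      Lam * psiCore s (inner ℝ N (θ : Pt m)) ρ := by
  rw [norm_smul, norm_sphere_coe, mul_one, norm_mul, norm_of_nonneg (psiCore_nonneg hρ),
    mul_comm, norm_eq_abs]
  have := k.abs_le_sphere θ
  have h0 := psiCore_nonneg (s := s) (c := inner ℝ N (θ : Pt m)) hρ
  gcongr

lemma norm_psi_le (k : Ker s lam Lam K) (N : Pt m) (hρ : 0 < ρ) :
    ‖psi s K N ρ‖ ≤ Lam * ((2 + 4 / s) * ρ ^ (2 - 2 * s) * ‖N‖) * (sph m).real univ := by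
  have hL := k.Lam_nonneg
  have hs0 := k.hs.1
  refine norm_integral_le_of_norm_le_const (.of_forall fun θ => ?_)
  refine (norm_psi_integrand_le k N hρ θ).trans ?_
  gcongr
  refine (psiCore_le k.hs hρ).trans ?_
  gcongr
  simpa using abs_real_inner_le_norm N (θ : Pt m)

lemma norm_psi_le_tail (k : Ker s lam Lam K) (hc0 : 0 < c0) (hN : c0 ≤ ‖N‖) (hρ : 0 < ρ) :
    ‖psi s K N ρ‖ ≤ Lam * (ρ ^ (-s) / s) * sphereConst m s c0 := by
  have hL := k.Lam_nonneg
  have hs0 := k.hs.1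
  obtain ⟨i1, i2⟩ := sphere_posPow k.hs hc0 hN
  calc ‖psi s K N ρ‖ ≤ ∫ θ : 𝕊 m,
        Lam * (ρ ^ (-s) / s) * posPow s (inner ℝ N (θ : Pt m)) ∂sph m := by
        refine norm_integral_le_of_norm_le (i1.const_mul _) (.of_forall fun θ => ?_)
        refine (norm_psi_integrand_le k N hρ θ).trans ?_
        rw [mul_assoc]
        gcongr
        exact psiCore_le_tail k.hs hρ
    _ ≤ _ := by
        rw [integral_const_mul]
        gcongr

lemma continuousOn_psi (k : Ker s lam Lam K) :
    ContinuousOn (fun p : Pt m × ℝ => psi s K p.1 p.2) (univ ×ˢ Ioi 0) := by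
  rintro ⟨N, ρ⟩ ⟨-, hρ' : 0 < ρ⟩
  have hL := k.Lam_nonneg
  have hs0 := k.hs.1
  refine ContinuousAt.continuousWithinAt ?_
  have e1 : ∀ᶠ p : Pt m × ℝ in 𝓝 (N, ρ), 0 < p.2 := continuousAt_snd.eventually (lt_mem_nhds hρ')
  have e2 : ∀ᶠ p : Pt m × ℝ in 𝓝 (N, ρ), p.2 < ρ + 1 :=
    continuousAt_snd.eventually (gt_mem_nhds (by linarith))
  have e3 : ∀ᶠ p : Pt m × ℝ in 𝓝 (N, ρ), ‖p.1‖ < ‖N‖ + 1 :=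
    continuousAt_fst.norm.eventually (gt_mem_nhds (by simp))
  refine continuousAt_of_dominated (F := fun (p : Pt m × ℝ) (θ : 𝕊 m) =>
    (psiCore s (inner ℝ p.1 (θ : Pt m)) p.2 * K θ) • (θ : Pt m))
    (bound := fun _ => Lam * ((2 + 4 / s) * (ρ + 1) ^ (2 - 2 * s) * (‖N‖ + 1))) ?_ ?_
    (integrable_const _) ?_
  · filter_upwards [e1] with p hp
    exact aestronglyMeasurable_psi_integrand k.hs k.hKm p.1 hp
  · filter_upwards [e1, e2, e3] with p h1 h2 h3
    refine Eventually.of_forall fun θ => (norm_psi_integrand_le k p.1 h1 θ).trans ?_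
    gcongr
    refine (psiCore_le k.hs h1).trans ?_
    gcongr
    · linarith [k.hs.2]
    · refine le_trans (by simpa using abs_real_inner_le_norm p.1 (θ : Pt m)) h3.le
  · refine Eventually.of_forall fun θ => ?_
    have h1 : ContinuousAt (fun p : ℝ × ℝ => psiCore s p.1 p.2) (inner ℝ N (θ : Pt m), ρ) :=
      (continuousOn_psiCore k.hs).continuousAt (prod_mem_nhds univ_mem (Ioi_mem_nhds hρ'))
    have h2 : ContinuousAt (fun p : Pt m × ℝ => psiCore s (inner ℝ p.1 (θ : Pt m)) p.2) (N, ρ) :=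
      ContinuousAt.comp (f := fun p : Pt m × ℝ => ((inner ℝ p.1 (θ : Pt m), p.2) : ℝ × ℝ))
        (g := fun p : ℝ × ℝ => psiCore s p.1 p.2) h1 (by fun_prop)
    exact (h2.mul continuousAt_const).smul continuousAt_const

/-- `c_+^{2s-1}` bounded by `|N|^s c_+^{s-1}`. -/
lemma posPow_two_mul_le (hs : s ∈ Ioo 0 1) (hc : c ≤ M) :
    posPow (2 * s) c ≤ M ^ s * posPow s c := by
  have := hs.1
  rcases le_or_gt c 0 with h | h
  · simp [posPow_of_nonpos h]
  rw [posPow_of_pos h, posPow_of_pos h, show 2 * s - 1 = s + (s - 1) by ring, rpow_add h]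
  gcongr

lemma sphere_posPow_two_mul (hs : s ∈ Ioo 0 1) (hc0 : 0 < c0) (hN : c0 ≤ ‖N‖) :
    Integrable (fun θ : 𝕊 m => posPow (2 * s) (inner ℝ N (θ : Pt m))) (sph m) ∧
      ∫ θ : 𝕊 m, posPow (2 * s) (inner ℝ N (θ : Pt m)) ∂sph m ≤ ‖N‖ ^ s * sphereConst m s c0 := by
  obtain ⟨i1, i2⟩ := sphere_posPow hs hc0 hN
  have hle : ∀ θ : 𝕊 m, posPow (2 * s) (inner ℝ N (θ : Pt m)) ≤
      ‖N‖ ^ s * posPow s (inner ℝ N (θ : Pt m)) := fun θ =>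
    posPow_two_mul_le hs (inner_sphere_le N θ)
  have i3 : Integrable (fun θ : 𝕊 m =>
      posPow (2 * s) (inner ℝ N (θ : Pt m))) (sph m) := by
    refine Integrable.mono' (i1.const_mul (‖N‖ ^ s)) (by
      exact Measurable.aestronglyMeasurable (by fun_prop)) (.of_forall fun θ => ?_)
    rw [norm_of_nonneg (posPow_nonneg _ _)]
    exact hle θ
  refine ⟨i3, ?_⟩
  calc _ ≤ ∫ θ : 𝕊 m, ‖N‖ ^ s * posPow s (inner ℝ N (θ : Pt m)) ∂sph m :=
        integral_mono i3 (i1.const_mul _) hle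
    _ ≤ _ := by
        rw [integral_const_mul]
        gcongr

lemma indicator_sphereInt (N : Pt m) : (halfSphere N).indicator (sphereInt s K N) = fun θ : 𝕊 m =>
      (posPow (2 * s) (inner ℝ N (θ : Pt m)) * K θ) • (θ : Pt m) := by
  ext1 θ
  by_cases h : θ ∈ halfSphere N
  · have h' : 0 < inner ℝ N (θ : Pt m) := h
    rw [indicator_of_mem h, posPow_of_pos h']; rfl
  · have h' : ¬ 0 < inner ℝ N (θ : Pt m) := h
    rw [indicator_of_notMem h, posPow_of_nonpos (not_lt.1 h')]; simp

lemma halfVec_eq (N : Pt m) : halfVec s K N = ∫ θ : 𝕊 m,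
    (posPow (2 * s) (inner ℝ N (θ : Pt m)) * K θ) • (θ : Pt m) ∂sph m := by
  rw [halfVec, ← integral_indicator (measurableSet_halfSphere N), indicator_sphereInt]

lemma norm_sphereInt_le (k : Ker s lam Lam K) (N : Pt m) (θ : 𝕊 m) :
    ‖(posPow (2 * s) (inner ℝ N (θ : Pt m)) * K θ) • (θ : Pt m)‖ ≤
      Lam * posPow (2 * s) (inner ℝ N (θ : Pt m)) := by
  rw [norm_smul, norm_sphere_coe, mul_one, norm_mul, norm_of_nonneg (posPow_nonneg _ _),
    mul_comm, norm_eq_abs]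
  have := k.abs_le_sphere θ
  have h0 := posPow_nonneg (2 * s) (inner ℝ N (θ : Pt m))
  gcongr

lemma integrable_sphereInt (k : Ker s lam Lam K) (hN : N ≠ 0) : Integrable (fun θ : 𝕊 m =>
      (posPow (2 * s) (inner ℝ N (θ : Pt m)) * K θ) • (θ : Pt m)) (sph m) := by
  obtain ⟨i1, i2⟩ := sphere_posPow_two_mul k.hs (norm_pos_iff.2 hN) le_rfl
  refine Integrable.mono' (i1.const_mul Lam) ?_ (.of_forall (norm_sphereInt_le k N))
  exact (((by fun_prop : Measurable fun θ : 𝕊 m =>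
    posPow (2 * s) (inner ℝ N (θ : Pt m))).mul (k.hKm.comp measurable_subtype_coe)).smul
    measurable_subtype_coe).aestronglyMeasurable

lemma integrableOn_sphereInt (k : Ker s lam Lam K) (hN : N ≠ 0) :
    IntegrableOn (sphereInt s K N) (halfSphere N) (sph m) := by
  rw [← integrable_indicator_iff (measurableSet_halfSphere N), indicator_sphereInt]
  exact integrable_sphereInt k hN

lemma psiCore_div_eq (hc : 0 < c) :
    ρ⁻¹ * psiCore s c ρ = posPow (2 * s) c * c * (Psi s (ρ * c) * (ρ * c)⁻¹) := by
  rw [psiCore, if_pos hc, posPow_of_pos hc, mul_inv]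
  field_simp

lemma integral_psiCore_div (hs : s ∈ Ioo 0 1) (c : ℝ) :
    IntegrableOn (fun ρ => ρ⁻¹ * psiCore s c ρ) (Ioi 0) ∧
    ∫ ρ in Ioi (0 : ℝ), ρ⁻¹ * psiCore s c ρ = cs s * posPow (2 * s) c := by
  rcases le_or_gt c 0 with h | h
  · simp [psiCore, not_lt.2 h, posPow_of_nonpos h]
  simp_rw [psiCore_div_eq h]
  constructor
  · refine Integrable.const_mul ?_ _
    have := (integrableOn_Ioi_comp_mul_right_iff (fun x => Psi s x * x⁻¹) 0 h).2 (by
      rw [zero_mul]; exact integrableOn_Psi_div hs)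
    exact this
  · rw [integral_const_mul, integral_comp_mul_right_Ioi (fun x => Psi s x * x⁻¹) 0 h, zero_mul,
      integral_Psi_div hs, smul_eq_mul]
    field_simp

lemma integral_psi_div (k : Ker s lam Lam K) (hN : N ≠ 0) :
    ∫ ρ in Ioi (0 : ℝ), ρ⁻¹ • psi s K N ρ = cs s • halfVec s K N := by
  have hL := k.Lam_nonneg
  set f : ℝ × 𝕊 m → Pt m := fun p =>
    (p.1⁻¹ * psiCore s (inner ℝ N (p.2 : Pt m)) p.1 * K p.2) • (p.2 : Pt m) with hf
  have hfm : AEStronglyMeasurable f ((volume.restrict (Ioi (0 : ℝ))).prod (sph m)) := by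
    have h1 : AEStronglyMeasurable (fun p : ℝ × 𝕊 m =>
        psiCore s (inner ℝ N (p.2 : Pt m)) p.1) ((volume.restrict (Ioi (0 : ℝ))).prod (sph m)) := by
      have hc : ContinuousOn (fun p : ℝ × 𝕊 m =>
          psiCore s (inner ℝ N (p.2 : Pt m)) p.1) (Ioi 0 ×ˢ univ) :=
        (continuousOn_psiCore k.hs).comp (f := fun p : ℝ × 𝕊 m =>
          ((inner ℝ N (p.2 : Pt m), p.1) : ℝ × ℝ)) (by fun_prop)
          (fun p hp => ⟨mem_univ _, hp.1⟩)
      have := hc.aestronglyMeasurable (μ := (volume : Measure ℝ).prod (sph m))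
        (measurableSet_Ioi.prod MeasurableSet.univ)
      rwa [← Measure.prod_restrict, Measure.restrict_univ] at this
    have h2 : Measurable fun p : ℝ × 𝕊 m => K p.2 :=
      k.hKm.comp (measurable_subtype_coe.comp measurable_snd)
    have h3 : Measurable fun p : ℝ × 𝕊 m => (p.2 : Pt m) := by fun_prop
    have h4 : Measurable fun p : ℝ × 𝕊 m => p.1⁻¹ := by fun_prop
    exact ((h4.aestronglyMeasurable.mul h1).mul h2.aestronglyMeasurable).smul h3.aestronglyMeasurable
  have hnorm : ∀ (θ : 𝕊 m) (ρ : ℝ), 0 < ρ →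
      ‖f (ρ, θ)‖ = (ρ⁻¹ * psiCore s (inner ℝ N (θ : Pt m)) ρ) * |K θ| := by
    intro θ ρ hρ
    simp only [hf, norm_smul, norm_sphere_coe, mul_one, norm_mul, norm_eq_abs]
    rw [abs_of_nonneg (psiCore_nonneg hρ), abs_of_pos (inv_pos.2 hρ)]
  have hfi : Integrable f ((volume.restrict (Ioi (0 : ℝ))).prod (sph m)) := by
    rw [integrable_prod_iff' hfm]
    constructor
    · refine Eventually.of_forall fun θ => ?_
      simp only [hf]
      exact ((integral_psiCore_div k.hs _).1.mul_const _).smul_const _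
    · have e : ∀ θ : 𝕊 m, ∫ ρ in Ioi (0 : ℝ), ‖f (ρ, θ)‖ =
          cs s * (posPow (2 * s) (inner ℝ N (θ : Pt m)) * |K θ|) := by
        intro θ
        rw [setIntegral_congr_fun measurableSet_Ioi (fun ρ hρ => hnorm θ ρ hρ), integral_mul_const,
          (integral_psiCore_div k.hs _).2, mul_assoc]
      simp_rw [e]
      refine ((integrable_sphereInt k hN).norm.congr (.of_forall fun θ => ?_)).const_mul _
      simp only [norm_smul, norm_sphere_coe, mul_one, norm_mul, norm_eq_abs,
        abs_of_nonneg (posPow_nonneg _ _)]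
  calc ∫ ρ in Ioi (0 : ℝ), ρ⁻¹ • psi s K N ρ = ∫ ρ in Ioi (0 : ℝ), (∫ θ, f (ρ, θ) ∂sph m) := by
        refine integral_congr_ae (.of_forall fun ρ => ?_)
        simp only [psi, hf]
        rw [← integral_smul]
        simp only [smul_smul, mul_assoc]
    _ = ∫ θ, (∫ ρ in Ioi (0 : ℝ), f (ρ, θ)) ∂sph m := integral_integral_swap hfi
    _ = _ := by
        rw [halfVec_eq, ← integral_smul]
        refine integral_congr_ae (.of_forall fun θ => ?_)
        simp only [hf]
        rw [integral_smul_const, integral_mul_const, (integral_psiCore_div k.hs _).2, smul_smul,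
          mul_assoc]

/-- The vector `e_n`. -/
def eN (m : ℕ) : Pt m := mk 0 1

lemma norm_eN : ‖eN m‖ = 1 := by
  have := norm_sq_eq_initC_lastC (eN m)
  simp only [eN, initC_mk, lastC_mk, norm_zero] at this
  nlinarith [norm_nonneg (mk 0 1 : Pt m), show ‖eN m‖ = ‖(mk 0 1 : Pt m)‖ from rfl]

lemma inner_eN (x : Pt m) : inner ℝ (eN m) x = lastC x := by
  rw [inner_eq_initC_lastC]; simp [eN]

lemma eN_ne_zero : eN m ≠ 0 := by
  rw [← norm_ne_zero_iff, norm_eN]; exact one_ne_zero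

lemma norm_K_smul_mk_le (k : Ker s lam Lam K) (x : Hyp m) (ht : 1 ≤ t) :
    ‖K (mk x t) • mk x t‖ ≤ Lam * (1 + ‖x‖ ^ 2) ^ (-(m + 2 * s) / 2) := by
  have hL := k.Lam_nonneg
  have hs := k.hs.1
  have hn : 1 + ‖x‖ ^ 2 ≤ ‖mk x t‖ ^ 2 := by
    rw [norm_sq_eq_initC_lastC, initC_mk, lastC_mk]; nlinarith
  have hpos : 0 < ‖mk x t‖ := by
    by_contra! h
    nlinarith [norm_nonneg (mk x t), sq_nonneg ‖x‖]
  calc ‖K (mk x t) • mk x t‖ ≤ Lam * ‖mk x t‖ ^ (-((m : ℝ) + 1) - 2 * s) * ‖mk x t‖ := by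
        rw [norm_smul, norm_eq_abs]
        gcongr
        exact k.abs_le (norm_pos_iff.1 hpos)
    _ = Lam * (‖mk x t‖ ^ 2) ^ (-(m + 2 * s) / 2) := by
        rw [mul_assoc, ← rpow_add_one hpos.ne', ← rpow_natCast, ← rpow_mul hpos.le]
        congr 2; push_cast; ring
    _ ≤ _ := mul_le_mul_of_nonneg_left
        (rpow_le_rpow_of_nonpos (by positivity) hn (by linarith [m.cast_nonneg (α := ℝ)])) hL

lemma integrable_hyp (k : Ker s lam Lam K) :
    Integrable (fun x : Hyp m => Lam * (1 + ‖x‖ ^ 2) ^ (-(m + 2 * s) / 2)) := by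
  refine Integrable.const_mul (integrable_rpow_neg_one_add_norm_sq ?_) _
  simp only [finrank_euclideanSpace, Fintype.card_fin]
  linarith [k.hs.1]

lemma integrable_mk_one (k : Ker s lam Lam K) :
    Integrable (fun h' : Hyp m => K (mk h' 1) • mk h' 1) := by
  have hc : Measurable fun h' : Hyp m => mk h' 1 :=
    (continuous_mk.comp (by fun_prop : Continuous fun h' : Hyp m => (h', (1 : ℝ)))).measurable
  exact (integrable_hyp k).mono' ((k.hKm.comp hc).smul hc).aestronglyMeasurable
    (.of_forall fun x => norm_K_smul_mk_le k x le_rfl)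

lemma smul_mk (t : ℝ) (x : Hyp m) (u : ℝ) : t • mk x u = mk (t • x) (t * u) := by
  rw [← mk_initC_lastC (t • mk x u), initC_smul, lastC_smul, initC_mk, lastC_mk]

lemma IsKernel.smul_pos (hK : IsKernel s lam Lam K) (hx : x ≠ 0) (ht : 0 < t) :
    K (t • x) = t ^ (-((m : ℝ) + 1) - 2 * s) * K x := by
  rw [hK.homog _ (smul_ne_zero ht.ne' hx), hK.homog x hx, norm_smul, norm_of_nonneg ht.le,
    mul_rpow ht.le (norm_nonneg x), smul_smul, mul_inv_rev, inv_mul_cancel_right₀ ht.ne', mul_assoc]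

lemma integral_smul_euclid (f : Hyp m → Pt m) (ht : 0 < t) : ∫ x, f x = t ^ m • ∫ x, f (t • x) := by
  have h := Measure.integral_comp_smul (volume : Measure (Hyp m)) f t
  rw [finrank_euclideanSpace, Fintype.card_fin, abs_of_pos (by positivity)] at h
  rw [h, smul_smul, mul_inv_cancel₀ (by positivity), one_smul]

/-- Gnomonic projection: the two expressions for the constant vector agree. -/
lemma halfVec_eN (k : Ker s lam Lam K) :
    halfVec s K (eN m) = ∫ h' : Hyp m, K (mk h' 1) • mk h' 1 := by
  have hs := k.hs.1
  set S : Set (Pt m) := {h | lastC h ∈ Ioo (1 : ℝ) 2} with hS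
  have hSm : MeasurableSet S := measurable_lastC measurableSet_Ioo
  set F : Pt m → Pt m := S.indicator (fun h => lastC h ^ (2 * s) • K h • h) with hF
  have hFm : AEStronglyMeasurable F := (((measurable_lastC.pow_const _).smul
    (k.hKm.smul measurable_id)).indicator hSm).aestronglyMeasurable
  have hFi' : Integrable (fun p : Hyp m × ℝ => F (mk p.1 p.2)) (volume.prod volume) := by
    refine ((integrable_hyp k).mul_prod ((integrable_indicator_iff measurableSet_Ioo).2
      (integrableOn_const (C := (2 : ℝ) ^ (2 * s)) (measure_Ioo_lt_top (a := (1 : ℝ)) (b := 2)).ne))).mono'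
      (hFm.comp_measurePreserving measurePreserving_mk) (.of_forall fun p => ?_)
    by_cases hp : p.2 ∈ Ioo (1 : ℝ) 2
    · rw [hF, indicator_of_mem (by simpa [hS] using hp), indicator_of_mem hp, lastC_mk, norm_smul,
        norm_of_nonneg (rpow_nonneg (by linarith [hp.1]) _), mul_comm]
      exact mul_le_mul (norm_K_smul_mk_le k p.1 hp.1.le)
        (rpow_le_rpow (by linarith [hp.1]) hp.2.le (by linarith))
        (rpow_nonneg (by linarith [hp.1]) _) ((norm_nonneg _).trans (norm_K_smul_mk_le k p.1 hp.1.le))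
    · rw [hF, indicator_of_notMem (by simpa [hS] using hp), indicator_of_notMem hp]; simp
  have hFi : Integrable F :=
    (measurePreserving_mk.integrable_comp_emb measurableEmbedding_mk).1 hFi'
  rw [halfVec_eq, ← one_smul ℝ (∫ h' : Hyp m, _)]
  trans ∫ x, F x
  · rw [integral_polar F hFi]
    refine integral_congr_ae (.of_forall fun θ => ?_)
    simp only [inner_eN]
    set b := lastC (θ : Pt m)
    rcases le_or_gt b 0 with hb | hb
    · rw [posPow_of_nonpos hb, zero_mul, zero_smul, setIntegral_eq_zero_of_forall_eq_zero]
      intro r (hr : 0 < r)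
      rw [hF, indicator_of_notMem, smul_zero]
      intro h
      have h1 : 1 < lastC (r • (θ : Pt m)) := h.1
      rw [lastC_smul] at h1
      nlinarith
    · have e : ∀ r ∈ Ioi (0 : ℝ), r ^ m • F (r • (θ : Pt m)) =
          (Ioo (1 / b) (2 / b)).indicator (fun _ => (b ^ (2 * s) * K θ) • (θ : Pt m)) r := by
        intro r (hr : 0 < r)
        have hmem : r • (θ : Pt m) ∈ S ↔ r ∈ Ioo (1 / b) (2 / b) := by
          rw [mem_Ioo, div_lt_iff₀ hb, lt_div_iff₀ hb, hS, mem_ofPred_eq, lastC_smul]; rfl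
        by_cases hr1 : r ∈ Ioo (1 / b) (2 / b)
        · rw [hF, indicator_of_mem (hmem.2 hr1), indicator_of_mem hr1,
            k.hK.smul (norm_sphere_coe θ) hr, lastC_smul]
          simp only [smul_smul]
          congr 1
          rw [mul_rpow hr.le hb.le]
          have : r ^ m * r ^ (-((m : ℝ) + 1) - 2 * s) * r * r ^ (2 * s) = 1 := by
            rw [radial_factor hr, mul_comm _ r, ← rpow_neg_one_sub hr, ← rpow_add hr]; simp
          linear_combination (b ^ (2 * s) * K θ) * this
        · rw [hF, indicator_of_notMem (by rwa [hmem]), indicator_of_notMem hr1, smul_zero]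
      rw [setIntegral_congr_fun measurableSet_Ioi e, setIntegral_indicator measurableSet_Ioo,
        inter_eq_self_of_subset_right (s := Ioi 0) fun r hr => (one_div_pos.2 hb).trans hr.1, setIntegral_const,
        volume_real_Ioo_of_le (by gcongr; norm_num), smul_smul, posPow_of_pos hb, rpow_sub_one hb.ne']
      congr 1
      ring
  · rw [← measurePreserving_mk.integral_comp measurableEmbedding_mk, Measure.volume_eq_prod,
      integral_prod_symm _ hFi']
    have e : ∀ t, ∫ x, F (mk x t) =
        (Ioo (1 : ℝ) 2).indicator (fun _ => ∫ h' : Hyp m, K (mk h' 1) • mk h' 1) t := by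
      intro t
      by_cases ht : t ∈ Ioo (1 : ℝ) 2
      · have ht0 : 0 < t := by linarith [ht.1]
        rw [indicator_of_mem ht, integral_smul_euclid _ ht0, ← integral_smul]
        refine integral_congr_ae (.of_forall fun x => ?_)
        have h0 : mk x 1 ≠ 0 := fun h => by
          have := lastC_mk x 1
          rw [h] at this; simp [lastC] at this
        have : mk (t • x) t ∈ S := by simpa [hS] using ht
        simp only [hF, indicator_of_mem this]
        rw [lastC_mk, show mk (t • x) t = t • mk x 1 by rw [smul_mk, mul_one], k.hK.smul_pos h0 ht0]
        simp only [smul_smul]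
        have : t ^ m * t ^ (-((m : ℝ) + 1) - 2 * s) * t * t ^ (2 * s) = 1 := by
          rw [radial_factor ht0, mul_comm _ t, ← rpow_neg_one_sub ht0, ← rpow_add ht0]; simp
        congr 1
        linear_combination K (mk x 1) * this
      · have : ∀ x : Hyp m, F (mk x t) = 0 := fun x =>
          indicator_of_notMem (by simpa [hS] using ht) _
        simp [this, indicator_of_notMem ht]
    simp_rw [e]
    rw [integral_indicator measurableSet_Ioo, setIntegral_const, volume_real_Ioo_of_le one_le_two]
    norm_num

lemma integral_radial_second (ha : 0 < a) (hc : 0 < c) (hε : 0 < ε) :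
    ∫ r in Ioi ε, r ^ (-1 - 2 * s) * (2 * posPow s a - posPow s (a + r * c) - posPow s (a - r * c)) =
      a ^ (-s - 1) * (c ^ (2 * s) * Phi s (ε / a * c)) := by
  have h := integral_radial_scale (s := s) (b := -1 - 2 * s)
    (fun t => 2 - (1 + t) ^ (s - 1) - posPow s (1 - t)) ha hc hε
  rw [show -(-1 - 2 * s) - 1 = 2 * s by ring, show s + (-1 - 2 * s) = -s - 1 by ring] at h
  rw [Phi, ← h]
  refine setIntegral_congr_fun measurableSet_Ioi fun r hr => ?_
  have hr0 : 0 < r := hε.trans hr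
  rw [posPow_add_mul ha, posPow_sub_mul ha, posPow_of_pos ha, posPow_of_pos (by positivity)]
  ring_nf

lemma integrableOn_kernel_scalar (k : Ker s lam Lam K) (hp : Measurable p) (hA : 0 ≤ A)
    (hA' : A < m + 1 + 2 * s)
    (hC : AbsGrowth p C A) (x : Pt m) (hε : 0 < ε) :
    IntegrableOn (fun y => p y * K (y - x)) {y : Pt m | ε < ‖y - x‖} := by
  have h1 := (hC.tail hp hA (b := -((m : ℝ) + 1) - 2 * s) (by linarith) x hε).1
  refine Integrable.mono' ((h1.mono_set fun h (hh : ε < ‖h - x‖) => hh.le).const_mul Lam) ?_ ?_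
  · exact (hp.mul (k.hKm.comp (measurable_id.sub_const x))).aestronglyMeasurable
  filter_upwards [ae_restrict_mem (measurableSet_lt measurable_const (by fun_prop))] with h hh
  have hh' : 0 < ‖h - x‖ := hε.trans hh
  rw [norm_mul, norm_eq_abs, norm_eq_abs]
  calc |p h| * |K (h - x)| ≤ |p h| * (Lam * ‖h - x‖ ^ (-((m : ℝ) + 1) - 2 * s)) := by
        gcongr
        exact k.abs_le (norm_pos_iff.1 hh')
    _ = _ := by ring

/-- The principal value of `∫ (a^{s-1} - (a + N · h)_+^{s-1}) K(h) dh` is `0`. -/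
lemma tendsto_weight_trunc (k : Ker s lam Lam K) (ha : 0 < a) (hN : ‖N‖ = 1) :
    Tendsto (fun ε => ∫ h in {h : Pt m | ε < ‖h‖}, (posPow s a - posPow s (a + inner ℝ N h)) * K h)
      (𝓝[>] 0) (𝓝 0) := by
  have hs0 := k.hs.1
  have hL := k.Lam_nonneg
  have hint : ∀ ε > 0, IntegrableOn (fun h : Pt m => (posPow s a - posPow s (a + inner ℝ N h)) * K h)
      {h : Pt m | ε < ‖h‖} := by
    intro ε hε
    simp_rw [sub_mul]
    refine Integrable.sub ?_ ?_
    · simpa using (integrableOn_kernel_scalar k measurable_const (by positivity) (by linarith)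
        absGrowth_one (0 : Pt m) hε).const_mul (posPow s a)
    · have := integrableOn_kernel_scalar k (by fun_prop) (by positivity)
        (by linarith) (absGrowth_affine hs0 k.hs.2.le one_pos hN.ge a) (0 : Pt m) hε
      simp only [sub_zero] at this
      exact this
  have hbound : ∀ᶠ ε in 𝓝[>] (0 : ℝ), ‖∫ h in {h : Pt m | ε < ‖h‖},
      (posPow s a - posPow s (a + inner ℝ N h)) * K h‖ ≤
      a ^ (-s - 1) * ((1 + 3 / s) * (ε / a) ^ (2 - 2 * s)) * Lam * (sph m).real univ := by
    filter_upwards [Ioo_mem_nhdsGT ha] with ε hεa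
    have hε' := hεa.1
    rw [integral_half_polar hε' N _ (hint ε hε') (fun h hh => by simp [hh]),
      ← integral_indicator (measurableSet_halfSphere N)]
    refine norm_integral_le_of_norm_le_const (.of_forall fun θ => ?_)
    by_cases hθ : θ ∈ halfSphere N
    · have hc : 0 < inner ℝ N (θ : Pt m) := hθ
      have hc1 : inner ℝ N (θ : Pt m) ≤ 1 := (inner_sphere_le N θ).trans hN.le
      rw [indicator_of_mem hθ]
      set c := inner ℝ N (θ : Pt m) with hcdef
      have e : ∀ r ∈ Ioi ε, r ^ m • ((posPow s a - posPow s (a + inner ℝ N (r • (θ : Pt m)))) * K (r • (θ : Pt m))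
          + (posPow s a - posPow s (a + inner ℝ N (-(r • (θ : Pt m))))) * K (-(r • (θ : Pt m))))
          = r ^ (-1 - 2 * s) * (2 * posPow s a - posPow s (a + r * c) - posPow s (a - r * c)) * K θ := by
        intro r hr
        have hr0 : 0 < r := hε'.trans hr
        rw [k.hK.neg, k.hK.smul (norm_sphere_coe θ) hr0, inner_neg_right, inner_smul_right,
          ← sub_eq_add_neg, ← radial_factor (m := m) hr0, smul_eq_mul]
        ring
      rw [setIntegral_congr_fun measurableSet_Ioi e, integral_mul_const,
        integral_radial_second ha hc hε', norm_mul, norm_eq_abs, norm_eq_abs]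
      have hεa' : ε / a < 1 := (div_lt_one ha).2 hεa.2
      have hεa0 : 0 < ε / a := by positivity
      have h1 : |Phi s (ε / a * c)| ≤ (1 + 3 / s) * (ε / a) ^ (2 - 2 * s) := by
        refine (abs_Phi_le k.hs (by positivity) (by nlinarith)).trans ?_
        gcongr
        · linarith [k.hs.2]
        · nlinarith
      rw [abs_mul, abs_mul, abs_of_pos (rpow_pos_of_pos ha _), abs_of_pos (rpow_pos_of_pos hc _)]
      have h3 : c ^ (2 * s) * |Phi s (ε / a * c)| ≤ (1 + 3 / s) * (ε / a) ^ (2 - 2 * s) :=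
        (mul_le_of_le_one_left (abs_nonneg _) (rpow_le_one hc.le hc1 (by positivity))).trans h1
      have h5 : 0 ≤ a ^ (-s - 1) := rpow_nonneg ha.le _
      have h6 : 0 ≤ (1 + 3 / s) * (ε / a) ^ (2 - 2 * s) := (abs_nonneg _).trans h1
      exact mul_le_mul (mul_le_mul_of_nonneg_left h3 h5) (k.abs_le_sphere θ) (abs_nonneg _) (mul_nonneg h5 h6)
    · rw [indicator_of_notMem hθ, norm_zero]
      positivity
  refine squeeze_zero_norm' hbound ?_
  have h1 : Tendsto (fun ε : ℝ => (ε / a) ^ (2 - 2 * s)) (𝓝[>] 0) (𝓝 0) := by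
    have : ContinuousAt (fun ε : ℝ => (ε / a) ^ (2 - 2 * s)) 0 :=
      ContinuousAt.rpow_const (by fun_prop) (Or.inr (by linarith [k.hs.2]))
    have h2 := this.tendsto.mono_left (nhdsWithin_le_nhds (s := Ioi 0))
    rwa [zero_div, zero_rpow (by linarith [k.hs.2])] at h2
  have h2 := (((h1.const_mul (1 + 3 / s)).const_mul (a ^ (-s - 1))).mul_const Lam).mul_const
    ((sph m).real univ)
  simpa using h2

/-- An integrable majorant on the half line. -/
def majorant (s τ : ℝ) : ℝ := (Ioc (0 : ℝ) 1).indicator (fun τ => τ ^ (s - 1)) τ +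
  (Ioi (1 : ℝ)).indicator (fun τ => τ ^ (2 * s - 3)) τ

lemma integrable_majorant (hs : s ∈ Ioo 0 1) : Integrable (majorant s) := by
  refine Integrable.add ?_ ?_
  · rw [integrable_indicator_iff measurableSet_Ioc,
      ← intervalIntegrable_iff_integrableOn_Ioc_of_le zero_le_one]
    exact intervalIntegral.intervalIntegrable_rpow' (by linarith [hs.1])
  · rw [integrable_indicator_iff measurableSet_Ioi]
    exact integrableOn_Ioi_rpow_of_lt (by linarith [hs.2]) one_pos

lemma majorant_nonneg (s τ : ℝ) : 0 ≤ majorant s τ := by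
  refine add_nonneg (indicator_nonneg (fun x hx => rpow_nonneg hx.1.le _) _)
    (indicator_nonneg (fun x (hx : 1 < x) => rpow_nonneg (by linarith) _) _)

lemma le_majorant {B : ℝ} (hτ : 0 < τ) (hA : 0 ≤ A) (hB : 0 ≤ B)
    (h1 : b ≤ A * τ ^ (s - 1)) (h2 : b ≤ B * τ ^ (2 * s - 3)) : b ≤ (A + B) * majorant s τ := by
  rcases le_or_gt τ 1 with h | h
  · have : majorant s τ = τ ^ (s - 1) := by
      simp [majorant, indicator, hτ, h, not_lt.2 h]
    rw [this]
    have := rpow_nonneg hτ.le (s - 1)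
    nlinarith
  · have : majorant s τ = τ ^ (2 * s - 3) := by
      simp [majorant, indicator, not_le.2 h, h]
    rw [this]
    have := rpow_nonneg hτ.le (2 * s - 3)
    nlinarith

lemma exists_psi_bound (k : Ker s lam Lam K) (hc0 : 0 < c0) :
    ∃ A ≥ 0, ∀ N : Pt m, c0 ≤ ‖N‖ → ‖N‖ ≤ C0 → ∀ ρ : ℝ, 0 < ρ →
      ‖psi s K N ρ‖ ≤ A * ρ ^ (2 - 2 * s) ∧ ‖psi s K N ρ‖ ≤ A * ρ ^ (-s) := by
  have hL := k.Lam_nonneg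
  have hs0 := k.hs.1
  have hS : 0 ≤ sphereConst m s c0 := by unfold sphereConst; positivity
  set A1 := Lam * ((2 + 4 / s) * |C0|) * (sph m).real univ
  set A2 := Lam * (1 / s) * sphereConst m s c0
  have hA1 : 0 ≤ A1 := by positivity
  have hA2 : 0 ≤ A2 := by positivity
  refine ⟨A1 + A2, by positivity, fun N h1 h2 ρ hρ => ⟨?_, ?_⟩⟩
  · have hp := rpow_nonneg hρ.le (2 - 2 * s)
    calc ‖psi s K N ρ‖ ≤ Lam * ((2 + 4 / s) * ρ ^ (2 - 2 * s) * ‖N‖) * (sph m).real univ :=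
          norm_psi_le k N hρ
      _ ≤ Lam * ((2 + 4 / s) * ρ ^ (2 - 2 * s) * |C0|) * (sph m).real univ := by
          gcongr; exact h2.trans (le_abs_self _)
      _ = A1 * ρ ^ (2 - 2 * s) := by simp only [A1]; ring
      _ ≤ _ := by gcongr; linarith
  · have hp := rpow_nonneg hρ.le (-s)
    calc ‖psi s K N ρ‖ ≤ Lam * (ρ ^ (-s) / s) * sphereConst m s c0 :=
          norm_psi_le_tail k hc0 h1 hρ
      _ = A2 * ρ ^ (-s) := by simp only [A2]; ring
      _ ≤ _ := by gcongr; linarith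

/-- Bound for the rescaled boundary-layer integrand. -/
lemma exists_layer_bound (k : Ker s lam Lam K) {C : ℝ} (hc0 : 0 < c0) (hc : 0 < c) :
    ∃ A ≥ 0, ∀ N : Pt m, c0 ≤ ‖N‖ → ‖N‖ ≤ C0 → ∀ τ q : ℝ, 0 < τ → c * τ ≤ q → q ≤ C * τ →
      q⁻¹ * ‖psi s K N q⁻¹‖ ≤ A * majorant s τ := by
  obtain ⟨A, hA, hb⟩ := exists_psi_bound k hc0
  have hs0 := k.hs.1
  refine ⟨c⁻¹ * A * |C| ^ s + c⁻¹ * A * c⁻¹ ^ (2 - 2 * s), by positivity,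
    fun N h1 h2 τ q hτ hq1 hq2 => ?_⟩
  have hq := (mul_pos hc hτ).trans_le hq1
  obtain ⟨b1, b2⟩ := hb N h1 h2 q⁻¹ (inv_pos.2 hq)
  have hqi : q⁻¹ ≤ c⁻¹ * τ⁻¹ := by
    rw [← mul_inv]; exact inv_anti₀ (mul_pos hc hτ) hq1
  have hC : 0 < C := by
    by_contra h
    have : C * τ ≤ 0 := mul_nonpos_of_nonpos_of_nonneg (not_lt.1 h) hτ.le
    linarith
  refine le_majorant hτ (by positivity) (by positivity) ?_ ?_
  · calc q⁻¹ * ‖psi s K N q⁻¹‖ ≤ (c⁻¹ * τ⁻¹) * (A * (C * τ) ^ s) := by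
          gcongr
          refine b2.trans ?_
          rw [inv_rpow hq.le, rpow_neg hq.le, inv_inv]
          gcongr
      _ = _ := by
          rw [mul_rpow hC.le hτ.le, rpow_sub_one hτ.ne', abs_of_pos hC]
          field_simp
  · calc q⁻¹ * ‖psi s K N q⁻¹‖ ≤ (c⁻¹ * τ⁻¹) * (A * (c⁻¹ * τ⁻¹) ^ (2 - 2 * s)) := by
          gcongr
          refine b1.trans ?_
          gcongr
          linarith [k.hs.2]
      _ = _ := by
          rw [mul_rpow (by positivity) (by positivity), inv_rpow hτ.le,
            ← rpow_neg hτ.le, show 2 * s - 3 = (-(2 - 2 * s)) - 1 by ring,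
            rpow_sub_one hτ.ne']
          field_simp

lemma map_scale (hε : 0 < ε) : Measure.map (fun p : Hyp m × ℝ => (p.1, ε * p.2)) volume =
      ofReal ε⁻¹ • volume := by
  have h := Measure.map_prod_map (volume : Measure (Hyp m))
    (volume : Measure ℝ) (g := fun t => ε * t) measurable_id (by fun_prop)
  rw [map_volume_mul_left hε.ne', Measure.map_id, Measure.prod_smul_right,
    abs_of_pos (inv_pos.2 hε)] at h
  rw [Measure.volume_eq_prod]
  exact h.symm

lemma measurableEmbedding_scale (hε : 0 < ε) :
    MeasurableEmbedding (fun p : Hyp m × ℝ => (p.1, ε * p.2)) :=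
  (MeasurableEmbedding.id.prodMap (measurableEmbedding_mulLeft₀ hε.ne'))

lemma integral_scale (hε : 0 < ε) (f : Hyp m × ℝ → ℝ) :
    ∫ p, f p = ∫ p : Hyp m × ℝ, ε * f (p.1, ε * p.2) := by
  have h := (measurableEmbedding_scale hε).integral_map f (μ := volume)
  rw [map_scale hε, integral_smul_measure, ENNReal.toReal_ofReal (by positivity)] at h
  rw [integral_const_mul, ← h, smul_eq_mul]
  field_simp

lemma integrable_scale (hε : 0 < ε) (f : Hyp m × ℝ → ℝ) :
    Integrable f ↔ Integrable (fun p : Hyp m × ℝ => ε * f (p.1, ε * p.2)) := by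
  have h := (measurableEmbedding_scale hε).integrable_map_iff (g := f) (μ := volume)
  rw [map_scale hε, integrable_smul_measure (by simp [hε]) ofReal_ne_top] at h
  rw [h, integrable_const_mul_iff (IsUnit.mk0 _ hε.ne')]
  rfl

/-- The boundary-layer integrand. -/
def layer (s : ℝ) (K : Pt m → ℝ) (G : Hyp m × ℝ → Pt m)
    (D : Hyp m × ℝ → ℝ) (N : Hyp m × ℝ → Pt m)
    (ε : ℝ) (p : Hyp m × ℝ) : ℝ :=
  (D p)⁻¹ * inner ℝ (psi s K (N p) (ε / D p)) (G p)

lemma integral_inv_psi (k : Ker s lam Lam K) (hN : N ≠ 0) {J : ℝ} (hJ : 0 < J) :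
    IntegrableOn (fun τ : ℝ => (J * τ⁻¹) • psi s K N (J * τ⁻¹)) (Ioi 0) ∧
    ∫ τ in Ioi (0 : ℝ), (J * τ⁻¹) • psi s K N (J * τ⁻¹) = (J * cs s) • halfVec s K N := by
  constructor
  · obtain ⟨A, hA, hb⟩ := exists_layer_bound k
      (norm_pos_iff.2 hN) (inv_pos.2 hJ)
    have hc : ContinuousOn (fun τ => (J * τ⁻¹) • psi s K N (J * τ⁻¹)) (Ioi 0) := by
      have h1 : ContinuousOn (fun τ => J * τ⁻¹) (Ioi 0) :=
        continuousOn_const.mul (continuousOn_inv₀.mono fun x hx => ne_of_gt hx)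
      refine h1.smul ?_
      exact (continuousOn_psi k).comp (f := fun τ => (N, J * τ⁻¹))
        (continuousOn_const.prodMk h1) fun x hx =>
          ⟨mem_univ _, mul_pos hJ (inv_pos.2 hx)⟩
    refine Integrable.mono' ((integrable_majorant k.hs).const_mul A).integrableOn
      (hc.aestronglyMeasurable measurableSet_Ioi) ?_
    filter_upwards [ae_restrict_mem measurableSet_Ioi] with τ hτ
    have hτ0 : 0 < τ := hτ
    have := hb N le_rfl le_rfl τ (J⁻¹ * τ) hτ le_rfl le_rfl
    rw [mul_inv, inv_inv] at this
    rw [norm_smul, norm_of_nonneg (by positivity)]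
    exact this
  · have h := integral_comp_rpow_Ioi (fun y => (J * y) • psi s K N (J * y)) (p := -1) (by norm_num)
    have h2 : ∫ y in Ioi 0, y⁻¹ • psi s K N (J * y) = cs s • halfVec s K N := by
      rw [← integral_psi_div k hN]
      have := integral_comp_mul_left_Ioi (fun y => y⁻¹ • psi s K N y) 0 hJ
      rw [mul_zero] at this
      rw [← smul_right_injective _ (inv_ne_zero hJ.ne') |>.eq_iff, ← this, ← integral_smul]
      refine integral_congr_ae (.of_forall fun y => ?_)
      simp only [smul_smul, mul_inv]
    rw [mul_smul, ← h2, ← integral_smul, ← integral_comp_rpow_Ioi (fun y => J • y⁻¹ • psi s K N (J * y))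
      (p := -1) (by norm_num)]
    refine setIntegral_congr_fun measurableSet_Ioi fun τ hτ => ?_
    have hτ0 := hτ
    simp only [abs_neg, abs_one, one_mul, rpow_neg_one, inv_inv, smul_smul]
    congr 1
    rw [show (-1 - 1 : ℝ) = -1 - 1 from rfl, rpow_sub_one hτ0.ne', rpow_neg_one]
    field_simp

section BoundaryLimit

/-- The data of a boundary layer: an amplitude `G`, a distance `D` and a direction `N`. -/
structure LayerData (m : ℕ) (G : Hyp m × ℝ → Pt m)
    (D : Hyp m × ℝ → ℝ) (N : Hyp m × ℝ → Pt m)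
    (Q : Set (Hyp m)) (M c C c0 C0 : ℝ) : Prop where
  measG : Measurable G
  measD : Measurable D
  measN : Measurable N
  measQ : MeasurableSet Q
  volQ : volume Q ≠ ⊤
  hc : 0 < c
  hc0 : 0 < c0
  supp : ∀ p, G p ≠ 0 → p.1 ∈ Q ∧ 0 < p.2
  bdd : ∀ p, ‖G p‖ ≤ M
  dist_le : ∀ p, G p ≠ 0 → c * p.2 ≤ D p ∧ D p ≤ C * p.2
  norm_le : ∀ p, G p ≠ 0 → c0 ≤ ‖N p‖ ∧ ‖N p‖ ≤ C0

variable {G N : Hyp m × ℝ → Pt m} {D : Hyp m × ℝ → ℝ}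
  {Q : Set (Hyp m)} {C : ℝ}

lemma measurable_psi_comp (k : Ker s lam Lam K) : Measurable (((univ : Set (Pt m)) ×ˢ Ioi (0 : ℝ)).indicator
      (fun p : Pt m × ℝ => psi s K p.1 p.2)) := by
  classical
  rw [← piecewise_eq_indicator]
  exact (continuousOn_psi k).measurable_piecewise continuousOn_const
    (MeasurableSet.univ.prod measurableSet_Ioi)

lemma tendsto_psi (k : Ker s lam Lam K) {ι : Type*} {l : Filter ι} {f : ι → Pt m} {g : ι → ℝ} {a : Pt m}
    (hb : 0 < b) (hf : Tendsto f l (𝓝 a)) (hg : Tendsto g l (𝓝 b)) :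
    Tendsto (fun i => psi s K (f i) (g i)) l (𝓝 (psi s K a b)) := by
  have hmem : (univ : Set (Pt m)) ×ˢ Ioi 0 ∈ 𝓝 (a, b) :=
    (isOpen_univ.prod isOpen_Ioi).mem_nhds ⟨mem_univ _, hb⟩
  have hc : Tendsto (fun p => psi s K p.1 p.2) (𝓝 (a, b)) (𝓝 (psi s K a b)) :=
    (continuousOn_psi k).continuousAt hmem
  have h2 := hf.prodMk_nhds hg
  have h3 := hc.comp h2
  rw [Function.comp_def] at h3
  exact h3

lemma LayerData.measurable_layer (h : LayerData m G D N Q M c C c0 C0) (k : Ker s lam Lam K) (hε : 0 < ε) :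
    Measurable (layer s K G D N ε) := by
  have h1 := (measurable_psi_comp k).comp (h.measN.prodMk (h.measD.const_div ε))
  have h2 : Measurable fun p => (D p)⁻¹ * inner ℝ ((((univ : Set (Pt m)) ×ˢ Ioi 0).indicator
      (fun p => psi s K p.1 p.2)) (N p, ε / D p)) (G p) :=
    h.measD.inv.mul (h1.inner h.measG)
  convert h2 using 2 with p
  unfold layer
  by_cases hG : G p = 0
  · simp [hG]
  · have hD := (mul_pos h.hc (h.supp p hG).2).trans_le (h.dist_le p hG).1
    rw [indicator_of_mem]
    exact ⟨mem_univ _, div_pos hε hD⟩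

lemma LayerData.exists_bound (h : LayerData m G D N Q M c C c0 C0) (k : Ker s lam Lam K) :
    ∃ g : Hyp m × ℝ → ℝ, Integrable g ∧ ∀ ε > 0, ∀ p : Hyp m × ℝ,
        |ε * layer s K G D N ε (p.1, ε * p.2)| ≤ g p := by
  obtain ⟨A, hA, hb⟩ := exists_layer_bound k (C0 := C0) (C := C) h.hc0 h.hc
  have hM := (norm_nonneg _).trans (h.bdd 0)
  refine ⟨fun p => (Q.indicator (fun _ => M) p.1) * (A * majorant s p.2), ?_, ?_⟩
  · refine Integrable.mul_prod ?_
      ((integrable_majorant k.hs).const_mul A)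
    exact (integrable_indicator_iff h.measQ).2 (integrableOn_const h.volQ)
  · intro ε hε p
    by_cases hG : G (p.1, ε * p.2) = 0
    · simp only [layer, hG, inner_zero_right, mul_zero, abs_zero]
      exact mul_nonneg (indicator_nonneg (fun _ _ => hM) _) (mul_nonneg hA (majorant_nonneg _ _))
    · obtain ⟨hp1, hp2⟩ := h.supp _ hG
      obtain ⟨d1, d2⟩ := h.dist_le _ hG
      obtain ⟨n1, n2⟩ := h.norm_le _ hG
      have hτ := pos_of_mul_pos_right hp2 hε.le
      have hD := (mul_pos h.hc hp2).trans_le d1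
      have hb' := hb _ n1 n2 p.2 (D (p.1, ε * p.2) / ε) hτ
        (by rw [le_div_iff₀ hε]; simp only at d1; linarith)
        (by rw [div_le_iff₀ hε]; simp only at d2; linarith)
      rw [inv_div] at hb'
      have hp1' := hp1
      simp only [indicator_of_mem hp1']
      rw [layer, ← mul_assoc, ← div_eq_mul_inv, abs_mul, abs_of_pos (div_pos hε hD)]
      calc _ ≤ ε / D (p.1, ε * p.2) * (‖psi s K (N (p.1, ε * p.2)) (ε / D (p.1, ε * p.2))‖ * M) := by
            gcongr
            refine (abs_real_inner_le_norm _ _).trans ?_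
            gcongr
            exact h.bdd _
        _ = M * (ε / D (p.1, ε * p.2) * ‖psi s K (N (p.1, ε * p.2)) (ε / D (p.1, ε * p.2))‖) := by
            ring
        _ ≤ _ := by gcongr

lemma LayerData.integrable_layer (h : LayerData m G D N Q M c C c0 C0) (k : Ker s lam Lam K) (hε : 0 < ε) :
    Integrable (layer s K G D N ε) := by
  obtain ⟨g, hg, hb⟩ := h.exists_bound k
  rw [integrable_scale hε]
  refine hg.mono' ?_ (.of_forall fun p => hb ε hε p)
  exact (((h.measurable_layer k hε).comp
    (measurableEmbedding_scale hε).measurable).const_mul ε).aestronglyMeasurable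

set_option maxHeartbeats 800000 in
/-- The limit of the boundary layer integrals. -/
lemma LayerData.tendsto (h : LayerData m G D N Q M c C c0 C0) (k : Ker s lam Lam K)
    {J : Hyp m → ℝ} {N0 G0 : Hyp m → Pt m}
    (hlim : ∀ᵐ x', ((∀ᶠ t in 𝓝[>] (0 : ℝ), G (x', t) = 0) ∧ G0 x' = 0) ∨
      (0 < J x' ∧ N0 x' ≠ 0 ∧ Tendsto (fun t => G (x', t)) (𝓝[>] 0) (𝓝 (G0 x')) ∧
        Tendsto (fun t => N (x', t)) (𝓝[>] 0) (𝓝 (N0 x')) ∧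
        Tendsto (fun t => D (x', t) / t) (𝓝[>] 0) (𝓝 (J x')⁻¹))) :
    Integrable (fun x' => J x' * cs s * inner ℝ (halfVec s K (N0 x')) (G0 x')) ∧
    Tendsto (fun ε => ∫ p, layer s K G D N ε p) (𝓝[>] 0)
      (𝓝 (∫ x', J x' * cs s * inner ℝ (halfVec s K (N0 x')) (G0 x'))) := by
  obtain ⟨g, hg, hb⟩ := h.exists_bound k
  set F : ℝ → Hyp m × ℝ → ℝ :=
    fun ε p => ε * layer s K G D N ε (p.1, ε * p.2) with hF
  set f : Hyp m × ℝ → ℝ := fun p => (Ioi 0).indicator (fun τ =>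
    inner ℝ ((J p.1 * τ⁻¹) • psi s K (N0 p.1) (J p.1 * τ⁻¹)) (G0 p.1)) p.2 with hf
  have hFm : ∀ᶠ ε in 𝓝[>] 0, AEStronglyMeasurable (F ε) volume := by
    filter_upwards [self_mem_nhdsWithin] with ε hε
    exact (((h.measurable_layer k hε).comp
      (measurableEmbedding_scale hε).measurable).const_mul ε).aestronglyMeasurable
  have hFb : ∀ᶠ ε in 𝓝[>] 0, ∀ᵐ p, ‖F ε p‖ ≤ g p := by
    filter_upwards [self_mem_nhdsWithin] with ε hε
    exact Eventually.of_forall fun p => hb ε hε p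
  have hFl : ∀ᵐ p, Tendsto (fun ε => F ε p) (𝓝[>] 0) (𝓝 (f p)) := by
    have := (Measure.quasiMeasurePreserving_fst
      (ν := (volume : Measure ℝ))).ae hlim
    filter_upwards [this] with p hp
    rcases le_or_gt p.2 0 with h0 | h0
    · have hfp : f p = 0 := indicator_of_notMem (by simpa using h0) _
      rw [hfp]
      refine (tendsto_congr' ?_).2 tendsto_const_nhds
      filter_upwards [self_mem_nhdsWithin] with ε hε
      have : G (p.1, ε * p.2) = 0 := by
        by_contra hne
        exact absurd (h.supp _ hne).2 (not_lt.2 (mul_nonpos_of_nonneg_of_nonpos (le_of_lt hε) h0))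
      simp [hF, layer, this]
    have hfp : f p = inner ℝ ((J p.1 * p.2⁻¹) • psi s K (N0 p.1) (J p.1 * p.2⁻¹)) (G0 p.1) :=
      indicator_of_mem (by simpa using h0) _
    have hsc : Tendsto (fun ε => ε * p.2) (𝓝[>] 0) (𝓝[>] 0) := by
      refine tendsto_nhdsWithin_iff.2 ⟨?_, ?_⟩
      · exact tendsto_nhdsWithin_of_tendsto_nhds
          (by simpa using (tendsto_id (x := 𝓝 0)).mul_const p.2)
      · filter_upwards [self_mem_nhdsWithin] with ε hε
        exact mul_pos hε h0
    rcases hp with ⟨hG, hG0⟩ | ⟨hJ, hN0, hG, hN, hD⟩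
    · rw [hfp, hG0, inner_zero_right]
      refine (tendsto_congr' ?_).2 tendsto_const_nhds
      filter_upwards [hsc.eventually hG] with ε hε
      simp [hF, layer, hε]
    · rw [hfp, real_inner_smul_left]
      have hq : Tendsto (fun ε => ε / D (p.1, ε * p.2)) (𝓝[>] 0) (𝓝 (J p.1 * p.2⁻¹)) := by
        have := ((hD.comp hsc).mul_const p.2).inv₀ (mul_ne_zero (inv_ne_zero hJ.ne') h0.ne')
        rw [mul_inv, inv_inv] at this
        refine this.congr_within fun ε hε => ?_
        have hε0 : ε ≠ 0 := ne_of_gt hε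
        simp only [Function.comp]
        rw [div_mul_eq_mul_div, mul_div_mul_right _ _ h0.ne', inv_div]
      have hpsi : Tendsto (fun ε => psi s K (N (p.1, ε * p.2)) (ε / D (p.1, ε * p.2))) (𝓝[>] 0)
          (𝓝 (psi s K (N0 p.1) (J p.1 * p.2⁻¹))) := by
        have hpos := mul_pos hJ (inv_pos.2 h0)
        exact tendsto_psi k hpos (hN.comp hsc) hq
      have hprod := hq.mul (hpsi.inner (hG.comp hsc))
      refine hprod.congr fun ε => ?_
      simp only [hF, layer, Function.comp_apply]
      rw [div_eq_mul_inv, mul_assoc]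
  have hfm : AEStronglyMeasurable f volume := by
    obtain ⟨u, hu⟩ := (𝓝[>] (0 : ℝ)).exists_seq_tendsto
    obtain ⟨n0, hn0⟩ := (hu.eventually hFm).exists_forall_of_atTop
    refine aestronglyMeasurable_of_tendsto_ae atTop (f := fun n => F (u (n + n0)))
      (fun n => hn0 _ (by omega)) ?_
    filter_upwards [hFl] with p hp
    exact hp.comp (hu.comp (tendsto_add_atTop_nat n0))
  have hfi : Integrable f := by
    refine hg.mono' hfm ?_
    filter_upwards [hFl] with p hp
    refine le_of_tendsto hp.norm ?_
    filter_upwards [self_mem_nhdsWithin] with ε hε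
    exact hb ε hε p
  have hinner : ∀ᵐ x', ∫ t, f (x', t) = J x' * cs s * inner ℝ (halfVec s K (N0 x')) (G0 x') := by
    filter_upwards [hlim] with x' hx'
    have e1 : ∫ t, f (x', t) = ∫ τ in Ioi 0,
        inner ℝ ((J x' * τ⁻¹) • psi s K (N0 x') (J x' * τ⁻¹)) (G0 x') := by
      rw [← integral_indicator measurableSet_Ioi]
    rw [e1]
    rcases hx' with ⟨-, hG0⟩ | ⟨hJ, hN0, -⟩
    · simp [hG0]
    · obtain ⟨i1, i2⟩ := integral_inv_psi k hN0 hJ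
      have := integral_inner (𝕜 := ℝ) i1 (G0 x')
      simp only [real_inner_comm (G0 x')]
      rw [this, i2, real_inner_smul_right, real_inner_comm]
  have hfi' := hfi
  refine ⟨hfi'.integral_prod_left.congr hinner, ?_⟩
  have h1 := tendsto_integral_filter_of_dominated_convergence g hFm hFb hg hFl
  have h2 : ∫ p, f p = ∫ x', J x' * cs s * inner ℝ (halfVec s K (N0 x')) (G0 x') := by
    rw [Measure.volume_eq_prod, integral_prod f hfi']
    exact integral_congr_ae hinner
  rw [h2] at h1
  exact h1.congr_within fun ε hε =>
    (integral_scale hε _).symm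

end BoundaryLimit

/-- Integrability on a product of a function that vanishes unless one of the variables lies in a
given set, from bounds of the partial integrals over that set. -/
lemma integrable_of_active {E : Type*} [MeasurableSpace E] {μ : Measure E} [SFinite μ]
    {F : E × E → ℝ} (hF : AEStronglyMeasurable F (μ.prod μ)) {X : Set E} (hX : MeasurableSet X)
    {g1 g2 : E → ℝ} (hg1 : IntegrableOn g1 X μ) (hg2 : IntegrableOn g2 X μ)
    (h₁ : ∀ᵐ x ∂μ, x ∈ X → Integrable (fun y => F (x, y)) μ ∧ (∫ y, |F (x, y)| ∂μ) ≤ g1 x)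
    (h₂ : ∀ᵐ y ∂μ, y ∈ X → Integrable (fun x => F (x, y)) μ ∧ (∫ x, |F (x, y)| ∂μ) ≤ g2 y)
    (h0 : ∀ x y, x ∉ X → y ∉ X → F (x, y) = 0) : Integrable F (μ.prod μ) := by
  have key : ∀ (H : E × E → ℝ) (g : E → ℝ), AEStronglyMeasurable H (μ.prod μ) → IntegrableOn g X μ →
      (∀ᵐ x ∂μ, x ∈ X → Integrable (fun y => H (x, y)) μ ∧ (∫ y, |H (x, y)| ∂μ) ≤ g x) →
      IntegrableOn H (X ×ˢ univ) (μ.prod μ) := by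
    intro H g hH hg h
    have hr : (μ.prod μ).restrict (X ×ˢ univ) = (μ.restrict X).prod μ := by
      rw [← Measure.prod_restrict, Measure.restrict_univ]
    have hH' := hr ▸ hH.restrict
    rw [IntegrableOn, hr, integrable_prod_iff hH']
    have h' := (ae_restrict_iff' hX).2 h
    refine ⟨h'.mono fun x hx => hx.1, Integrable.mono' hg hH'.norm.integral_prod_right' ?_⟩
    filter_upwards [h'] with x hx
    rw [norm_of_nonneg (integral_nonneg fun y => norm_nonneg _)]
    exact hx.2
  have a1 := key F g1 hF hg1 h₁
  have a2 := key (fun z => F z.swap) g2 hF.prod_swap hg2 h₂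
  have a3 : IntegrableOn F (univ ×ˢ X) (μ.prod μ) := by
    have : IntegrableOn ((fun z => F z.swap) ∘ Prod.swap) (univ ×ˢ X) (μ.prod μ) := by
      have hmp : MeasurePreserving (Prod.swap : E × E → E × E) (μ.prod μ) (μ.prod μ) :=
        Measure.measurePreserving_swap
      have := (hmp.integrableOn_comp_preimage
        (MeasurableEquiv.prodComm).measurableEmbedding
       ).2 a2
      rwa [preimage_swap_prod] at this
    exact this
  refine (integrableOn_iff_integrable_of_support_subset ?_).1
    (a1.union a3)
  rintro ⟨x, y⟩ hxy
  by_contra hn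
  simp at hn
  exact hxy (h0 x y hn.1 hn.2)

lemma IsKernel.symm_sub (hK : IsKernel s lam Lam K) (x y : Pt m) : K (x - y) = K (y - x) := by
  rw [← neg_sub, hK.neg]

lemma measurableSet_trunc (x : Pt m) (ε : ℝ) : MeasurableSet (𝔽 x ε) :=
  measurableSet_lt measurable_const (by fun_prop)

lemma measurableSet_offDiag (ε : ℝ) : MeasurableSet (𝔾 ε : Set (Pt m × Pt m)) :=
  measurableSet_lt measurable_const (by fun_prop)

/-- Reduction of the double integral to a limit of truncated operators. -/
lemma tendsto_trunc_double (hK : IsKernel s lam Lam K) {μ : Pt m → ℝ}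
    (hP : Integrable (fun z : Pt m × Pt m =>
      𝓔 K p f μ z))
    (hQ : ∀ ε > 0, IntegrableOn (fun z : Pt m × Pt m =>
      μ z.1 * (f z.1 - f z.2) * (p z.1 * p z.2 * K (z.1 - z.2))) (𝔾 ε)) :
    (∀ ε > 0, Integrable (fun x => μ x * p x * (2 * 𝓣 K p f x ε))) ∧
    Tendsto (fun ε => ∫ x, μ x * p x * (2 * 𝓣 K p f x ε)) (𝓝[>] 0) (𝓝 (∫ z : Pt m × Pt m,
        𝓔 K p f μ z)) := by
  set P : Pt m × Pt m → ℝ := fun z =>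
    𝓔 K p f μ z with hPdef
  set Q : Pt m × Pt m → ℝ := fun z =>
    μ z.1 * (f z.1 - f z.2) * (p z.1 * p z.2 * K (z.1 - z.2)) with hQdef
  have hin : ∀ ε : ℝ, ∀ x, ∫ y, (𝔾 ε).indicator Q (x, y) = μ x * p x * 𝓣 K p f x ε := by
    intro ε x
    rw [← integral_const_mul, ← integral_indicator (measurableSet_trunc x ε)]
    refine integral_congr_ae (.of_forall fun y => ?_)
    simp only [indicator, mem_ofPred_eq, hQdef]
    split_ifs <;> ring
  have hQi : ∀ ε > 0, Integrable ((𝔾 ε).indicator Q) ((volume : Measure (Pt m)).prod volume) :=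
    fun ε hε => (integrable_indicator_iff (measurableSet_offDiag ε)).2 (hQ ε hε)
  constructor
  · intro ε hε
    refine ((hQi ε hε).integral_prod_left.const_mul 2).congr (.of_forall fun x => ?_)
    simp only [hin]
    ring
  have hlim : Tendsto (fun ε => ∫ z, (𝔾 ε).indicator P z) (𝓝[>] 0) (𝓝 (∫ z, P z)) := by
    refine tendsto_integral_filter_of_dominated_convergence (fun z => ‖P z‖)
      (.of_forall fun ε => hP.aestronglyMeasurable.indicator (measurableSet_offDiag ε))
      (.of_forall fun ε => Eventually.of_forall fun z => norm_indicator_le_norm_self _ _)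
      hP.norm (.of_forall fun z => ?_)
    by_cases hz : z.1 = z.2
    · have : P z = 0 := by simp [hPdef, hz]
      rw [this]
      refine tendsto_const_nhds.congr fun ε => ?_
      by_cases h : z ∈ 𝔾 ε <;> simp [indicator, this]
    · have hpos := norm_pos_iff.2 (sub_ne_zero.2 hz)
      refine tendsto_const_nhds.congr' ?_
      filter_upwards [nhdsWithin_le_nhds (Iio_mem_nhds hpos)] with ε hε
      exact (indicator_of_mem (show z ∈ 𝔾 ε from hε) _).symm
  refine hlim.congr_within fun ε hε => ?_
  have hsw : Integrable (fun z => (𝔾 ε).indicator Q z.swap)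
      ((volume : Measure (Pt m)).prod volume) := (hQi ε hε).swap
  have e1 : ∀ z, (𝔾 ε).indicator P z = (𝔾 ε).indicator Q z + (𝔾 ε).indicator Q z.swap := by
    intro z
    simp only [indicator, mem_ofPred_eq, Prod.fst_swap, Prod.snd_swap, norm_sub_rev z.2, hPdef,
      hQdef, hK.symm_sub z.2 z.1]
    split_ifs <;> ring
  rw [integral_congr_ae (.of_forall e1), Measure.volume_eq_prod,
    integral_add (hQi ε hε) hsw, integral_prod_swap, ← two_mul, integral_prod _ (hQi ε hε),
    ← integral_const_mul]
  refine integral_congr_ae (.of_forall fun x => ?_)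
  simp only [hin]
  ring

/-- The integration by parts formula, from a splitting of the truncated operators into a dominated
part and a part that concentrates at the boundary. -/
lemma integral_by_parts_of_split (hK : IsKernel s lam Lam K) {μ : Pt m → ℝ}
    (hP : Integrable (fun z : Pt m × Pt m =>
      𝓔 K p f μ z))
    (hQ : ∀ ε > 0, IntegrableOn (fun z : Pt m × Pt m =>
      μ z.1 * (f z.1 - f z.2) * (p z.1 * p z.2 * K (z.1 - z.2))) (𝔾 ε))
    {b : ℝ → Pt m → ℝ} {B : ℝ} {g F : Pt m → ℝ} (hb : ∀ ε > 0, Integrable (b ε))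
    (hB : Tendsto (fun ε => ∫ x, b ε x) (𝓝[>] 0) (𝓝 B)) (hg : Integrable g)
    (hdom : ∀ᶠ ε in 𝓝[>] (0 : ℝ), ∀ᵐ x, |μ x * p x * (2 * 𝓣 K p f x ε) + b ε x| ≤ g x)
    (hlim : ∀ᵐ x, Tendsto (fun ε => μ x * p x * (2 * 𝓣 K p f x ε) + b ε x) (𝓝[>] 0) (𝓝 (F x))) :
    Integrable F ∧ ∫ z : Pt m × Pt m, 𝓔 K p f μ z = (∫ x, F x) - B := by
  obtain ⟨t1, t2⟩ := tendsto_trunc_double hK hP hQ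
  have hm : ∀ᶠ ε in 𝓝[>] 0, AEStronglyMeasurable (fun x => μ x * p x *
      (2 * 𝓣 K p f x ε) + b ε x) volume := by
    filter_upwards [self_mem_nhdsWithin] with ε hε
    exact ((t1 ε hε).add (hb ε hε)).aestronglyMeasurable
  have l1 := tendsto_integral_filter_of_dominated_convergence g hm hdom hg hlim
  have l2 := (t2.add hB)
  constructor
  · obtain ⟨u, hu⟩ := (𝓝[>] (0 : ℝ)).exists_seq_tendsto
    obtain ⟨n0, hn0⟩ := (hu.eventually (hm.and hdom)).exists_forall_of_atTop
    have hul : ∀ᵐ x, Tendsto (fun n => μ x * p x * (2 * 𝓣 K p f x (u (n + n0))) + b (u (n + n0)) x) atTop (𝓝 (F x)) := by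
      filter_upwards [hlim] with x hx
      exact hx.comp (hu.comp (tendsto_add_atTop_nat n0))
    refine hg.mono' (aestronglyMeasurable_of_tendsto_ae atTop
      (fun n => (hn0 (n + n0) (by omega)).1) hul) ?_
    have hall :=
      ae_all_iff.2 fun n => (hn0 (n + n0) (by omega)).2
    filter_upwards [hul, hall] with x h1 h2
    exact le_of_tendsto h1.norm (.of_forall h2)
  · have : ∫ x, F x = (∫ z : Pt m × Pt m, 𝓔 K p f μ z) + B := by
      refine tendsto_nhds_unique l1 (l2.congr' ?_)
      filter_upwards [self_mem_nhdsWithin] with ε hε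
      exact (integral_add (t1 ε hε) (hb ε hε)).symm
    rw [this]
    ring

section KernelBounds

variable {R : Pt m → ℝ}

lemma ae_ne_point (x : Pt m) : ∀ᵐ y : Pt m, y ≠ x :=
  compl_mem_ae_iff.2 (measure_singleton x)

lemma kernel_bound_on (k : Ker s lam Lam K)
    (hp : Measurable p) (hR : AEStronglyMeasurable R volume) (x : Pt m) {S : Set (Pt m)}
    (hS : MeasurableSet S) {B : ℝ}
    (h : IntegrableOn (fun y => ‖y - x‖ ^ (q - (m + 1) - 2 * s) * |p y|) S ∧
      ∫ y in S, ‖y - x‖ ^ (q - (m + 1) - 2 * s) * |p y| ≤ B) (hM : 0 ≤ M)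
    (hb : ∀ᵐ y, y ∈ S → p y ≠ 0 → |R y| ≤ M * ‖y - x‖ ^ q) :
    IntegrableOn (fun y => R y * p y * K (y - x)) S ∧
      ∫ y in S, |R y * p y * K (y - x)| ≤ M * Lam * B := by
  have hL := k.Lam_nonneg
  have hle : ∀ᵐ y ∂(volume.restrict S), |R y * p y * K (y - x)| ≤
      M * Lam * (‖y - x‖ ^ (q - (m + 1) - 2 * s) * |p y|) := by
    filter_upwards [ae_restrict_of_ae hb, ae_restrict_mem hS, ae_restrict_of_ae (ae_ne_point x)]
      with y h1 h2 h3
    have hpos := norm_pos_iff.2 (sub_ne_zero.2 h3)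
    by_cases hpy : p y = 0
    · simp [hpy]
    rw [abs_mul, abs_mul]
    calc |R y| * |p y| * |K (y - x)|
        ≤ (M * ‖y - x‖ ^ q) * |p y| * (Lam * ‖y - x‖ ^ (-(m + 1) - 2 * s)) := by
          gcongr
          · exact h1 h2 hpy
          · exact k.abs_le (sub_ne_zero.2 h3)
      _ = _ := by
          rw [show q - (m + 1) - 2 * s = q + (-(m + 1) - 2 * s) by ring, rpow_add hpos]
          ring
  have hi : IntegrableOn (fun y => R y * p y * K (y - x)) S := by
    refine Integrable.mono' (h.1.const_mul (M * Lam)) ?_ hle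
    exact ((hR.mul hp.aestronglyMeasurable).mul
      (k.hKm.comp (measurable_id.sub_const x)).aestronglyMeasurable).restrict
  refine ⟨hi, ?_⟩
  calc ∫ y in S, |R y * p y * K (y - x)|
      ≤ ∫ y in S, M * Lam * (‖y - x‖ ^ (q - (m + 1) - 2 * s) * |p y|) :=
        integral_mono_ae hi.abs (h.1.const_mul _) hle
    _ ≤ _ := by
        rw [integral_const_mul]
        gcongr
        exact h.2

/-- Far part of an integral against the kernel. -/
lemma kernel_tail_bound (k : Ker s lam Lam K)
    (hp : Measurable p) (hR : AEStronglyMeasurable R volume) (hpA : AbsGrowth p C A) (hA : 0 ≤ A)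
    (hq : q < m + 1 + 2 * s - A) (x : Pt m) (hr : 0 < r) (hM : 0 ≤ M)
    (hb : ∀ᵐ y, r ≤ ‖y - x‖ → p y ≠ 0 → |R y| ≤ M * ‖y - x‖ ^ q) :
    IntegrableOn (fun y => R y * p y * K (y - x)) {y | r ≤ ‖y - x‖} ∧
      ∫ y in {y | r ≤ ‖y - x‖}, |R y * p y * K (y - x)| ≤ M * Lam *
        (C * ((q - (m + 1) - 2 * s) / (q - (m + 1) - 2 * s + A) * r ^ (q - (m + 1) - 2 * s + A))) :=
  kernel_bound_on k hp hR x (measurableSet_le measurable_const (by fun_prop))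
    (hpA.tail hp hA (by linarith) x hr) hM hb

/-- Near part of an integral against the kernel. -/
lemma kernel_near_bound (k : Ker s lam Lam K)
    (hp : Measurable p) (hR : AEStronglyMeasurable R volume) (hpA : AbsGrowth p C A)
    (hq : m + 1 + 2 * s - A < q) (x : Pt m) (hr : 0 < r) (hM : 0 ≤ M)
    (hb : ∀ᵐ y, ‖y - x‖ < r → p y ≠ 0 → |R y| ≤ M * ‖y - x‖ ^ q) :
    IntegrableOn (fun y => R y * p y * K (y - x)) {y | ‖y - x‖ < r} ∧
      ∫ y in {y | ‖y - x‖ < r}, |R y * p y * K (y - x)| ≤ M * Lam *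
        (C * ((|q - (m + 1) - 2 * s| / (q - (m + 1) - 2 * s + A) + 1) *
          r ^ (q - (m + 1) - 2 * s + A))) :=
  kernel_bound_on k hp hR x (measurableSet_lt (by fun_prop) measurable_const)
    (hpA.near hp (by linarith) x hr) hM hb

lemma integrable_near_far (x : Pt m) (r : ℝ) {b₁ b₂ : ℝ}
    (h1 : IntegrableOn f {y | ‖y - x‖ < r} ∧ ∫ y in {y | ‖y - x‖ < r}, |f y| ≤ b₁)
    (h2 : IntegrableOn f {y | r ≤ ‖y - x‖} ∧ ∫ y in {y | r ≤ ‖y - x‖}, |f y| ≤ b₂) :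
    Integrable f ∧ ∫ y, |f y| ≤ b₁ + b₂ := by
  have hS : MeasurableSet {y : Pt m | ‖y - x‖ < r} :=
    measurableSet_lt (by fun_prop) measurable_const
  have hc : {y : Pt m | r ≤ ‖y - x‖} = {y : Pt m | ‖y - x‖ < r}ᶜ := by
    ext y; simp
  rw [hc] at h2
  have hi := integrableOn_univ.1 (by
    rw [← union_compl_self {y : Pt m | ‖y - x‖ < r}]; exact h1.1.union h2.1)
  refine ⟨hi, ?_⟩
  rw [← integral_add_compl hS hi.abs]
  exact add_le_add h1.2 h2.2

/-- The basic weighted estimate: a quantity that is `O(|h|^q)` far away and `O(r^{q-ρ}|h|^ρ)` near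
`x` has an integral of size `r^{q-s-1}` against a weight that behaves like `dist^{s-1}`. -/
lemma exists_weighted_bound (k : Ker s lam Lam K) (hp : Measurable p) (hpA : AbsGrowth p C (m + s))
    (hc : 0 < c) (hq : q < 1 + s) (hρ : 2 * s < ρ) (hM : 0 ≤ M) (hP0 : 0 ≤ P0) :
    ∃ B ≥ 0, ∀ (x : Pt m) (r : ℝ), 0 < r → ∀ R : Pt m → ℝ, AEStronglyMeasurable R volume →
      (∀ y, ‖y - x‖ < c * r → |p y| ≤ P0 * r ^ (s - 1)) →
      (∀ᵐ y, ‖y - x‖ < c * r → p y ≠ 0 → |R y| ≤ M * r ^ (q - ρ) * ‖y - x‖ ^ ρ) →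
      (∀ᵐ y, c * r ≤ ‖y - x‖ → p y ≠ 0 → |R y| ≤ M * ‖y - x‖ ^ q) →
      Integrable (fun y => R y * p y * K (y - x)) ∧
        ∫ y, |R y * p y * K (y - x)| ≤ B * r ^ (q - s - 1) := by
  have hL := k.Lam_nonneg
  set V : ℝ≥0 := (volume (ball (0 : Pt m) 1)).toNNReal
  set D1 := |ρ - (m + 1) - 2 * s| / (ρ - (m + 1) - 2 * s + (m + 1)) + 1
  set D2 := (q - (m + 1) - 2 * s) / (q - (m + 1) - 2 * s + (m + s))
  have hD1 : 0 ≤ D1 := add_nonneg (div_nonneg (abs_nonneg _) (by linarith)) zero_le_one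
  have hm : 0 ≤ m := Nat.cast_nonneg _
  have hD2 : 0 ≤ D2 := div_nonneg_of_nonpos (by linarith [k.hs.1, k.hs.2]) (by linarith)
  refine ⟨M * P0 * Lam * (V * (D1 * c ^ (ρ - 2 * s))) + M * Lam * (C * (D2 * c ^ (q - s - 1))),
    by positivity, fun x r hr R hR h1 h2 h3 => ?_⟩
  have hcr := mul_pos hc hr
  have near := kernel_near_bound (R := fun y => R y * p y) (q := ρ)
    (M := M * r ^ (q - ρ) * (P0 * r ^ (s - 1))) k measurable_const
    (hR.mul hp.aestronglyMeasurable) absGrowth_one (by linarith) x hcr (by positivity) (by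
      filter_upwards [h2] with y hy hlt _
      by_cases hpy : p y = 0
      · simp only [hpy, mul_zero, abs_zero]; positivity
      rw [abs_mul]
      calc |R y| * |p y| ≤ (M * r ^ (q - ρ) * ‖y - x‖ ^ ρ) * (P0 * r ^ (s - 1)) := by
            gcongr
            · exact hy hlt hpy
            · exact h1 y hlt
        _ = _ := by ring)
  simp only [mul_one] at near
  have far := kernel_tail_bound k hp hR hpA (by linarith [k.hs.1])
    (by linarith) x hcr hM h3
  obtain ⟨i1, i2⟩ := integrable_near_far x (c * r) near far
  refine ⟨i1, i2.trans (le_of_eq ?_)⟩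
  have e1 : (c * r) ^ (ρ - (m + 1) - 2 * s + (m + 1)) = c ^ (ρ - 2 * s) * r ^ (ρ - 2 * s) := by
    rw [← mul_rpow hc.le hr.le]; congr 1; ring
  have e2 : (c * r) ^ (q - (m + 1) - 2 * s + (m + s)) = c ^ (q - s - 1) * r ^ (q - s - 1) := by
    rw [← mul_rpow hc.le hr.le]; congr 1; ring
  have e3 : r ^ (q - s - 1) = r ^ (q - ρ) * r ^ (s - 1) * r ^ (ρ - 2 * s) := by
    rw [← rpow_add hr, ← rpow_add hr]; congr 1; ring
  rw [e1, e2]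
  change M * r ^ (q - ρ) * (P0 * r ^ (s - 1)) * Lam *
    (V * (D1 * (c ^ (ρ - 2 * s) * r ^ (ρ - 2 * s)))) +
    M * Lam * (C * (D2 * (c ^ (q - s - 1) * r ^ (q - s - 1)))) = _
  linear_combination (-(M * P0 * Lam * (V * (D1 * c ^ (ρ - 2 * s))))) * e3

end KernelBounds

lemma aestronglyMeasurable_double (hKm : Measurable K) (hp : Measurable p)
    {Φ : Pt m × Pt m → ℝ} (hΦ : AEStronglyMeasurable Φ volume) :
    AEStronglyMeasurable (fun z : Pt m × Pt m => Φ z * (p z.1 * p z.2 * K (z.1 - z.2))) volume := by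
  refine hΦ.mul (Measurable.aestronglyMeasurable ?_)
  exact ((hp.comp measurable_fst).mul (hp.comp measurable_snd)).mul
    (hKm.comp (measurable_fst.sub measurable_snd))

/-- Absolute convergence of the double integral. -/
lemma integrable_double (k : Ker s lam Lam K) (hp : Measurable p) (hpA : AbsGrowth p C (m + s))
    (hc : 0 < c) (hq : q < 1 + s) (hq' : 2 * s < q) (hM : 0 ≤ M) (hP0 : 0 ≤ P0)
    {X : Set (Pt m)} (hX : MeasurableSet X) {D : Pt m → ℝ} {Φ : Pt m × Pt m → ℝ}
    (hΦ : AEStronglyMeasurable Φ volume)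
    (hD : ∀ x ∈ X, p x ≠ 0 → 0 < D x ∧ ∀ y, ‖y - x‖ < c * D x → |p y| ≤ P0 * D x ^ (s - 1))
    (hb : ∀ x ∈ X, p x ≠ 0 → ∀ᵐ y, p y ≠ 0 →
      |Φ (x, y)| ≤ M * ‖y - x‖ ^ q ∧ |Φ (y, x)| ≤ M * ‖y - x‖ ^ q)
    (h0 : ∀ x y, x ∉ X → y ∉ X → Φ (x, y) = 0)
    (hi : IntegrableOn (fun x => |p x| * D x ^ (q - s - 1)) X) :
    Integrable (fun z : Pt m × Pt m => Φ z * (p z.1 * p z.2 * K (z.1 - z.2))) := by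
  obtain ⟨B, hB, hw⟩ := exists_weighted_bound k hp hpA hc hq hq' hM hP0
  have key : ∀ Ψ : Pt m × Pt m → ℝ, AEStronglyMeasurable Ψ volume →
      (∀ x ∈ X, p x ≠ 0 → ∀ᵐ y, p y ≠ 0 → |Ψ (x, y)| ≤ M * ‖y - x‖ ^ q) →
      ∀ᵐ x, x ∈ X → Integrable (fun y => Ψ (x, y) * (p x * p y * K (x - y))) ∧
        (∫ y, |Ψ (x, y) * (p x * p y * K (x - y))|) ≤ B * (|p x| * D x ^ (q - s - 1)) := by
    intro Ψ hΨ hΨb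
    filter_upwards [hΨ.prodMk_left] with x hxm hxX
    by_cases hpx : p x = 0
    · simp [hpx]
    obtain ⟨hD0, hDp⟩ := hD x hxX hpx
    obtain ⟨i1, i2⟩ := hw x (D x) hD0 _ hxm hDp
      (by filter_upwards [hΨb x hxX hpx] with y hy _ hpy; simpa using hy hpy)
      (by filter_upwards [hΨb x hxX hpx] with y hy _ hpy using hy hpy)
    have e : ∀ y, Ψ (x, y) * (p x * p y * K (x - y)) = p x * (Ψ (x, y) * p y * K (y - x)) := by
      intro y; rw [k.hK.symm_sub x y]; ring
    simp only [e]
    refine ⟨i1.const_mul _, ?_⟩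
    simp only [abs_mul (p x)]
    rw [integral_const_mul]
    calc |p x| * _ ≤ |p x| * (B * D x ^ (q - s - 1)) := by gcongr
      _ = _ := by ring
  refine integrable_of_active (aestronglyMeasurable_double k.hKm hp hΦ) hX (hi.const_mul B)
    (hi.const_mul B) (key Φ hΦ fun x hx hpx => (hb x hx hpx).mono fun y hy hpy => (hy hpy).1) ?_
    (fun x y hx hy => by simp [h0 x y hx hy])
  have := key (fun z => Φ z.swap) hΦ.prod_swap
    fun x hx hpx => (hb x hx hpx).mono fun y hy hpy => (hy hpy).2
  filter_upwards [this] with y hy hyX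
  have e : ∀ x, Φ (x, y) * (p x * p y * K (x - y)) =
      Φ ((y, x) : Pt m × Pt m).swap * (p y * p x * K (y - x)) := by
    intro x; rw [k.hK.symm_sub x y, Prod.swap_prod_mk]; ring
  simp only [e]
  exact hy hyX

/-- Absolute convergence of the truncated double integral. -/
lemma integrableOn_double_trunc (k : Ker s lam Lam K) (hp : Measurable p)
    (hpA : AbsGrowth p C (m + s)) (hq : q < 1 + s) (hM : 0 ≤ M)
    {X : Set (Pt m)} (hX : MeasurableSet X) {Φ : Pt m × Pt m → ℝ}
    (hΦ : AEStronglyMeasurable Φ volume) (hε : 0 < ε)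
    (hb : ∀ x ∈ X, p x ≠ 0 → ∀ᵐ y, ε ≤ ‖y - x‖ → p y ≠ 0 →
      |Φ (x, y)| ≤ M * ‖y - x‖ ^ q ∧ |Φ (y, x)| ≤ M * ‖y - x‖ ^ q)
    (h0 : ∀ x y, x ∉ X → y ∉ X → Φ (x, y) = 0) (hi : IntegrableOn p X) :
    IntegrableOn (fun z : Pt m × Pt m => Φ z * (p z.1 * p z.2 * K (z.1 - z.2))) (𝔾 ε) := by
  have hT : MeasurableSet (𝔾 ε : Set (Pt m × Pt m)) := measurableSet_offDiag ε
  rw [← integrable_indicator_iff hT]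
  obtain ⟨B, hB⟩ : ∃ B : ℝ, M * Lam * (C * ((q - (m + 1) - 2 * s) / (q - (m + 1) - 2 * s + (m + s)) *
    ε ^ (q - (m + 1) - 2 * s + (m + s)))) ≤ B := ⟨_, le_rfl⟩
  have key : ∀ Ψ : Pt m × Pt m → ℝ, AEStronglyMeasurable Ψ volume →
      (∀ x ∈ X, p x ≠ 0 → ∀ᵐ y, ε ≤ ‖y - x‖ → p y ≠ 0 → |Ψ (x, y)| ≤ M * ‖y - x‖ ^ q) →
      ∀ᵐ x, x ∈ X → Integrable (fun y => (𝔾 ε).indicator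
        (fun z => Ψ z * (p z.1 * p z.2 * K (z.1 - z.2))) (x, y)) ∧
        (∫ y, |(𝔾 ε).indicator
          (fun z => Ψ z * (p z.1 * p z.2 * K (z.1 - z.2))) (x, y)|) ≤ B * |p x| := by
    intro Ψ hΨ hΨb
    filter_upwards [hΨ.prodMk_left] with x hxm hxX
    have e : ∀ y, (𝔾 ε).indicator (fun z => Ψ z * (p z.1 * p z.2 * K (z.1 - z.2))) (x, y) =
        p x * (𝔽 x ε).indicator (fun y => Ψ (x, y) * p y * K (y - x)) y := by
      intro y
      simp only [indicator, mem_ofPred_eq, k.hK.symm_sub x y]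
      split_ifs <;> ring
    by_cases hpx : p x = 0
    · simp [e, hpx]
    obtain ⟨i1, i2⟩ := kernel_tail_bound k hp hxm hpA (by linarith [k.hs.1, (Nat.cast_nonneg m : (0:ℝ) ≤ m)])
      (by linarith) x hε hM (hΨb x hxX hpx)
    have hsub := fun y (hy : ε < ‖x - y‖) => by
      rw [norm_sub_rev] at hy; exact hy.le
    have i3 := i1.mono_set hsub
    simp only [e]
    refine ⟨((integrable_indicator_iff (measurableSet_trunc x ε)).2 i3).const_mul _, ?_⟩
    simp
    rw [integral_const_mul, mul_comm]
    gcongr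
    refine le_trans ?_ (i2.trans hB)
    have : ∀ y, |(𝔽 x ε).indicator (fun y => Ψ (x, y) * p y * K (y - x)) y| =
        (𝔽 x ε).indicator (fun y => |Ψ (x, y) * p y * K (y - x)|) y := fun y =>
      (norm_indicator_eq_indicator_norm (fun y => Ψ (x, y) * p y * K (y - x)) y)
    simp only [this]
    rw [integral_indicator (measurableSet_trunc x ε)]
    exact setIntegral_mono_set i1.abs (.of_forall fun y => abs_nonneg _)
      (HasSubset.Subset.eventuallyLE hsub)
  refine integrable_of_active ((aestronglyMeasurable_double k.hKm hp hΦ).indicator hT) hX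
    (hi.abs.const_mul B) (hi.abs.const_mul B)
    (key Φ hΦ fun x hx hpx => (hb x hx hpx).mono fun y hy h1 hpy => (hy h1 hpy).1) ?_
    (fun x y hx hy => by simp [indicator, h0 x y hx hy])
  have := key (fun z => Φ z.swap) hΦ.prod_swap
    fun x hx hpx => (hb x hx hpx).mono fun y hy h1 hpy => (hy h1 hpy).2
  filter_upwards [this] with y hy hyX
  have e : ∀ x, (𝔾 ε).indicator (fun z => Φ z * (p z.1 * p z.2 * K (z.1 - z.2))) (x, y) =
      (𝔾 ε).indicator (fun z => Φ z.swap * (p z.1 * p z.2 * K (z.1 - z.2))) (y, x) := by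
    intro x
    simp only [indicator, mem_ofPred_eq, norm_sub_rev y x, Prod.swap_prod_mk, k.hK.symm_sub y x]
    split_ifs <;> ring
  simp only [e]
  exact hy hyX

section Truncation

variable {G : Type*} [NormedAddCommGroup G] [NormedSpace ℝ G]

lemma integral_trunc_translate (g : Pt m → G) (x : Pt m) (ε : ℝ) :
    ∫ y in 𝔽 x ε, g (y - x) = ∫ h in {h : Pt m | ε < ‖h‖}, g h := by
  rw [← integral_indicator (measurableSet_trunc x ε), ← integral_indicator (measurableSet_norm_gt ε),
    ← integral_sub_right_eq_self ({h : Pt m | ε < ‖h‖}.indicator g) x]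
  congr 1 with y
  simp only [indicator, mem_ofPred_eq, norm_sub_rev x y]

lemma integrableOn_trunc_translate (g : Pt m → G) (x : Pt m) (ε : ℝ) :
    IntegrableOn (fun y => g (y - x)) (𝔽 x ε) ↔ IntegrableOn g {h : Pt m | ε < ‖h‖} := by
  rw [← integrable_indicator_iff (measurableSet_trunc x ε),
    ← integrable_indicator_iff (measurableSet_norm_gt ε)]
  have : (𝔽 x ε).indicator (fun y => g (y - x)) =
      fun y => ({h : Pt m | ε < ‖h‖}.indicator g) (y - x) := by
    funext y
    simp only [indicator, mem_ofPred_eq, norm_sub_rev x y]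
  rw [this]
  exact ((measurePreserving_sub_right volume x).integrable_comp_emb
    (g := {h : Pt m | ε < ‖h‖}.indicator g)
    (MeasurableEquiv.subRight x).measurableEmbedding)

lemma tendsto_setIntegral_trunc {f : Pt m → G} (hf : Integrable f) (x : Pt m) :
    Tendsto (fun ε => ∫ y in 𝔽 x ε, f y) (𝓝[>] 0) (𝓝 (∫ y, f y)) := by
  have h : Tendsto (fun ε => ∫ y, (𝔽 x ε).indicator f y) (𝓝[>] 0) (𝓝 (∫ y, f y)) := by
    refine tendsto_integral_filter_of_dominated_convergence (fun y => ‖f y‖)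
      (.of_forall fun ε => hf.aestronglyMeasurable.indicator (measurableSet_trunc x ε))
      (.of_forall fun ε => Eventually.of_forall fun y => norm_indicator_le_norm_self _ _)
      hf.norm ?_
    filter_upwards [ae_ne_point x] with y hy
    have hpos := norm_pos_iff.2 (sub_ne_zero.2 hy.symm)
    refine tendsto_const_nhds.congr' ?_
    filter_upwards [nhdsWithin_le_nhds (Iio_mem_nhds hpos)] with ε hε
    exact (indicator_of_mem (show y ∈ 𝔽 x ε from hε) _).symm
  refine h.congr fun ε => ?_
  rw [integral_indicator (measurableSet_trunc x ε)]

/-- The truncated first moment of `p(x + ·) K`. -/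
def moment (K p : Pt m → ℝ) (x : Pt m) (ε : ℝ) : Pt m :=
  ∫ h in {h : Pt m | ε < ‖h‖}, (p (x + h) * K h) • h

lemma AbsGrowth.translate (h : AbsGrowth p C A) (x : Pt m) :
    AbsGrowth (fun h => p (x + h)) C A := by
  intro z R hR
  refine le_trans (le_of_eq ?_) (h (x + z) R hR)
  have := (measurePreserving_add_left (volume : Measure (Pt m)) x).setLIntegral_comp_preimage_emb
    (MeasurableEquiv.addLeft x).measurableEmbedding (fun y => ofReal |p y|)
    (ball (x + z) R)
  rw [← this]
  congr 2
  ext y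
  simp

lemma integrableOn_moment (k : Ker s lam Lam K) (hp : Measurable p) (hpA : AbsGrowth p C (m + s)) (x : Pt m) (hε : 0 < ε) :
    IntegrableOn (fun h => (p (x + h) * K h) • h) {h : Pt m | ε < ‖h‖} :=
  integrableOn_kernel_tail k (hp.comp (measurable_const_add x)) (hpA.translate x) hε

/-- Splitting off the first-order Taylor term from a truncated operator. -/
lemma trunc_eq_sub_moment (k : Ker s lam Lam K) (hp : Measurable p) (hpA : AbsGrowth p C (m + s)) (x v : Pt m)
    (f : Pt m → ℝ) (hε : 0 < ε)
    (hR : IntegrableOn (fun y => (f y - f x - inner ℝ v (y - x)) * p y * K (y - x)) (𝔽 x ε)) :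
    IntegrableOn (fun y => (f x - f y) * (p y * K (x - y))) (𝔽 x ε) ∧
    2 * 𝓣 K p f x ε = -2 * (∫ y in 𝔽 x ε, (f y - f x - inner ℝ v (y - x)) * p y * K (y - x)) -
        2 * inner ℝ v (moment K p x ε) := by
  have hm := integrableOn_moment k hp hpA x hε
  have h1 : IntegrableOn (fun h => inner ℝ v ((p (x + h) * K h) • h)) {h : Pt m | ε < ‖h‖} :=
    hm.const_inner v
  have h2 : ∫ h in {h : Pt m | ε < ‖h‖}, inner ℝ v ((p (x + h) * K h) • h) =
      inner ℝ v (moment K p x ε) := integral_inner hm v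
  rw [← integrableOn_trunc_translate _ x] at h1
  rw [← integral_trunc_translate _ x] at h2
  have e : ∀ y, (f x - f y) * (p y * K (x - y)) =
      -((f y - f x - inner ℝ v (y - x)) * p y * K (y - x) +
        inner ℝ v ((p (x + (y - x)) * K (y - x)) • (y - x))) := by
    intro y
    rw [real_inner_smul_right, add_sub_cancel, k.hK.symm_sub x y]
    ring
  simp only [e]
  refine ⟨(hR.add h1).neg, ?_⟩
  rw [integral_neg, integral_add hR h1, h2]
  ring

end Truncation

lemma norm_taylor_le {L : ℝ≥0} (hf : Differentiable ℝ f)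
    (hL : LipschitzWith L (fderiv ℝ f)) (x y : Pt m) :
    |f y - f x - fderiv ℝ f x (y - x)| ≤ L * ‖y - x‖ ^ 2 := by
  have h := (convex_segment x y).norm_image_sub_le_of_norm_hasFDerivWithin_le'
    (f' := fderiv ℝ f) (C := L * ‖y - x‖)
    (fun z _ => (hf z).hasFDerivAt.hasFDerivWithinAt) (fun z hz => by
      refine (hL.norm_sub_le z x).trans ?_
      gcongr
      obtain ⟨a, b, ha, hb, hab, rfl⟩ := hz
      rw [show a • x + b • y - x = b • (y - x) by
        rw [show a = 1 - b by linarith]; module]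
      rw [norm_smul, norm_of_nonneg hb]
      exact mul_le_of_le_one_left (norm_nonneg _) (by linarith))
    (left_mem_segment ℝ x y) (right_mem_segment ℝ x y)
  rw [norm_eq_abs] at h
  linarith

/-- Quantitative bounds for a smooth function with compact support. -/
lemma exists_test_bounds (hη : ContDiff ℝ ∞ η) (hc : HasCompactSupport η) :
    ∃ C ≥ 0, (∀ x, |η x| ≤ C) ∧ (∀ x, ‖gradient η x‖ ≤ C) ∧ (∀ x y, |η y - η x| ≤ C * ‖y - x‖) ∧
      ∀ x y, |η y - η x - inner ℝ (gradient η x) (y - x)| ≤ C * ‖y - x‖ ^ 2 := by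
  obtain ⟨C1, h1⟩ := hη.continuous.bounded_above_of_compact_support hc
  have h1η : ContDiff ℝ 1 η := hη.of_le (by exact_mod_cast le_top)
  have hd := hη.fderiv_right (m := 1) (by norm_cast)
  obtain ⟨C2, h2⟩ := hd.continuous.bounded_above_of_compact_support (hc.fderiv ℝ)
  obtain ⟨L1, hL1⟩ := h1η.lipschitzWith_of_hasCompactSupport hc one_ne_zero
  obtain ⟨L2, hL2⟩ := hd.lipschitzWith_of_hasCompactSupport (hc.fderiv ℝ) one_ne_zero
  have hg : ∀ x, ‖gradient η x‖ = ‖fderiv ℝ η x‖ := fun x => by simp [gradient]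
  have hC1 := (norm_nonneg _).trans (h1 0)
  have hC2 := (norm_nonneg _).trans (h2 0)
  refine ⟨C1 + C2 + L1 + L2, by positivity, fun x => ?_, fun x => ?_, fun x y => ?_, fun x y => ?_⟩
  · have := h1 x
    rw [norm_eq_abs] at this
    linarith
  · rw [hg]; linarith [h2 x, L1.coe_nonneg, L2.coe_nonneg]
  · have := hL1.norm_sub_le y x
    rw [norm_eq_abs] at this
    refine this.trans ?_
    gcongr
    linarith
  · have := norm_taylor_le (h1η.differentiable one_ne_zero) hL2 x y
    rw [gradient, InnerProductSpace.toDual_symm_apply]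
    refine this.trans ?_
    gcongr
    linarith

lemma hdeg_eq_zero (h1 : τ ≤ 1) : hdeg τ = 0 := by
  have : ⌈τ⌉₊ ≤ 1 := Nat.ceil_le.2 (by simpa using h1)
  unfold hdeg
  omega

lemma le_hdeg {k : ℕ} (h : (k : ℝ) < τ) : k ≤ hdeg τ := by
  have : k < ⌈τ⌉₊ := Nat.lt_ceil.2 h
  unfold hdeg
  omega

lemma exists_local_holder {v : Pt m → ℝ} (hv : HolderLoc γ v univ) (z : Pt m) :
    ∃ r > 0, ∃ C ≥ 0, ∀ x ∈ ball z r, ∀ y ∈ ball z r,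
      |v x - v y| ≤ C * ‖x - y‖ ^ min γ 1 := by
  rcases le_or_gt γ 1 with h1 | h1
  · obtain ⟨r, hr, C, hC⟩ := hv.2 z (mem_univ z)
    refine ⟨r, hr, |C|, abs_nonneg _, fun x hx y hy => ?_⟩
    have := hC x hx y hy
    rw [hdeg_eq_zero h1] at this
    simp at this
    rw [iteratedFDeriv_zero_eq_comp] at this
    simp only [Function.comp_apply, ← map_sub, LinearIsometryEquiv.norm_map] at this
    rw [min_eq_left h1]
    refine this.trans ?_
    gcongr
    exact le_abs_self C
  · have hd : ContDiffAt ℝ 1 v z := by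
      have := (hv.1.of_le (m := 1) (by exact_mod_cast le_hdeg (by simpa using h1)))
      exact (contDiffOn_univ.1 this).contDiffAt
    obtain ⟨L, t, ht, hL⟩ := hd.exists_lipschitzOnWith
    obtain ⟨r, hr, hrt⟩ := Metric.mem_nhds_iff.1 ht
    refine ⟨r, hr, L, L.2, fun x hx y hy => ?_⟩
    rw [min_eq_right h1.le, rpow_one]
    exact hL.norm_sub_le (hrt hx) (hrt hy)

/-- Uniform Hölder bound near a compact set. -/
lemma exists_uniform_holder {v : Pt m → ℝ} (hv : HolderLoc γ v univ)
    {S : Set (Pt m)} (hS : IsCompact S) :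
    ∃ r > 0, ∃ C ≥ 0, ∀ x ∈ S, ∀ y, ‖y - x‖ < r → |v y - v x| ≤ C * ‖y - x‖ ^ min γ 1 := by
  refine hS.induction_on ⟨1, one_pos, 0, le_rfl, by simp⟩ ?_ ?_ ?_
  · rintro s t hst ⟨r, hr, C, hC, h⟩
    exact ⟨r, hr, C, hC, fun x hx => h x (hst hx)⟩
  · rintro s t ⟨r, hr, C, hC, h⟩ ⟨r', hr', C', hC', h'⟩
    refine ⟨min r r', lt_min hr hr', max C C', hC.trans (le_max_left _ _), ?_⟩
    rintro x (hx | hx) y hy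
    · refine (h x hx y (hy.trans_le (min_le_left _ _))).trans ?_
      gcongr
      exact le_max_left _ _
    · refine (h' x hx y (hy.trans_le (min_le_right _ _))).trans ?_
      gcongr
      exact le_max_right _ _
  · intro z _
    obtain ⟨r, hr, C, hC, h⟩ := exists_local_holder hv z
    refine ⟨ball z (r / 2), mem_nhdsWithin_of_mem_nhds (ball_mem_nhds z (by linarith)),
      r / 2, by linarith, C, hC, fun x hx y hy => h y ?_ x ?_⟩
    · rw [mem_ball_iff_norm] at hx ⊢
      have : ‖y - z‖ ≤ ‖y - x‖ + ‖x - z‖ := norm_sub_le_norm_sub_add_norm_sub _ _ _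
      linarith
    · exact ball_subset_ball (by linarith) hx

lemma HolderLoc.continuous {v : Pt m → ℝ} (hv : HolderLoc γ v univ) : Continuous v :=
  continuousOn_univ.1 hv.1.continuousOn

/-- Growth of the increments of `v` based at a point of a bounded set. -/
lemma exists_increment_bound (hγ : 0 < γ) {v : Pt m → ℝ} (hv : HolderLoc γ v univ)
    (hg : ∃ C : ℝ, ∀ x, |v x| ≤ C * (1 + ‖x‖ ^ γ)) (R : ℝ) (hR : 0 ≤ R) :
    ∃ M ≥ 0, ∃ r > 0, r ≤ 1 ∧ ∀ x, ‖x‖ ≤ R → ∀ y,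
      (‖y - x‖ < r → |v y - v x| ≤ M * ‖y - x‖ ^ min γ 1) ∧
      (r ≤ ‖y - x‖ → |v y - v x| ≤ M * ‖y - x‖ ^ γ) := by
  obtain ⟨C, hC⟩ := hg
  have hC0 : 0 ≤ C := by
    have := (abs_nonneg _).trans (hC 0)
    rw [norm_zero, zero_rpow hγ.ne'] at this
    linarith
  obtain ⟨r', hr', A, hA, h⟩ := exists_uniform_holder hv (isCompact_closedBall 0 R)
  set r := min r' 1
  have hr := lt_min hr' one_pos
  refine ⟨A + C * (2 * r⁻¹ ^ γ + (R / r) ^ γ + (R / r + 1) ^ γ), by positivity, r, hr,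
    min_le_right _ _, fun x hx y => ⟨fun hy => ?_, fun hy => ?_⟩⟩
  · refine (h x (by simpa using hx) y (hy.trans_le (min_le_left _ _))).trans ?_
    gcongr
    have : 0 ≤ C * (2 * r⁻¹ ^ γ + (R / r) ^ γ + (R / r + 1) ^ γ) := by positivity
    linarith
  · have ht := hr.trans_le hy
    set t := ‖y - x‖
    have h1 : 1 ≤ r⁻¹ ^ γ * t ^ γ := by
      rw [← mul_rpow (by positivity) ht.le]
      refine one_le_rpow ?_ hγ.le
      rw [← div_eq_inv_mul, le_div_iff₀ hr]
      linarith
    have hRt : R ≤ R / r * t := by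
      rw [div_mul_eq_mul_div, le_div_iff₀ hr]
      exact mul_le_mul_of_nonneg_left hy hR
    have h2 : ‖x‖ ^ γ ≤ (R / r) ^ γ * t ^ γ := by
      rw [← mul_rpow (by positivity) ht.le]
      exact rpow_le_rpow (norm_nonneg _) (hx.trans hRt) hγ.le
    have h3 : ‖y‖ ^ γ ≤ (R / r + 1) ^ γ * t ^ γ := by
      rw [← mul_rpow (by positivity) ht.le]
      refine rpow_le_rpow (norm_nonneg _) ?_ hγ.le
      have : ‖y‖ ≤ t + ‖x‖ := by simpa using norm_add_le (y - x) x
      linarith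
    calc |v y - v x| ≤ |v y| + |v x| := abs_sub _ _
      _ ≤ C * (1 + ‖y‖ ^ γ) + C * (1 + ‖x‖ ^ γ) := add_le_add (hC y) (hC x)
      _ ≤ C * (r⁻¹ ^ γ * t ^ γ + (R / r + 1) ^ γ * t ^ γ) +
          C * (r⁻¹ ^ γ * t ^ γ + (R / r) ^ γ * t ^ γ) := by gcongr
      _ = C * (2 * r⁻¹ ^ γ + (R / r) ^ γ + (R / r + 1) ^ γ) * t ^ γ := by ring
      _ ≤ _ := by
        gcongr
        linarith

lemma mul_rpow_le_of_near (hM : 0 ≤ M) (ht : 0 ≤ t) (ht1 : t ≤ 1) (hq : 0 < q)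
    (hqa : q ≤ a) : M * t ^ a ≤ M * t ^ q := by
  rcases ht.eq_or_lt with rfl | h
  · rw [zero_rpow hq.ne', zero_rpow (hq.trans_le hqa).ne']
  · gcongr 1
    exact rpow_le_rpow_of_exponent_ge h ht1 hqa

lemma rpow_le_of_far (hr : 0 < r) (ht : r ≤ t) (hqa : a ≤ q) : t ^ a ≤ r ^ (a - q) * t ^ q := by
  have h0 := hr.trans_le ht
  rw [show t ^ a = t ^ (a - q) * t ^ q by rw [← rpow_add h0]; congr 1; ring]
  gcongr ?_ * _
  exact rpow_le_rpow_of_nonpos hr ht (by linarith)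

lemma min_le_rpow (hA : 0 ≤ A) (ht : 0 ≤ t) (h1 : 1 ≤ q) (h2 : q ≤ 2) (hb1 : b ≤ A * t ^ 2)
    (hb2 : b ≤ A * t) : b ≤ A * t ^ q := by
  rcases le_total t 1 with h | h
  · refine hb1.trans ?_
    rw [← rpow_two]
    exact mul_rpow_le_of_near hA ht h (by linarith) h2
  · refine hb2.trans ?_
    gcongr
    calc t = t ^ 1 := (rpow_one t).symm
      _ ≤ t ^ q := rpow_le_rpow_of_exponent_le h h1

lemma weight_eq_inner (x : Pt m) : weight s x = posPow s (0 + inner ℝ (eN m) x) := by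
  rw [inner_eN, zero_add, weight_eq]

lemma measurable_weight : Measurable (weight s : Pt m → ℝ) :=
  (measurable_posPow s).comp measurable_lastC

lemma exists_absGrowth_weight (hs : s ∈ Ioo 0 1) :
    ∃ C : ℝ≥0, AbsGrowth (weight s : Pt m → ℝ) C (m + s) := by
  have := absGrowth_affine (m := m) hs.1 hs.2.le one_pos (by rw [norm_eN]) 0
  simp only [← weight_eq_inner] at this
  exact ⟨_, this⟩

lemma abs_weight_near (hs : s ∈ Ioo 0 1) (hx : 0 < lastC x)
    (hy : ‖y - x‖ < 1 / 2 * lastC x) : |weight s y| ≤ (1 / 2) ^ (s - 1) * lastC x ^ (s - 1) := by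
  have h1 : 1 / 2 * lastC x ≤ lastC y := by
    have := abs_lastC_le (y - x)
    rw [lastC_sub] at this
    have := (abs_le.1 (this.trans hy.le)).1
    linarith
  have h2 : 0 < lastC y := by linarith
  rw [weight, if_pos h2, abs_of_nonneg (rpow_nonneg h2.le _), ← mul_rpow (by norm_num) hx.le]
  exact rpow_le_rpow_of_nonpos (by positivity) h1 (by linarith [hs.2])

lemma moment_weight (ε : ℝ) : moment K (weight s) x ε = modInt s K (lastC x) (eN m) ε := by
  unfold moment modInt
  congr 1 with h
  rw [weight_eq, inner_eN, lastC_add]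

/-- The model boundary term tends to zero at interior points. -/
lemma tendsto_modInt_zero (k : Ker s lam Lam K) (ha : 0 < a) (hN : N ≠ 0) :
    Tendsto (modInt s K a N) (𝓝[>] 0) (𝓝 0) := by
  obtain ⟨A, hA, hb⟩ := exists_psi_bound k (norm_pos_iff.2 hN)
  have h0 : Tendsto (fun ε => a ^ (-s) * (A * (ε / a) ^ (2 - 2 * s))) (𝓝[>] 0) (𝓝 0) := by
    have hc : Tendsto (fun ε => ε / a) (𝓝[>] 0) (𝓝 0) :=
      tendsto_nhdsWithin_of_tendsto_nhds
        (by simpa using (tendsto_id (x := 𝓝 0)).div_const a)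
    have := (hc.rpow_const (p := 2 - 2 * s) (Or.inr (by linarith [k.hs.2])))
    rw [zero_rpow (by linarith [k.hs.2])] at this
    simpa using (this.const_mul A).const_mul (a ^ (-s))
  refine squeeze_zero_norm' ?_ h0
  filter_upwards [self_mem_nhdsWithin] with ε hε
  rw [modInt_eq k ha hN hε, norm_smul, norm_of_nonneg (by positivity)]
  gcongr
  exact (hb N le_rfl le_rfl _ (div_pos hε ha)).1

/-- The truncated operator with the weight inside. -/
def gTrunc (K f p : Pt m → ℝ) (x : Pt m) (ε : ℝ) : ℝ :=
  2 * 𝓣 K p f x ε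

lemma exists_remainder_bound (k : Ker s lam Lam K) (hη : ContDiff ℝ ∞ η) (hc : HasCompactSupport η) (h1 : 1 ≤ q)
    (h2 : q < 1 + s) (h3 : 2 * s < q) :
    ∃ B ≥ 0, ∀ x : Pt m, 0 < lastC x →
      Integrable (fun y => (η y - η x - inner ℝ (gradient η x) (y - x)) * weight s y * K (y - x)) ∧
      ∫ y, |(η y - η x - inner ℝ (gradient η x) (y - x)) * weight s y * K (y - x)| ≤
        B * lastC x ^ (q - s - 1) := by
  obtain ⟨C, hC, -, b2, b3, b4⟩ := exists_test_bounds hη hc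
  obtain ⟨Cw, hw⟩ := exists_absGrowth_weight k.hs
  obtain ⟨B, hB, h⟩ := exists_weighted_bound k measurable_weight hw (c := 1 / 2)
    (M := 2 * C) (P0 := (1 / 2) ^ (s - 1)) (by norm_num) h2 h3 (by positivity)
    (by positivity)
  have hR : ∀ x y, |η y - η x - inner ℝ (gradient η x) (y - x)| ≤ 2 * C * ‖y - x‖ ^ q := by
    intro x y
    refine min_le_rpow (by positivity) (norm_nonneg _) h1 (by linarith) ?_ ?_
    · refine (b4 x y).trans ?_
      gcongr
      linarith
    · calc _ ≤ |η y - η x| + |inner ℝ (gradient η x) (y - x)| := abs_sub _ _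
        _ ≤ C * ‖y - x‖ + C * ‖y - x‖ := by
          refine add_le_add (b3 x y) ((abs_real_inner_le_norm _ _).trans ?_)
          gcongr
          exact b2 x
        _ = _ := by ring
  refine ⟨B, hB, fun x hx => h x (lastC x) hx _ ?_ (fun y hy => abs_weight_near k.hs hx hy)
    (.of_forall fun y _ _ => ?_) (.of_forall fun y _ _ => hR x y)⟩
  · have := hη.continuous
    exact (by fun_prop : Continuous fun y => η y - η x - inner ℝ (gradient η x) (y - x)).aestronglyMeasurable
  · simpa using hR x y

lemma gTrunc_weight (k : Ker s lam Lam K) {v : Pt m}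
    (hR : Integrable (fun y => (f y - f x - inner ℝ v (y - x)) * weight s y * K (y - x))) (hε : 0 < ε) :
    gTrunc K f (weight s) x ε = -2 * (∫ y in 𝔽 x ε,
      (f y - f x - inner ℝ v (y - x)) * weight s y * K (y - x)) -
        2 * inner ℝ v (modInt s K (lastC x) (eN m) ε) := by
  obtain ⟨Cw, hw⟩ := exists_absGrowth_weight k.hs
  rw [← moment_weight]
  exact (trunc_eq_sub_moment k measurable_weight hw x v f hε hR.integrableOn).2

/-- Existence of the principal value of the weighted test function. -/
lemma halfSpace_limit (k : Ker s lam Lam K) (hη : ContDiff ℝ ∞ η) (hc : HasCompactSupport η)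
    (hx : 0 < lastC x) :
    OpExists (fun x y => K (y - x)) (fun z => weight s z * η z) x ∧
      Tendsto (gTrunc K η (weight s) x) (𝓝[>] 0) (𝓝 (opL K (fun z => weight s z * η z) x)) := by
  obtain ⟨q, hq1, hq2⟩ := exists_between (show max 1 (2 * s) < 1 + s from
    max_lt (by linarith [k.hs.1]) (by linarith [k.hs.2]))
  obtain ⟨B, -, hB⟩ := exists_remainder_bound k hη hc
    ((le_max_left _ _).trans hq1.le) hq2 ((le_max_right _ _).trans_lt hq1)
  obtain ⟨Cw, hw⟩ := exists_absGrowth_weight k.hs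
  have hR := (hB x hx).1
  have hm0 := tendsto_modInt_zero k hx (eN_ne_zero)
  obtain ⟨l, hl⟩ : ∃ l, Tendsto (gTrunc K η (weight s) x) (𝓝[>] 0) (𝓝 l) := by
    refine ⟨_, Tendsto.congr' ?_ (((tendsto_setIntegral_trunc hR x).const_mul (-2)).sub
      (((tendsto_const_nhds (x := gradient η x)).inner hm0).const_mul 2))⟩
    filter_upwards [self_mem_nhdsWithin] with ε hε
    exact (gTrunc_weight k hR hε).symm
  have hm : 0 ≤ m := Nat.cast_nonneg _
  have i1 : ∀ ε > 0, IntegrableOn (fun y => (η x - η y) * (weight s y * K (x - y)))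
      (𝔽 x ε) := fun ε hε =>
    (trunc_eq_sub_moment k measurable_weight hw x _ η hε hR.integrableOn).1
  have i2 : ∀ ε > 0, IntegrableOn (fun y => (weight s x - weight s y) * K (y - x)) (𝔽 x ε) := by
    intro ε hε
    have a1 := integrableOn_kernel_scalar k (measurable_const (a := weight s x))
      (A := m + 1) (by positivity) (by linarith [k.hs.1])
      (by
        have := absGrowth_one (m := m)
        intro z R hR
        have h2 := this z R hR
        simp only [abs_one, ofReal_one] at h2
        rw [lintegral_const, ENNReal.coe_mul, mul_assoc]
        simp only [lintegral_one] at h2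
        rw [ofReal]
        gcongr) x hε
    have a2 := integrableOn_kernel_scalar k measurable_weight (by linarith [k.hs.1] : (0:ℝ) ≤ m + s)
      (by linarith [k.hs.1]) hw x hε
    have := a1.sub a2
    simp only [norm_sub_rev x]
    refine this.congr (.of_forall fun y => ?_)
    simp
    ring
  have e : ∀ ε > 0, opTrunc (fun x y => K (y - x)) (fun z => weight s z * η z) x ε =
      gTrunc K η (weight s) x ε + 2 * (η x * ∫ h in {h : Pt m | ε < ‖h‖},
        (posPow s (lastC x) - posPow s (lastC x + inner ℝ (eN m) h)) * K h) := by
    intro ε hε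
    rw [← integral_trunc_translate _ x, opTrunc, gTrunc, ← mul_add, ← integral_const_mul (η x),
      ← integral_add (i1 ε hε)]
    · congr 2 with y
      rw [inner_eN, lastC_sub, add_sub_cancel, weight_eq, weight_eq, k.hK.symm_sub x y]
      ring
    · refine ((i2 ε hε).const_mul (η x)).congr (.of_forall fun y => ?_)
      simp only [inner_eN, lastC_sub, add_sub_cancel, weight_eq]
  have hl2 : Tendsto (opTrunc (fun x y => K (y - x)) (fun z => weight s z * η z) x) (𝓝[>] 0)
      (𝓝 l) := by
    have := hl.add (((tendsto_weight_trunc k hx (norm_eN)).const_mul (η x)).const_mul 2)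
    rw [mul_zero, mul_zero, add_zero] at this
    exact this.congr_within fun ε hε =>
      (e ε hε).symm
  refine ⟨⟨fun ε hε => ?_, l, hl2⟩, ?_⟩
  · refine ((i1 ε hε).add ((i2 ε hε).const_mul (η x))).congr (.of_forall fun y => ?_)
    simp only [Pi.add_apply, k.hK.symm_sub x y]
    ring
  · rw [opL, op, hl2.limUnder_eq]
    exact hl

variable {v : Pt m → ℝ}

lemma integrableOn_posPow_ball (ha : 0 < a) (ha1 : a ≤ 1) (R : ℝ) (hR : 0 < R) :
    IntegrableOn (fun x : Pt m => posPow a (lastC x)) (ball 0 R) := by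
  have h := growthBound_affine (m := m) ha ha1 one_pos (by rw [norm_eN]) 0 0 R hR
  simp only [inner_eN, zero_add] at h
  exact (integrableOn_of_lintegral_le ((measurable_posPow a).comp measurable_lastC)
    (fun x => posPow_nonneg _ _)
    (B := ((toNNReal (1 ^ (a - 1)) * fiberConst m a : ℝ≥0) : ℝ) * R ^ (m + a))
    (by positivity) (by
      rw [ofReal_mul (by positivity), ofReal_coe_nnreal]; exact h)).1

lemma weight_mul_rpow (q : ℝ) (x : Pt m) :
    weight s x * lastC x ^ (q - s - 1) = posPow (q - 1) (lastC x) := by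
  rcases le_or_gt (lastC x) 0 with h | h
  · rw [weight, if_neg (not_lt.2 h), posPow_of_nonpos h, zero_mul]
  · rw [weight, if_pos h, posPow_of_pos h, ← rpow_add h]
    congr 1
    ring

lemma weight_nonneg (x : Pt m) : 0 ≤ weight s x := by
  rw [weight_eq]; exact posPow_nonneg _ _

lemma lastC_pos_of_weight (h : weight s x ≠ 0) : 0 < lastC x := by
  by_contra hn
  exact h (by rw [weight, if_neg hn])

lemma gradient_eq_zero (hx : x ∉ tsupport η) : gradient η x = 0 := by
  rw [gradient, image_eq_zero_of_notMem_tsupport (fun h => hx (tsupport_fderiv_subset ℝ h)), map_zero]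

/-- The boundary concentration in the half-space. -/
lemma halfSpace_boundary (k : Ker s lam Lam K) (hη : ContDiff ℝ ∞ η) (hc : HasCompactSupport η) (hv : Continuous v) :
    (∀ ε > 0, Integrable (fun x => 2 * (v x * weight s x *
      inner ℝ (gradient η x) (modInt s K (lastC x) (eN m) ε)))) ∧
    Integrable (fun x' : Hyp m =>
      inner ℝ (thetaK s K) (gradient η (mk x' 0)) * v (mk x' 0)) ∧
    Tendsto (fun ε => ∫ x, 2 * (v x * weight s x *
      inner ℝ (gradient η x) (modInt s K (lastC x) (eN m) ε))) (𝓝[>] 0)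
      (𝓝 (∫ x' : Hyp m, inner ℝ (thetaK s K) (gradient η (mk x' 0)) * v (mk x' 0))) := by
  have hη1 : ContDiff ℝ 1 η := hη.of_le (by exact_mod_cast le_top)
  have hgc : Continuous (gradient η) :=
    (InnerProductSpace.toDual ℝ (Pt m)).symm.continuous.comp (hη1.continuous_fderiv one_ne_zero)
  have hvg : Continuous fun x => v x • gradient η x := hv.smul hgc
  obtain ⟨R, hR⟩ := hc.isBounded.subset_closedBall 0
  have hcs : HasCompactSupport fun x => v x • gradient η x :=
    HasCompactSupport.intro hc fun x hx => by simp [gradient_eq_zero hx]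
  obtain ⟨M, hM⟩ := hvg.bounded_above_of_compact_support hcs
  set G : Hyp m × ℝ → Pt m :=
    {p | 0 < p.2}.indicator fun p => v (mk p.1 p.2) • gradient η (mk p.1 p.2) with hGdef
  have hGpos : ∀ p, 0 < p.2 → G p = v (mk p.1 p.2) • gradient η (mk p.1 p.2) := fun p hp =>
    indicator_of_mem (s := {p : Hyp m × ℝ | 0 < p.2}) hp _
  have hGm : MeasurableSet {p : Hyp m × ℝ | 0 < p.2} :=
    measurableSet_lt measurable_const measurable_snd
  have hcont : Continuous fun p : Hyp m × ℝ =>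
      v (mk p.1 p.2) • gradient η (mk p.1 p.2) := hvg.comp continuous_mk
  have hLD : LayerData m G (fun p => p.2) (fun _ => eN m) (closedBall 0 R) M 1 1 1 1 := by
    refine ⟨hcont.measurable.indicator hGm, measurable_snd, measurable_const,
      measurableSet_closedBall, measure_closedBall_lt_top.ne, one_pos, one_pos, ?_, ?_, ?_, ?_⟩
    · intro p hp
      have hp2 : 0 < p.2 := by
        by_contra h
        exact hp (indicator_of_notMem (by simpa using h) _)
      have h2 : mk p.1 p.2 ∈ tsupport η := by
        by_contra h
        exact hp (by rw [hGpos p hp2, gradient_eq_zero h, smul_zero])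
      have h3 := (norm_initC_le _).trans (mem_closedBall_zero_iff.1 (hR h2))
      rw [initC_mk] at h3
      exact ⟨mem_closedBall_zero_iff.2 h3, hp2⟩
    · intro p
      exact (norm_indicator_le_norm_self _ _).trans (hM _)
    · intro p _; simp
    · intro p _; simp [norm_eN]
  have hlim := hLD.tendsto k (J := fun _ => 1) (N0 := fun _ => eN m)
    (G0 := fun x' => v (mk x' 0) • gradient η (mk x' 0)) (.of_forall fun x' => Or.inr
      ⟨one_pos, eN_ne_zero, by
        have h1 : Tendsto (fun t : ℝ => v (mk x' t) • gradient η (mk x' t)) (𝓝[>] 0)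
            (𝓝 (v (mk x' 0) • gradient η (mk x' 0))) :=
          tendsto_nhdsWithin_of_tendsto_nhds
            ((hcont.comp (by fun_prop : Continuous fun t : ℝ => (x', t))).tendsto 0)
        exact h1.congr_within fun t ht =>
          (hGpos (x', t) ht).symm,
      tendsto_const_nhds, by
        rw [inv_one]
        exact tendsto_const_nhds.congr_within fun t ht =>
          (div_self (ne_of_gt ht)).symm⟩)
  have hth : ∀ x' : Hyp m, inner ℝ (thetaK s K) (gradient η (mk x' 0)) * v (mk x' 0) =
      2 * (1 * cs s * inner ℝ (halfVec s K (eN m)) (v (mk x' 0) • gradient η (mk x' 0))) := by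
    intro x'
    rw [thetaK, ← halfVec_eN k, real_inner_smul_left, real_inner_smul_right]
    ring
  have hlay : ∀ ε > 0, ∀ p : Hyp m × ℝ,
      2 * (v (mk p.1 p.2) * weight s (mk p.1 p.2) * inner ℝ (gradient η (mk p.1 p.2))
        (modInt s K (lastC (mk p.1 p.2)) (eN m) ε)) =
      2 * layer s K G (fun p => p.2) (fun _ => eN m) ε p := by
    intro ε hε p
    rw [lastC_mk, layer]
    rcases le_or_gt p.2 0 with h | h
    · rw [weight, lastC_mk, if_neg (not_lt.2 h), hGdef, indicator_of_notMem (by simpa using h)]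
      simp
    · rw [weight, lastC_mk, if_pos h, hGdef, indicator_of_mem (by simpa using h),
        modInt_eq k h eN_ne_zero hε, real_inner_smul_right, real_inner_smul_right,
        real_inner_comm]
      have : p.2 ^ (s - 1) * p.2 ^ (-s) = p.2⁻¹ := by
        rw [← rpow_add h, show s - 1 + -s = -1 by ring, rpow_neg_one]
      rw [← this]
      ring
  have hint : ∀ ε > 0, Integrable (fun x => 2 * (v x * weight s x *
      inner ℝ (gradient η x) (modInt s K (lastC x) (eN m) ε))) := by
    intro ε hε
    rw [← measurePreserving_mk.integrable_comp_emb measurableEmbedding_mk]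
    refine ((hLD.integrable_layer k hε).const_mul 2).congr (.of_forall fun p => ?_)
    exact (hlay ε hε p).symm
  refine ⟨hint, ?_, ?_⟩
  · simp only [hth]
    exact hlim.1.const_mul 2
  · simp only [hth]
    rw [integral_const_mul]
    refine (hlim.2.const_mul 2).congr_within fun ε hε => ?_
    rw [← measurePreserving_mk.integral_comp measurableEmbedding_mk, ← integral_const_mul]
    exact integral_congr_ae (.of_forall fun p => (hlay ε hε p).symm)

/-- The weighted integration by parts formula in the half-space. -/
theorem halfSpace_formula (k : Ker s lam Lam K) (hγ : γ ∈ Ioo (max 0 (2 * s - 1)) (s + 1))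
    (hv : HolderLoc γ v univ) (hg : ∃ C : ℝ, ∀ x, |v x| ≤ C * (1 + ‖x‖ ^ γ))
    (hη : ContDiff ℝ ∞ η) (hc : HasCompactSupport η) :
    Integrable (fun p : Pt m × Pt m =>
      (v p.1 - v p.2) * (η p.1 - η p.2) * weight s p.1 * weight s p.2 * K (p.1 - p.2)) ∧
    (∀ x, 0 < lastC x → OpExists (fun x y => K (y - x)) (fun z => weight s z * η z) x) ∧
    IntegrableOn (fun x => v x * weight s x * opL K (fun z => weight s z * η z) x)
      {x | 0 < lastC x} ∧
    Integrable (fun x' : Hyp m =>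
      inner ℝ (thetaK s K) (gradient η (mk x' 0)) * v (mk x' 0)) ∧
    ∫ x, ∫ y, (v x - v y) * (η x - η y) * weight s x * weight s y * K (x - y)
      = (∫ x in {x | 0 < lastC x}, v x * weight s x * opL K (fun z => weight s z * η z) x)
        - ∫ x' : Hyp m, inner ℝ (thetaK s K) (gradient η (mk x' 0)) * v (mk x' 0) := by
  have hγ0 : 0 < γ := (le_max_left _ _).trans_lt hγ.1
  have hγ1 : 2 * s - 1 < γ := (le_max_right _ _).trans_lt hγ.1
  have hγ2 : γ < s + 1 := hγ.2
  have hs0 := k.hs.1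
  have hs1 := k.hs.2
  obtain ⟨q, hqa, hqb⟩ := exists_between (show max (max γ 1) (2 * s) < min (1 + s) (1 + min γ 1) by
    simp only [max_lt_iff, lt_min_iff]
    refine ⟨⟨⟨?_, ?_⟩, ?_⟩, ⟨?_, ?_⟩, ?_⟩ <;> rcases min_cases γ 1 with h | h <;> linarith)
  simp only [max_lt_iff, lt_min_iff] at hqa hqb
  obtain ⟨⟨hqγ, hq1⟩, hqs⟩ := hqa
  obtain ⟨hq2, hq3⟩ := hqb
  have hvc : Continuous v := hv.continuous
  obtain ⟨Cη, hCη, hη1, hη2, hη3, hη4⟩ := exists_test_bounds hη hc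
  obtain ⟨R0, hR0⟩ := hc.isBounded.subset_closedBall 0
  set R := |R0| + 1
  have hR : 0 < R := by positivity
  set X : Set (Pt m) := ball 0 (R + 1)
  have hX : MeasurableSet X := measurableSet_ball
  have hη0 : ∀ x, R ≤ ‖x‖ → x ∉ tsupport η := fun x hx h => by
    have h2 := hR0 h
    rw [mem_closedBall_zero_iff] at h2
    have := le_abs_self R0
    simp only [R] at hx
    linarith
  have hXn : ∀ x, x ∉ X → R + 1 ≤ ‖x‖ := fun x hx => by simpa [X] using hx
  have hηX : ∀ x, x ∉ X → η x = 0 := fun x hx =>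
    image_eq_zero_of_notMem_tsupport (hη0 x (by linarith [hXn x hx]))
  obtain ⟨Cw, hw⟩ := exists_absGrowth_weight (m := m) k.hs
  obtain ⟨M, hM, r, hr, hr1, hMv⟩ := exists_increment_bound hγ0 hv hg (R + 1) (by linarith)
  obtain ⟨Mv, hMv'⟩ := (isCompact_closedBall (0 : Pt m) (R + 1)).exists_bound_of_continuousOn
    hvc.continuousOn
  have hMv0 : 0 ≤ Mv := (norm_nonneg _).trans (hMv' 0 (by simp; linarith))
  have hXv : ∀ x ∈ X, |v x| ≤ Mv := fun x hx => hMv' x (ball_subset_closedBall hx)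
  have hΔ : ∀ x ∈ X, ∀ y, |(v x - v y) * (η x - η y)| ≤
      (M * Cη + M * (2 * Cη) * r ^ (γ - q)) * ‖y - x‖ ^ q := by
    intro x hx y
    have hxn : ‖x‖ ≤ R + 1 := (mem_ball_zero_iff.1 hx).le
    obtain ⟨b1, b2⟩ := hMv x hxn y
    rw [abs_mul, abs_sub_comm (v x), abs_sub_comm (η x)]
    have p1 : 0 ≤ M * (2 * Cη) * r ^ (γ - q) * ‖y - x‖ ^ q := by positivity
    have p2 : 0 ≤ M * Cη * ‖y - x‖ ^ q := by positivity
    rcases lt_or_ge ‖y - x‖ r with h | h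
    · rcases (norm_nonneg (y - x)).eq_or_lt with h0 | h0
      · have : y = x := by rw [← sub_eq_zero, ← norm_eq_zero, ← h0]
        rw [this]; simp only [sub_self, abs_zero, mul_zero]; positivity
      calc |v y - v x| * |η y - η x| ≤ (M * ‖y - x‖ ^ min γ 1) * (Cη * ‖y - x‖) := by
            gcongr
            · exact b1 h
            · exact hη3 x y
        _ = M * Cη * ‖y - x‖ ^ (1 + min γ 1) := by
            rw [rpow_add h0, rpow_one]; ring
        _ ≤ M * Cη * ‖y - x‖ ^ q :=
            mul_rpow_le_of_near (by positivity) h0.le (h.le.trans hr1) (by linarith) hq3.le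
        _ ≤ _ := by linarith
    · calc |v y - v x| * |η y - η x| ≤ (M * ‖y - x‖ ^ γ) * (2 * Cη) := by
            gcongr
            · exact b2 h
            · calc |η y - η x| ≤ |η y| + |η x| := abs_sub _ _
                _ ≤ 2 * Cη := by linarith [hη1 x, hη1 y]
        _ ≤ (M * (r ^ (γ - q) * ‖y - x‖ ^ q)) * (2 * Cη) := by
            gcongr
            exact rpow_le_of_far hr h hqγ.le
        _ ≤ _ := by linarith
  have hgi : IntegrableOn (fun x : Pt m => posPow (q - 1) (lastC x)) X :=
    integrableOn_posPow_ball (by linarith) (by linarith) _ (by linarith)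
  have hηc : Continuous η := hη.continuous
  have hΔm : AEStronglyMeasurable (fun z : Pt m × Pt m => (v z.1 - v z.2) * (η z.1 - η z.2))
      volume := (by fun_prop : Continuous _).aestronglyMeasurable
  have hP : Integrable (fun z : Pt m × Pt m => 𝓔 K (weight s) η v z) := by
    refine integrable_double k measurable_weight hw (c := 1 / 2)
      (P0 := (1 / 2) ^ (s - 1)) (by norm_num) hq2 hqs
      (M := M * Cη + M * (2 * Cη) * r ^ (γ - q)) (by positivity)
      (by positivity) hX (D := lastC) hΔm
      (fun x hx hpx => ⟨lastC_pos_of_weight hpx, fun y hy =>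
        abs_weight_near k.hs (lastC_pos_of_weight hpx) hy⟩)
      (fun x hx _ => Eventually.of_forall fun y _ => ⟨hΔ x hx y, ?_⟩)
      (fun x y hx hy => by simp [hηX x hx, hηX y hy]) ?_
    · have := hΔ x hx y
      rwa [show (v y - v x) * (η y - η x) = (v x - v y) * (η x - η y) by ring]
    · simp only [abs_of_nonneg (weight_nonneg _), weight_mul_rpow]
      exact hgi
  have hwX : IntegrableOn (weight s) X :=
    integrableOn_posPow_ball hs0 hs1.le _ (by linarith)
  have hQ : ∀ ε > 0, IntegrableOn (fun z : Pt m × Pt m => v z.1 * (η z.1 - η z.2) *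
      (weight s z.1 * weight s z.2 * K (z.1 - z.2))) (𝔾 ε) := by
    intro ε hε
    obtain ⟨D, hD, hvD⟩ : ∃ D ≥ 0, ∀ x ∈ X, ∀ y, ε ≤ ‖y - x‖ →
        |v x| ≤ D * ‖y - x‖ ^ q ∧ |v y| ≤ D * ‖y - x‖ ^ q := by
      refine ⟨(Mv + M) * ε ^ (-q) + M * ε ^ (γ - q), by positivity, fun x hx y hy => ?_⟩
      obtain ⟨b1, b2⟩ := hMv x (mem_ball_zero_iff.1 hx).le y
      have e1 : 1 ≤ ε ^ (-q) * ‖y - x‖ ^ q := by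
        simpa using rpow_le_of_far hε hy (a := 0) (q := q) (by linarith)
      have e2 := mul_le_mul_of_nonneg_left (rpow_le_of_far hε hy hqγ.le) hM
      have p := mul_nonneg hM (rpow_nonneg (norm_nonneg (y - x)) γ)
      have h1 : |v y - v x| ≤ M + M * ‖y - x‖ ^ γ := by
        rcases lt_or_ge ‖y - x‖ r with h | h
        · linarith [b1 h, mul_le_of_le_one_right hM (rpow_le_one (norm_nonneg (y - x))
            (h.le.trans hr1) (le_min hγ0.le zero_le_one))]
        · linarith [b2 h]
      have h2 := abs_sub_abs_le_abs_sub (v y) (v x)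
      have h3 := mul_le_mul_of_nonneg_left e1 (add_nonneg hMv0 hM)
      constructor <;> linarith [hXv x hx]
    refine integrableOn_double_trunc k measurable_weight hw (q := q) (by linarith)
      (M := D * (2 * Cη)) (by positivity) hX (by fun_prop : Continuous _).aestronglyMeasurable hε
      (fun x hx _ => .of_forall fun y hy _ => ?_)
      (fun x y hx hy => by simp [hηX x hx, hηX y hy]) hwX
    have hd : ∀ a b, |η a - η b| ≤ 2 * Cη := fun a b =>
      (abs_sub _ _).trans (by linarith [hη1 a, hη1 b])
    obtain ⟨h1, h2⟩ := hvD x hx y hy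
    rw [mul_right_comm, abs_mul, abs_mul]
    exact ⟨mul_le_mul h1 (hd _ _) (abs_nonneg _) (by positivity),
      mul_le_mul h2 (hd _ _) (abs_nonneg _) (by positivity)⟩
  obtain ⟨hb1, hb2, hb3⟩ := halfSpace_boundary k hη hc hvc
  obtain ⟨B, hB, hrem⟩ := exists_remainder_bound k hη hc hq1.le hq2 hqs
  set Q : Pt m × Pt m → ℝ := {z : Pt m × Pt m | 1 / 2 < ‖z.1 - z.2‖}.indicator
    (fun z => v z.1 * (η z.1 - η z.2) * (weight s z.1 * weight s z.2 * K (z.1 - z.2))) with hQdef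
  have hQi : Integrable Q ((volume : Measure (Pt m)).prod volume) :=
    (integrable_indicator_iff (measurableSet_offDiag _)).2 (hQ (1 / 2) (by norm_num))
  set g : Pt m → ℝ := fun x => X.indicator (fun x => 2 * (Mv * B) * posPow (q - 1) (lastC x)) x +
    2 * ∫ y, |Q (x, y)| with hgdef
  have hgint : Integrable g :=
    ((integrable_indicator_iff hX).2 (hgi.const_mul _)).add (hQi.abs.integral_prod_left.const_mul 2)
  set F : Pt m → ℝ := {x | 0 < lastC x}.indicator
    (fun x => v x * weight s x * opL K (fun z => weight s z * η z) x) with hFdef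
  have hpos : MeasurableSet {x : Pt m | 0 < lastC x} := measurableSet_lt measurable_const (by fun_prop)
  have heq : ∀ ε > 0, ∀ x, 0 < lastC x → v x * weight s x * gTrunc K η (weight s) x ε +
      2 * (v x * weight s x * inner ℝ (gradient η x) (modInt s K (lastC x) (eN m) ε)) =
      -2 * (v x * weight s x * ∫ y in 𝔽 x ε,
        (η y - η x - inner ℝ (gradient η x) (y - x)) * weight s y * K (y - x)) := by
    intro ε hε x hx
    rw [gTrunc_weight k (hrem x hx).1 hε]
    ring
  have hmain := integral_by_parts_of_split k.hK hP hQ hb1 hb3 hgint (F := F) ?_ ?_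
  · obtain ⟨m1, m2⟩ := hmain
    have hP' : Integrable (fun p : Pt m × Pt m =>
        (v p.1 - v p.2) * (η p.1 - η p.2) * weight s p.1 * weight s p.2 * K (p.1 - p.2))
        ((volume : Measure (Pt m)).prod volume) :=
      hP.congr (.of_forall fun z => by ring)
    refine ⟨hP', fun x hx => (halfSpace_limit k hη hc hx).1,
      (integrable_indicator_iff hpos).1 m1, hb2, ?_⟩
    rw [← integral_indicator hpos, ← m2]
    rw [← integral_prod _ hP', Measure.volume_eq_prod]
    exact integral_congr_ae (.of_forall fun z => by ring)
  · filter_upwards [self_mem_nhdsWithin] with ε hε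
    filter_upwards [hQi.prod_right_ae] with x hxQ
    change |v x * weight s x * gTrunc K η (weight s) x ε + _| ≤ _
    have hgn : 0 ≤ 2 * ∫ y, |Q (x, y)| := by positivity
    have hgn2 : 0 ≤ X.indicator (fun x => 2 * (Mv * B) * posPow (q - 1) (lastC x)) x :=
      indicator_nonneg (fun x _ => mul_nonneg (by positivity) (posPow_nonneg _ _)) _
    rcases le_or_gt (lastC x) 0 with hx | hx
    · have : weight s x = 0 := if_neg (not_lt.2 hx)
      simp only [this, mul_zero, zero_mul, add_zero, abs_zero]
      exact add_nonneg hgn2 hgn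
    rw [heq ε hε x hx, abs_mul, abs_neg, abs_two, abs_mul, abs_mul, abs_of_nonneg (weight_nonneg x)]
    obtain ⟨i1, i2⟩ := hrem x hx
    have i3 := abs_setIntegral_le i1 (𝔽 x ε)
    by_cases hxX : x ∈ X
    · simp only [hgdef, indicator_of_mem hxX]
      calc 2 * (|v x| * weight s x * |_|) ≤ 2 * (Mv * weight s x * (B * lastC x ^ (q - s - 1))) := by
            have := weight_nonneg (s := s) x
            gcongr
            · exact hXv x hxX
            · exact i3.trans i2
        _ = 2 * (Mv * B) * posPow (q - 1) (lastC x) := by rw [← weight_mul_rpow (s := s)]; ring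
        _ ≤ _ := by linarith
    · simp only [hgdef, indicator_of_notMem hxX, zero_add]
      gcongr
      refine (mul_le_mul_of_nonneg_left i3 (mul_nonneg (abs_nonneg _) (weight_nonneg x))).trans_eq ?_
      rw [← integral_const_mul]
      refine integral_congr_ae (.of_forall fun y => ?_)
      simp only [hηX x hxX, gradient_eq_zero (hη0 x (by linarith [hXn x hxX])), inner_zero_left,
        sub_zero, hQdef, indicator, mem_ofPred_eq, zero_sub, k.hK.symm_sub x y]
      split_ifs with hy
      · simp only [abs_mul, abs_neg, abs_of_nonneg (weight_nonneg x)]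
        ring
      · have : η y = 0 := image_eq_zero_of_notMem_tsupport (hη0 y (by
          linarith [hXn x hxX, norm_sub_norm_le x y]))
        simp [this]
  · refine Eventually.of_forall fun x => ?_
    rcases le_or_gt (lastC x) 0 with hx | hx
    · have h0 : weight s x = 0 := if_neg (not_lt.2 hx)
      have hF0 : F x = 0 := indicator_of_notMem (by simpa using hx) _
      simp only [h0, hF0, mul_zero, zero_mul, add_zero]
      exact tendsto_const_nhds
    · have hF0 : F x = v x * weight s x * opL K (fun z => weight s z * η z) x :=
        indicator_of_mem (by simpa using hx) _
      rw [hF0]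
      have l1 := (halfSpace_limit k hη hc hx).2.const_mul (v x * weight s x)
      have l2 := (((tendsto_const_nhds (x := gradient η x)).inner (𝕜 := ℝ)
        (tendsto_modInt_zero k hx (eN_ne_zero (m := m)))).const_mul (v x * weight s x)).const_mul 2
      have := l1.add l2
      rw [inner_zero_right, mul_zero, mul_zero, add_zero] at this
      exact this

/-- A chart in which `Ω` is, near `x0 ∈ ∂Ω`, the epigraph of a `C¹` function. -/
structure EpiChart (Ω : Set (Pt m)) (x0 : Pt m) where
  A : Pt m ≃ₗᵢ[ℝ] Pt m
  g : Hyp m → ℝ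
  r : ℝ
  L : ℝ≥0
  r_pos : 0 < r
  contDiff : ContDiff ℝ 1 g
  lip : LipschitzOnWith L g (ball (initC (A x0)) r)
  mem_iff : ∀ x ∈ ball x0 r, x ∈ Ω ↔ g (initC (A x)) < lastC (A x)
  base : g (initC (A x0)) = lastC (A x0)

namespace EpiChart

variable (c : EpiChart Ω x0)

/-- The height above the graph. -/
def height (z : Pt m) : ℝ := lastC (c.A z) - c.g (initC (c.A z))

/-- The vertical direction. -/
def e : Pt m := c.A.symm (eN m)

lemma norm_e : ‖c.e‖ = 1 := by rw [e, LinearIsometryEquiv.norm_map, norm_eN]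

lemma A_add_smul_e (z : Pt m) (t : ℝ) : c.A (z + t • c.e) = c.A z + t • eN m := by
  simp [e]

lemma initC_eN : initC (eN m) = 0 := initC_mk _ _

lemma lastC_eN : lastC (eN m) = 1 := lastC_mk _ _

lemma height_add_e (z : Pt m) (t : ℝ) : c.height (z + t • c.e) = c.height z + t := by
  rw [height, height, A_add_smul_e, initC_add, lastC_add, initC_smul, lastC_smul, initC_eN, lastC_eN,
    smul_zero, add_zero, mul_one, add_sub_right_comm]

lemma continuous_height : Continuous c.height := by
  exact (continuous_lastC.comp c.A.continuous).sub
    (c.contDiff.continuous.comp (continuous_initC.comp c.A.continuous))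

lemma height_base : c.height x0 = 0 := by rw [height, c.base, sub_self]

lemma norm_initC_sub_le (z w : Pt m) : ‖initC (c.A z) - initC (c.A w)‖ ≤ ‖z - w‖ := by
  rw [← initC_sub, ← map_sub]
  exact (norm_initC_le _).trans_eq (c.A.norm_map _)

lemma initC_mem (hz : z ∈ ball x0 c.r) : initC (c.A z) ∈ ball (initC (c.A x0)) c.r := by
  exact mem_ball_iff_norm.2 ((c.norm_initC_sub_le _ _).trans_lt (mem_ball_iff_norm.1 hz))

lemma abs_height_sub_le {w : Pt m} (hz : z ∈ ball x0 c.r) (hw : w ∈ ball x0 c.r) :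
    |c.height z - c.height w| ≤ (1 + c.L) * ‖z - w‖ := by
  have h1 := c.lip.norm_sub_le (c.initC_mem hz) (c.initC_mem hw)
  have h2 : |lastC (c.A z) - lastC (c.A w)| ≤ ‖z - w‖ := by
    rw [← lastC_sub, ← map_sub]
    exact (abs_lastC_le _).trans_eq (c.A.norm_map _)
  rw [norm_eq_abs] at h1
  calc |c.height z - c.height w| = |(lastC (c.A z) - lastC (c.A w)) -
        (c.g (initC (c.A z)) - c.g (initC (c.A w)))| := by unfold height; ring_nf
    _ ≤ |lastC (c.A z) - lastC (c.A w)| + |c.g (initC (c.A z)) - c.g (initC (c.A w))| := abs_sub _ _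
    _ ≤ ‖z - w‖ + c.L * ‖z - w‖ := by
        refine add_le_add h2 (h1.trans ?_)
        gcongr
        exact c.norm_initC_sub_le z w
    _ = _ := by ring

lemma mem_iff_height (hx : x ∈ ball x0 c.r) : x ∈ Ω ↔ 0 < c.height x := by
  rw [c.mem_iff x hx, height, sub_pos]

lemma abs_height_le (hx : x ∈ ball x0 c.r) :
    |c.height x| ≤ (1 + c.L) * ‖x - x0‖ := by
  have := c.abs_height_sub_le hx (mem_ball_self c.r_pos)
  rwa [c.height_base, sub_zero] at this

lemma mem_frontier_iff (hΩ : IsOpen Ω) (hx : x ∈ ball x0 c.r) :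
    x ∈ frontier Ω ↔ c.height x = 0 := by
  have hnhds := isOpen_ball.mem_nhds hx
  rw [hΩ.frontier_eq]
  constructor
  · rintro ⟨h1, h2⟩
    rw [c.mem_iff_height hx, not_lt] at h2
    refine le_antisymm h2 (not_lt.1 fun hneg => ?_)
    have hU : {z | c.height z < 0} ∩ ball x0 c.r ∈ 𝓝 x :=
      inter_mem (c.continuous_height.continuousAt (Iio_mem_nhds hneg)) hnhds
    obtain ⟨y, hy1, hy2⟩ := mem_closure_iff_nhds.1 h1 _ hU
    exact lt_asymm ((c.mem_iff_height hy1.2).1 hy2) hy1.1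
  · intro h
    refine ⟨?_, fun h2 => ?_⟩
    · have ht : Tendsto (fun t : ℝ => x + t • c.e) (𝓝[>] 0) (𝓝 x) := by
        have : Continuous fun t : ℝ => x + t • c.e := by fun_prop
        exact tendsto_nhdsWithin_of_tendsto_nhds (by simpa using this.tendsto 0)
      refine mem_closure_of_tendsto ht ?_
      filter_upwards [self_mem_nhdsWithin, ht.eventually hnhds] with t h1 h2
      rw [c.mem_iff_height h2, height_add_e, h, zero_add]
      exact h1
    · exact ((c.mem_iff_height hx).1 h2).ne' h

/-- The constant governing the length of paths in the chart. -/
def Λ : ℝ := 1 + c.L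

lemma one_le_Λ : 1 ≤ c.Λ := by
  simp [Λ]

/-- A smaller radius. -/
def r1 : ℝ := c.r / (4 * c.Λ)

lemma r₁_pos : 0 < c.r1 := div_pos c.r_pos (by linarith [c.one_le_Λ])

lemma r₁_mul : 4 * c.Λ * c.r1 = c.r := by
  have := c.one_le_Λ
  unfold r1
  field_simp

lemma r₁_le : 4 * c.r1 ≤ c.r := by
  nlinarith [c.r₁_mul, c.one_le_Λ, c.r₁_pos]

lemma ball_subset : ball x0 c.r1 ⊆ ball x0 c.r :=
  ball_subset_ball (by linarith [c.r₁_le, c.r₁_pos])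

lemma add_e_mem (hx : x ∈ ball x0 c.r1) (ht0 : 0 ≤ t)
    (ht : t ≤ 2 * c.Λ * c.r1) : x + t • c.e ∈ ball x0 c.r := by
  rw [mem_ball_iff_norm] at hx ⊢
  calc ‖x + t • c.e - x0‖ = ‖(x - x0) + t • c.e‖ := by congr 1; abel
    _ ≤ ‖x - x0‖ + ‖t • c.e‖ := norm_add_le _ _
    _ = ‖x - x0‖ + t := by rw [norm_smul, norm_e, mul_one, norm_of_nonneg ht0]
    _ < c.r := by nlinarith [c.r₁_mul, c.one_le_Λ, c.r₁_pos]

/-- Any two points near the base point are joined by a polygonal path inside the domain. -/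
lemma path_mem (hx : x ∈ Ω ∩ ball x0 c.r1) (hy : y ∈ Ω ∩ ball x0 c.r1) :
    segment ℝ x (x + (c.Λ * ‖y - x‖) • c.e) ⊆ Ω ∩ ball x0 c.r ∧
    segment ℝ (x + (c.Λ * ‖y - x‖) • c.e) (y + (c.Λ * ‖y - x‖) • c.e) ⊆ Ω ∩ ball x0 c.r ∧
    segment ℝ (y + (c.Λ * ‖y - x‖) • c.e) y ⊆ Ω ∩ ball x0 c.r := by
  have hM := c.one_le_Λ
  have hd : ‖y - x‖ ≤ 2 * c.r1 := by
    rw [← dist_eq_norm]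
    linarith [dist_triangle_right y x x0, mem_ball.1 hx.2, mem_ball.1 hy.2]
  set T := c.Λ * ‖y - x‖ with hT
  have hT0 : 0 ≤ T := by positivity
  have hT1 : T ≤ 2 * c.Λ * c.r1 := by rw [hT]; nlinarith
  have vert : ∀ z ∈ Ω ∩ ball x0 c.r1, ∀ t, 0 ≤ t → t ≤ T → z + t • c.e ∈ Ω ∩ ball x0 c.r := by
    intro z hz t h0 h1
    have hb := c.add_e_mem hz.2 h0 (h1.trans hT1)
    refine ⟨?_, hb⟩
    rw [c.mem_iff_height hb, height_add_e]
    linarith [(c.mem_iff_height (c.ball_subset hz.2)).1 hz.1]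
  refine ⟨?_, ?_, ?_⟩
  · rintro _ ⟨a, b, ha, hb, hab, rfl⟩
    rw [show a • x + b • (x + T • c.e) = x + (b * T) • c.e by
      rw [show a = 1 - b by linarith]; module]
    exact vert x hx _ (by positivity) (mul_le_of_le_one_left hT0 (by linarith))
  · rintro _ ⟨a, b, ha, hb, hab, rfl⟩
    rw [show a • (x + T • c.e) + b • (y + T • c.e) = (x + b • (y - x)) + T • c.e by
      rw [show a = 1 - b by linarith]; module]
    have hz : x + b • (y - x) ∈ ball x0 c.r1 := by
      have := (convex_ball x0 c.r1) hx.2 hy.2 ha hb hab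
      rwa [show a • x + b • y = x + b • (y - x) by
        rw [show a = 1 - b by linarith]; module] at this
    have hzb := c.add_e_mem hz hT0 hT1
    refine ⟨?_, hzb⟩
    rw [c.mem_iff_height hzb, height_add_e]
    have h2 := c.abs_height_sub_le (c.ball_subset hz) (c.ball_subset hx.2)
    rw [add_sub_cancel_left, norm_smul, norm_of_nonneg hb] at h2
    have h4 : (1 + c.L : ℝ) * (b * ‖y - x‖) ≤ T := by
      rw [hT, Λ]
      gcongr
      exact mul_le_of_le_one_left (norm_nonneg _) (by linarith)
    linarith [(abs_le.1 h2).1, (c.mem_iff_height (c.ball_subset hx.2)).1 hx.1]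
  · rintro _ ⟨a, b, ha, hb, hab, rfl⟩
    rw [show a • (y + T • c.e) + b • y = y + (a * T) • c.e by
      rw [show b = 1 - a by linarith]; module]
    exact vert y hy _ (by positivity) (mul_le_of_le_one_left hT0 (by linarith))

section Taylor

variable {F : Type*} [NormedAddCommGroup F] [NormedSpace ℝ F] {f : Pt m → F}

lemma norm_segment_taylor {a b : Pt m} {φ : Pt m →L[ℝ] F} {H : ℝ}
    (hd : ∀ z ∈ segment ℝ a b, DifferentiableAt ℝ f z)
    (hH : ∀ z ∈ segment ℝ a b, ‖fderiv ℝ f z - φ‖ ≤ H) :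
    ‖f b - f a - φ (b - a)‖ ≤ H * ‖b - a‖ :=
  (convex_segment a b).norm_image_sub_le_of_norm_hasFDerivWithin_le'
    (fun z hz => (hd z hz).hasFDerivAt.hasFDerivWithinAt) hH (left_mem_segment ℝ a b)
    (right_mem_segment ℝ a b)

lemma norm_sub_le_of_mem_segment {a b : Pt m} (hz : z ∈ segment ℝ a b)
    (ha : ‖a - x‖ ≤ R) (hb : ‖b - x‖ ≤ R) : ‖z - x‖ ≤ R :=
  mem_closedBall_iff_norm.1 ((convex_closedBall x R).segment_subset (mem_closedBall_iff_norm.2 ha)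
    (mem_closedBall_iff_norm.2 hb) hz)

lemma path_taylor (hd : ∀ z ∈ Ω ∩ ball x0 c.r, DifferentiableAt ℝ f z) (hx : x ∈ Ω ∩ ball x0 c.r1) (hy : y ∈ Ω ∩ ball x0 c.r1)
    {φ : Pt m →L[ℝ] F} {H : ℝ}
    (hH : ∀ z ∈ Ω ∩ ball x0 c.r, ‖z - x‖ ≤ (2 * c.Λ + 1) * ‖y - x‖ → ‖fderiv ℝ f z - φ‖ ≤ H) :
    ‖f y - f x - φ (y - x)‖ ≤ H * ((2 * c.Λ + 1) * ‖y - x‖) := by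
  obtain ⟨p1, p2, p3⟩ := c.path_mem hx hy
  have hM := c.one_le_Λ
  set T := c.Λ * ‖y - x‖ with hT
  have hT0 : 0 ≤ T := by positivity
  have n0 := norm_nonneg (y - x)
  have nTe : ‖T • c.e‖ = T := by rw [norm_smul, norm_e, mul_one, norm_of_nonneg hT0]
  have b0 : ‖x - x‖ ≤ (2 * c.Λ + 1) * ‖y - x‖ := by rw [sub_self, norm_zero]; positivity
  have b1 : ‖x + T • c.e - x‖ ≤ (2 * c.Λ + 1) * ‖y - x‖ := by
    rw [add_sub_cancel_left, nTe, hT]; nlinarith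
  have b2 : ‖y + T • c.e - x‖ ≤ (2 * c.Λ + 1) * ‖y - x‖ := by
    rw [add_sub_right_comm]
    refine (norm_add_le _ _).trans ?_
    rw [nTe, hT]; nlinarith
  have b3 : ‖y - x‖ ≤ (2 * c.Λ + 1) * ‖y - x‖ := by nlinarith
  have t1 := norm_segment_taylor (fun z hz => hd z (p1 hz))
    fun z hz => hH z (p1 hz) (norm_sub_le_of_mem_segment hz b0 b1)
  have t2 := norm_segment_taylor (fun z hz => hd z (p2 hz))
    fun z hz => hH z (p2 hz) (norm_sub_le_of_mem_segment hz b1 b2)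
  have t3 := norm_segment_taylor (fun z hz => hd z (p3 hz))
    fun z hz => hH z (p3 hz) (norm_sub_le_of_mem_segment hz b2 b3)
  rw [add_sub_cancel_left, nTe] at t1
  rw [add_sub_add_right_eq_sub] at t2
  rw [sub_add_cancel_left, norm_neg, nTe] at t3
  have e : f y - f x - φ (y - x) = (f (x + T • c.e) - f x - φ (T • c.e)) +
      (f (y + T • c.e) - f (x + T • c.e) - φ (y - x)) +
      (f y - f (y + T • c.e) - φ (-(T • c.e))) := by
    rw [map_neg]; abel
  rw [e]
  refine (norm_add₃_le).trans ?_
  calc _ ≤ H * T + H * ‖y - x‖ + H * T := add_le_add (add_le_add t1 t2) t3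
    _ = _ := by rw [hT]; ring

lemma path_lipschitz (hd : ∀ z ∈ Ω ∩ ball x0 c.r, DifferentiableAt ℝ f z) {C : ℝ}
    (hC : ∀ z ∈ Ω ∩ ball x0 c.r, ‖fderiv ℝ f z‖ ≤ C) (hx : x ∈ Ω ∩ ball x0 c.r1) (hy : y ∈ Ω ∩ ball x0 c.r1) :
    ‖f y - f x‖ ≤ C * ((2 * c.Λ + 1) * ‖y - x‖) := by
  simpa using c.path_taylor (φ := 0) hd hx hy fun z hz _ => by simpa using hC z hz

lemma path_holder (hd : ∀ z ∈ Ω ∩ ball x0 c.r, DifferentiableAt ℝ f z) {C : ℝ}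
    (hτ : 0 < τ) (hC0 : 0 ≤ C)
    (hC : ∀ z ∈ Ω ∩ ball x0 c.r, ∀ w ∈ Ω ∩ ball x0 c.r,
      ‖fderiv ℝ f z - fderiv ℝ f w‖ ≤ C * ‖z - w‖ ^ τ) (hx : x ∈ Ω ∩ ball x0 c.r1) (hy : y ∈ Ω ∩ ball x0 c.r1) :
    ‖f y - f x - fderiv ℝ f x (y - x)‖ ≤ C * (2 * c.Λ + 1) ^ (1 + τ) * ‖y - x‖ ^ (1 + τ) := by
  have hM := c.one_le_Λ
  have := c.path_taylor (H := C * ((2 * c.Λ + 1) * ‖y - x‖) ^ τ) hd hx hy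
    fun z hz hzx => (hC z hz x ⟨hx.1, c.ball_subset hx.2⟩).trans (by gcongr)
  refine this.trans (le_of_eq ?_)
  have h0 : 0 ≤ (2 * c.Λ + 1) * ‖y - x‖ := by positivity
  rw [mul_assoc, mul_assoc, ← mul_rpow (by positivity) (norm_nonneg _)]
  rcases h0.eq_or_lt with h | h
  · rw [← h, zero_rpow hτ.ne', zero_rpow (by linarith)]; ring
  · rw [rpow_add h, rpow_one]; ring

end Taylor

lemma infDist_le (hΩ : IsOpen Ω) (hx : x ∈ Ω ∩ ball x0 c.r1) :
    infDist x (frontier Ω) ≤ c.height x := by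
  have hM := c.one_le_Λ
  have hxr := c.ball_subset hx.2
  have h0 := (c.mem_iff_height hxr).1 hx.1
  have h1 := c.abs_height_le hxr
  rw [abs_of_pos h0] at h1
  have hxn := mem_ball_iff_norm.1 hx.2
  have hr := c.r₁_mul
  have hr0 := c.r₁_pos
  have hz : x + (-c.height x) • c.e ∈ ball x0 c.r := by
    rw [mem_ball_iff_norm]
    calc ‖x + (-c.height x) • c.e - x0‖ = ‖(x - x0) + (-c.height x) • c.e‖ := by congr 1; abel
      _ ≤ ‖x - x0‖ + c.height x := (norm_add_le _ _).trans (by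
          rw [norm_smul, norm_e, norm_neg, norm_of_nonneg h0.le, mul_one])
      _ ≤ ‖x - x0‖ + c.Λ * ‖x - x0‖ := by unfold Λ; linarith
      _ < c.r := by nlinarith
  have hf : x + (-c.height x) • c.e ∈ frontier Ω := by
    rw [c.mem_frontier_iff hΩ hz, height_add_e]; ring
  refine (infDist_le_dist_of_mem hf).trans (le_of_eq ?_)
  rw [dist_eq_norm, sub_add_cancel_left, norm_neg, norm_smul, norm_e, norm_neg,
    norm_of_nonneg h0.le, mul_one]

lemma base_mem_frontier (c : EpiChart Ω x0) (hΩ : IsOpen Ω) : x0 ∈ frontier Ω :=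
  (c.mem_frontier_iff hΩ (mem_ball_self c.r_pos)).2 c.height_base

lemma le_infDist (hΩ : IsOpen Ω) (hx : x ∈ Ω ∩ ball x0 c.r1) :
    c.height x ≤ c.Λ * infDist x (frontier Ω) := by
  have hM := c.one_le_Λ
  have hxr := c.ball_subset hx.2
  have h0 := (c.mem_iff_height hxr).1 hx.1
  rw [← div_le_iff₀' (by linarith)]
  refine (Metric.le_infDist ⟨x0, c.base_mem_frontier hΩ⟩).2 fun z hz => ?_
  rw [div_le_iff₀' (by linarith), dist_eq_norm]
  by_cases hzr : z ∈ ball x0 c.r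
  · have h1 := c.abs_height_sub_le hxr hzr
    rw [(c.mem_frontier_iff hΩ hzr).1 hz, sub_zero, abs_of_pos h0] at h1
    exact h1
  · rw [mem_ball_iff_norm, not_lt] at hzr
    have h1 := c.abs_height_le hxr
    rw [abs_of_pos h0] at h1
    refine h1.trans ?_
    unfold Λ
    gcongr
    linarith [c.r₁_le, c.r₁_pos, mem_ball_iff_norm.1 hx.2, norm_sub_le_norm_sub_add_norm_sub z x x0,
      norm_sub_rev z x]

end EpiChart

/-- Existence of charts inside a given neighbourhood. -/
lemma exists_epiChart (hδ : 0 < δ) (hΩ : IsOpen Ω)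
    (hB : BoundaryC1Holder δ Ω B) (hx : x0 ∈ frontier Ω ∩ B) (hρ : 0 < ρ) :
    ∃ c : EpiChart Ω x0, c.r ≤ ρ := by
  obtain ⟨r, hr, A, g, hg, hmem⟩ := hB x0 hx
  have hg1 : ContDiff ℝ 1 g := contDiffOn_univ.1
    (hg.1.of_le (by exact_mod_cast le_hdeg (by simpa using hδ)))
  obtain ⟨L, t, ht, hL⟩ := (hg1.contDiffAt).exists_lipschitzOnWith
  obtain ⟨r', hr', hrt⟩ := Metric.mem_nhds_iff.1 ht
  have hxΩ := (hΩ.frontier_eq ▸ hx.1).2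
  have h2 : ¬ lastC (A x0) < g (initC (A x0)) := by
    intro h
    have hcont :=
      (hg1.continuous.comp (continuous_initC.comp A.continuous)).sub
        (continuous_lastC.comp A.continuous)
    have hU : {z | 0 < g (initC (A z)) - lastC (A z)} ∩ ball x0 r ∈ 𝓝 x0 :=
      inter_mem (hcont.continuousAt (Ioi_mem_nhds (sub_pos.2 h))) (ball_mem_nhds x0 hr)
    obtain ⟨y, hy1, hy2⟩ := mem_closure_iff_nhds.1 (frontier_subset_closure hx.1) _ hU
    exact lt_asymm ((hmem y hy1.2).1 hy2) (sub_pos.1 hy1.1)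
  exact ⟨{ A := A, g := g, r := min (min r r') ρ, L := L, r_pos := lt_min (lt_min hr hr') hρ
           contDiff := hg1
           lip := hL.mono ((ball_subset_ball
             ((min_le_left _ _).trans (min_le_right _ _))).trans hrt)
           mem_iff := fun x hx => hmem x (ball_subset_ball
             ((min_le_left _ _).trans (min_le_left _ _)) hx)
           base := le_antisymm (not_lt.1 h2) (not_lt.1 fun h => hxΩ ((hmem x0 (mem_ball_self hr)).2 h)) }, min_le_right _ _⟩

section HolderUpTo

variable {F G : Type*} [NormedAddCommGroup F] [NormedSpace ℝ F]
  [NormedAddCommGroup G] [NormedSpace ℝ G]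

lemma hdeg_one_add (h0 : 0 < τ) (h1 : τ ≤ 1) : hdeg (1 + τ) = 1 := by
  have a : ⌈1 + τ⌉₊ ≤ 2 := Nat.ceil_le.2 (by push_cast; linarith)
  have b : 1 < ⌈1 + τ⌉₊ := Nat.lt_ceil.2 (by push_cast; linarith)
  unfold hdeg
  omega

lemma norm_fderiv_sub_le (f : F → G) (x y : F) :
    ‖fderiv ℝ f x - fderiv ℝ f y‖ ≤ ‖iteratedFDeriv ℝ 1 f x - iteratedFDeriv ℝ 1 f y‖ := by
  refine ContinuousLinearMap.opNorm_le_bound _ (norm_nonneg _) fun v => ?_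
  have := (iteratedFDeriv ℝ 1 f x - iteratedFDeriv ℝ 1 f y).le_opNorm (fun _ => v)
  simpa [iteratedFDeriv_one_apply] using this

lemma HolderSeminormLE.fderiv_le {C : ℝ} (h0 : 0 < τ) (h1 : τ ≤ 1) {f : F → G} {U : Set F}
    (h : HolderSeminormLE (1 + τ) C f U) {x y : F} (hx : x ∈ U) (hy : y ∈ U) :
    ‖fderiv ℝ f x - fderiv ℝ f y‖ ≤ C * ‖x - y‖ ^ τ := by
  have := h x hx y hy
  rw [hdeg_one_add h0 h1] at this
  simp at this
  exact (norm_fderiv_sub_le f x y).trans this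

lemma HolderUpTo.exists_bounds (h0 : 0 < τ) (h1 : τ ≤ 1) {f : F → G} {U : Set F}
    (hU : IsOpen U) (h : HolderUpTo (1 + τ) f U) :
    (∀ x ∈ U, DifferentiableAt ℝ f x) ∧ ContinuousOn (fderiv ℝ f) U ∧
    ∃ C ≥ 0, (∀ x ∈ U, ‖f x‖ ≤ C) ∧ (∀ x ∈ U, ‖fderiv ℝ f x‖ ≤ C) ∧
      ∀ x ∈ U, ∀ y ∈ U, ‖fderiv ℝ f x - fderiv ℝ f y‖ ≤ C * ‖x - y‖ ^ τ := by
  obtain ⟨hd, C, hC, hH⟩ := h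
  rw [hdeg_one_add h0 h1] at hd hC
  refine ⟨fun x hx => (hd.differentiableOn (by norm_num)).differentiableAt (hU.mem_nhds hx),
    hd.continuousOn_fderiv_of_isOpen hU (by norm_num), |C|, abs_nonneg _, fun x hx => ?_,
    fun x hx => ?_, fun x hx y hy => ?_⟩
  · exact (norm_iteratedFDeriv_zero).ge.trans ((hC 0 (by norm_num) x hx).trans (le_abs_self _))
  · exact (norm_iteratedFDeriv_one f).ge.trans ((hC 1 le_rfl x hx).trans (le_abs_self _))
  · refine (hH.fderiv_le h0 h1 hx hy).trans ?_
    gcongr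
    exact le_abs_self _

end HolderUpTo

lemma exists_tendsto_of_holder {E F : Type*} [NormedAddCommGroup E] [NormedAddCommGroup F]
    [CompleteSpace F] {f : E → F} {U : Set E} {C : ℝ} (hτ : 0 < τ) (hC : 0 ≤ C)
    (hf : ∀ x ∈ U, ∀ y ∈ U, ‖f x - f y‖ ≤ C * ‖x - y‖ ^ τ) {z : E} (hz : z ∈ closure U) :
    ∃ l, Tendsto f (𝓝[U] z) (𝓝 l) := by
  have : (𝓝[U] z).NeBot := mem_closure_iff_nhdsWithin_neBot.1 hz
  refine cauchy_map_iff_exists_tendsto.1 (Metric.cauchy_iff.2 ⟨inferInstance, fun ε hε => ?_⟩)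
  have h0 : Tendsto (fun t => C * (2 * t) ^ τ) (𝓝 0) (𝓝 0) := by
    have h1 : Tendsto (fun t : ℝ => 2 * t) (𝓝 0) (𝓝 0) := by
      simpa using (tendsto_id (α := ℝ) (x := 𝓝 0)).const_mul 2
    have h2 := (h1.rpow_const (Or.inr hτ.le)).const_mul C
    rwa [zero_rpow hτ.ne', mul_zero] at h2
  obtain ⟨ρ, hρ, hρ'⟩ := Metric.eventually_nhds_iff.1 (h0.eventually (Iio_mem_nhds hε))
  have hρ2 : C * (2 * (ρ / 2)) ^ τ < ε :=
    hρ' (by rw [dist_0_eq_abs, abs_of_pos (by linarith)]; linarith)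
  refine ⟨f '' (ball z (ρ / 2) ∩ U), image_mem_map (inter_mem
    (mem_nhdsWithin_of_mem_nhds (ball_mem_nhds z (by linarith))) self_mem_nhdsWithin), ?_⟩
  rintro _ ⟨x, ⟨hx1, hx2⟩, rfl⟩ _ ⟨y, ⟨hy1, hy2⟩, rfl⟩
  rw [dist_eq_norm]
  refine (hf x hx2 y hy2).trans_lt (lt_of_le_of_lt ?_ hρ2)
  have : ‖x - y‖ ≤ 2 * (ρ / 2) := by
    have h1 := mem_ball_iff_norm.1 hx1
    have h2 := mem_ball_iff_norm.1 hy1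
    have h3 := norm_sub_le_norm_sub_add_norm_sub x z y
    rw [norm_sub_rev z y] at h3
    linarith
  gcongr

/-- A unit inner normal is unique. -/
lemma IsInnerNormal.unique {ν' : Pt m} (h : IsInnerNormal Ω z ν) (h' : IsInnerNormal Ω z ν') :
    ν = ν' := by
  by_contra hne
  have h1 := h.1
  have h2 := h'.1
  have hpos : 0 < 1 - (inner ℝ ν ν' : ℝ) := by
    have := real_inner_le_norm ν ν'
    rw [h1, h2, one_mul] at this
    rcases this.eq_or_lt with he | hl
    · exact absurd ((inner_eq_one_iff_of_norm_eq_one h1 h2).1 he) hne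
    · linarith
  set θ := ν - ν'
  have hθ : θ ≠ 0 := sub_ne_zero.2 hne
  have hθn := norm_pos_iff.2 hθ
  have i1 : inner ℝ θ ν = 1 - (inner ℝ ν ν' : ℝ) := by
    rw [inner_sub_left, real_inner_self_eq_norm_sq, h1, real_inner_comm]; norm_num
  have i2 : inner ℝ θ ν' = -(1 - (inner ℝ ν ν' : ℝ)) := by
    rw [inner_sub_left, real_inner_self_eq_norm_sq, h2]; norm_num
  have hc : 0 < (1 - (inner ℝ ν ν' : ℝ)) / (2 * ‖θ‖) := by positivity
  have ht : Tendsto (fun t : ℝ => z + t • θ) (𝓝[>] 0) (𝓝 z) := by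
    have : Continuous fun t : ℝ => z + t • θ := by fun_prop
    exact tendsto_nhdsWithin_of_tendsto_nhds (by simpa using this.tendsto 0)
  obtain ⟨t, ⟨e1, e2⟩, ht0⟩ := ((ht.eventually ((h.2 _ hc).and (h'.2 _ hc))).and
    self_mem_nhdsWithin).exists
  have ht0' := ht0
  have hn : (1 - (inner ℝ ν ν' : ℝ)) / (2 * ‖θ‖) * ‖z + t • θ - z‖ =
      t * (1 - (inner ℝ ν ν' : ℝ)) / 2 := by
    rw [add_sub_cancel_left, norm_smul, norm_of_nonneg ht0'.le]
    field_simp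
  have hp : 0 < t * (1 - (inner ℝ ν ν' : ℝ)) := by positivity
  refine e2.2 ?_ (e1.1 ?_)
  · rw [hn, add_sub_cancel_left, real_inner_smul_left, i2]; linarith
  · rw [hn, add_sub_cancel_left, real_inner_smul_left, i1]; linarith

lemma IsInnerNormal.innerNormal_eq (h : IsInnerNormal Ω z ν) : innerNormal Ω z = ν := by
  have hex : ∃ ν, IsInnerNormal Ω z ν := ⟨ν, h⟩
  rw [innerNormal, dif_pos hex]
  exact hex.choose_spec.unique h

namespace EpiChart

variable (c : EpiChart Ω x0)

/-- The upward normal vector `(-∇g, 1)`, not normalized. -/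
def nvec (x' : Hyp m) : Pt m := c.A.symm (WeightedIBP.mk (-(gradient c.g x')) 1)

/-- The area element of the graph. -/
def jac (x' : Hyp m) : ℝ := ‖c.nvec x'‖

/-- The unit normal of the graph. -/
def nu (x' : Hyp m) : Pt m := (c.jac x')⁻¹ • c.nvec x'

lemma continuous_gradient_g : Continuous (gradient c.g) :=
  (InnerProductSpace.toDual ℝ _).symm.continuous.comp (c.contDiff.continuous_fderiv one_ne_zero)

lemma continuous_nvec : Continuous c.nvec :=
  c.A.symm.continuous.comp (continuous_mk.comp (c.continuous_gradient_g.neg.prodMk continuous_const))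

lemma inner_nvec (x' : Hyp m) (h : Pt m) :
    inner ℝ (c.nvec x') h = lastC (c.A h) - fderiv ℝ c.g x' (initC (c.A h)) := by
  rw [nvec, ← LinearIsometryEquiv.inner_map_map c.A, LinearIsometryEquiv.apply_symm_apply,
    inner_eq_initC_lastC, initC_mk, lastC_mk, inner_neg_left, gradient,
    InnerProductSpace.toDual_symm_apply]
  ring

lemma inner_nvec_e (x' : Hyp m) : inner ℝ (c.nvec x') c.e = 1 := by
  rw [inner_nvec, e, LinearIsometryEquiv.apply_symm_apply, lastC_eN, initC_eN, map_zero, sub_zero]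

lemma one_le_jac (x' : Hyp m) : 1 ≤ c.jac x' := by
  have := real_inner_le_norm (c.nvec x') c.e
  rwa [inner_nvec_e, norm_e, mul_one] at this

lemma jac_pos (x' : Hyp m) : 0 < c.jac x' := one_pos.trans_le (c.one_le_jac x')

lemma continuous_jac : Continuous c.jac := c.continuous_nvec.norm

lemma norm_nu (x' : Hyp m) : ‖c.nu x'‖ = 1 := by
  rw [nu, norm_smul, norm_inv, norm_of_nonneg (c.jac_pos x').le]
  exact inv_mul_cancel₀ (c.jac_pos x').ne'

lemma inner_nu_e (x' : Hyp m) : inner ℝ (c.nu x') c.e = (c.jac x')⁻¹ := by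
  rw [nu, real_inner_smul_left, inner_nvec_e, mul_one]

lemma hasFDerivAt_height (z : Pt m) :
    HasFDerivAt c.height (innerSL ℝ (c.nvec (initC (c.A z)))) z := by
  have hA : HasFDerivAt c.A (c.A.toContinuousLinearEquiv : Pt m →L[ℝ] Pt m) z :=
    c.A.toContinuousLinearEquiv.hasFDerivAt
  let l : Pt m →L[ℝ] ℝ := LinearMap.toContinuousLinearMap
    { toFun := lastC, map_add' := lastC_add, map_smul' := fun a x => lastC_smul a x }
  let i : Pt m →L[ℝ] Hyp m := LinearMap.toContinuousLinearMap
    { toFun := initC, map_add' := initC_add, map_smul' := fun a x => initC_smul a x }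
  have h1 := (l.hasFDerivAt).comp z hA
  have h2 := (i.hasFDerivAt).comp z hA
  have h3 := (((c.contDiff.differentiable one_ne_zero) (initC (c.A z))).hasFDerivAt).comp z h2
  have h4 := h1.sub h3
  refine h4.congr_fderiv ?_
  ext h
  simp only [sub_apply, innerSL_apply_apply, inner_nvec]
  rfl

/-- The inner normal at a boundary point in the chart. -/
lemma isInnerNormal (hΩ : IsOpen Ω) (hz : z ∈ ball x0 c.r)
    (hzf : z ∈ frontier Ω) : IsInnerNormal Ω z (c.nu (initC (c.A z))) := by
  set x' := initC (c.A z)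
  have hJ := c.jac_pos x'
  refine ⟨c.norm_nu x', fun κ hκ => ?_⟩
  have h0 := (c.mem_frontier_iff hΩ hz).1 hzf
  have hd := (c.hasFDerivAt_height z).isLittleO.def (c := κ * c.jac x' ) (by positivity)
  filter_upwards [hd, isOpen_ball.mem_nhds hz] with y hy hyb
  rw [h0, sub_zero, innerSL_apply_apply, norm_eq_abs] at hy
  have hinn : inner ℝ (c.nvec x') (y - z) = c.jac x' * inner ℝ (y - z) (c.nu x') := by
    rw [nu, real_inner_smul_right, real_inner_comm, mul_inv_cancel_left₀ hJ.ne']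
  rw [hinn] at hy
  obtain ⟨l1, l2⟩ := abs_le.1 hy
  rw [c.mem_iff_height hyb]
  constructor
  · intro h
    have := mul_lt_mul_of_pos_left h hJ
    linarith
  · intro h
    have := mul_lt_mul_of_pos_left h hJ
    rw [not_lt]
    linarith

lemma innerNormal_eq (hΩ : IsOpen Ω) (hz : z ∈ ball x0 c.r)
    (hzf : z ∈ frontier Ω) : innerNormal Ω z = c.nu (initC (c.A z)) :=
  (c.isInnerNormal hΩ hz hzf).innerNormal_eq

end EpiChart

lemma IsInnerNormal.tendsto_infDist (hΩ : IsOpen Ω) (h : IsInnerNormal Ω z ν)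
    (hz : z ∈ frontier Ω) :
    Tendsto (fun t : ℝ => infDist (z + t • ν) (frontier Ω) / t) (𝓝[>] 0) (𝓝 1) := by
  have hup : ∀ t > 0, infDist (z + t • ν) (frontier Ω) / t ≤ 1 := fun t ht => by
    rw [div_le_one ht]
    refine (infDist_le_dist_of_mem hz).trans (le_of_eq ?_)
    rw [dist_eq_norm, add_sub_cancel_left, norm_smul, h.1, mul_one, norm_of_nonneg ht.le]
  refine tendsto_order.2 ⟨fun a ha => ?_, fun a ha => ?_⟩
  swap
  · filter_upwards [self_mem_nhdsWithin] with t ht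
    exact (hup t ht).trans_lt ha
  obtain ⟨κ, hκ0, hκ⟩ : ∃ κ > 0, a < 1 - 3 * κ := ⟨(1 - a) / 6, by linarith, by linarith⟩
  obtain ⟨ρ, hρ, hball⟩ := Metric.eventually_nhds_iff.1 (h.2 κ hκ0)
  filter_upwards [self_mem_nhdsWithin, nhdsWithin_le_nhds (Iio_mem_nhds (show 0 < ρ / 3 by linarith))]
    with t ht ht2
  have ht0 : 0 < t := ht
  have ht3 : t < ρ / 3 := ht2
  refine hκ.trans_le ?_
  rw [le_div_iff₀ ht0]
  refine (le_infDist ⟨z, hz⟩).2 fun y hy => ?_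
  rw [dist_eq_norm]
  by_cases hfar : 3 * t ≤ ‖y - z‖
  · have h1 : ‖y - z‖ ≤ ‖z + t • ν - y‖ + ‖t • ν‖ := by
      calc ‖y - z‖ = ‖-(z + t • ν - y) + t • ν‖ := by congr 1; abel
        _ ≤ _ := (norm_add_le _ _).trans (by rw [norm_neg])
    rw [norm_smul, h.1, mul_one, norm_of_nonneg ht0.le] at h1
    nlinarith
  · push Not at hfar
    have hyin : inner ℝ (y - z) ν ≤ κ * ‖y - z‖ := by
      by_contra hcon
      push Not at hcon
      have := (hball (by rw [dist_eq_norm]; linarith)).1 hcon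
      rw [hΩ.frontier_eq] at hy
      exact hy.2 this
    have h1 : inner ℝ (z + t • ν - y) ν = t - inner ℝ (y - z) ν := by
      rw [show z + t • ν - y = t • ν - (y - z) by abel, inner_sub_left, real_inner_smul_left,
        real_inner_self_eq_norm_sq, h.1]
      ring
    have h2 := real_inner_le_norm (z + t • ν - y) ν
    rw [h1, h.1, mul_one] at h2
    nlinarith

lemma norm_gradient_sub (f : Pt m → ℝ) (x y : Pt m) :
    ‖gradient f x - gradient f y‖ = ‖fderiv ℝ f x - fderiv ℝ f y‖ := by
  rw [gradient, gradient, ← map_sub, LinearIsometryEquiv.norm_map]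

lemma norm_gradient (f : Pt m → ℝ) (x : Pt m) : ‖gradient f x‖ = ‖fderiv ℝ f x‖ := by
  rw [gradient, LinearIsometryEquiv.norm_map]

lemma inner_gradient (f : Pt m → ℝ) (x h : Pt m) : inner ℝ (gradient f x) h = fderiv ℝ f x h := by
  rw [gradient, InnerProductSpace.toDual_symm_apply]

/-- The gradient of a function of class `C^{1+τ}` up to the boundary has boundary values. -/
lemma HolderUpTo.exists_gradient_limit (h0 : 0 < τ) (h1 : τ ≤ 1)
    (hΩ : IsOpen Ω) (hB : IsOpen B) (h : HolderUpTo (1 + τ) f (Ω ∩ B))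
    (hz : z ∈ frontier Ω ∩ B) : ∃ l, Tendsto (gradient f) (𝓝[Ω] z) (𝓝 l) := by
  obtain ⟨-, -, C, hC, -, -, hH⟩ := h.exists_bounds h0 h1 (hΩ.inter hB)
  have hcl : z ∈ closure (Ω ∩ B) := by
    rw [inter_comm]
    exact hB.inter_closure ⟨hz.2, frontier_subset_closure hz.1⟩
  obtain ⟨l, hl⟩ := exists_tendsto_of_holder h0 hC
    (fun x hx y hy => by rw [norm_gradient_sub]; exact hH x hx y hy) hcl
  rw [nhdsWithin_inter_of_mem' (mem_nhdsWithin_of_mem_nhds (hB.mem_nhds hz.2))] at hl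
  exact ⟨l, hl⟩

lemma mem_closure_nhdsWithin (hz : z ∈ frontier Ω) : (𝓝[Ω] z).NeBot :=
  mem_closure_iff_nhdsWithin_neBot.1 (frontier_subset_closure hz)

lemma IsRegDist.tendsto_zero (h : IsRegDist δ Ω B d) (hB : IsOpen B)
    (hz : z ∈ frontier Ω ∩ B) : Tendsto d (𝓝[Ω] z) (𝓝 0) := by
  obtain ⟨C, hC, hd⟩ := h.comparable
  have h1 : Tendsto (fun x => C * infDist x (frontier Ω)) (𝓝[Ω] z) (𝓝 0) := by
    have := ((continuous_infDist_pt (frontier Ω)).tendsto z).const_mul C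
    rw [infDist_zero_of_mem hz.1, mul_zero] at this
    exact tendsto_nhdsWithin_of_tendsto_nhds this
  refine squeeze_zero' ?_ ?_ h1
  · filter_upwards [self_mem_nhdsWithin] with x hx using (h.pos x hx).le
  · filter_upwards [self_mem_nhdsWithin, mem_nhdsWithin_of_mem_nhds (hB.mem_nhds hz.2)] with x h1 h2
      using (hd x ⟨h1, h2⟩).2

/-- First-order expansion of the regularized distance at a boundary point. -/
lemma IsRegDist.expansion (h : IsRegDist δ Ω B d) (hδ : δ ∈ Ioc (0 : ℝ) 1) (hΩ : IsOpen Ω)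
    (hB : IsOpen B) (c : EpiChart Ω x0) (hcB : ball x0 c.r ⊆ B)
    (hV : Tendsto (gradient d) (𝓝[Ω] x0) (𝓝 V)) :
    ∃ C ≥ 0, ∀ y ∈ Ω ∩ ball x0 c.r1, |d y - inner ℝ V (y - x0)| ≤ C * ‖y - x0‖ ^ (1 + δ) := by
  obtain ⟨hd, -, C, hC, -, -, hH⟩ := h.holder.exists_bounds hδ.1 hδ.2 (hΩ.inter hB)
  have hx : x0 ∈ frontier Ω ∩ B :=
    ⟨c.base_mem_frontier hΩ, hcB (mem_ball_self c.r_pos)⟩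
  have hsub : Ω ∩ ball x0 c.r ⊆ Ω ∩ B := inter_subset_inter_right _ hcB
  refine ⟨C * (2 * c.Λ + 1) ^ (1 + δ), by have := c.one_le_Λ; positivity, fun y hy => ?_⟩
  have := mem_closure_nhdsWithin hx.1
  have t0 := h.tendsto_zero hB hx
  have tid : Tendsto (fun x => y - x) (𝓝[Ω] x0) (𝓝 (y - x0)) :=
    tendsto_nhdsWithin_of_tendsto_nhds ((continuous_const.sub continuous_id).tendsto x0)
  have l1 : Tendsto (fun x => |d y - d x - inner ℝ (gradient d x) (y - x)|) (𝓝[Ω] x0)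
      (𝓝 |d y - 0 - inner ℝ V (y - x0)|) :=
    ((tendsto_const_nhds.sub t0).sub (hV.inner tid)).abs
  have l2 : Tendsto (fun x => C * (2 * c.Λ + 1) ^ (1 + δ) * ‖y - x‖ ^ (1 + δ)) (𝓝[Ω] x0)
      (𝓝 (C * (2 * c.Λ + 1) ^ (1 + δ) * ‖y - x0‖ ^ (1 + δ))) :=
    (tid.norm.rpow_const (Or.inr (by linarith [hδ.1]))).const_mul _
  rw [sub_zero] at l1
  refine le_of_tendsto_of_tendsto l1 l2 ?_
  filter_upwards [self_mem_nhdsWithin,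
    mem_nhdsWithin_of_mem_nhds (ball_mem_nhds x0 c.r₁_pos)] with x h1 h2
  rw [inner_gradient]
  exact c.path_holder (fun z hz => hd z (hsub hz)) hδ.1 hC
    (fun z hz w hw => hH z (hsub hz) w (hsub hw)) ⟨h1, h2⟩ hy

lemma tendsto_line (z θ : Pt m) : Tendsto (fun t : ℝ => z + t • θ) (𝓝[>] 0) (𝓝 z) := by
  have : Continuous fun t : ℝ => z + t • θ := by fun_prop
  exact tendsto_nhdsWithin_of_tendsto_nhds (by simpa using this.tendsto 0)

lemma tendsto_quotient_of_expansion {C : ℝ} (hr : 0 < r) (hδ : 0 < δ)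
    (he : ∀ y ∈ Ω ∩ ball x0 r, |d y - inner ℝ V (y - x0)| ≤ C * ‖y - x0‖ ^ (1 + δ))
    {θ : Pt m} (hθ : ∀ᶠ t in 𝓝[>] (0 : ℝ), x0 + t • θ ∈ Ω) :
    Tendsto (fun t : ℝ => d (x0 + t • θ) / t) (𝓝[>] 0) (𝓝 (inner ℝ V θ)) := by
  have h0 : Tendsto (fun t => C * ‖θ‖ ^ (1 + δ) * t ^ δ) (𝓝[>] 0) (𝓝 0) := by
    have h1 : Tendsto (fun t : ℝ => t ^ δ) (𝓝[>] 0) (𝓝 (0 ^ δ)) :=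
      (tendsto_nhdsWithin_of_tendsto_nhds tendsto_id).rpow_const (Or.inr hδ.le)
    have h2 := h1.const_mul (C * ‖θ‖ ^ (1 + δ))
    rwa [zero_rpow hδ.ne', mul_zero] at h2
  refine tendsto_iff_norm_sub_tendsto_zero.2 (squeeze_zero' (.of_forall fun t =>
    norm_nonneg _) ?_ h0)
  filter_upwards [hθ, (tendsto_line x0 θ).eventually (ball_mem_nhds x0 hr),
    self_mem_nhdsWithin] with t h1 h2 h3
  have ht : 0 < t := h3
  have := he _ ⟨h1, h2⟩
  rw [add_sub_cancel_left, real_inner_smul_right, norm_smul, norm_of_nonneg ht.le,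
    mul_rpow ht.le (norm_nonneg _)] at this
  rw [norm_eq_abs, show d (x0 + t • θ) / t - inner ℝ V θ =
    (d (x0 + t • θ) - t * inner ℝ V θ) / t by field_simp, abs_div, abs_of_pos ht, div_le_iff₀ ht]
  refine this.trans (le_of_eq ?_)
  rw [rpow_add ht, rpow_one]
  ring

lemma IsInnerNormal.eventually_mem (h : IsInnerNormal Ω z ν) {θ : Pt m}
    (hθ : 0 < inner ℝ θ ν) : ∀ᶠ t in 𝓝[>] (0 : ℝ), z + t • θ ∈ Ω := by
  have hθ0 : 0 < ‖θ‖ := norm_pos_iff.2 fun h0 => by rw [h0, inner_zero_left] at hθ; exact hθ.false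
  have hc : 0 < (inner ℝ θ ν : ℝ) / (2 * ‖θ‖) := by positivity
  filter_upwards [(tendsto_line z θ).eventually (h.2 _ hc), self_mem_nhdsWithin] with t h1 ht
  have ht0 := ht
  refine h1.1 ?_
  rw [add_sub_cancel_left, norm_smul, norm_of_nonneg ht0.le, real_inner_smul_left]
  rw [show (inner ℝ θ ν : ℝ) / (2 * ‖θ‖) * (t * ‖θ‖) = t * inner ℝ θ ν / 2 by field_simp]
  have := mul_pos ht0 hθ
  linarith

/-- At the boundary, the gradient of a regularized distance is the inner unit normal. -/
lemma IsRegDist.gradient_limit_eq (h : IsRegDist δ Ω B d) (hδ : δ ∈ Ioc (0 : ℝ) 1) (hΩ : IsOpen Ω)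
    (hB : IsOpen B) (c : EpiChart Ω x0) (hcB : ball x0 c.r ⊆ B)
    (hV : Tendsto (gradient d) (𝓝[Ω] x0) (𝓝 V)) (hν : IsInnerNormal Ω x0 ν) : V = ν := by
  obtain ⟨C, hC, he⟩ := h.expansion hδ hΩ hB c hcB hV
  have hx : x0 ∈ frontier Ω ∩ B :=
    ⟨c.base_mem_frontier hΩ, hcB (mem_ball_self c.r_pos)⟩
  have hνν : inner ℝ ν ν = 1 := by rw [real_inner_self_eq_norm_sq, hν.1, one_pow]
  have hnn : ∀ θ : Pt m, 0 < inner ℝ θ ν → 0 ≤ inner ℝ V θ := by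
    intro θ hθ
    have hm := hν.eventually_mem hθ
    refine ge_of_tendsto (tendsto_quotient_of_expansion c.r₁_pos hδ.1 he hm) ?_
    filter_upwards [hm, self_mem_nhdsWithin] with t h1 h2
    exact div_nonneg (h.pos _ h1).le (le_of_lt h2)
  have hone : inner ℝ V ν = 1 := by
    have hm := hν.eventually_mem (by rw [hνν]; exact one_pos)
    refine tendsto_nhds_unique (tendsto_quotient_of_expansion c.r₁_pos hδ.1 he hm) ?_
    have ht :=
      tendsto_nhdsWithin_iff.2 ⟨tendsto_line x0 ν, hm⟩
    have hi := hν.tendsto_infDist hΩ hx.1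
    have := ((h.asymp x0 hx).comp ht).mul hi
    rw [one_mul] at this
    refine this.congr' ?_
    filter_upwards [hi.eventually (lt_mem_nhds (zero_lt_one)), self_mem_nhdsWithin] with t h1 h2
    have ht0 := h2
    have : infDist (x0 + t • ν) (frontier Ω) ≠ 0 := fun h0 => by
      rw [h0, zero_div] at h1; exact h1.false
    simp
    field_simp
  set W := V - ν with hW
  have hWν : inner ℝ W ν = 0 := by rw [hW, inner_sub_left, hone, hνν, sub_self]
  have hVW : inner ℝ V W = ‖W‖ ^ 2 := by
    have : V = ν + W := by rw [hW]; abel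
    conv_lhs => rw [this]
    rw [inner_add_left, real_inner_self_eq_norm_sq, real_inner_comm, hWν, zero_add]
  have hall : ∀ σ > 0, ‖W‖ ^ 2 ≤ σ := by
    intro σ hσ
    have := hnn (σ • ν - W) (by
      rw [inner_sub_left, real_inner_smul_left, hνν, hWν]; linarith)
    rw [inner_sub_right, real_inner_smul_right, hone, hVW] at this
    linarith
  have hW0 : ‖W‖ ^ 2 ≤ 0 := le_of_forall_pos_le_add fun σ hσ => by
    simpa using hall σ hσ
  have : W = 0 := by
    rw [← norm_eq_zero]
    exact pow_eq_zero_iff (two_ne_zero) |>.1 (le_antisymm hW0 (by positivity))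
  exact sub_eq_zero.1 this

/-- Boundary behaviour of the regularized distance. -/
lemma IsRegDist.boundary (h : IsRegDist δ Ω B d) (hδ : δ ∈ Ioc (0 : ℝ) 1) (hΩ : IsOpen Ω)
    (hB : IsOpen B) (hbd : BoundaryC1Holder δ Ω B) (hz : z ∈ frontier Ω ∩ B) :
    IsInnerNormal Ω z (innerNormal Ω z) ∧ Tendsto (gradient d) (𝓝[Ω] z) (𝓝 (innerNormal Ω z)) ∧
    ∀ θ : Pt m, (∀ᶠ t in 𝓝[>] (0 : ℝ), z + t • θ ∈ Ω) →
      Tendsto (fun t : ℝ => d (z + t • θ) / t) (𝓝[>] 0) (𝓝 (inner ℝ (innerNormal Ω z) θ)) := by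
  obtain ⟨ρ, hρ, hρB⟩ := isOpen_iff.1 hB z hz.2
  obtain ⟨c, hc⟩ := exists_epiChart hδ.1 hΩ hbd hz hρ
  have hcB := (ball_subset_ball hc).trans hρB
  have hν := c.isInnerNormal hΩ (mem_ball_self c.r_pos) hz.1
  rw [← hν.innerNormal_eq] at hν
  obtain ⟨V, hV⟩ := h.holder.exists_gradient_limit hδ.1 hδ.2 hΩ hB hz
  obtain rfl := h.gradient_limit_eq hδ hΩ hB c hcB hV hν
  obtain ⟨C, -, he⟩ := h.expansion hδ hΩ hB c hcB hV
  exact ⟨hν, hV, fun θ hθ => tendsto_quotient_of_expansion c.r₁_pos hδ.1 he hθ⟩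

lemma LipschitzOnWith.euclideanHausdorffMeasure_image_le {X Y : Type*} [EMetricSpace X]
    [MeasurableSpace X] [BorelSpace X] [EMetricSpace Y] [MeasurableSpace Y] [BorelSpace Y]
    {K : ℝ≥0} {f : X → Y} {S : Set X} (h : LipschitzOnWith K f S) (m : ℕ) :
    (μHE[m] : Measure Y) (f '' S) ≤ (K : ℝ≥0∞) ^ m * μHE[m] S := by
  have h1 := h.hausdorffMeasure_image_le (Nat.cast_nonneg m)
  rw [ENNReal.rpow_natCast] at h1
  rw [Measure.euclideanHausdorffMeasure_def, Measure.euclideanHausdorffMeasure_def,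
    Measure.smul_apply, Measure.smul_apply, ENNReal.smul_def, ENNReal.smul_def, smul_eq_mul,
    smul_eq_mul, mul_left_comm]
  gcongr

/-- A local comparison of measures implies a global one. -/
lemma measure_le_of_local {X : Type*} [TopologicalSpace X] [SecondCountableTopology X]
    [MeasurableSpace X] [BorelSpace X] {μ ν : Measure X} {C : ℝ≥0∞}
    (h : ∀ x, ∃ U ∈ 𝓝 x, ∀ S ⊆ U, MeasurableSet S → μ S ≤ C * ν S) {S : Set X}
    (hS : MeasurableSet S) : μ S ≤ C * ν S := by
  choose U hU hUS using h
  obtain ⟨s, hs, hcov⟩ := TopologicalSpace.countable_cover_nhds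
    (fun x => interior_mem_nhds.2 (hU x))
  rcases s.eq_empty_or_nonempty with rfl | hne
  · have : (univ : Set X) = ∅ := by simpa using hcov.symm
    have hSe := subset_empty_iff.1 (this ▸ subset_univ S)
    simp [hSe]
  obtain ⟨f, hf⟩ := hs.exists_eq_range hne
  set V : ℕ → Set X := fun n => interior (U (f n))
  have hVm : ∀ n, MeasurableSet (V n) := fun n => isOpen_interior.measurableSet
  have hV : ⋃ n, V n = univ := by
    rw [← hcov, hf, biUnion_range]
  have hD := fun n => MeasurableSet.disjointed hVm n
  have hSU : S = ⋃ n, S ∩ disjointed V n := by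
    rw [← inter_iUnion, iUnion_disjointed, hV, inter_univ]
  have hdis : Pairwise (Function.onFun Disjoint fun n => S ∩ disjointed V n) := fun i j hij =>
    (disjoint_disjointed V hij).mono inter_subset_right inter_subset_right
  rw [hSU, measure_iUnion hdis fun n => hS.inter (hD n),
    measure_iUnion hdis fun n => hS.inter (hD n), ← ENNReal.tsum_mul_left]
  refine ENNReal.tsum_le_tsum fun n => hUS (f n) _ ?_ (hS.inter (hD n))
  exact inter_subset_right.trans ((disjointed_subset V n).trans interior_subset)

/-- The square root of `1 + b ⊗ b`. -/
def tilt (b : Hyp m) : Hyp m →ₗ[ℝ] Hyp m :=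
  LinearMap.transvection (((√(1 + ‖b‖ ^ 2) + 1)⁻¹ • innerSL ℝ b : _ →L[ℝ] ℝ) : _ →ₗ[ℝ] ℝ) b

lemma tilt_apply (b h : Hyp m) : tilt b h = h + ((√(1 + ‖b‖ ^ 2) + 1)⁻¹ * inner ℝ b h) • b := by
  simp [tilt, LinearMap.transvection.apply]

lemma sqrt_one_add_sq (b : Hyp m) : √(1 + ‖b‖ ^ 2) ^ 2 = 1 + ‖b‖ ^ 2 :=
  sq_sqrt (by positivity)

lemma norm_tilt_sq (b h : Hyp m) : ‖tilt b h‖ ^ 2 = ‖h‖ ^ 2 + (inner ℝ b h) ^ 2 := by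
  have h1 := sqrt_one_add_sq b
  have h2 : (√(1 + ‖b‖ ^ 2) + 1) ≠ 0 := by positivity
  rw [tilt_apply, norm_add_sq_real, norm_smul, real_inner_smul_right, mul_pow, norm_eq_abs,
    sq_abs, real_inner_comm h b]
  rw [show ‖b‖ ^ 2 = √(1 + ‖b‖ ^ 2) ^ 2 - 1 by rw [h1]; ring]
  set J := √(1 + ‖b‖ ^ 2)
  rw [show √(1 + (J ^ 2 - 1)) = J by
    rw [show 1 + (J ^ 2 - 1) = J ^ 2 by ring, sqrt_sq (sqrt_nonneg _)]]
  field_simp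
  ring

lemma det_tilt (b : Hyp m) : LinearMap.det (tilt b) = √(1 + ‖b‖ ^ 2) := by
  have h1 := sqrt_one_add_sq b
  have h2 : (√(1 + ‖b‖ ^ 2) + 1) ≠ 0 := by positivity
  rw [tilt, LinearMap.transvection.det]
  simp
  rw [show ‖b‖ ^ 2 = √(1 + ‖b‖ ^ 2) ^ 2 - 1 by rw [h1]; ring]
  set J := √(1 + ‖b‖ ^ 2)
  rw [show √(1 + (J ^ 2 - 1)) = J by
    rw [show 1 + (J ^ 2 - 1) = J ^ 2 by ring, sqrt_sq (sqrt_nonneg _)]]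
  field_simp
  ring

lemma le_norm_tilt (b h : Hyp m) : ‖h‖ ≤ ‖tilt b h‖ := by
  refine abs_le_of_sq_le_sq' ?_ (norm_nonneg _) |>.2
  rw [norm_tilt_sq]
  nlinarith

lemma volume_tilt_image (b : Hyp m) (S : Set (Hyp m)) :
    volume (tilt b '' S) = ofReal (√(1 + ‖b‖ ^ 2)) * volume S := by
  rw [Measure.addHaar_image_linearMap, det_tilt, abs_of_nonneg (sqrt_nonneg _)]

namespace EpiChart

variable (c : EpiChart Ω x0)

/-- The graph parametrization. -/
def graph (x' : Hyp m) : Pt m := c.A.symm (WeightedIBP.mk x' (c.g x'))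

lemma initC_A_graph (x' : Hyp m) : initC (c.A (c.graph x')) = x' := by
  rw [graph, LinearIsometryEquiv.apply_symm_apply, initC_mk]

lemma height_graph (x' : Hyp m) : c.height (c.graph x') = 0 := by
  rw [height, initC_A_graph, graph, LinearIsometryEquiv.apply_symm_apply, lastC_mk, sub_self]

lemma graph_of_height (h : c.height z = 0) : c.graph (initC (c.A z)) = z := by
  rw [height, sub_eq_zero] at h
  rw [graph, ← h, mk_initC_lastC, LinearIsometryEquiv.symm_apply_apply]

lemma mem_range_graph : z ∈ range c.graph ↔ c.height z = 0 :=
  ⟨by rintro ⟨x, rfl⟩; exact c.height_graph x, fun h => ⟨_, c.graph_of_height h⟩⟩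

lemma continuous_graph : Continuous c.graph :=
  c.A.symm.continuous.comp (continuous_mk.comp (continuous_id.prodMk c.contDiff.continuous))

lemma measurableEmbedding_graph : MeasurableEmbedding c.graph := by
  refine Topology.IsClosedEmbedding.measurableEmbedding ?_
  refine Topology.IsClosedEmbedding.of_continuous_injective_isClosedMap c.continuous_graph ?_ ?_
  · intro x y h
    rw [← c.initC_A_graph x, h, c.initC_A_graph]
  · intro S hS
    have : c.graph '' S = {z | c.height z = 0} ∩ (fun z => initC (c.A z)) ⁻¹' S := by
      ext z
      constructor
      · rintro ⟨x, hx, rfl⟩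
        exact ⟨c.height_graph x, by simpa [c.initC_A_graph] using hx⟩
      · rintro ⟨h1, h2⟩
        exact ⟨_, h2, c.graph_of_height h1⟩
    rw [this]
    exact (isClosed_eq c.continuous_height continuous_const).inter
      (hS.preimage (continuous_initC.comp c.A.continuous))

lemma jac_eq (x' : Hyp m) : c.jac x' = √(1 + ‖gradient c.g x'‖ ^ 2) := by
  rw [jac, nvec, LinearIsometryEquiv.norm_map, ← sqrt_sq (norm_nonneg _),
    norm_sq_eq_initC_lastC, initC_mk, lastC_mk, norm_neg]
  congr 1
  ring

lemma norm_mk_sq (x' : Hyp m) (t : ℝ) : ‖WeightedIBP.mk x' t‖ ^ 2 = ‖x'‖ ^ 2 + t ^ 2 := by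
  rw [norm_sq_eq_initC_lastC, initC_mk, lastC_mk]

lemma norm_graph_sub (b x y : Hyp m) :
    |‖c.graph x - c.graph y‖ - ‖tilt b (x - y)‖| ≤ |c.g x - c.g y - inner ℝ b (x - y)| := by
  have h1 : c.graph x - c.graph y = c.A.symm (WeightedIBP.mk (x - y) (c.g x - c.g y)) := by
    rw [graph, graph, ← map_sub]
    congr 1
    rw [← mk_initC_lastC (WeightedIBP.mk x (c.g x) - WeightedIBP.mk y (c.g y)), initC_sub, lastC_sub,
      initC_mk, initC_mk, lastC_mk, lastC_mk]
  have h2 : ‖tilt b (x - y)‖ = ‖WeightedIBP.mk (x - y) (inner ℝ b (x - y))‖ := by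
    rw [← sqrt_sq (norm_nonneg (tilt b (x - y))), norm_tilt_sq, ← norm_mk_sq,
      sqrt_sq (norm_nonneg _)]
  rw [h1, LinearIsometryEquiv.norm_map, h2]
  refine (abs_norm_sub_norm_le _ _).trans (le_of_eq ?_)
  rw [← mk_initC_lastC (WeightedIBP.mk (x - y) (c.g x - c.g y) -
    WeightedIBP.mk (x - y) (inner ℝ b (x - y))), initC_sub, lastC_sub,
    initC_mk, initC_mk, lastC_mk, lastC_mk, sub_self, ← sqrt_sq (norm_nonneg _), norm_mk_sq,
    norm_zero]
  rw [zero_pow two_ne_zero, zero_add, sqrt_sq_eq_abs]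

end EpiChart

lemma euclideanHausdorffMeasure_image_le_image {X Y Z : Type*} [Nonempty X] [EMetricSpace Y]
    [MeasurableSpace Y] [BorelSpace Y] [EMetricSpace Z] [MeasurableSpace Z] [BorelSpace Z]
    {K : ℝ≥0} {f : X → Y} {g : X → Z} {S : Set X}
    (h : ∀ x ∈ S, ∀ y ∈ S, edist (f x) (f y) ≤ K * edist (g x) (g y)) (m : ℕ) :
    (μHE[m] : Measure Y) (f '' S) ≤ (K : ℝ≥0∞) ^ m * μHE[m] (g '' S) := by
  have hinv : ∀ x ∈ S, Function.invFunOn g S (g x) ∈ S ∧ g (Function.invFunOn g S (g x)) = g x :=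
    fun x hx => ⟨Function.invFunOn_mem ⟨x, hx, rfl⟩, Function.invFunOn_eq ⟨x, hx, rfl⟩⟩
  have h1 : LipschitzOnWith K (f ∘ Function.invFunOn g S) (g '' S) := by
    rintro _ ⟨x, hx, rfl⟩ _ ⟨y, hy, rfl⟩
    refine (h _ (hinv x hx).1 _ (hinv y hy).1).trans (le_of_eq ?_)
    rw [(hinv x hx).2, (hinv y hy).2]
  have h2 : f '' S = (f ∘ Function.invFunOn g S) '' (g '' S) := by
    rw [image_image]
    refine image_congr fun x hx => ?_
    have := h x hx _ (hinv x hx).1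
    rw [(hinv x hx).2, edist_self, mul_zero, nonpos_iff_eq_zero, edist_eq_zero] at this
    exact this
  rw [h2]
  exact LipschitzOnWith.euclideanHausdorffMeasure_image_le h1 m

lemma exists_pow_lt (m : ℕ) (ha : 1 < a) : ∃ κ ∈ Ioo (0 : ℝ) 1, ((1 - κ)⁻¹) ^ m < a := by
  have h1 : Tendsto (fun κ : ℝ => ((1 - κ)⁻¹) ^ m) (𝓝[>] 0) (𝓝 1) := by
    have : ContinuousAt (fun κ : ℝ => ((1 - κ)⁻¹) ^ m) 0 := by
      refine ContinuousAt.pow (ContinuousAt.inv₀ (by fun_prop) (by norm_num)) m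
    have h2 := this.tendsto
    simp only [sub_zero, inv_one, one_pow] at h2
    exact h2.mono_left nhdsWithin_le_nhds
  obtain ⟨κ, h2, h3⟩ := ((h1.eventually_lt_const ha).and
    (Ioo_mem_nhdsGT (show 0 < 1 by norm_num))).exists
  exact ⟨κ, h3, h2⟩

namespace EpiChart

variable (c : EpiChart Ω x0)

lemma continuous_jac_ofReal : Continuous fun x => ofReal (c.jac x) :=
  ENNReal.continuous_ofReal.comp c.continuous_jac

lemma exists_nhds_measure_graph (ht : 1 < t) (x : Hyp m) : ∃ U ∈ 𝓝 x, ∀ S ⊆ U, MeasurableSet S →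
      (μHE[m] : Measure (Pt m)) (c.graph '' S) ≤ ofReal t * ∫⁻ y in S, ofReal (c.jac y) ∧
      ∫⁻ y in S, ofReal (c.jac y) ≤ ofReal t * (μHE[m] : Measure (Pt m)) (c.graph '' S) := by
  have ha : 1 < √t := lt_sqrt_of_sq_lt (by linarith)
  have ha0 : 0 ≤ √t := by positivity
  have haa : √t * √t = t := mul_self_sqrt (by linarith)
  obtain ⟨κ, ⟨hκ, hκ1⟩, hK⟩ := exists_pow_lt m ha
  set K : ℝ := (1 - κ)⁻¹ with hKdef
  have hK0 : 0 < K := by rw [hKdef]; exact inv_pos.2 (by linarith)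
  have hKκ : 1 + κ ≤ K := by
    rw [hKdef, le_inv_comm₀ (by linarith) (by linarith)]
    rw [inv_eq_one_div, le_div_iff₀ (by linarith)]
    nlinarith
  have hd : HasStrictFDerivAt c.g (fderiv ℝ c.g x) x :=
    c.contDiff.contDiffAt.hasStrictFDerivAt one_ne_zero
  set b := gradient c.g x with hb
  have hbf : ∀ h, fderiv ℝ c.g x h = inner ℝ b h := fun h => by
    rw [hb, inner_gradient_left]
  have hd1 := hd.isLittleO.def hκ
  have hd2 := (nhds_prod_eq (x := x) (y := x)) ▸ hd1
  obtain ⟨U1, hU1, hU₁g⟩ := (Filter.eventually_prod_self_iff (r := fun y z =>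
    ‖c.g y - c.g z - (fderiv ℝ c.g x) (y - z)‖ ≤ κ * ‖y - z‖)).1 hd2
  have hj := c.jac_pos x
  have hJ1 : ∀ᶠ y in 𝓝 x, c.jac y < √t * c.jac x :=
    c.continuous_jac.continuousAt.tendsto.eventually_lt_const (by nlinarith)
  have hJ2 :=
    (c.continuous_jac.continuousAt.tendsto.const_mul (√t)).eventually_const_lt (by nlinarith)
  refine ⟨U1 ∩ {y | c.jac y < √t * c.jac x ∧ c.jac x < √t * c.jac y},
    inter_mem hU1 (hJ1.and hJ2), fun S hS hSm => ?_⟩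
  have hnear : ∀ y ∈ S, ∀ z ∈ S, |‖c.graph y - c.graph z‖ - ‖tilt b (y - z)‖| ≤
      κ * ‖tilt b (y - z)‖ := fun y hy z hz => by
    refine (c.norm_graph_sub b y z).trans ?_
    have := hU₁g y (hS hy).1 z (hS hz).1
    simp only [hbf, norm_eq_abs] at this
    exact this.trans (mul_le_mul_of_nonneg_left (le_norm_tilt _ _) hκ.le)
  have hK' : ((K.toNNReal : ℝ≥0∞)) ^ m ≤ ofReal (√t) := by
    rw [← ofReal, ← ofReal_pow hK0.le]
    exact ofReal_le_ofReal hK.le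
  have hl1 := euclideanHausdorffMeasure_image_le_image (f := c.graph)
    (g := tilt b) (fun y hy z hz => by
      rw [edist_dist, edist_dist, dist_eq_norm, dist_eq_norm, ← map_sub, ← ofReal,
        ← ofReal_mul hK0.le]
      refine ofReal_le_ofReal ?_
      have := (abs_le.1 (hnear y hy z hz)).2
      nlinarith [norm_nonneg (tilt b (y - z))]) m
  have hl2 := euclideanHausdorffMeasure_image_le_image (f := tilt b)
    (g := c.graph) (fun y hy z hz => by
      rw [edist_dist, edist_dist, dist_eq_norm, dist_eq_norm, ← map_sub, ← ofReal,
        ← ofReal_mul hK0.le]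
      refine ofReal_le_ofReal ?_
      have := (abs_le.1 (hnear y hy z hz)).1
      rw [hKdef, inv_mul_eq_div, le_div_iff₀ (by linarith)]
      nlinarith) m
  rw [EuclideanSpace.euclideanHausdorffMeasure_eq_volume, volume_tilt_image, hb, ← c.jac_eq] at hl1 hl2
  have hi1 : ∫⁻ y in S, ofReal (c.jac y) ≤ ofReal (√t) * (ofReal (c.jac x) * volume S) := by
    rw [← mul_assoc, ← ofReal_mul ha0, ← setLIntegral_const]
    exact setLIntegral_mono measurable_const fun y hy => ofReal_le_ofReal (hS hy).2.1.le
  have hi2 : ofReal (c.jac x) * volume S ≤ ofReal (√t) * ∫⁻ y in S, ofReal (c.jac y) := by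
    rw [← setLIntegral_const, ← lintegral_const_mul _ c.continuous_jac_ofReal.measurable]
    refine setLIntegral_mono (by have := c.continuous_jac_ofReal.measurable; fun_prop) fun y hy => ?_
    rw [← ofReal_mul ha0]
    exact ofReal_le_ofReal (hS hy).2.2.le
  have htt : ofReal t = ofReal (√t) * ofReal (√t) := by
    rw [← ofReal_mul ha0, haa]
  rw [htt, mul_assoc, mul_assoc]
  constructor
  · exact hl1.trans (mul_le_mul' hK' hi2)
  · exact hi1.trans (mul_le_mul' le_rfl (hl2.trans (mul_le_mul' hK' le_rfl)))

lemma comap_graph : (μHE[m] : Measure (Pt m)).comap c.graph =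
    volume.withDensity fun x => ofReal (c.jac x) := by
  ext S hS
  have hlim : ∀ a : ℝ≥0∞, Tendsto (fun t => ofReal t * a) (𝓝[>] 1) (𝓝 a) := by
    intro a
    have h1 : Tendsto (fun t => ofReal t) (𝓝[>] 1) (𝓝 1) := by
      have := (ENNReal.continuous_ofReal.tendsto 1).mono_left
        (nhdsWithin_le_nhds (s := Ioi 1))
      simpa using this
    simpa using ENNReal.Tendsto.mul_const h1 (Or.inl one_ne_zero)
  have h1 := fun T (_ : MeasurableSet T) => c.measurableEmbedding_graph.comap_apply μHE[m] T
  have h2 := fun T (hT : MeasurableSet T) =>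
    withDensity_apply (μ := (volume : Measure (Hyp m))) (fun x => ofReal (c.jac x)) hT
  refine le_antisymm ?_ ?_
  · refine ge_of_tendsto (hlim _) (eventually_mem_nhdsWithin.mono fun t ht =>
      measure_le_of_local (fun x => ?_) hS)
    obtain ⟨U, hU, hUS⟩ := c.exists_nhds_measure_graph ht x
    refine ⟨U, hU, fun T hT hTm => ?_⟩
    rw [h1 T hTm, h2 T hTm]
    exact (hUS T hT hTm).1
  · refine ge_of_tendsto (hlim _) (eventually_mem_nhdsWithin.mono fun t ht =>
      measure_le_of_local (fun x => ?_) hS)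
    obtain ⟨U, hU, hUS⟩ := c.exists_nhds_measure_graph ht x
    refine ⟨U, hU, fun T hT hTm => ?_⟩
    rw [h1 T hTm, h2 T hTm]
    exact (hUS T hT hTm).2

lemma map_graph : (volume.withDensity fun x => ofReal (c.jac x)).map c.graph =
    (μHE[m] : Measure (Pt m)).restrict (range c.graph) := by
  rw [← comap_graph, c.measurableEmbedding_graph.map_comap]

/-- Integration over `∂Ω` in graph coordinates. -/
lemma area_formula (hΩ : IsOpen Ω) (hB : MeasurableSet B) {F : Pt m → ℝ}
    (hF : ∀ z, z ∉ ball x0 c.r ∩ B → F z = 0) :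
    (Integrable (fun x => c.jac x * F (c.graph x)) → IntegrableOn F (frontier Ω ∩ B) μHE[m]) ∧
    ∫ z in frontier Ω ∩ B, F z ∂μHE[m] = ∫ x, c.jac x * F (c.graph x) := by
  have hrm := c.measurableEmbedding_graph.measurableSet_range
  have hfm : MeasurableSet (frontier Ω ∩ B) := isClosed_frontier.measurableSet.inter hB
  have hind : (frontier Ω ∩ B).indicator F = (range c.graph).indicator F := by
    ext z
    by_cases hz : z ∈ ball x0 c.r ∩ B
    · have := c.mem_frontier_iff hΩ hz.1
      by_cases h : c.height z = 0
      · rw [indicator_of_mem (show z ∈ frontier Ω ∩ B from ⟨this.2 h, hz.2⟩),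
          indicator_of_mem (c.mem_range_graph.2 h)]
      · rw [indicator_of_notMem (fun h' => h (this.1 h'.1)),
          indicator_of_notMem (fun h' => h (c.mem_range_graph.1 h'))]
    · rw [indicator_apply_eq_zero.2 fun _ => hF z hz, indicator_apply_eq_zero.2 fun _ => hF z hz]
  have hjm := c.continuous_jac_ofReal.measurable
  have htop : ∀ᵐ x : Hyp m, ofReal (c.jac x) < ⊤ :=
    Eventually.of_forall fun x => ofReal_lt_top
  have hsm : ∀ x, (ofReal (c.jac x)).toReal • F (c.graph x) = c.jac x * F (c.graph x) :=
    fun x => by rw [ENNReal.toReal_ofReal (c.jac_pos x).le, smul_eq_mul]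
  constructor
  · intro h
    rw [← integrable_indicator_iff hfm, hind, integrable_indicator_iff hrm, IntegrableOn,
      ← map_graph, c.measurableEmbedding_graph.integrable_map_iff,
      integrable_withDensity_iff_integrable_smul' hjm htop]
    simpa only [Function.comp_apply, hsm] using h
  · rw [← integral_indicator hfm, hind, integral_indicator hrm, ← map_graph,
      c.measurableEmbedding_graph.integral_map,
      integral_withDensity_eq_integral_toReal_smul hjm htop]
    simp only [hsm]

end EpiChart

lemma posPow_sub_le_of_le (hs : s ∈ Ioo 0 1) (hκ : κ ∈ Icc (0 : ℝ) 1) (ha : 0 ≤ a) (hab : a ≤ b) :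
    |posPow s a - posPow s b| ≤ (b - a) ^ κ * (posPow (s - κ) a + posPow (s - κ) b) := by
  rcases ha.eq_or_lt with rfl | ha
  · rw [posPow_of_nonpos le_rfl, posPow_of_nonpos le_rfl, zero_sub, abs_neg,
      abs_of_nonneg (posPow_nonneg _ _), zero_add, sub_zero]
    rcases hab.eq_or_lt with rfl | hb
    · rw [posPow_of_nonpos le_rfl, posPow_of_nonpos le_rfl, mul_zero]
    · rw [posPow_of_pos hb, posPow_of_pos hb, ← rpow_add hb]
      exact le_of_eq (by congr 1; ring)
  have hb : 0 < b := ha.trans_le hab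
  rw [posPow_of_pos ha, posPow_of_pos hb, posPow_of_pos ha, posPow_of_pos hb]
  have h1 : b ^ (s - 1) ≤ a ^ (s - 1) := rpow_le_rpow_of_nonpos ha hab (by linarith [hs.2])
  rw [abs_of_nonneg (by linarith)]
  have hab' : 0 < a / b := div_pos ha hb
  have hab1 : a / b ≤ 1 := (div_le_one hb).2 hab
  have h2 : b ^ (s - 1) = a ^ (s - 1) * (a / b) ^ (1 - s) := by
    rw [div_rpow ha.le hb.le, mul_div_assoc', ← rpow_add ha]
    rw [show s - 1 + (1 - s) = 0 by ring, rpow_zero, one_div, ← rpow_neg hb.le, neg_sub]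
  have h3 : a / b ≤ (a / b) ^ (1 - s) :=
    self_le_rpow_of_le_one hab'.le hab1 (by linarith [hs.1])
  have h4 : 1 - a / b ≤ (1 - a / b) ^ κ :=
    self_le_rpow_of_le_one (by linarith) (by linarith) hκ.2
  have h5 : (1 - a / b) ^ κ ≤ (b - a) ^ κ * a ^ (-κ) := by
    rw [one_sub_div hb.ne', div_rpow (sub_nonneg.2 hab) hb.le, div_eq_mul_inv, ← rpow_neg hb.le]
    exact mul_le_mul_of_nonneg_left (rpow_le_rpow_of_nonpos ha hab (by linarith [hκ.1]))
      (rpow_nonneg (sub_nonneg.2 hab) _)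
  have h6 : 0 ≤ (b - a) ^ κ * b ^ (s - κ - 1) :=
    mul_nonneg (rpow_nonneg (sub_nonneg.2 hab) _) (rpow_nonneg hb.le _)
  calc a ^ (s - 1) - b ^ (s - 1) = a ^ (s - 1) * (1 - (a / b) ^ (1 - s)) := by rw [h2]; ring
    _ ≤ a ^ (s - 1) * ((b - a) ^ κ * a ^ (-κ)) := by
        gcongr
        linarith
    _ = (b - a) ^ κ * a ^ (s - κ - 1) := by
        rw [show s - κ - 1 = (s - 1) + -κ by ring, rpow_add ha]; ring
    _ ≤ _ := by rw [mul_add]; linarith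

lemma abs_posPow_sub_le {T : ℝ} (hs : s ∈ Ioo 0 1) (hκ : κ ∈ Icc (0 : ℝ) 1)
    (ha : 0 ≤ a) (hb : 0 ≤ b) (hT : |a - b| ≤ T) :
    |posPow s a - posPow s b| ≤ T ^ κ * (posPow (s - κ) a + posPow (s - κ) b) := by
  have h0 : 0 ≤ posPow (s - κ) a + posPow (s - κ) b :=
    add_nonneg (posPow_nonneg _ _) (posPow_nonneg _ _)
  rcases le_total a b with h | h
  · refine (posPow_sub_le_of_le hs hκ ha h).trans (mul_le_mul_of_nonneg_right ?_ h0)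
    exact rpow_le_rpow (sub_nonneg.2 h) (by rw [abs_sub_comm] at hT; exact (le_abs_self _).trans hT) hκ.1
  · rw [abs_sub_comm, add_comm]
    refine (posPow_sub_le_of_le hs hκ hb h).trans (mul_le_mul_of_nonneg_right ?_ (by linarith))
    exact rpow_le_rpow (sub_nonneg.2 h) ((le_abs_self _).trans hT) hκ.1

lemma posPow_max (a t : ℝ) : posPow a (max t 0) = posPow a t := by
  rcases le_total t 0 with h | h
  · rw [max_eq_right h, posPow_of_nonpos le_rfl, posPow_of_nonpos h]
  · rw [max_eq_left h]

lemma AbsGrowth.of_le_add {q : Pt m → ℝ} {C C' : ℝ≥0} (hpm : Measurable p)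
    (hp : AbsGrowth p C A) (hq : AbsGrowth q C' A) (h : ∀ y, |f y| ≤ |p y| + |q y|) :
    AbsGrowth f (C + C') A := by
  intro x R hR
  calc ∫⁻ y in ball x R, ofReal |f y| ≤ ∫⁻ y in ball x R, (ofReal |p y| + ofReal |q y|) :=
        lintegral_mono fun y => (ofReal_le_ofReal (h y)).trans ofReal_add_le
    _ = (∫⁻ y in ball x R, ofReal |p y|) +
        ∫⁻ y in ball x R, ofReal |q y| := lintegral_add_left (by fun_prop) _
    _ ≤ _ := by
        rw [ENNReal.coe_add, add_mul]
        exact add_le_add (hp x R hR) (hq x R hR)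

lemma exists_tail_power (k : Ker s lam Lam K)
    {C : ℝ≥0} (hA : 0 ≤ A) (hq : q < m + 1 + 2 * s - A) (hc : 0 < c) :
    ∃ B ≥ 0, ∀ p : Pt m → ℝ, Measurable p → AbsGrowth p C A → ∀ (x : Pt m) (r : ℝ), 0 < r →
      IntegrableOn (fun y => ‖y - x‖ ^ q * p y * K (y - x)) {y | c * r ≤ ‖y - x‖} ∧
      ∫ y in {y | c * r ≤ ‖y - x‖}, |‖y - x‖ ^ q * p y * K (y - x)| ≤
        B * r ^ (q - (m + 1) - 2 * s + A) := by
  have hL := k.Lam_nonneg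
  set e := q - (m + 1) - 2 * s + A with he
  have hD : 0 ≤ (q - (m + 1) - 2 * s) / e :=
    div_nonneg_of_nonpos (by linarith) (by linarith)
  refine ⟨1 * Lam * (C * ((q - (m + 1) - 2 * s) / e * c ^ e)), by positivity,
    fun p hp hpA x r hr => ?_⟩
  obtain ⟨h1, h2⟩ := kernel_tail_bound k hp (R := fun y => ‖y - x‖ ^ q)
    (by fun_prop : Measurable fun y : Pt m => ‖y - x‖ ^ q).aestronglyMeasurable hpA hA hq x
    (mul_pos hc hr) zero_le_one (.of_forall fun y _ _ => by
      rw [one_mul, abs_of_nonneg (by positivity)])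
  refine ⟨h1, h2.trans (le_of_eq ?_)⟩
  rw [mul_rpow hc.le hr.le]
  ring

/-- Local model of a weight `p` near a boundary point: `p = φ d^{s-1}` in `Ω`, where `d` is
`C^{1,δ}` up to the boundary with gradient `N`, and `φ` is Lipschitz. -/
structure BoundaryModel (Ω : Set (Pt m)) (x0 : Pt m) (s δ ρ c0 C : ℝ) (Cp : ℝ≥0)
    (d φ p : Pt m → ℝ) (N : Pt m → Pt m) : Prop where
  radius : ρ ∈ Ioc (0 : ℝ) (1 / 2)
  one_le_C : 1 ≤ C
  c₀_pos : 0 < c0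
  d_mem : ∀ x ∈ Ω ∩ ball x0 ρ, d x ∈ Ioc (0 : ℝ) 1
  norm_N : ∀ x ∈ Ω ∩ ball x0 ρ, c0 ≤ ‖N x‖ ∧ ‖N x‖ ≤ C
  taylor : ∀ x ∈ Ω ∩ ball x0 ρ, ∀ y ∈ ball x0 ρ,
    |(Ω ∩ ball x0 ρ).indicator d y - max (d x + inner ℝ (N x) (y - x)) 0| ≤
      C * ‖y - x‖ ^ (1 + δ)
  phi_le : ∀ x ∈ Ω ∩ ball x0 ρ, |φ x| ≤ C
  phi_lip : ∀ x ∈ Ω ∩ ball x0 ρ, ∀ y ∈ Ω ∩ ball x0 ρ, |φ y - φ x| ≤ C * ‖y - x‖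
  p_eq : ∀ x ∈ Ω ∩ ball x0 ρ, p x = φ x * posPow s (d x)
  p_zero : ∀ x ∉ Ω, p x = 0
  measurable_p : Measurable p
  growth_p : AbsGrowth p Cp (m + s)
  measurable_d : Measurable ((Ω ∩ ball x0 ρ).indicator d)
  growth_d : ∀ a ∈ Ioc (0 : ℝ) 1, ∃ C : ℝ≥0,
    AbsGrowth (fun y => posPow a ((Ω ∩ ball x0 ρ).indicator d y)) C (m + a)

lemma posPow_le_half (hs : s ≤ 1) (ha : 0 < a) (ht : a / 2 ≤ t) :
    posPow s t ≤ (1 / 2) ^ (s - 1) * a ^ (s - 1) := by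
  rw [posPow_of_pos (by linarith), ← mul_rpow (by norm_num) ha.le]
  exact rpow_le_rpow_of_nonpos (by positivity) (by linarith) (by linarith)

namespace BoundaryModel

variable {C : ℝ}
  {N : Pt m → Pt m}

/-- The difference between the weight and its model at `x`. -/
def defect (s : ℝ) (d φ p : Pt m → ℝ) (N : Pt m → Pt m) (x y : Pt m) : ℝ :=
  p y - φ x * posPow s (d x + inner ℝ (N x) (y - x))

variable (h : BoundaryModel Ω x0 s δ ρ c0 C Cp d φ p N)
include h

lemma norm_sub_le_one (hx : x ∈ ball x0 ρ) (hy : y ∈ ball x0 ρ) : ‖y - x‖ ≤ 1 := by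
  rw [mem_ball_iff_norm] at hx hy
  have : y - x = (y - x0) - (x - x0) := by abel
  rw [this]
  have := h.radius.2
  exact (norm_sub_le _ _).trans (by linarith)

lemma defect_le (hs : s ∈ Ioo 0 1) (hκ : κ ∈ Icc (0 : ℝ) 1) (hx : x ∈ Ω ∩ ball x0 ρ)
    (hy : y ∈ ball x0 ρ) :
    |defect s d φ p N x y| ≤ C * ‖y - x‖ * posPow s ((Ω ∩ ball x0 ρ).indicator d y) +
      C * ((C * ‖y - x‖ ^ (1 + δ)) ^ κ * (posPow (s - κ) ((Ω ∩ ball x0 ρ).indicator d y) +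
        posPow (s - κ) (d x + inner ℝ (N x) (y - x)))) := by
  have hC := h.one_le_C
  set D := (Ω ∩ ball x0 ρ).indicator d y with hD
  set l := d x + inner ℝ (N x) (y - x) with hl
  have hD0 : 0 ≤ D := indicator_nonneg (fun z hz => (h.d_mem z hz).1.le) y
  have h1 := abs_posPow_sub_le hs hκ hD0 (le_max_right l 0) (h.taylor x hx y hy)
  rw [posPow_max, posPow_max] at h1
  have hpD : |p y - φ x * posPow s D| ≤ C * ‖y - x‖ * posPow s D := by
    by_cases hyΩ : y ∈ Ω
    · rw [hD, indicator_of_mem (show y ∈ Ω ∩ ball x0 ρ from ⟨hyΩ, hy⟩), h.p_eq y ⟨hyΩ, hy⟩,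
        ← sub_mul, abs_mul, abs_of_nonneg (posPow_nonneg _ _)]
      exact mul_le_mul_of_nonneg_right (h.phi_lip x hx y ⟨hyΩ, hy⟩) (posPow_nonneg _ _)
    · rw [hD, indicator_of_notMem (fun h' => hyΩ h'.1), h.p_zero y hyΩ, posPow_of_nonpos le_rfl]
      simp
  have e : defect s d φ p N x y = (p y - φ x * posPow s D) + φ x * (posPow s D - posPow s l) := by
    rw [defect]; ring
  rw [e]
  refine (abs_add_le _ _).trans (add_le_add hpD ?_)
  rw [abs_mul]
  exact mul_le_mul (h.phi_le x hx) h1 (abs_nonneg _) (by linarith)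

lemma near_mem (hδ : 0 < δ) (hx : x ∈ Ω ∩ ball x0 (ρ / 2))
    (hy : ‖y - x‖ < min (1 / (4 * C)) (ρ / 2) * d x) :
    y ∈ Ω ∩ ball x0 ρ ∧ ‖y - x‖ ≤ d x ∧ d x / 2 ≤ d y ∧ d x / 2 ≤ d x + inner ℝ (N x) (y - x) := by
  have hC := h.one_le_C
  have hρ := h.radius
  have hx' : x ∈ Ω ∩ ball x0 ρ :=
    ⟨hx.1, ball_subset_ball (by linarith [hρ.1]) hx.2⟩
  obtain ⟨hd0, hd1⟩ := h.d_mem x hx'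
  have h1 : ‖y - x‖ < 1 / (4 * C) * d x :=
    hy.trans_le (mul_le_mul_of_nonneg_right (min_le_left _ _) hd0.le)
  have h2 : ‖y - x‖ < ρ / 2 * d x :=
    hy.trans_le (mul_le_mul_of_nonneg_right (min_le_right _ _) hd0.le)
  have hyb : y ∈ ball x0 ρ := by
    have hxn := mem_ball_iff_norm.1 hx.2
    rw [mem_ball_iff_norm, show y - x0 = (y - x) + (x - x0) by abel]
    have : ρ / 2 * d x ≤ ρ / 2 := by nlinarith [hρ.1]
    linarith [norm_add_le (y - x) (x - x0)]
  have h3 : C * ‖y - x‖ ≤ d x / 4 := by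
    calc C * ‖y - x‖ ≤ C * (1 / (4 * C) * d x) := by gcongr
      _ = _ := by field_simp
  have hle1 : ‖y - x‖ ≤ 1 := h.norm_sub_le_one hx'.2 hyb
  have hin : -(d x / 4) ≤ inner ℝ (N x) (y - x) := by
    have a1 := abs_real_inner_le_norm (N x) (y - x)
    have a2 : ‖N x‖ * ‖y - x‖ ≤ C * ‖y - x‖ := by
      gcongr
      exact (h.norm_N x hx').2
    linarith [(abs_le.1 (a1.trans a2)).1]
  have ht : C * ‖y - x‖ ^ (1 + δ) ≤ d x / 4 := by
    refine le_trans ?_ h3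
    gcongr
    exact rpow_le_self_of_le_one (norm_nonneg _) hle1 (by linarith)
  have hT := (abs_le.1 ((h.taylor x hx' y hyb).trans ht)).1
  rw [max_eq_left (by linarith)] at hT
  have hyΩ : y ∈ Ω ∩ ball x0 ρ := by
    by_contra hn
    rw [indicator_of_notMem hn] at hT
    linarith
  rw [indicator_of_mem hyΩ] at hT
  refine ⟨hyΩ, ?_, by linarith, by linarith⟩
  nlinarith [norm_nonneg (y - x)]

lemma measurable_defect (x : Pt m) : Measurable (defect s d φ p N x) := by
  exact h.measurable_p.sub (((measurable_posPow s).comp (by fun_prop)).const_mul _)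

lemma exists_near_bound (k : Ker s lam Lam K) (hδ : δ ∈ Ioo 0 1) :
    ∃ B ≥ 0, ∀ x ∈ Ω ∩ ball x0 (ρ / 2),
      IntegrableOn (fun y => ‖y - x‖ * defect s d φ p N x y * K (y - x))
        {y | ‖y - x‖ < min (1 / (4 * C)) (ρ / 2) * d x} ∧
      ∫ y in {y | ‖y - x‖ < min (1 / (4 * C)) (ρ / 2) * d x},
        |‖y - x‖ * defect s d φ p N x y * K (y - x)| ≤ B * d x ^ (δ * (s / 2) - s) := by
  have hC := h.one_le_C
  have hρ := h.radius
  have hL := k.Lam_nonneg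
  set c := min (1 / (4 * C)) (ρ / 2) with hc
  have hc0 : 0 < c := lt_min (by positivity) (by linarith [hρ.1])
  set k1 : ℝ := (1 / 2) ^ (s - 1)
  set k2 : ℝ := (1 / 2) ^ (s - 1 - 1)
  have hk1 : 0 ≤ k1 := by positivity
  have hk2 : 0 ≤ k2 := by positivity
  set M := C * k1 + C * (C * (k2 + k2)) with hM
  have hM0 : 0 ≤ M := by positivity
  set V : ℝ≥0 := (volume (ball (0 : Pt m) 1)).toNNReal
  set D1 := |(2 : ℝ) - (m + 1) - 2 * s| / (2 - (m + 1) - 2 * s + (m + 1)) + 1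
  have hD1 : 0 ≤ D1 :=
    add_nonneg (div_nonneg (abs_nonneg _) (by linarith [k.hs.2])) zero_le_one
  refine ⟨M * Lam * (V * (D1 * c ^ (2 - 2 * s))), by positivity, fun x hx => ?_⟩
  have hx' : x ∈ Ω ∩ ball x0 ρ :=
    ⟨hx.1, ball_subset_ball (by linarith [hρ.1]) hx.2⟩
  obtain ⟨hd0, hd1⟩ := h.d_mem x hx'
  have hmeas := h.measurable_defect x
  obtain ⟨i1, i2⟩ := kernel_near_bound (p := fun _ => 1)
    (R := fun y => ‖y - x‖ * defect s d φ p N x y) (q := 2)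
    (M := M * d x ^ (s - 2 + δ)) k measurable_const
    (by fun_prop : Measurable fun y => ‖y - x‖ * defect s d φ p N x y).aestronglyMeasurable
    absGrowth_one (by linarith [k.hs.2]) x (mul_pos hc0 hd0) (by positivity)
    (.of_forall fun y hy _ => by
      obtain ⟨hyΩ, hyd, hy1, hy2⟩ := h.near_mem hδ.1 hx hy
      have h1 := h.defect_le k.hs (κ := 1) ⟨zero_le_one, le_rfl⟩ hx' hyΩ.2
      rw [indicator_of_mem hyΩ, rpow_one] at h1
      have b1 := posPow_le_half (s := s) k.hs.2.le hd0 hy1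
      have b2 := posPow_le_half (s := s - 1) (by linarith [k.hs.2]) hd0 hy1
      have b3 := posPow_le_half (s := s - 1) (by linarith [k.hs.2]) hd0 hy2
      have e1 : d x ^ (s - 1) ≤ d x ^ (s - 2 + δ) :=
        rpow_le_rpow_of_exponent_ge hd0 hd1 (by linarith [hδ.2])
      have e2 : ‖y - x‖ ^ (1 + δ) * d x ^ (s - 1 - 1) ≤ ‖y - x‖ * d x ^ (s - 2 + δ) := by
        rw [rpow_add' (norm_nonneg _) (by linarith [hδ.1]), rpow_one, mul_assoc]
        gcongr
        rw [show s - 2 + δ = δ + (s - 1 - 1) by ring, rpow_add hd0]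
        gcongr
        exact hδ.1.le
      rw [abs_mul, abs_norm, show (2 : ℝ) = 1 + 1 by norm_num,
        rpow_add' (norm_nonneg _) (by norm_num), rpow_one, mul_comm, ← mul_assoc,
        show (1 : ℝ) + 1 = 2 by norm_num]
      gcongr
      refine h1.trans ?_
      calc C * ‖y - x‖ * posPow s (d y) + C * (C * ‖y - x‖ ^ (1 + δ) *
            (posPow (s - 1) (d y) + posPow (s - 1) (d x + inner ℝ (N x) (y - x))))
          ≤ C * ‖y - x‖ * (k1 * d x ^ (s - 1)) + C * (C * ‖y - x‖ ^ (1 + δ) *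
            (k2 * d x ^ (s - 1 - 1) + k2 * d x ^ (s - 1 - 1))) := by gcongr
        _ = C * k1 * (‖y - x‖ * d x ^ (s - 1)) + C * (C * (k2 + k2)) *
            (‖y - x‖ ^ (1 + δ) * d x ^ (s - 1 - 1)) := by ring
        _ ≤ C * k1 * (‖y - x‖ * d x ^ (s - 2 + δ)) + C * (C * (k2 + k2)) *
            (‖y - x‖ * d x ^ (s - 2 + δ)) := by gcongr
        _ = _ := by rw [hM]; ring)
  simp only [mul_one] at i1 i2
  refine ⟨i1, i2.trans ?_⟩
  have e1 : (c * d x) ^ ((2 : ℝ) - (m + 1) - 2 * s + (m + 1)) = c ^ (2 - 2 * s) * d x ^ (2 - 2 * s) := by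
    rw [← mul_rpow hc0.le hd0.le]; congr 1; ring
  have e2 : d x ^ (s - 2 + δ) * d x ^ (2 - 2 * s) ≤ d x ^ (δ * (s / 2) - s) := by
    rw [← rpow_add hd0]
    refine rpow_le_rpow_of_exponent_ge hd0 hd1 ?_
    nlinarith [hδ.1, k.hs.1, k.hs.2]
  rw [e1]
  calc M * d x ^ (s - 2 + δ) * Lam * (V * (D1 * (c ^ (2 - 2 * s) * d x ^ (2 - 2 * s))))
      = M * Lam * (V * (D1 * c ^ (2 - 2 * s))) * (d x ^ (s - 2 + δ) * d x ^ (2 - 2 * s)) := by ring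
    _ ≤ _ := by gcongr

lemma exists_far_bound (k : Ker s lam Lam K) (hδ : δ ∈ Ioo 0 1) (hc0 : 0 < c) :
    ∃ B ≥ 0, ∀ x ∈ Ω ∩ ball x0 (ρ / 2),
      IntegrableOn (fun y => ‖y - x‖ * defect s d φ p N x y * K (y - x)) {y | c * d x ≤ ‖y - x‖} ∧
      ∫ y in {y | c * d x ≤ ‖y - x‖}, |‖y - x‖ * defect s d φ p N x y * K (y - x)| ≤
        B * d x ^ (δ * (s / 2) - s) := by
  have hC := h.one_le_C
  have hρ := h.radius
  have hm : (0 : ℝ) ≤ m := Nat.cast_nonneg _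
  set κ := s / 2 with hκ
  have hκ0 : 0 < κ := by linarith [k.hs.1]
  have hκ1 : κ < 1 := by linarith [k.hs.2]
  have hδκ : δ * κ < κ := by nlinarith [hδ.2]
  have hδκ0 : 0 < δ * κ := mul_pos hδ.1 hκ0
  set Dc : Pt m → ℝ := (Ω ∩ ball x0 ρ).indicator d with hDc
  have hDm := h.measurable_d
  obtain ⟨C1, hC1⟩ := h.growth_d s ⟨k.hs.1, k.hs.2.le⟩
  obtain ⟨C2, hC2⟩ := h.growth_d (s - κ) ⟨by linarith [k.hs.1], by linarith [k.hs.2]⟩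
  set l : Pt m → Pt m → ℝ := fun x y => d x + inner ℝ (N x) (y - x) with hl
  have hlm : ∀ x, Measurable (l x) := fun x => (by fun_prop : Continuous (l x)).measurable
  have hlg : ∀ a ∈ Ioc (0 : ℝ) 1, ∀ x ∈ Ω ∩ ball x0 ρ, AbsGrowth (fun y => posPow a (l x y))
      (toNNReal (c0 ^ (a - 1)) * fiberConst m a) (m + a) := by
    intro a ha x hx
    have := absGrowth_affine (m := m) ha.1 ha.2 h.c₀_pos (h.norm_N x hx).1 (d x - inner ℝ (N x) x)
    simpa only [hl, inner_sub_right, add_sub, sub_add_eq_add_sub] using this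
  obtain ⟨B1, hB1, hb1⟩ := exists_tail_power (m := m) k
    (C := Cp + (C1 + toNNReal (c0 ^ (s - 1)) * fiberConst m s)) (A := m + s)
    (q := 1 + δ * κ) (by linarith [k.hs.1]) (by linarith [k.hs.1]) hc0
  obtain ⟨B2, hB2, hb2⟩ := exists_tail_power (m := m) k
    (C := C2 + toNNReal (c0 ^ (s - κ - 1)) * fiberConst m (s - κ)) (A := m + (s - κ))
    (q := 1 + (1 + δ) * κ) (by linarith [k.hs.1]) (by linarith [k.hs.1]) hc0
  set M := C + C * C ^ κ + C * (ρ / 2) ^ (-(δ * κ)) with hM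
  have hρ2 : 0 < ρ / 2 := by linarith [hρ.1]
  have hM0 : 0 ≤ M := by positivity
  refine ⟨M * (B1 + B2), by positivity, fun x hx => ?_⟩
  have hx' : x ∈ Ω ∩ ball x0 ρ :=
    ⟨hx.1, ball_subset_ball (by linarith [hρ.1]) hx.2⟩
  obtain ⟨hd0, hd1⟩ := h.d_mem x hx'
  set P1 : Pt m → ℝ := fun y => |p y| + (posPow s (Dc y) + posPow s (l x y)) with hP1
  set P2 : Pt m → ℝ := fun y => posPow (s - κ) (Dc y) + posPow (s - κ) (l x y) with hP2
  have hDpm : ∀ a, Measurable fun y => posPow a (Dc y) := fun a => (measurable_posPow a).comp hDm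
  have hlpm : ∀ a, Measurable fun y => posPow a (l x y) := fun a => (measurable_posPow a).comp (hlm x)
  have hP₁m : Measurable P1 := h.measurable_p.norm.add ((hDpm s).add (hlpm s))
  have hP₂m : Measurable P2 := (hDpm _).add (hlpm _)
  have hP₁0 : ∀ y, 0 ≤ P1 y := fun y =>
    add_nonneg (abs_nonneg _) (add_nonneg (posPow_nonneg _ _) (posPow_nonneg _ _))
  have hP₂0 : ∀ y, 0 ≤ P2 y := fun y => add_nonneg (posPow_nonneg _ _) (posPow_nonneg _ _)
  have hP₁g : AbsGrowth P1 (Cp + (C1 + toNNReal (c0 ^ (s - 1)) * fiberConst m s)) (m + s) := by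
    refine h.growth_p.of_le_add h.measurable_p ((hC1.of_le_add (hDpm s)
      (hlg s ⟨k.hs.1, k.hs.2.le⟩ x hx') (fun y => abs_add_le _ _))) fun y => ?_
    exact (abs_add_le _ _).trans (by rw [abs_abs])
  have hP₂g := hC2.of_le_add (hDpm (s - κ))
    (hlg (s - κ) ⟨by linarith [k.hs.1], by linarith [k.hs.2]⟩ x hx') (f := P2)
    (fun y => abs_add_le _ _)
  obtain ⟨i1, j1⟩ := hb1 P1 hP₁m hP₁g x (d x) hd0
  obtain ⟨i2, j2⟩ := hb2 P2 hP₂m hP₂g x (d x) hd0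
  have hS : MeasurableSet {y : Pt m | c * d x ≤ ‖y - x‖} :=
    measurableSet_le measurable_const (by fun_prop)
  have hbd : ∀ y, ‖y - x‖ * |defect s d φ p N x y| ≤
      M * (‖y - x‖ ^ (1 + δ * κ) * P1 y + ‖y - x‖ ^ (1 + (1 + δ) * κ) * P2 y) := by
    intro y
    have hn := norm_nonneg (y - x)
    have q1 : 0 ≤ ‖y - x‖ ^ (1 + δ * κ) * P1 y := mul_nonneg (by positivity) (hP₁0 y)
    have q2 : 0 ≤ ‖y - x‖ ^ (1 + (1 + δ) * κ) * P2 y := mul_nonneg (by positivity) (hP₂0 y)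
    by_cases hy : y ∈ ball x0 ρ
    · have hle1 := h.norm_sub_le_one hx'.2 hy
      have h1 := h.defect_le k.hs ⟨hκ0.le, hκ1.le⟩ hx' hy
      rw [mul_rpow (by linarith) (by positivity), ← rpow_mul hn] at h1
      have e1 : ‖y - x‖ * ‖y - x‖ ≤ ‖y - x‖ ^ (1 + δ * κ) := by
        have := rpow_le_rpow_of_exponent_ge' hn hle1 (by linarith)
          (show 1 + δ * κ ≤ 1 + 1 by linarith)
        rwa [rpow_add' hn (by norm_num), rpow_one] at this
      have e2 : ‖y - x‖ * ‖y - x‖ ^ ((1 + δ) * κ) = ‖y - x‖ ^ (1 + (1 + δ) * κ) := by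
        rw [rpow_add' hn (by nlinarith [hδ.1]), rpow_one]
      have e3 : posPow s (Dc y) ≤ P1 y := by
        have := posPow_nonneg s (l x y)
        have := abs_nonneg (p y)
        simp only [hP1]; linarith
      calc ‖y - x‖ * |defect s d φ p N x y| ≤ ‖y - x‖ * (C * ‖y - x‖ * posPow s (Dc y) +
            C * (C ^ κ * ‖y - x‖ ^ ((1 + δ) * κ) * P2 y)) := by gcongr
        _ = C * ((‖y - x‖ * ‖y - x‖) * posPow s (Dc y)) +
            C * C ^ κ * ((‖y - x‖ * ‖y - x‖ ^ ((1 + δ) * κ)) * P2 y) := by ring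
        _ ≤ C * (‖y - x‖ ^ (1 + δ * κ) * P1 y) +
            C * C ^ κ * (‖y - x‖ ^ (1 + (1 + δ) * κ) * P2 y) := by
          rw [e2]
          gcongr
          exact posPow_nonneg _ _
        _ ≤ M * (‖y - x‖ ^ (1 + δ * κ) * P1 y) + M * (‖y - x‖ ^ (1 + (1 + δ) * κ) * P2 y) := by
          have a1 : 0 ≤ C * C ^ κ := by positivity
          have a2 : 0 ≤ C * (ρ / 2) ^ (-(δ * κ)) := by positivity
          gcongr <;> rw [hM] <;> linarith
        _ = _ := by ring
    · have hfar : ρ / 2 ≤ ‖y - x‖ := by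
        have hxn := mem_ball_iff_norm.1 hx.2
        rw [mem_ball_iff_norm, not_lt, show y - x0 = (y - x) + (x - x0) by abel] at hy
        linarith [norm_add_le (y - x) (x - x0)]
      have hpos : 0 < ‖y - x‖ := hρ2.trans_le hfar
      have e1 : |defect s d φ p N x y| ≤ C * P1 y := by
        have a1 := posPow_nonneg s (l x y)
        have a2 := posPow_nonneg s (Dc y)
        calc |defect s d φ p N x y| ≤ |p y| + |φ x * posPow s (l x y)| := abs_sub _ _
          _ ≤ C * |p y| + C * posPow s (l x y) := by
            rw [abs_mul, abs_of_nonneg a1]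
            have := h.phi_le x hx'
            gcongr
            nlinarith [abs_nonneg (p y)]
          _ ≤ C * P1 y := by
            rw [← mul_add]
            gcongr
            simp only [hP1]; linarith
      have e2 : ‖y - x‖ ≤ (ρ / 2) ^ (-(δ * κ)) * ‖y - x‖ ^ (1 + δ * κ) := by
        rw [rpow_add hpos, rpow_one, rpow_neg hρ2.le]
        have a1 : (ρ / 2) ^ (δ * κ) ≤ ‖y - x‖ ^ (δ * κ) :=
          rpow_le_rpow hρ2.le hfar hδκ0.le
        have a2 : 0 < (ρ / 2) ^ (δ * κ) := by positivity
        rw [inv_mul_eq_div, le_div_iff₀ a2]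
        gcongr
      calc ‖y - x‖ * |defect s d φ p N x y|
          ≤ ((ρ / 2) ^ (-(δ * κ)) * ‖y - x‖ ^ (1 + δ * κ)) * (C * P1 y) :=
            mul_le_mul e2 e1 (abs_nonneg _) (by positivity)
        _ = C * (ρ / 2) ^ (-(δ * κ)) * (‖y - x‖ ^ (1 + δ * κ) * P1 y) := by ring
        _ ≤ M * (‖y - x‖ ^ (1 + δ * κ) * P1 y) := by
          have a1 : 0 ≤ C * C ^ κ := by positivity
          gcongr
          rw [hM]; linarith
        _ ≤ _ := by gcongr; linarith
  have hle : ∀ y, |‖y - x‖ * defect s d φ p N x y * K (y - x)| ≤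
      M * (|‖y - x‖ ^ (1 + δ * κ) * P1 y * K (y - x)| +
        |‖y - x‖ ^ (1 + (1 + δ) * κ) * P2 y * K (y - x)|) := by
    intro y
    rw [abs_mul, abs_mul, abs_norm, abs_mul, abs_mul (‖y - x‖ ^ (1 + (1 + δ) * κ) * P2 y),
      abs_of_nonneg (mul_nonneg (by positivity) (hP₁0 y)),
      abs_of_nonneg (mul_nonneg (by positivity) (hP₂0 y)), ← add_mul, ← mul_assoc]
    exact mul_le_mul_of_nonneg_right (hbd y) (abs_nonneg _)
  have hint := (i1.abs.add i2.abs).const_mul M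
  have hfm : Measurable fun y => ‖y - x‖ * defect s d φ p N x y * K (y - x) :=
    ((by fun_prop : Measurable fun y : Pt m => ‖y - x‖).mul (h.measurable_defect x)).mul
      (k.hKm.comp (measurable_id.sub_const x))
  have hi := hint.mono' hfm.aestronglyMeasurable (.of_forall hle)
  refine ⟨hi, (integral_mono hi.abs hint hle).trans ?_⟩
  rw [integral_const_mul, integral_add' i1.abs i2.abs, mul_assoc]
  refine mul_le_mul_of_nonneg_left ?_ hM0
  rw [add_mul B1]
  refine add_le_add (j1.trans_eq ?_) (j2.trans_eq ?_) <;> congr 2 <;> ring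

/-- The first moment of the defect of the model. -/
lemma exists_defect_bound (k : Ker s lam Lam K) (hδ : δ ∈ Ioo 0 1) :
    ∃ B ≥ 0, ∀ x ∈ Ω ∩ ball x0 (ρ / 2),
      Integrable (fun y => ‖y - x‖ * defect s d φ p N x y * K (y - x)) ∧
      ∫ y, |‖y - x‖ * defect s d φ p N x y * K (y - x)| ≤ B * d x ^ (δ * (s / 2) - s) := by
  have hC := h.one_le_C
  obtain ⟨B1, hB1, h1⟩ := h.exists_near_bound k hδ
  obtain ⟨B2, hB2, h2⟩ := h.exists_far_bound k hδ
    (c := min (1 / (4 * C)) (ρ / 2)) (lt_min (by positivity) (by linarith [h.radius.1]))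
  refine ⟨B1 + B2, by positivity, fun x hx => ?_⟩
  rw [add_mul]
  exact integrable_near_far x _ (h1 x hx) (h2 x hx)

end BoundaryModel

section BoundaryEstimates

/-- The increment of `f` against `p`, with the first-order model subtracted. -/
def modelRem (s : ℝ) (K d φ p : Pt m → ℝ) (N : Pt m → Pt m) (f : Pt m → ℝ) (v : Pt m → Pt m)
    (x y : Pt m) : ℝ :=
  ((f x - f y) * p y + φ x * inner ℝ (v x) (y - x) * posPow s (d x + inner ℝ (N x) (y - x))) *
    K (y - x)

lemma trunc_add_model (k : Ker s lam Lam K) {N v : Pt m → Pt m} (hN : N x ≠ 0)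
    (hE : Integrable (modelRem s K d φ p N f v x)) (hε : 0 < ε) :
    IntegrableOn (fun y => (f x - f y) * (p y * K (x - y))) (𝔽 x ε) ∧
    2 * (𝓣 K p f x ε) + 2 * φ x * inner ℝ (v x) (modInt s K (d x) (N x) ε) =
      2 * ∫ y in 𝔽 x ε, modelRem s K d φ p N f v x y := by
  have hm := integrableOn_modInt (a := d x) k hN hε
  have h1 : IntegrableOn (fun h => inner ℝ (v x) ((posPow s (d x + inner ℝ (N x) h) * K h) • h))
      {h : Pt m | ε < ‖h‖} := hm.const_inner (v x)
  have h2 : ∫ h in {h : Pt m | ε < ‖h‖}, inner ℝ (v x) ((posPow s (d x + inner ℝ (N x) h) * K h) • h) =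
      inner ℝ (v x) (modInt s K (d x) (N x) ε) := integral_inner hm (v x)
  have h1' := (integrableOn_trunc_translate _ x ε).2 h1
  rw [← integral_trunc_translate _ x] at h2
  have e : ∀ y, (f x - f y) * (p y * K (x - y)) = modelRem s K d φ p N f v x y -
      φ x * inner ℝ (v x) ((posPow s (d x + inner ℝ (N x) (y - x)) * K (y - x)) • (y - x)) := by
    intro y
    rw [modelRem, real_inner_smul_right, k.hK.symm_sub x y]
    ring
  simp only [e]
  refine ⟨hE.integrableOn.sub (h1'.const_mul _), ?_⟩
  rw [integral_sub hE.integrableOn (h1'.const_mul _), integral_const_mul, h2]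
  ring

variable {C : ℝ}
  {N v : Pt m → Pt m}

/-- A function `f` that is `C^{q}` up to the boundary near `x0`, with gradient `v`, and of class
`C^ϱ` inside, with weighted bounds. -/
structure BoundaryFunction (Ω : Set (Pt m)) (x0 : Pt m) (ρ C M q ϱ c : ℝ)
    (d p f : Pt m → ℝ) (v : Pt m → Pt m) : Prop where
  aesm : AEStronglyMeasurable f volume
  M_nonneg : 0 ≤ M
  c_pos : 0 < c
  c_le : c ≤ min (1 / (4 * C)) (ρ / 2)
  norm_v : ∀ x ∈ Ω ∩ ball x0 ρ, ‖v x‖ ≤ M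
  measurable_v : Measurable ((Ω ∩ ball x0 ρ).indicator v)
  incr : ∀ x ∈ Ω ∩ ball x0 (ρ / 2), ∀ᵐ y, p y ≠ 0 → |f y - f x| ≤ M * ‖y - x‖
  far : ∀ x ∈ Ω ∩ ball x0 (ρ / 2), ∀ᵐ y, p y ≠ 0 →
    |f y - f x - inner ℝ (v x) (y - x)| ≤ M * ‖y - x‖ ^ q
  near : ∀ x ∈ Ω ∩ ball x0 (ρ / 2), ∀ y, ‖y - x‖ < c * d x →
    |f y - f x - inner ℝ (v x) (y - x)| ≤ M * d x ^ (q - ϱ) * ‖y - x‖ ^ ϱ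

namespace BoundaryModel

variable (h : BoundaryModel Ω x0 s δ ρ c0 C Cp d φ p N)
include h

lemma half_mem (hx : x ∈ Ω ∩ ball x0 (ρ / 2)) : x ∈ Ω ∩ ball x0 ρ :=
  ⟨hx.1, ball_subset_ball (by linarith [h.radius.1]) hx.2⟩

lemma N_ne_zero (hx : x ∈ Ω ∩ ball x0 ρ) : N x ≠ 0 :=
  norm_pos_iff.1 (h.c₀_pos.trans_le (h.norm_N x hx).1)

lemma abs_p_near (hs : s ∈ Ioo 0 1) (hδ : 0 < δ) (hc : c ≤ min (1 / (4 * C)) (ρ / 2))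
    (hx : x ∈ Ω ∩ ball x0 (ρ / 2)) (hy : ‖y - x‖ < c * d x) :
    |p y| ≤ C * (1 / 2) ^ (s - 1) * d x ^ (s - 1) := by
  have hd := (h.d_mem x (h.half_mem hx)).1
  obtain ⟨hyΩ, -, hy1, -⟩ := h.near_mem hδ hx (hy.trans_le (by gcongr))
  rw [h.p_eq y hyΩ, abs_mul, abs_of_nonneg (posPow_nonneg _ _), mul_assoc]
  have := h.one_le_C
  exact mul_le_mul (h.phi_le y hyΩ) (posPow_le_half hs.2.le hd hy1) (posPow_nonneg _ _) (by linarith)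

lemma abs_p_le (hx : x ∈ Ω ∩ ball x0 ρ) : |p x| ≤ C * d x ^ (s - 1) := by
  rw [h.p_eq x hx, abs_mul, abs_of_nonneg (posPow_nonneg _ _), posPow_of_pos (h.d_mem x hx).1]
  have := (h.d_mem x hx).1
  gcongr
  exact h.phi_le x hx

lemma exists_modelRem_bound (k : Ker s lam Lam K) (hδ : δ ∈ Ioo 0 1) (hf : BoundaryFunction Ω x0 ρ C M q ϱ c d p f v) (hq : q < 1 + s)
    (hϱ : 2 * s < ϱ) :
    ∃ B ≥ 0, ∀ x ∈ Ω ∩ ball x0 (ρ / 2), Integrable (modelRem s K d φ p N f v x) ∧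
      ∫ y, |modelRem s K d φ p N f v x y| ≤ B * (d x ^ (q - s - 1) + d x ^ (δ * (s / 2) - s)) := by
  have hC := h.one_le_C
  have hM := hf.M_nonneg
  obtain ⟨B1, hB1, h1⟩ := exists_weighted_bound k h.measurable_p h.growth_p
    (P0 := C * (1 / 2) ^ (s - 1)) hf.c_pos hq hϱ hM (by positivity)
  obtain ⟨B2, hB2, h2⟩ := h.exists_defect_bound k hδ
  refine ⟨B1 + M * B2, by positivity, fun x hx => ?_⟩
  have hd := (h.d_mem x (h.half_mem hx)).1
  have hcont : Continuous fun y => inner ℝ (v x) (y - x) := by fun_prop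
  have hRm : AEStronglyMeasurable (fun y => f y - f x - inner ℝ (v x) (y - x)) volume :=
    (hf.aesm.sub aestronglyMeasurable_const).sub hcont.aestronglyMeasurable
  obtain ⟨i1, j1⟩ := h1 x (d x) hd _ hRm (fun y hy => h.abs_p_near k.hs hδ.1 hf.c_le hx hy)
    (.of_forall fun y hy _ => hf.near x hx y hy)
    ((hf.far x hx).mono fun y hy _ => hy)
  obtain ⟨i2, j2⟩ := h2 x hx
  have e : ∀ y, modelRem s K d φ p N f v x y =
      -((f y - f x - inner ℝ (v x) (y - x)) * p y * K (y - x)) -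
        inner ℝ (v x) (y - x) * defect s d φ p N x y * K (y - x) := by
    intro y
    rw [modelRem, defect]
    ring
  have hle : ∀ y, |inner ℝ (v x) (y - x) * defect s d φ p N x y * K (y - x)| ≤
      M * |‖y - x‖ * defect s d φ p N x y * K (y - x)| := by
    intro y
    rw [mul_assoc, abs_mul, mul_assoc, abs_mul ‖y - x‖, abs_norm, ← mul_assoc]
    refine mul_le_mul_of_nonneg_right ?_ (abs_nonneg _)
    refine (abs_real_inner_le_norm _ _).trans ?_
    gcongr
    exact hf.norm_v x (h.half_mem hx)
  have hm2 : AEStronglyMeasurable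
      (fun y => inner ℝ (v x) (y - x) * defect s d φ p N x y * K (y - x)) volume :=
    ((hcont.measurable.mul (h.measurable_defect x)).mul
      (k.hKm.comp (measurable_id.sub_const x))).aestronglyMeasurable
  have i3 :=
    (i2.abs.const_mul M).mono' hm2 (.of_forall hle)
  have hi :=
    (i1.neg.sub i3).congr (.of_forall fun y => (e y).symm)
  refine ⟨hi, ?_⟩
  calc ∫ y, |modelRem s K d φ p N f v x y|
      ≤ ∫ y, (|(f y - f x - inner ℝ (v x) (y - x)) * p y * K (y - x)| +
          M * |‖y - x‖ * defect s d φ p N x y * K (y - x)|) := by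
        refine integral_mono hi.abs (i1.abs.add (i2.abs.const_mul M)) fun y => ?_
        simp only [e y]
        refine (abs_sub _ _).trans ?_
        rw [abs_neg]
        exact add_le_add le_rfl (hle y)
    _ ≤ B1 * d x ^ (q - s - 1) + M * (B2 * d x ^ (δ * (s / 2) - s)) := by
        rw [integral_add i1.abs (i2.abs.const_mul M), integral_const_mul]
        gcongr
    _ ≤ _ := by
        have a1 : 0 ≤ d x ^ (q - s - 1) := by positivity
        have a2 : 0 ≤ d x ^ (δ * (s / 2) - s) := by positivity
        nlinarith [mul_nonneg hB1 a2, mul_nonneg (mul_nonneg hM hB2) a1]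

/-- Existence of the principal value near the boundary. -/
lemma tendsto_trunc (k : Ker s lam Lam K) (hx : x ∈ Ω ∩ ball x0 ρ)
    (hE : Integrable (modelRem s K d φ p N f v x)) :
    Tendsto (fun ε => 2 * 𝓣 K p f x ε) (𝓝[>] 0) (𝓝 (2 * ∫ y, modelRem s K d φ p N f v x y)) := by
  have hm0 := tendsto_modInt_zero k (h.d_mem x hx).1 (h.N_ne_zero hx)
  have h1 := ((tendsto_setIntegral_trunc hE x).const_mul 2).sub
    (((tendsto_const_nhds (x := v x)).inner hm0).const_mul (2 * φ x))
  rw [inner_zero_right, mul_zero, sub_zero] at h1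
  refine h1.congr_within fun ε hε => ?_
  rw [← (trunc_add_model k (h.N_ne_zero hx) hE hε).2]
  ring

lemma integrableOn_ball_posPow (ha : a ∈ Ioc (0 : ℝ) 1) (x : Pt m) (hR : 0 < R) :
    IntegrableOn (fun y => posPow a ((Ω ∩ ball x0 ρ).indicator d y)) (ball x R) := by
  obtain ⟨C', hC'⟩ := h.growth_d a ha
  refine ⟨((measurable_posPow a).comp h.measurable_d).aestronglyMeasurable, ?_⟩
  rw [hasFiniteIntegral_iff_norm]
  exact (hC' x R hR).trans_lt (ENNReal.mul_lt_top ENNReal.coe_lt_top ofReal_lt_top)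

end BoundaryModel
end BoundaryEstimates

section BoundaryLayer

namespace EpiChart

variable (c : EpiChart Ω x0)

/-- Coordinates adapted to the boundary. -/
def flat : Hyp m × ℝ ≃ₜ Pt m where
  toFun p := c.graph p.1 + p.2 • c.e
  invFun z := (initC (c.A z), c.height z)
  left_inv p := by
    refine Prod.ext ?_ ?_
    · change initC (c.A (c.graph p.1 + p.2 • c.e)) = p.1
      rw [c.A_add_smul_e, initC_add, initC_smul, c.initC_A_graph, initC_eN, smul_zero, add_zero]
    · change c.height (c.graph p.1 + p.2 • c.e) = p.2
      rw [c.height_add_e, c.height_graph, zero_add]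
  right_inv z := by
    change c.graph (initC (c.A z)) + c.height z • c.e = z
    apply c.A.injective
    rw [c.A_add_smul_e, graph, LinearIsometryEquiv.apply_symm_apply,
      ← mk_initC_lastC (WeightedIBP.mk _ _ + _), initC_add, lastC_add, initC_smul, lastC_smul,
      initC_eN, lastC_eN, initC_mk, lastC_mk, smul_zero, add_zero, height, mul_one, add_sub_cancel,
      mk_initC_lastC]
  continuous_toFun := (c.continuous_graph.comp continuous_fst).add
    (continuous_snd.smul continuous_const)
  continuous_invFun := (continuous_initC.comp c.A.continuous).prodMk c.continuous_height

lemma flat_apply (p : Hyp m × ℝ) : c.flat p = c.graph p.1 + p.2 • c.e := rfl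

lemma height_flat (p : Hyp m × ℝ) : c.height (c.flat p) = p.2 := by
  rw [flat_apply, c.height_add_e, c.height_graph, zero_add]

lemma initC_A_flat (p : Hyp m × ℝ) : initC (c.A (c.flat p)) = p.1 := by
  rw [flat_apply, c.A_add_smul_e, initC_add, initC_smul, c.initC_A_graph, initC_eN, smul_zero,
    add_zero]

lemma measurePreserving_flat : MeasurePreserving c.flat := by
  have h1 : MeasurePreserving (fun p : Hyp m × ℝ => (p.1, c.g p.1 + p.2)) := by
    have := (MeasurePreserving.id (volume : Measure (Hyp m))).skew_product
      (g := fun x' t => c.g x' + t)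
      (((c.contDiff.continuous.comp continuous_fst).add continuous_snd).measurable)
      (.of_forall fun x' => (measurePreserving_add_left volume (c.g x')).map_eq)
    exact this
  have h2 := c.A.symm.measurePreserving.comp (measurePreserving_mk.comp h1)
  convert h2 using 1
  ext1 p
  apply c.A.injective
  simp
  rw [flat_apply, c.A_add_smul_e, graph, LinearIsometryEquiv.apply_symm_apply,
    ← mk_initC_lastC (WeightedIBP.mk _ _ + _), initC_add, lastC_add, initC_smul, lastC_smul,
    initC_eN, lastC_eN, initC_mk, lastC_mk, smul_zero, add_zero, mul_one]

lemma integral_flat (F : Pt m → ℝ) : ∫ p, F (c.flat p) = ∫ x, F x :=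
  c.measurePreserving_flat.integral_comp c.flat.measurableEmbedding F

lemma integrable_flat {F : Pt m → ℝ} : Integrable (fun p => F (c.flat p)) ↔ Integrable F :=
  c.measurePreserving_flat.integrable_comp_emb c.flat.measurableEmbedding

lemma graph_mem_frontier (hΩ : IsOpen Ω) {x' : Hyp m}
    (h : c.graph x' ∈ ball x0 c.r) : c.graph x' ∈ frontier Ω :=
  (c.mem_frontier_iff hΩ h).2 (c.height_graph x')

lemma tendsto_flat {x' : Hyp m} (h : c.graph x' ∈ ball x0 c.r) :
    Tendsto (fun t : ℝ => c.flat (x', t)) (𝓝[>] 0) (𝓝[Ω] (c.graph x')) := by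
  have h1 : Tendsto (fun t => c.flat (x', t)) (𝓝[>] 0) (𝓝 (c.graph x')) :=
    tendsto_line (c.graph x') c.e
  refine tendsto_nhdsWithin_iff.2 ⟨h1, ?_⟩
  filter_upwards [h1.eventually (isOpen_ball.mem_nhds h), self_mem_nhdsWithin] with t ht h0
  exact (c.mem_iff_height ht).2 (by rw [c.height_flat]; exact h0)

end EpiChart

variable {C : ℝ} {φ0 : Pt m → ℝ}
  {N v v0 : Pt m → Pt m}

/-- Boundary values of the data of a boundary model. -/
structure BoundaryTrace (c : EpiChart Ω x0) (ρ c1 C1 : ℝ)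
    (d φ φ0 : Pt m → ℝ) (N v v0 : Pt m → Pt m) : Prop where
  radius_le : ρ ≤ c.r
  c₁_pos : 0 < c1
  comparable : ∀ x ∈ Ω ∩ ball x0 ρ, c1 * c.height x ≤ d x ∧ d x ≤ C1 * c.height x
  measurable_phi : Measurable ((Ω ∩ ball x0 ρ).indicator φ)
  measurable_N : Measurable ((Ω ∩ ball x0 ρ).indicator N)
  phi : ∀ z ∈ frontier Ω ∩ ball x0 ρ, Tendsto φ (𝓝[Ω] z) (𝓝 (φ0 z))
  normal : ∀ z ∈ frontier Ω ∩ ball x0 ρ, Tendsto N (𝓝[Ω] z) (𝓝 (c.nu (initC (c.A z))))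
  grad : ∀ z ∈ frontier Ω ∩ ball x0 ρ, Tendsto v (𝓝[Ω] z) (𝓝 (v0 z))
  dist : ∀ z ∈ frontier Ω ∩ ball x0 ρ,
    Tendsto (fun t : ℝ => d (z + t • c.e) / t) (𝓝[>] 0) (𝓝 (c.jac (initC (c.A z)))⁻¹)

/-- The amplitude of the boundary layer. -/
def amplitude (V : Set (Pt m)) (η φ : Pt m → ℝ) (v : Pt m → Pt m) (x : Pt m) : Pt m :=
  (2 * η x * V.indicator φ x ^ 2) • V.indicator v x

/-- The part of the truncated operator that concentrates at the boundary. -/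
def layerFun (s : ℝ) (K : Pt m → ℝ) (V : Set (Pt m)) (η d φ : Pt m → ℝ) (N v : Pt m → Pt m)
    (ε : ℝ) (x : Pt m) : ℝ :=
  (V.indicator d x)⁻¹ * inner ℝ (psi s K (V.indicator N x) (ε / V.indicator d x))
    (amplitude V η φ v x)

lemma layerFun_of_notMem {V : Set (Pt m)} (hx : x ∉ V) : layerFun s K V η d φ N v ε x = 0 := by
  rw [layerFun, amplitude, indicator_of_notMem hx v, smul_zero, inner_zero_right, mul_zero]

lemma layerFun_of_eq_zero {V : Set (Pt m)} (hx : η x = 0) : layerFun s K V η d φ N v ε x = 0 := by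
  rw [layerFun, amplitude, hx, mul_zero, zero_mul, zero_smul, inner_zero_right, mul_zero]

lemma BoundaryModel.layerFun_eq (h : BoundaryModel Ω x0 s δ ρ c0 C Cp d φ p N) (k : Ker s lam Lam K) (hε : 0 < ε) (hx : x ∈ Ω ∩ ball x0 ρ) :
    layerFun s K (Ω ∩ ball x0 ρ) η d φ N v ε x =
      η x * p x * (2 * φ x * inner ℝ (v x) (modInt s K (d x) (N x) ε)) := by
  have hd := (h.d_mem x hx).1
  rw [modInt_eq k hd (h.N_ne_zero hx) hε, h.p_eq x hx, posPow_of_pos hd, layerFun,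
    amplitude, indicator_of_mem hx, indicator_of_mem hx, indicator_of_mem hx, indicator_of_mem hx,
    real_inner_smul_right, real_inner_smul_right, real_inner_comm (v x)]
  have e : d x ^ (s - 1) * d x ^ (-s) = (d x)⁻¹ := by
    rw [← rpow_add hd, ← rpow_neg_one]; congr 1; ring
  rw [← e]
  ring

lemma BoundaryModel.layerData (h : BoundaryModel Ω x0 s δ ρ c0 C Cp d φ p N) {c : EpiChart Ω x0}
    (ht : BoundaryTrace c ρ c1 C1 d φ φ0 N v v0) (hη : Continuous η) {Cη : ℝ}
    (hηb : ∀ x, |η x| ≤ Cη) (hM : 0 ≤ M) (hv : ∀ x ∈ Ω ∩ ball x0 ρ, ‖v x‖ ≤ M)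
    (hvm : Measurable ((Ω ∩ ball x0 ρ).indicator v)) :
    LayerData m (fun P => amplitude (Ω ∩ ball x0 ρ) η φ v (c.flat P))
      (fun P => (Ω ∩ ball x0 ρ).indicator d (c.flat P))
      (fun P => (Ω ∩ ball x0 ρ).indicator N (c.flat P))
      (ball (initC (c.A x0)) c.r) (2 * Cη * C ^ 2 * M) c1 C1 c0 C := by
  have hCη := (abs_nonneg _).trans (hηb 0)
  have hfm := c.flat.continuous.measurable
  have hmem : ∀ P, amplitude (Ω ∩ ball x0 ρ) η φ v (c.flat P) ≠ 0 →
      c.flat P ∈ Ω ∩ ball x0 ρ := fun P hP => by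
    by_contra hn
    exact hP (by rw [amplitude, indicator_of_notMem hn v, smul_zero])
  have hball := ball_subset_ball (x := x0) ht.radius_le
  refine ⟨?_, h.measurable_d.comp hfm, ht.measurable_N.comp hfm, measurableSet_ball,
    measure_ball_lt_top.ne, ht.c₁_pos, h.c₀_pos, fun P hP => ?_, fun P => ?_, fun P hP => ?_,
    fun P hP => ?_⟩
  · have : Measurable (amplitude (Ω ∩ ball x0 ρ) η φ v) :=
      ((hη.measurable.const_mul 2).mul (ht.measurable_phi.pow_const 2)).smul hvm
    exact this.comp hfm
  · have hP' := hmem P hP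
    refine ⟨?_, ?_⟩
    · have := c.initC_mem (hball hP'.2)
      rwa [c.initC_A_flat] at this
    · have := (c.mem_iff_height (hball hP'.2)).1 hP'.1
      rwa [c.height_flat] at this
  · by_cases hP : c.flat P ∈ Ω ∩ ball x0 ρ
    · rw [amplitude, indicator_of_mem hP, indicator_of_mem hP, norm_smul, norm_eq_abs, abs_mul,
        abs_mul, abs_two, abs_pow]
      gcongr
      · exact hηb _
      · exact h.phi_le _ hP
      · exact hv _ hP
    · rw [amplitude, indicator_of_notMem hP v, smul_zero, norm_zero]
      have := h.one_le_C
      positivity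
  · have hP' := hmem P hP
    have := ht.comparable _ hP'
    rw [c.height_flat] at this
    simpa only [indicator_of_mem hP'] using this
  · have hP' := hmem P hP
    simpa only [indicator_of_mem hP'] using h.norm_N _ hP'

/-- The limit of the boundary layer. -/
lemma BoundaryModel.tendsto_layerFun (h : BoundaryModel Ω x0 s δ ρ c0 C Cp d φ p N) (k : Ker s lam Lam K)
    (hΩ : IsOpen Ω) {c : EpiChart Ω x0}
    (ht : BoundaryTrace c ρ c1 C1 d φ φ0 N v v0) (hη : Continuous η) {Cη : ℝ}
    (hηb : ∀ x, |η x| ≤ Cη) (hM : 0 ≤ M) (hv : ∀ x ∈ Ω ∩ ball x0 ρ, ‖v x‖ ≤ M)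
    (hvm : Measurable ((Ω ∩ ball x0 ρ).indicator v)) {B : Set (Pt m)} (hB : MeasurableSet B)
    (hsupp : tsupport η ⊆ ball x0 ρ ∩ B) :
    (∀ ε > 0, Integrable (layerFun s K (Ω ∩ ball x0 ρ) η d φ N v ε)) ∧
    IntegrableOn (fun z => η z * inner ℝ ((2 * cs s * φ0 z ^ 2) • halfVec s K (innerNormal Ω z))
      (v0 z)) (frontier Ω ∩ B) μHE[m] ∧
    Tendsto (fun ε => ∫ x, layerFun s K (Ω ∩ ball x0 ρ) η d φ N v ε x) (𝓝[>] 0)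
      (𝓝 (∫ z in frontier Ω ∩ B, η z * inner ℝ
        ((2 * cs s * φ0 z ^ 2) • halfVec s K (innerNormal Ω z)) (v0 z) ∂μHE[m])) := by
  have hball := ball_subset_ball (x := x0) ht.radius_le
  have hL := h.layerData ht hη hηb hM hv hvm
  set F : Pt m → ℝ := fun z => η z * inner ℝ
    ((2 * cs s * φ0 z ^ 2) • halfVec s K (innerNormal Ω z)) (v0 z) with hF
  have hzero : ∀ z, z ∉ tsupport η → η z = 0 := fun z hz => image_eq_zero_of_notMem_tsupport hz
  have hlim := hL.tendsto k (N0 := c.nu)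
   
    (.of_forall fun x' => by
      by_cases hz : c.graph x' ∈ tsupport η
      · right
        have hzρ := (hsupp hz).1
        have hzr := hball hzρ
        have hzf := c.graph_mem_frontier hΩ hzr
        have hT := c.tendsto_flat hzr
        have hV : ∀ᶠ t in 𝓝[>] 0, c.flat (x', t) ∈ Ω ∩ ball x0 ρ :=
          (hT.eventually_mem self_mem_nhdsWithin).and
            ((hT.mono_right nhdsWithin_le_nhds).eventually_mem (isOpen_ball.mem_nhds hzρ))
        have hηT :=
          (hη.tendsto _).comp (hT.mono_right nhdsWithin_le_nhds)
        refine ⟨c.jac_pos x', norm_ne_zero_iff.1 (by rw [c.norm_nu]; exact one_ne_zero), ?_, ?_, ?_⟩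
        · refine Tendsto.congr' ?_ (((hηT.const_mul 2).mul
            (((ht.phi _ ⟨hzf, hzρ⟩).comp hT).pow 2)).smul ((ht.grad _ ⟨hzf, hzρ⟩).comp hT))
          filter_upwards [hV] with t htV
          simp only [amplitude, indicator_of_mem htV, Function.comp_apply]
        · have := (ht.normal _ ⟨hzf, hzρ⟩).comp hT
          rw [c.initC_A_graph] at this
          refine this.congr' ?_
          filter_upwards [hV] with t htV
          simp only [indicator_of_mem htV, Function.comp_apply]
        · have := ht.dist _ ⟨hzf, hzρ⟩
          rw [c.initC_A_graph] at this
          refine this.congr' ?_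
          filter_upwards [hV] with t htV
          rw [indicator_of_mem htV, c.flat_apply]
      · left
        refine ⟨?_, ?_⟩
        · have hT : Tendsto (fun t => c.flat (x', t)) (𝓝[>] 0) (𝓝 (c.graph x')) :=
            tendsto_line (c.graph x') c.e
          filter_upwards [hT.eventually_mem ((isClosed_tsupport η).isOpen_compl.mem_nhds hz)]
            with t ht0
          rw [amplitude, hzero _ ht0, mul_zero, zero_mul, zero_smul]
        · rw [hzero _ hz, mul_zero, zero_mul, zero_smul])
  have hFe : ∀ x', c.jac x' * cs s * inner ℝ (halfVec s K (c.nu x'))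
      ((2 * η (c.graph x') * φ0 (c.graph x') ^ 2) • v0 (c.graph x')) = c.jac x' * F (c.graph x') := by
    intro x'
    by_cases hz : c.graph x' ∈ tsupport η
    · have hzr := hball (hsupp hz).1
      have := c.innerNormal_eq hΩ hzr (c.graph_mem_frontier hΩ hzr)
      rw [c.initC_A_graph] at this
      rw [hF]
      simp only [this, real_inner_smul_left, real_inner_smul_right]
      ring
    · rw [hF]
      simp only [hzero _ hz]
      simp
  simp only [hFe] at hlim
  obtain ⟨a1, a2⟩ := c.area_formula hΩ hB (F := F) (fun z hz => by
    have : z ∉ tsupport η := fun hzs => hz ⟨hball (hsupp hzs).1, (hsupp hzs).2⟩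
    simp only [hF, hzero z this, zero_mul])
  refine ⟨fun ε hε => ?_, a1 hlim.1, ?_⟩
  · rw [← c.integrable_flat]
    exact hL.integrable_layer k hε
  · rw [a2]
    refine hlim.2.congr fun ε => ?_
    exact c.integral_flat (layerFun s K (Ω ∩ ball x0 ρ) η d φ N v ε)

end BoundaryLayer

section LocalFormula

/-- The kernel `p(x) p(y) K(x-y)`. -/
def pairKernel (K p : Pt m → ℝ) (x y : Pt m) : ℝ := p x * p y * K (x - y)

/-- The integration by parts formula for the test function `η`, with boundary density `β`. -/
structure Green (Ω B : Set (Pt m)) (K p f β η : Pt m → ℝ) : Prop where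
  energy : Integrable fun z : Pt m × Pt m =>
    𝓔 K p f η z
  operator : Integrable fun x => η x * op (pairKernel K p) f x
  boundary : IntegrableOn (fun z => η z * β z) (frontier Ω ∩ B) μHE[m]
  identity : ∫ z : Pt m × Pt m, 𝓔 K p f η z =
    (∫ x, η x * op (pairKernel K p) f x) - ∫ z in frontier Ω ∩ B, η z * β z ∂μHE[m]

lemma opTrunc_pairKernel (K p f : Pt m → ℝ) (x : Pt m) (ε : ℝ) : opTrunc (pairKernel K p) f x ε =
      p x * (2 * 𝓣 K p f x ε) := by
  rw [opTrunc, mul_left_comm, ← integral_const_mul (p x)]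
  congr 2 with y
  rw [pairKernel]
  ring

lemma opExists_pairKernel {l : ℝ}
    (hi : ∀ ε > 0, IntegrableOn (fun y => (f x - f y) * (p y * K (x - y))) (𝔽 x ε))
    (hl : Tendsto (fun ε => 2 * 𝓣 K p f x ε) (𝓝[>] 0) (𝓝 l)) :
    OpExists (pairKernel K p) f x ∧ op (pairKernel K p) f x = p x * l := by
  have h1 :=
    (hl.const_mul (p x)).congr fun ε => (opTrunc_pairKernel K p f x ε).symm
  refine ⟨⟨fun ε hε => ?_, _, h1⟩, h1.limUnder_eq⟩
  refine ((hi ε hε).const_mul (p x)).congr (.of_forall fun y => ?_)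
  simp only [pairKernel]
  ring

lemma op_pairKernel_of_eq_zero (hx : p x = 0) :
    OpExists (pairKernel K p) f x ∧ op (pairKernel K p) f x = 0 := by
  have h1 : Tendsto (opTrunc (pairKernel K p) f x) (𝓝[>] 0) (𝓝 0) :=
    tendsto_const_nhds.congr fun ε => by rw [opTrunc_pairKernel, hx, zero_mul]
  refine ⟨⟨fun ε _ => ?_, _, h1⟩, h1.limUnder_eq⟩
  simp [pairKernel, hx]

lemma integral_by_parts_of_remainder (k : Ker s lam Lam K)
    (hP : Integrable fun z : Pt m × Pt m => 𝓔 K p f η z)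
    (hQ : ∀ ε > 0, IntegrableOn (fun z : Pt m × Pt m =>
      η z.1 * (f z.1 - f z.2) * (p z.1 * p z.2 * K (z.1 - z.2))) (𝔾 ε))
    {b : ℝ → Pt m → ℝ} {B : ℝ} {g : Pt m → ℝ} {E : Pt m → Pt m → ℝ} {S : Set (Pt m)}
    (hb : ∀ ε > 0, Integrable (b ε)) (hB : Tendsto (fun ε => ∫ x, b ε x) (𝓝[>] 0) (𝓝 B))
    (hg : Integrable g) (hg0 : ∀ x, 0 ≤ g x) (hE : ∀ x ∈ S, Integrable (E x))
    (hEg : ∀ x ∈ S, |η x| * |p x| * (2 * ∫ y, |E x y|) ≤ g x)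
    (hop : ∀ x ∈ S, op (pairKernel K p) f x = p x * (2 * ∫ y, E x y))
    (hsplit : ∀ x ∈ S, ∀ ε > 0, η x * p x * (2 * 𝓣 K p f x ε) + b ε x =
      η x * p x * (2 * ∫ y in 𝔽 x ε, E x y))
    (hnull : ∀ x ∉ S, η x * p x = 0 ∧ ∀ ε, b ε x = 0) :
    Integrable (fun x => η x * op (pairKernel K p) f x) ∧
      ∫ z : Pt m × Pt m, 𝓔 K p f η z = (∫ x, η x * op (pairKernel K p) f x) - B := by
  refine integral_by_parts_of_split k.hK hP hQ hb hB hg (eventually_nhdsWithin_of_forall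
    fun ε hε => .of_forall fun x => ?_) (.of_forall fun x => ?_)
  · by_cases hx : x ∈ S
    · rw [hsplit x hx ε hε, abs_mul, abs_mul, abs_mul 2, abs_two]
      exact le_trans (by gcongr; exact abs_setIntegral_le (hE x hx) _) (hEg x hx)
    · rw [(hnull x hx).1, (hnull x hx).2, zero_mul, add_zero, abs_zero]
      exact hg0 x
  · by_cases hx : x ∈ S
    · rw [hop x hx, ← mul_assoc]
      exact (((tendsto_setIntegral_trunc (hE x hx) x).const_mul 2).const_mul _).congr_within
        fun ε hε => (hsplit x hx ε hε).symm
    · have : η x * op (pairKernel K p) f x = 0 := by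
        rcases mul_eq_zero.1 (hnull x hx).1 with h0 | h0
        · rw [h0, zero_mul]
        · rw [(op_pairKernel_of_eq_zero h0).2, mul_zero]
      simp only [hnull x hx, zero_mul, add_zero, this]
      exact tendsto_const_nhds

lemma green_zero (Ω B : Set (Pt m)) (K p f β : Pt m → ℝ) : Green Ω B K p f β (fun _ => 0) := by
  constructor <;> simp

lemma Green.add {β η₁ η₂ : Pt m → ℝ} (h₁ : Green Ω B K p f β η₁)
    (h₂ : Green Ω B K p f β η₂) : Green Ω B K p f β (fun x => η₁ x + η₂ x) := by
  have e1 : ∀ z : Pt m × Pt m, (η₁ z.1 + η₂ z.1 - (η₁ z.2 + η₂ z.2)) * (f z.1 - f z.2) *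
      (p z.1 * p z.2 * K (z.1 - z.2)) =
      𝓔 K p f η₁ z +
      𝓔 K p f η₂ z := fun z => by ring
  have e2 : ∀ x, (η₁ x + η₂ x) * op (pairKernel K p) f x =
      η₁ x * op (pairKernel K p) f x + η₂ x * op (pairKernel K p) f x := fun x => by ring
  have e3 : ∀ z, (η₁ z + η₂ z) * β z = η₁ z * β z + η₂ z * β z := fun x => by ring
  refine ⟨?_, ?_, ?_, ?_⟩
  · simp only [e1]; exact h₁.energy.add h₂.energy
  · simp only [e2]; exact h₁.operator.add h₂.operator
  · simp only [e3]; exact h₁.boundary.add h₂.boundary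
  · simp only [e1, e2, e3]
    rw [integral_add h₁.energy h₂.energy, integral_add h₁.operator h₂.operator,
      integral_add h₁.boundary h₂.boundary, h₁.identity, h₂.identity]
    ring

variable {C : ℝ}
  {φ0 : Pt m → ℝ} {N v v0 : Pt m → Pt m}

lemma integrable_energy (k : Ker s lam Lam K) (hp : Measurable p) (hpA : AbsGrowth p Cp (m + s))
    (hf : AEStronglyMeasurable f volume) (hη : ContDiff ℝ ∞ η) (hηc : HasCompactSupport η)
    {X : Set (Pt m)} (hX : MeasurableSet X) (hη0 : ∀ x, x ∉ X → η x = 0) {D : Pt m → ℝ}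
    (hc : 0 < c) (hP0 : 0 ≤ P0) (hM : 0 ≤ M)
    (hD : ∀ x ∈ X, p x ≠ 0 → 0 < D x ∧ ∀ y, ‖y - x‖ < c * D x → |p y| ≤ P0 * D x ^ (s - 1))
    (hincr : ∀ x ∈ X, p x ≠ 0 → ∀ᵐ y, p y ≠ 0 → |f y - f x| ≤ M * ‖y - x‖)
    (hi : ∀ r ∈ Ioo 1 (1 + s), IntegrableOn (fun x => |p x| * D x ^ (r - s - 1)) X) :
    Integrable (fun z : Pt m × Pt m =>
      𝓔 K p f η z) := by
  obtain ⟨Cη, hCη, b1, -, b3, -⟩ := exists_test_bounds hη hηc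
  obtain ⟨r, hr1, hr2⟩ := exists_between (show max 1 (2 * s) < 1 + s from
    max_lt (by linarith [k.hs.1]) (by linarith [k.hs.2]))
  have hr0 := (le_max_left _ _).trans_lt hr1
  have hηm : AEStronglyMeasurable η volume := hη.continuous.aestronglyMeasurable
  have hbound : ∀ x y, |f y - f x| ≤ M * ‖y - x‖ →
      |(η x - η y) * (f x - f y)| ≤ 2 * Cη * M * ‖y - x‖ ^ r := by
    intro x y hxy
    have hn := norm_nonneg (y - x)
    refine min_le_rpow (by positivity) hn hr0.le (by linarith [k.hs.2]) ?_ ?_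
    · rw [abs_mul, abs_sub_comm (f x), abs_sub_comm (η x)]
      calc |η y - η x| * |f y - f x| ≤ (Cη * ‖y - x‖) * (M * ‖y - x‖) := by
            gcongr
            exact b3 x y
        _ = Cη * M * ‖y - x‖ ^ 2 := by ring
        _ ≤ _ := by gcongr; linarith
    · rw [abs_mul, abs_sub_comm (f x)]
      have : |η x - η y| ≤ 2 * Cη := (abs_sub _ _).trans (by linarith [b1 x, b1 y])
      calc |η x - η y| * |f y - f x| ≤ (2 * Cη) * (M * ‖y - x‖) := by gcongr
        _ = _ := by ring
  refine integrable_double (M := 2 * Cη * M)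
    k
    hp hpA hc hr2 ((le_max_right _ _).trans_lt hr1) (by positivity)
    hP0 hX ?_ hD (fun x hx hpx => ?_) (fun x y hx hy => ?_) (hi r ⟨hr0, hr2⟩)
  · exact (hηm.comp_fst.sub hηm.comp_snd).mul (hf.comp_fst.sub hf.comp_snd)
  · filter_upwards [hincr x hx hpx] with y hy hpy
    have := hbound x y (hy hpy)
    refine ⟨this, ?_⟩
    rwa [show (η y - η x) * (f y - f x) = (η x - η y) * (f x - f y) by ring]
  · simp only [hη0 x hx, hη0 y hy, sub_self, zero_mul]

lemma integrableOn_trunc_energy (k : Ker s lam Lam K) (hp : Measurable p)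
    (hpA : AbsGrowth p Cp (m + s)) (hf : AEStronglyMeasurable f volume) (hη : Continuous η) {Cη : ℝ}
    (hηb : ∀ x, |η x| ≤ Cη) {X : Set (Pt m)} (hX : MeasurableSet X) (hη0 : ∀ x, x ∉ X → η x = 0)
    (hM : 0 ≤ M) (hincr : ∀ x ∈ X, p x ≠ 0 → ∀ᵐ y, p y ≠ 0 → |f y - f x| ≤ M * ‖y - x‖)
    (hi : IntegrableOn p X) {ε : ℝ} (hε : 0 < ε) :
    IntegrableOn (fun z : Pt m × Pt m =>
      η z.1 * (f z.1 - f z.2) * (p z.1 * p z.2 * K (z.1 - z.2))) (𝔾 ε) := by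
  have hCη := (abs_nonneg _).trans (hηb 0)
  have hηm : AEStronglyMeasurable η volume := hη.aestronglyMeasurable
  refine integrableOn_double_trunc (q := 1) (M := Cη * M)
    k hp hpA
    (by linarith [k.hs.1]) (by positivity) hX
    (hηm.comp_fst.mul (hf.comp_fst.sub hf.comp_snd)) hε (fun x hx hpx => ?_)
    (fun x y hx _ => by simp only [hη0 x hx, zero_mul]) hi
  filter_upwards [hincr x hx hpx] with y hy _ hpy
  rw [rpow_one, abs_mul, abs_mul, abs_sub_comm (f x), mul_assoc]
  exact ⟨mul_le_mul (hηb x) (hy hpy) (abs_nonneg _) hCη,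
    mul_le_mul (hηb y) (hy hpy) (abs_nonneg _) hCη⟩

lemma integrableOn_ball_of_growth (hp : Measurable p) (hpA : AbsGrowth p Cp A) (x : Pt m) (hR : 0 < R) : IntegrableOn p (ball x R) := by
  refine ⟨hp.aestronglyMeasurable, ?_⟩
  rw [hasFiniteIntegral_iff_norm]
  exact (hpA x R hR).trans_lt (ENNReal.mul_lt_top ENNReal.coe_lt_top ofReal_lt_top)

namespace BoundaryModel

variable (h : BoundaryModel Ω x0 s δ ρ c0 C Cp d φ p N)
include h

lemma opExists (k : Ker s lam Lam K) (hx : x ∈ Ω ∩ ball x0 ρ)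
    (hE : Integrable (modelRem s K d φ p N f v x)) :
    OpExists (pairKernel K p) f x ∧
      op (pairKernel K p) f x = p x * (2 * ∫ y, modelRem s K d φ p N f v x y) :=
  opExists_pairKernel (fun _ hε => (trunc_add_model k (h.N_ne_zero hx) hE hε).1)
    (h.tendsto_trunc k hx hE)

lemma p_ne_zero (hx : p x ≠ 0) : x ∈ Ω := by
  by_contra hn
  exact hx (h.p_zero x hn)

lemma integrableOn_weight (hs : s ∈ Ioo 0 1) (hr : r ∈ Ioo 1 (1 + s)) :
    IntegrableOn (fun x => |p x| * d x ^ (r - s - 1)) (ball x0 (ρ / 2)) := by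
  have hC := h.one_le_C
  have hi := (h.integrableOn_ball_posPow (a := r - 1) ⟨by linarith [hr.1], by linarith [hr.2, hs.2]⟩ x0
    (R := ρ / 2) (by linarith [h.radius.1])).const_mul C
  have hdm : Measurable fun x => |p x| * ((Ω ∩ ball x0 ρ).indicator d x) ^ (r - s - 1) :=
    h.measurable_p.norm.mul (h.measurable_d.pow_const _)
  have hcongr : ∀ x ∈ ball x0 (ρ / 2), |p x| * d x ^ (r - s - 1) =
      |p x| * ((Ω ∩ ball x0 ρ).indicator d x) ^ (r - s - 1) := by
    intro x hx
    by_cases hxΩ : x ∈ Ω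
    · rw [indicator_of_mem (h.half_mem ⟨hxΩ, hx⟩)]
    · rw [h.p_zero x hxΩ]; simp
  rw [integrableOn_congr_fun hcongr measurableSet_ball]
  refine hi.mono' hdm.aestronglyMeasurable ((ae_restrict_iff' measurableSet_ball).2
    (.of_forall fun x hx => ?_))
  by_cases hxΩ : x ∈ Ω
  · have hx' := h.half_mem ⟨hxΩ, hx⟩
    have hd := (h.d_mem x hx').1
    rw [indicator_of_mem hx', posPow_of_pos hd, norm_of_nonneg (by positivity)]
    calc |p x| * d x ^ (r - s - 1) ≤ C * d x ^ (s - 1) * d x ^ (r - s - 1) := by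
          gcongr
          exact h.abs_p_le hx'
      _ = _ := by
          rw [mul_assoc, ← rpow_add hd]; congr 2; ring
  · rw [h.p_zero x hxΩ, abs_zero, zero_mul, norm_zero]
    exact mul_nonneg (by linarith) (posPow_nonneg _ _)

/-- The integration by parts formula near a boundary point. -/
theorem green (k : Ker s lam Lam K) (hδ : δ ∈ Ioo 0 1) (hΩ : IsOpen Ω) (hf : BoundaryFunction Ω x0 ρ C M q ϱ c d p f v)
    (hq : q ∈ Ioo 1 (1 + s)) (hϱ : 2 * s < ϱ) {c' : EpiChart Ω x0}
    (ht : BoundaryTrace c' ρ c1 C1 d φ φ0 N v v0) (hB : MeasurableSet B)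
    (hη : ContDiff ℝ ∞ η) (hηc : HasCompactSupport η)
    (hsupp : tsupport η ⊆ ball x0 (ρ / 2) ∩ B) :
    Green Ω B K p f (fun z => inner ℝ ((2 * cs s * φ0 z ^ 2) • halfVec s K (innerNormal Ω z)) (v0 z))
      η := by
  have hC := h.one_le_C
  have hρ := h.radius
  have hsub : ball x0 (ρ / 2) ⊆ ball x0 ρ :=
    ball_subset_ball (by linarith [hρ.1])
  obtain ⟨Cη, hCη, b1, -, -, -⟩ := exists_test_bounds hη hηc
  have hη0 : ∀ x, x ∉ ball x0 (ρ / 2) → η x = 0 := fun x hx =>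
    image_eq_zero_of_notMem_tsupport fun h' => hx (hsupp h').1
  obtain ⟨Bm, hBm, hE⟩ := h.exists_modelRem_bound k hδ hf hq.2 hϱ
  obtain ⟨l1, l2, l3⟩ := h.tendsto_layerFun k hΩ ht hη.continuous b1 hf.M_nonneg
    hf.norm_v hf.measurable_v hB (hsupp.trans (inter_subset_inter_left _ hsub))
  have hincr := fun x hx hpx => hf.incr x ⟨h.p_ne_zero hpx, hx⟩
  have hP := integrable_energy k
    h.measurable_p h.growth_p hf.aesm hη hηc measurableSet_ball hη0 hf.c_pos
    (by positivity) hf.M_nonneg (fun x hx hpx => ⟨(h.d_mem x (h.half_mem ⟨h.p_ne_zero hpx, hx⟩)).1,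
      fun y hy => h.abs_p_near k.hs hδ.1 hf.c_le ⟨h.p_ne_zero hpx, hx⟩ hy⟩) hincr
    (fun r hr => h.integrableOn_weight k.hs hr)
  have hQ := fun ε (hε : ε > 0) => integrableOn_trunc_energy k h.measurable_p
    h.growth_p hf.aesm hη.continuous b1 measurableSet_ball hη0 hf.M_nonneg hincr
    (integrableOn_ball_of_growth h.measurable_p h.growth_p x0 (by linarith [hρ.1])) hε
  set V := Ω ∩ ball x0 ρ with hV
  have hκ1 : δ * (s / 2) ∈ Ioc 0 1 := by
    have := mul_pos hδ.1 k.hs.1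
    have := hδ.2
    have := k.hs.2
    have := k.hs.1
    exact ⟨by linarith, by nlinarith⟩
  set g : Pt m → ℝ := (ball x0 (ρ / 2)).indicator (fun x => Cη * C * 2 * Bm *
    (posPow (q - 1) (V.indicator d x) + posPow (δ * (s / 2)) (V.indicator d x))) with hg
  have hgi : Integrable g := by
    rw [hg, integrable_indicator_iff measurableSet_ball]
    exact ((h.integrableOn_ball_posPow ⟨by linarith [hq.1], by linarith [hq.2, k.hs.2]⟩
      x0 (by linarith [hρ.1])).add (h.integrableOn_ball_posPow hκ1 x0 (by linarith [hρ.1]))).const_mul _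
  have hg0 : ∀ x, 0 ≤ g x := fun x => indicator_nonneg (fun x _ => mul_nonneg (by positivity)
    (add_nonneg (posPow_nonneg _ _) (posPow_nonneg _ _))) x
  have := integral_by_parts_of_remainder k hP hQ l1 l3 hgi hg0
    (fun x hx => (hE x hx).1) (fun x hx => ?_)
    (fun x hx => (h.opExists k (h.half_mem hx) (hE x hx).1).2) (fun x hx ε hε => ?_) fun x hx => ?_
  · exact ⟨hP, this.1, l2, this.2⟩
  · have hx' := h.half_mem hx
    have hd := (h.d_mem x hx').1
    rw [hg, indicator_of_mem hx.2, indicator_of_mem hx', posPow_of_pos hd, posPow_of_pos hd]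
    calc _ ≤ Cη * (C * d x ^ (s - 1)) *
          (2 * (Bm * (d x ^ (q - s - 1) + d x ^ (δ * (s / 2) - s)))) := by
          gcongr
          exacts [b1 x, h.abs_p_le hx', (hE x hx).2]
      _ = Cη * C * 2 * Bm * (d x ^ (s - 1) * d x ^ (q - s - 1) +
          d x ^ (s - 1) * d x ^ (δ * (s / 2) - s)) := by ring
      _ = _ := by
          rw [← rpow_add hd, ← rpow_add hd]
          ring_nf
  · rw [h.layerFun_eq k hε (h.half_mem hx), ← mul_add,
      (trunc_add_model k (h.N_ne_zero (h.half_mem hx)) (hE x hx).1 hε).2]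
  · by_cases hxb : x ∈ ball x0 (ρ / 2)
    · have hxΩ := fun h' => hx ⟨h', hxb⟩
      exact ⟨by rw [h.p_zero x hxΩ, mul_zero], fun ε => layerFun_of_notMem fun h' => hxΩ h'.1⟩
    · exact ⟨by rw [hη0 x hxb, zero_mul], fun ε => layerFun_of_eq_zero (hη0 x hxb)⟩

end BoundaryModel
end LocalFormula

/-- A weight `p` that is Lipschitz near `x0`, and a function `f` of class `C^ϱ` near `x0`. -/
structure InteriorModel (x0 : Pt m) (s ρ M ϱ : ℝ) (Cp : ℝ≥0) (p f : Pt m → ℝ)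
    (v : Pt m → Pt m) : Prop where
  radius : 0 < ρ
  M_nonneg : 0 ≤ M
  aesm : AEStronglyMeasurable f volume
  measurable_p : Measurable p
  growth_p : AbsGrowth p Cp (m + s)
  p_le : ∀ y ∈ ball x0 (2 * ρ), |p y| ≤ M
  p_lip : ∀ x ∈ ball x0 ρ, ∀ y, ‖y - x‖ < ρ → |p y - p x| ≤ M * ‖y - x‖
  norm_v : ∀ x ∈ ball x0 ρ, ‖v x‖ ≤ M
  incr : ∀ x ∈ ball x0 ρ, ∀ᵐ y, p y ≠ 0 → |f y - f x| ≤ M * ‖y - x‖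
  near : ∀ x ∈ ball x0 ρ, ∀ y, ‖y - x‖ < ρ →
    |f y - f x - inner ℝ (v x) (y - x)| ≤ M * ‖y - x‖ ^ ϱ

/-- The linear part of the increment near `x`. -/
def linPart (ρ : ℝ) (V : Pt m) (h : Pt m) : ℝ :=
  (ball (0 : Pt m) ρ).indicator (fun h => inner ℝ V h) h

lemma measurable_linPart (ρ : ℝ) (V : Pt m) : Measurable (linPart ρ V) :=
  (by fun_prop : Measurable fun h => (inner ℝ V h : ℝ)).indicator measurableSet_ball

lemma linPart_of_lt {h : Pt m} (hh : ‖h‖ < ρ) : linPart ρ V h = inner ℝ V h :=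
  indicator_of_mem (mem_ball_zero_iff.2 hh) _

lemma linPart_of_le {h : Pt m} (hh : ρ ≤ ‖h‖) : linPart ρ V h = 0 :=
  indicator_of_notMem (fun h' => (mem_ball_zero_iff.1 h').not_ge hh) _

lemma linPart_neg (ρ : ℝ) (V h : Pt m) : linPart ρ V (-h) = -linPart ρ V h := by
  rcases lt_or_ge ‖h‖ ρ with hh | hh
  · rw [linPart_of_lt hh, linPart_of_lt (by rwa [norm_neg]), inner_neg_right]
  · rw [linPart_of_le hh, linPart_of_le (by rwa [norm_neg]), neg_zero]

lemma abs_linPart_le (ρ : ℝ) (V h : Pt m) : |linPart ρ V h| ≤ ‖V‖ * ‖h‖ := by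
  rcases lt_or_ge ‖h‖ ρ with hh | hh
  · rw [linPart_of_lt hh]; exact abs_real_inner_le_norm _ _
  · rw [linPart_of_le hh, abs_zero]; positivity

lemma integrableOn_linPart (k : Ker s lam Lam K) (hρ : 0 < ρ) (V x : Pt m) (hε : 0 < ε) :
    IntegrableOn (fun y => linPart ρ V (y - x) * K (y - x)) (𝔽 x ε) := by
  have h1 := (kernel_tail_bound (q := 0) (M := ‖V‖ * ρ) k
    measurable_const ((measurable_linPart ρ V).comp (measurable_id.sub_const x)).aestronglyMeasurable
    absGrowth_one (by positivity) (by linarith [k.hs.1]) x hε (by positivity)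
    (.of_forall fun y _ _ => by
      rw [rpow_zero, mul_one]
      simp
      rcases lt_or_ge ‖y - x‖ ρ with hh | hh
      · exact (abs_linPart_le ρ V _).trans (by gcongr)
      · rw [linPart_of_le hh, abs_zero]; positivity)).1
  simp only [mul_one] at h1
  exact h1.mono_set fun y (hy : ε < ‖x - y‖) => (norm_sub_rev x y ▸ hy).le

lemma integral_linPart (hK : IsKernel s lam Lam K) (ρ : ℝ) (V x : Pt m) (ε : ℝ) :
    ∫ y in 𝔽 x ε, linPart ρ V (y - x) * K (y - x) = 0 := by
  rw [integral_trunc_translate (fun h => linPart ρ V h * K h),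
    ← integral_indicator (measurableSet_norm_gt ε)]
  set G := {h : Pt m | ε < ‖h‖}.indicator fun h => linPart ρ V h * K h with hG
  have hodd : ∀ h, G (-h) = -G h := by
    intro h
    rw [hG]
    simp only [indicator, mem_ofPred_eq, norm_neg, linPart_neg, hK.neg]
    split_ifs <;> ring
  have h1 := integral_neg_eq_self G volume
  simp only [hodd] at h1
  rw [integral_neg] at h1
  linarith

/-- The increment of `f` against `p`, with the odd part subtracted. -/
def oddRem (ρ : ℝ) (K p f : Pt m → ℝ) (v : Pt m → Pt m) (x y : Pt m) : ℝ :=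
  ((f x - f y) * p y + p x * linPart ρ (v x) (y - x)) * K (y - x)

lemma trunc_eq_oddRem (k : Ker s lam Lam K) (hρ : 0 < ρ) {v : Pt m → Pt m}
    (hE : Integrable (oddRem ρ K p f v x)) (hε : 0 < ε) :
    IntegrableOn (fun y => (f x - f y) * (p y * K (x - y))) (𝔽 x ε) ∧
    𝓣 K p f x ε = ∫ y in 𝔽 x ε, oddRem ρ K p f v x y := by
  have h1 := (integrableOn_linPart k hρ (v x) x hε).const_mul (p x)
  have e : ∀ y, (f x - f y) * (p y * K (x - y)) =
      oddRem ρ K p f v x y - p x * (linPart ρ (v x) (y - x) * K (y - x)) := by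
    intro y
    rw [oddRem, k.hK.symm_sub x y]
    ring
  simp only [e]
  refine ⟨hE.integrableOn.sub h1, ?_⟩
  rw [integral_sub hE.integrableOn h1, integral_const_mul, integral_linPart k.hK, mul_zero, sub_zero]

lemma boundary_term_eq_zero {μ : Measure (Pt m)} (hB : MeasurableSet B)
    (h : ∀ z ∈ frontier Ω, η z = 0) (β : Pt m → ℝ) :
    IntegrableOn (fun z => η z * β z) (frontier Ω ∩ B) μ ∧
      ∫ z in frontier Ω ∩ B, η z * β z ∂μ = 0 := by
  have hz : EqOn (fun z => η z * β z) 0 (frontier Ω ∩ B) := fun z hz => by simp [h z hz.1]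
  have hm := (isClosed_frontier (s := Ω)).measurableSet.inter hB
  rw [integrableOn_congr_fun hz hm, setIntegral_congr_fun hm hz]
  exact ⟨integrableOn_zero, integral_zero _ _⟩

namespace InteriorModel

variable {v : Pt m → Pt m}

variable (h : InteriorModel x0 s ρ M ϱ Cp p f v)
include h

lemma ball_near (hx : x ∈ ball x0 ρ) (hy : ‖y - x‖ < ρ) : y ∈ ball x0 (2 * ρ) := by
  rw [mem_ball_iff_norm] at hx ⊢
  rw [show y - x0 = (y - x) + (x - x0) by abel]
  linarith [norm_add_le (y - x) (x - x0)]

lemma exists_oddRem_bound (k : Ker s lam Lam K) (hϱ : 2 * s < ϱ) :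
    ∃ B ≥ 0, ∀ x ∈ ball x0 ρ, Integrable (oddRem ρ K p f v x) ∧
      ∫ y, |oddRem ρ K p f v x y| ≤ B := by
  have hM := h.M_nonneg
  have hρ := h.radius
  obtain ⟨B1, hB1, h1⟩ := exists_weighted_bound k h.measurable_p h.growth_p
    (q := 1) hρ (by linarith [k.hs.1]) hϱ hM hM
  obtain ⟨B2, hB2⟩ : ∃ B2, M * M * Lam * ((volume (ball (0 : Pt m) 1)).toNNReal *
    ((|2 - (m + 1) - 2 * s| / (2 - (m + 1) - 2 * s + (m + 1)) + 1) *
      ρ ^ (2 - (m + 1) - 2 * s + (m + 1)))) = B2 := ⟨_, rfl⟩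
  have key : ∀ x ∈ ball x0 ρ, Integrable (oddRem ρ K p f v x) ∧
      ∫ y, |oddRem ρ K p f v x y| ≤ B1 + B2 := by
    intro x hx
    have hl :=
      (measurable_linPart ρ (v x)).comp (measurable_id.sub_const x)
    have hRm : AEStronglyMeasurable (fun y => f y - f x - linPart ρ (v x) (y - x)) volume :=
      (h.aesm.sub aestronglyMeasurable_const).sub hl.aestronglyMeasurable
    obtain ⟨i1, j1⟩ := h1 x 1 one_pos _ hRm (fun y hy => by
        rw [mul_one] at hy
        rw [one_rpow, mul_one]
        exact h.p_le y (h.ball_near hx hy))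
      (.of_forall fun y hy _ => by
        rw [mul_one] at hy
        rw [one_rpow, mul_one, linPart_of_lt hy]
        exact h.near x hx y hy)
      ((h.incr x hx).mono fun y hy hfar hpy => by
        rw [mul_one] at hfar
        rw [linPart_of_le hfar, sub_zero, rpow_one]
        exact hy hpy)
    rw [one_rpow, mul_one] at j1
    have hpm := h.measurable_p
    obtain ⟨i2, j2⟩ := kernel_near_bound
      (R := fun y => linPart ρ (v x) (y - x) * (p y - p x)) (q := 2) (M := M * M) k
      measurable_const (hl.mul (hpm.sub_const (p x))).aestronglyMeasurable absGrowth_one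
      (by linarith [k.hs.2]) x hρ (by positivity)
      (.of_forall fun y hy _ => by
        rw [abs_mul]
        calc |linPart ρ (v x) (y - x)| * |p y - p x| ≤ (M * ‖y - x‖) * (M * ‖y - x‖) := by
              gcongr
              · exact (abs_linPart_le _ _ _).trans (by gcongr; exact h.norm_v x hx)
              · exact h.p_lip x hx y hy
          _ = _ := by rw [rpow_two]; ring)
    simp only [mul_one] at i2 j2
    rw [hB2] at j2
    have hS : MeasurableSet {y : Pt m | ‖y - x‖ < ρ} := measurableSet_lt (by fun_prop) measurable_const
    have hsuppz : ∀ y, y ∉ {y : Pt m | ‖y - x‖ < ρ} →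
        linPart ρ (v x) (y - x) * (p y - p x) * K (y - x) = 0 := by
      intro y hy
      rw [linPart_of_le (not_lt.1 hy), zero_mul, zero_mul]
    have i3 :=
      (integrableOn_iff_integrable_of_support_subset fun y hy => by
        by_contra hn
        exact hy (hsuppz y hn)).1 i2
    have j3 : ∫ y, |linPart ρ (v x) (y - x) * (p y - p x) * K (y - x)| ≤ B2 := by
      rw [← setIntegral_eq_integral_of_forall_compl_eq_zero
        fun y hy => by rw [hsuppz y hy, abs_zero]]
      exact j2
    have e : ∀ y, oddRem ρ K p f v x y = -((f y - f x - linPart ρ (v x) (y - x)) * p y * K (y - x)) -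
          linPart ρ (v x) (y - x) * (p y - p x) * K (y - x) := fun y => by rw [oddRem]; ring
    have hi :=
      (i1.neg.sub i3).congr (.of_forall fun y => (e y).symm)
    refine ⟨hi, ?_⟩
    calc ∫ y, |oddRem ρ K p f v x y|
        ≤ ∫ y, (|(f y - f x - linPart ρ (v x) (y - x)) * p y * K (y - x)| +
            |linPart ρ (v x) (y - x) * (p y - p x) * K (y - x)|) := by
          refine integral_mono hi.abs (i1.abs.add i3.abs) fun y => ?_
          simp only [e y]
          refine (abs_sub _ _).trans ?_
          rw [abs_neg]
      _ ≤ B1 + B2 := by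
          rw [integral_add i1.abs i3.abs]
          exact add_le_add j1 j3
  refine ⟨B1 + B2, ?_, key⟩
  exact (integral_nonneg fun y => abs_nonneg _).trans (key x0 (mem_ball_self hρ)).2

lemma opExists (k : Ker s lam Lam K) (hE : Integrable (oddRem ρ K p f v x)) :
    OpExists (pairKernel K p) f x ∧
      op (pairKernel K p) f x = p x * (2 * ∫ y, oddRem ρ K p f v x y) := by
  refine opExists_pairKernel (fun _ hε => (trunc_eq_oddRem k h.radius hE hε).1) ?_
  refine ((tendsto_setIntegral_trunc hE x).const_mul 2).congr_within fun ε hε => ?_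
  rw [(trunc_eq_oddRem k h.radius hE hε).2]

/-- The integration by parts formula in the interior. -/
theorem green (k : Ker s lam Lam K) (hϱ : 2 * s < ϱ) (hB : MeasurableSet B) (hΩ : Disjoint (frontier Ω) (ball x0 ρ))
    (β : Pt m → ℝ) (hη : ContDiff ℝ ∞ η) (hηc : HasCompactSupport η)
    (hsupp : tsupport η ⊆ ball x0 ρ) : Green Ω B K p f β η := by
  have hM := h.M_nonneg
  have hρ := h.radius
  obtain ⟨Cη, hCη, b1, -, -, -⟩ := exists_test_bounds hη hηc
  have hη0 : ∀ x, x ∉ ball x0 ρ → η x = 0 := fun x hx =>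
    image_eq_zero_of_notMem_tsupport fun h' => hx (hsupp h')
  obtain ⟨Bm, hBm, hE⟩ := h.exists_oddRem_bound k hϱ
  have hi := integrableOn_ball_of_growth h.measurable_p h.growth_p x0 hρ
  have hincr := fun x hx (_ : p x ≠ 0) => h.incr x hx
  have hP := integrable_energy k
    h.measurable_p h.growth_p h.aesm hη hηc measurableSet_ball hη0 hρ
    hM hM (fun x hx _ => ⟨one_pos, fun y hy => by
      rw [mul_one] at hy
      rw [one_rpow, mul_one]
      exact h.p_le y (h.ball_near hx hy)⟩) hincr
    (fun r _ => by simp; exact hi.abs)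
  have hQ := fun ε (hε : ε > 0) => integrableOn_trunc_energy k h.measurable_p
    h.growth_p h.aesm hη.continuous b1 measurableSet_ball hη0 hM hincr hi hε
  set g : Pt m → ℝ := (ball x0 ρ).indicator (fun _ => Cη * M * (2 * Bm)) with hg
  have hgi : Integrable g := by
    rw [hg, integrable_indicator_iff measurableSet_ball]
    exact integrableOn_const measure_ball_lt_top.ne
  have hsub : ball x0 ρ ⊆ ball x0 (2 * ρ) := ball_subset_ball (by linarith)
  obtain ⟨r1, r2⟩ := integral_by_parts_of_remainder k hP hQ (b := fun _ _ => 0)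
    (B := 0) (fun _ _ => integrable_zero _ _ _) (by simp) hgi
    (fun x => indicator_nonneg (fun _ _ => by have := h.M_nonneg; positivity) x)
    (fun x hx => (hE x hx).1) (fun x hx => by
      rw [hg, indicator_of_mem hx]
      gcongr
      exacts [b1 x, h.p_le x (hsub hx), (hE x hx).2])
    (fun x hx => (h.opExists k (hE x hx).1).2)
    (fun x hx ε hε => by rw [add_zero, (trunc_eq_oddRem k hρ (hE x hx).1 hε).2])
    fun x hx => ⟨by rw [hη0 x hx, zero_mul], fun _ => rfl⟩
  obtain ⟨hb1, hb2⟩ := boundary_term_eq_zero hB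
    (fun z hz => hη0 z fun h' => hΩ.le_bot ⟨hz, h'⟩) β
  exact ⟨hP, r1, hb1, by rw [r2, hb2]⟩

end InteriorModel

/-- The integration by parts formula outside `Ω`. -/
lemma green_of_weight_eq_zero (hB : MeasurableSet B) {β : Pt m → ℝ}
    (hp : ∀ x ∈ tsupport η, p x = 0) (hβ : ∀ x ∈ tsupport η, x ∉ frontier Ω) :
    Green Ω B K p f β η := by
  have h0 : ∀ x, η x * p x = 0 := fun x => by
    by_cases hx : x ∈ tsupport η
    · rw [hp x hx, mul_zero]
    · rw [image_eq_zero_of_notMem_tsupport hx, zero_mul]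
  have e1 : ∀ z : Pt m × Pt m, 𝓔 K p f η z = 0 := fun z => by
    have h1 := h0 z.1
    have h2 := h0 z.2
    linear_combination (f z.1 - f z.2) * p z.2 * K (z.1 - z.2) * h1 -
      (f z.1 - f z.2) * p z.1 * K (z.1 - z.2) * h2
  have e2 : ∀ x, η x * op (pairKernel K p) f x = 0 := fun x => by
    rcases mul_eq_zero.1 (h0 x) with h | h
    · rw [h, zero_mul]
    · rw [(op_pairKernel_of_eq_zero h).2, mul_zero]
  obtain ⟨hb1, hb2⟩ := boundary_term_eq_zero hB
    (fun z hz => image_eq_zero_of_notMem_tsupport fun h' => hβ z h' hz) β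
  refine ⟨?_, ?_, hb1, ?_⟩
  · simp only [e1]; exact integrable_zero _ _ _
  · simp only [e2]; exact integrable_zero _ _ _
  · simp only [e1, e2, hb2]
    simp

lemma measurable_indicator_of_continuousOn {F : Type*} [TopologicalSpace F] [MeasurableSpace F]
    [BorelSpace F] [Zero F] {V : Set (Pt m)} (hV : IsOpen V) {f : Pt m → F} (hf : ContinuousOn f V) :
    Measurable (V.indicator f) := by
  classical
  rw [← piecewise_eq_indicator]
  exact hf.measurable_piecewise continuousOn_const hV.measurableSet

lemma AbsGrowth.of_le_mul {g : Pt m → ℝ} (hg : AbsGrowth g C A) (hM : 0 ≤ M)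
    (h : ∀ y, |f y| ≤ M * |g y|) : AbsGrowth f (M.toNNReal * C) A := by
  refine (GrowthBound.const_mul hg M.toNNReal).mono fun y => ?_
  rw [← ofReal, ← ofReal_mul hM]
  exact ofReal_le_ofReal (h y)

/-- First-order expansion of a function that is `C^{1,δ}` up to the boundary, extended by zero. -/
lemma EpiChart.taylor_indicator (c : EpiChart Ω x0) (hδ : 0 < δ)
    (hd : ∀ z ∈ Ω ∩ ball x0 c.r, DifferentiableAt ℝ d z) {Cd : ℝ} (hCd : 0 ≤ Cd)
    (hC1 : 0 ≤ C1)
    (hH : ∀ z ∈ Ω ∩ ball x0 c.r, ∀ w ∈ Ω ∩ ball x0 c.r,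
      ‖fderiv ℝ d z - fderiv ℝ d w‖ ≤ Cd * ‖z - w‖ ^ δ)
    (hpos : ∀ z ∈ Ω, 0 < d z)
    (hle : ∀ z ∈ Ω ∩ ball x0 c.r1, d z ≤ C1 * c.height z) (hρ : 0 < ρ) (hρ1 : ρ ≤ 1 / 2)
    (hρc : (2 * c.Λ + 4) * ρ ≤ c.r1)
    (he : ∀ z ∈ Ω ∩ ball x0 ρ, 0 ≤ inner ℝ (gradient d z) c.e) (hx : x ∈ Ω ∩ ball x0 ρ) (hy : y ∈ ball x0 ρ) :
    |(Ω ∩ ball x0 ρ).indicator d y - max (d x + inner ℝ (gradient d x) (y - x)) 0| ≤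
      (C1 + Cd * (2 * c.Λ + 1) ^ (1 + δ) * (c.Λ + 2) ^ (1 + δ)) * ‖y - x‖ ^ (1 + δ) := by
  have hM := c.one_le_Λ
  have hρr : ρ ≤ c.r1 := by nlinarith
  have hsub : ball x0 ρ ⊆ ball x0 c.r1 := ball_subset_ball hρr
  have hx1 : x ∈ Ω ∩ ball x0 c.r1 := ⟨hx.1, hsub hx.2⟩
  set Ct := Cd * (2 * c.Λ + 1) ^ (1 + δ) with hCt
  have hCt0 : 0 ≤ Ct := by positivity
  have hM2 : 1 ≤ (c.Λ + 2) ^ (1 + δ) := one_le_rpow (by linarith) (by linarith)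
  have hT : ∀ z ∈ Ω ∩ ball x0 c.r1,
      |d z - (d x + inner ℝ (gradient d x) (z - x))| ≤ Ct * ‖z - x‖ ^ (1 + δ) := by
    intro z hz
    have := c.path_holder hd hδ hCd hH hx1 hz
    rwa [norm_eq_abs, ← inner_gradient, sub_sub] at this
  have hn := norm_nonneg (y - x)
  set t := ‖y - x‖ with ht
  have ht0 : 0 ≤ t ^ (1 + δ) := by positivity
  by_cases hyΩ : y ∈ Ω
  · rw [indicator_of_mem (show y ∈ Ω ∩ ball x0 ρ from ⟨hyΩ, hy⟩)]
    have h1 := hT y ⟨hyΩ, hsub hy⟩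
    have h2 := (max_eq_left (hpos y hyΩ).le).symm
    rw [h2]
    refine (abs_max_sub_max_le_abs _ _ _).trans (h1.trans ?_)
    gcongr
    nlinarith
  · rw [indicator_of_notMem (fun h' => hyΩ h'.1), zero_sub, abs_neg, abs_of_nonneg (le_max_right _ _)]
    refine max_le ?_ (by positivity)
    have hxr := c.ball_subset hx1.2
    have hyr := c.ball_subset (hsub hy)
    have hyh : c.height y ≤ 0 := by
      rw [c.mem_iff_height hyr, not_lt] at hyΩ
      exact hyΩ
    have hxh := (c.mem_iff_height hxr).1 hx.1
    have htpos : 0 < t := by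
      refine norm_pos_iff.2 (sub_ne_zero.2 ?_)
      rintro rfl
      exact hyΩ hx.1
    have hyx : -c.height y ≤ c.Λ * t := by
      have := c.abs_height_sub_le hyr hxr
      have h2 := (abs_le.1 this).1
      change _ ≤ (1 + (c.L : ℝ)) * _
      linarith
    have ht1 : t ≤ 2 * ρ := by
      rw [ht, show y - x = (y - x0) - (x - x0) by abel]
      have h1 := mem_ball_iff_norm.1 hx.2
      have h2 := mem_ball_iff_norm.1 hy
      linarith [norm_sub_le (y - x0) (x - x0)]
    have htt : t ^ (1 + δ) ≤ t := by
      have := rpow_le_rpow_of_exponent_ge htpos (by linarith) (show 1 ≤ 1 + δ by linarith)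
      rwa [rpow_one] at this
    set τ := -c.height y + t ^ (1 + δ) with hτ
    have hτ0 : 0 ≤ τ := by rw [hτ]; linarith
    have hτle : τ ≤ (c.Λ + 1) * t := by rw [hτ]; linarith
    set z := y + τ • c.e with hz
    have hzy : ‖z - y‖ ≤ (c.Λ + 1) * t := by
      rw [hz, add_sub_cancel_left, norm_smul, c.norm_e, mul_one, norm_of_nonneg hτ0]
      exact hτle
    have hzx : ‖z - x‖ ≤ (c.Λ + 2) * t := by
      rw [show z - x = (z - y) + (y - x) by abel]
      refine (norm_add_le _ _).trans ?_
      linarith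
    have hzb : z ∈ ball x0 c.r1 := by
      rw [mem_ball_iff_norm, show z - x0 = (z - y) + (y - x0) by abel]
      have h2 := mem_ball_iff_norm.1 hy
      refine (norm_add_le _ _).trans_lt ?_
      nlinarith
    have hzh : c.height z = t ^ (1 + δ) := by
      rw [hz, c.height_add_e, hτ]; ring
    have hzΩ := (c.mem_iff_height (c.ball_subset hzb)).2 (by rw [hzh]; positivity)
    have h1 := (abs_le.1 (hT z ⟨hzΩ, hzb⟩)).1
    have h2 := hle z ⟨hzΩ, hzb⟩
    rw [hzh] at h2
    have h3 : inner ℝ (gradient d x) (z - x) =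
        inner ℝ (gradient d x) (y - x) + τ * inner ℝ (gradient d x) c.e := by
      rw [hz, show y + τ • c.e - x = (y - x) + τ • c.e by abel, inner_add_right,
        real_inner_smul_right]
    have h4 := mul_nonneg hτ0 (he x hx)
    have h5 : Ct * ‖z - x‖ ^ (1 + δ) ≤ Ct * ((c.Λ + 2) ^ (1 + δ) * t ^ (1 + δ)) := by
      rw [← mul_rpow (by linarith) hn]
      gcongr
    rw [add_mul, mul_assoc]
    linarith

/-- The data of the problem in a general domain. -/
structure DomainData (s α δ : ℝ) (Ω B : Set (Pt m)) (d w u : Pt m → ℝ) : Prop where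
  s_mem : s ∈ Ioo (0 : ℝ) 1
  α_mem : α ∈ Ioo 0 s
  δ_mem : δ ∈ Ioo (0 : ℝ) 1
  isOpen : IsOpen Ω
  isOpen_B : IsOpen B
  boundary : BoundaryC1Holder δ Ω B
  dist : IsRegDist δ Ω B d
  w_mem : HolderWeighted (1 + α + 2 * s) (1 + α) w Ω B
  w_bdd : MemLp w ⊤ volume
  u_mem : HolderCompact (1 + δ) (fun x => d x ^ (1 - s) • gradient u x) Ω B

/-- The quotient `∂_n u / d^{s-1}`. -/
def flux (s : ℝ) (d u : Pt m → ℝ) (x : Pt m) : ℝ := lastC (d x ^ (1 - s) • gradient u x)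

lemma continuousOn_gradient {V : Set (Pt m)} (h : ContinuousOn (fderiv ℝ f) V) :
    ContinuousOn (gradient f) V :=
  (InnerProductSpace.toDual ℝ _).symm.continuous.comp_continuousOn h

namespace DomainData

variable (H : DomainData s α δ Ω B d w u)
include H

lemma dn_eq (hx : x ∈ Ω) : dn Ω u x = flux s d u x * posPow s (d x) := by
  have hd := H.dist.pos x hx
  rw [dn, indicator_of_mem hx, flux, lastC_smul, posPow_of_pos hd, mul_right_comm,
    ← rpow_add hd, show 1 - s + (s - 1) = 0 by ring, rpow_zero, one_mul]

lemma flux_eq (hx : x ∈ Ω) : flux s d u x = lastC (gradient u x) / d x ^ (s - 1) := by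
  have hd := H.dist.pos x hx
  rw [flux, lastC_smul, div_eq_mul_inv, ← rpow_neg hd.le, neg_sub, mul_comm]

lemma α_mem' : 0 < α ∧ α ≤ 1 :=
  ⟨H.α_mem.1, by linarith [H.α_mem.2, H.s_mem.2]⟩

lemma continuousOn_flux : ContinuousOn (flux s d u) (Ω ∩ B) := by
  obtain ⟨hd, -⟩ := H.u_mem.1.exists_bounds H.δ_mem.1 H.δ_mem.2.le (H.isOpen.inter H.isOpen_B)
  exact fun x hx => (continuous_lastC.continuousAt.comp (hd x hx).continuousAt).continuousWithinAt

lemma continuousOn_d : ContinuousOn d (Ω ∩ B) :=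
  H.dist.smooth.continuousOn

lemma exists_chart (hx : x0 ∈ frontier Ω ∩ B) : ∃ c : EpiChart Ω x0, ball x0 c.r ⊆ B := by
  obtain ⟨r, hr, hrB⟩ := isOpen_iff.1 H.isOpen_B x0 hx.2
  obtain ⟨c, hc⟩ := exists_epiChart H.δ_mem.1 H.isOpen H.boundary hx hr
  exact ⟨c, (ball_subset_ball hc).trans hrB⟩

/-- The regularized distance in a chart. -/
lemma exists_comparable (c : EpiChart Ω x0)
    (hcB : ball x0 c.r ⊆ B) : ∃ c1 > 0, ∃ C1 > 0, ∀ x ∈ Ω ∩ ball x0 c.r1,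
      c1 * c.height x ≤ d x ∧ d x ≤ C1 * c.height x ∧
      d x ≤ C1 * infDist x (frontier Ω) := by
  obtain ⟨Cc, hCc, hcomp⟩ := H.dist.comparable
  have hM := c.one_le_Λ
  refine ⟨Cc⁻¹ * c.Λ⁻¹, by positivity, Cc, hCc, fun x hx => ?_⟩
  obtain ⟨h1, h2⟩ := hcomp x ⟨hx.1, hcB (c.ball_subset hx.2)⟩
  have h3 := c.infDist_le H.isOpen hx
  have h4 := c.le_infDist H.isOpen hx
  refine ⟨?_, h2.trans (by gcongr), h2⟩
  refine le_trans ?_ h1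
  rw [mul_assoc]
  gcongr
  rw [inv_mul_le_iff₀ (by linarith)]
  exact h4

/-- The gradient of the regularized distance near a boundary point. -/
lemma exists_gradient_bounds (hx : x0 ∈ frontier Ω ∩ B)
    (c : EpiChart Ω x0) : ∃ ρ > 0, ∀ x ∈ Ω ∩ ball x0 ρ,
      1 / 2 ≤ ‖gradient d x‖ ∧ 0 ≤ inner ℝ (gradient d x) c.e := by
  obtain ⟨h1, h2, -⟩ := H.dist.boundary ⟨H.δ_mem.1, H.δ_mem.2.le⟩ H.isOpen H.isOpen_B H.boundary hx
  have hn : 0 < inner ℝ (innerNormal Ω x0) c.e := by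
    rw [c.innerNormal_eq H.isOpen (mem_ball_self c.r_pos) hx.1, c.inner_nu_e]
    exact inv_pos.2 (c.jac_pos _)
  have e1 := (h2.norm.eventually_const_lt (show (1 / 2 : ℝ) < _ by rw [h1.1]; norm_num))
  have e2 := ((h2.inner (tendsto_const_nhds)).eventually_const_lt hn)
  obtain ⟨ρ, hρ, h⟩ := mem_nhdsWithin_iff.1 (e1.and e2)
  exact ⟨ρ, hρ, fun x hx => ⟨(h ⟨hx.2, hx.1⟩).1.le, (h ⟨hx.2, hx.1⟩).2.le⟩⟩

lemma flux_sub_le (x y : Pt m) :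
    |flux s d u y - flux s d u x| ≤
      ‖d y ^ (1 - s) • gradient u y - d x ^ (1 - s) • gradient u x‖ := by
  rw [flux, flux, ← lastC_sub]
  exact abs_lastC_le _

/-- The model of `∂_n u` near a boundary point. -/
lemma exists_boundaryModel (hx : x0 ∈ frontier Ω ∩ B) (c : EpiChart Ω x0) (hcB : ball x0 c.r ⊆ B) :
    ∃ ρ C c1 C1 : ℝ, ρ ≤ c.r1 ∧ 0 < c1 ∧ 0 < C1 ∧ (∀ x ∈ Ω ∩ ball x0 ρ,
      c1 * c.height x ≤ d x ∧ d x ≤ C1 * c.height x ∧ d x ≤ C1 * infDist x (frontier Ω)) ∧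
      0 < ρ ∧ (∃ C' : ℝ≥0, AbsGrowth ((ball x0 ρ).indicator (dn Ω u)) C' (m + s)) ∧
      ∀ Cp : ℝ≥0, Measurable (dn Ω u) → AbsGrowth (dn Ω u) Cp (m + s) →
        BoundaryModel Ω x0 s δ ρ (1 / 2) C Cp d (flux s d u) (dn Ω u) (gradient d) := by
  have hs := H.s_mem
  have hM := c.one_le_Λ
  have hr1 := c.r₁_pos
  have hU := H.isOpen.inter H.isOpen_B
  have hsubB : Ω ∩ ball x0 c.r ⊆ Ω ∩ B := inter_subset_inter_right _ hcB
  obtain ⟨hd1, hd2, Cd, hCd, hd3, hd4, hd5⟩ :=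
    H.dist.holder.exists_bounds H.δ_mem.1 H.δ_mem.2.le hU
  obtain ⟨hu1, -, Cu, hCu, hu3, hu4, -⟩ := H.u_mem.1.exists_bounds H.δ_mem.1 H.δ_mem.2.le hU
  obtain ⟨c1, hc1, C1, hC1, hcomp⟩ := H.exists_comparable c hcB
  obtain ⟨ρ0, hρ0, hgrad⟩ := H.exists_gradient_bounds hx c
  obtain ⟨ρ, hρdef⟩ : ∃ ρ, ρ = min (min (1 / 2) ρ0) (min (c.r1 / (2 * c.Λ + 4)) (1 / (C1 * c.Λ))) :=
    ⟨_, rfl⟩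
  have hρ : 0 < ρ := by
    rw [hρdef]
    exact lt_min (lt_min (by norm_num) hρ0) (lt_min (by positivity) (by positivity))
  have hρ1 := hρdef ▸ (min_le_left _ _).trans (min_le_left _ _)
  have hρ2 := hρdef ▸ (min_le_left _ _).trans (min_le_right _ _)
  have hρ3 : (2 * c.Λ + 4) * ρ ≤ c.r1 := by
    rw [mul_comm, ← le_div_iff₀ (by positivity)]
    exact hρdef ▸ (min_le_right _ _).trans (min_le_left _ _)
  have hρ4 : C1 * c.Λ * ρ ≤ 1 := by
    rw [mul_comm, ← le_div_iff₀ (by positivity)]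
    exact hρdef ▸ (min_le_right _ _).trans (min_le_right _ _)
  have hρr : ρ ≤ c.r1 := by nlinarith
  have hsub1 : ball x0 ρ ⊆ ball x0 c.r1 := ball_subset_ball hρr
  have hsub : Ω ∩ ball x0 ρ ⊆ Ω ∩ B :=
    fun z hz => ⟨hz.1, hcB (c.ball_subset (hsub1 hz.2))⟩
  have hsubr : Ω ∩ ball x0 ρ ⊆ Ω ∩ ball x0 c.r1 := inter_subset_inter_right _ hsub1
  have hVo : IsOpen (Ω ∩ ball x0 ρ) := H.isOpen.inter isOpen_ball
  have hdle : ∀ x ∈ Ω ∩ ball x0 ρ, d x ≤ 1 := by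
    intro x hx
    have h1 := (hcomp x (hsubr hx)).2.1
    have h2 := c.abs_height_le (c.ball_subset (hsub1 hx.2))
    have h3 : c.height x ≤ c.Λ * ρ := by
      refine (le_abs_self _).trans (h2.trans ?_)
      change c.Λ * _ ≤ _
      have := (mem_ball_iff_norm.1 hx.2).le
      gcongr
    calc d x ≤ C1 * c.height x := h1
      _ ≤ C1 * (c.Λ * ρ) := by gcongr
      _ ≤ 1 := by rwa [← mul_assoc]
  have hcutm :=
    measurable_indicator_of_continuousOn hVo (H.continuousOn_d.mono hsub)
  have hgrowth : ∀ a ∈ Ioc 0 1, ∃ C : ℝ≥0,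
      AbsGrowth (fun y => posPow a ((Ω ∩ ball x0 ρ).indicator d y)) C (m + a) := by
    intro a ha
    have hg : AbsGrowth (fun y => posPow a (c.height y)) (fiberConst m a) (m + a) := by
      unfold AbsGrowth
      simp_rw [abs_of_nonneg (posPow_nonneg _ _)]
      exact growthBound_graph ha.1 ha.2 c.A c.contDiff.continuous.measurable
    refine ⟨_, hg.of_le_mul (M := c1 ^ (a - 1)) (by positivity) fun y => ?_⟩
    rw [abs_of_nonneg (posPow_nonneg _ _), abs_of_nonneg (posPow_nonneg _ _)]
    by_cases hy : y ∈ Ω ∩ ball x0 ρ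
    · rw [indicator_of_mem hy, ← posPow_mul hc1]
      have hh := (c.mem_iff_height (c.ball_subset (hsub1 hy.2))).1 hy.1
      rw [posPow_of_pos (H.dist.pos y hy.1), posPow_of_pos (by positivity)]
      exact rpow_le_rpow_of_nonpos (by positivity) (hcomp y (hsubr hy)).1 (by linarith [ha.2])
    · rw [indicator_of_notMem hy, posPow_of_nonpos le_rfl]
      exact mul_nonneg (by positivity) (posPow_nonneg _ _)
  have hfl := fun x hx =>
    (abs_lastC_le _).trans (hu3 x (hsub hx))
  obtain ⟨Ct, hCt⟩ : ∃ Ct, Ct = C1 + Cd * (2 * c.Λ + 1) ^ (1 + δ) * (c.Λ + 2) ^ (1 + δ) := ⟨_, rfl⟩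
  have hCt0 : 0 ≤ Ct := by rw [hCt]; positivity
  refine ⟨ρ, 1 + Cd + Cu + Cu * (2 * c.Λ + 1) + Ct, c1, C1, hρr, hc1, hC1,
    fun x hx => hcomp x (hsubr hx), hρ, ?_, fun Cp hpm hpg => ?_⟩
  · obtain ⟨C', hC'⟩ := hgrowth s ⟨hs.1, hs.2.le⟩
    refine ⟨_, hC'.of_le_mul hCu fun y => ?_⟩
    by_cases hy : y ∈ Ω ∩ ball x0 ρ
    · rw [indicator_of_mem hy.2, indicator_of_mem hy, H.dn_eq hy.1, abs_mul]
      gcongr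
      exact hfl y hy
    · have : (ball x0 ρ).indicator (dn Ω u) y = 0 := by
        by_cases hyb : y ∈ ball x0 ρ
        · rw [indicator_of_mem hyb, dn, indicator_of_notMem fun h' => hy ⟨h', hyb⟩]
        · exact indicator_of_notMem hyb _
      rw [this, abs_zero]
      positivity
  · have hcu : 0 ≤ Cu * (2 * c.Λ + 1) := by positivity
    refine ⟨⟨hρ, hρ1⟩, by linarith, by norm_num, fun x hx => ⟨H.dist.pos x hx.1, hdle x hx⟩,
      fun x hx => ⟨(hgrad x ⟨hx.1, ball_subset_ball hρ2 hx.2⟩).1, ?_⟩, fun x hx y hy => ?_,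
      fun x hx => (hfl x hx).trans (by linarith), fun x hx y hy => ?_,
      fun x hx => H.dn_eq hx.1, fun x hx => indicator_of_notMem hx _, hpm, hpg, hcutm, hgrowth⟩
    · rw [norm_gradient]
      exact (hd4 x (hsub hx)).trans (by linarith)
    · refine (c.taylor_indicator H.δ_mem.1 (fun z hz => hd1 z (hsubB hz)) hCd hC1.le
        (fun z hz w hw => hd5 z (hsubB hz) w (hsubB hw)) H.dist.pos (fun z hz => (hcomp z hz).2.1)
        hρ hρ1 hρ3 (fun z hz => (hgrad z ⟨hz.1, ball_subset_ball hρ2 hz.2⟩).2) hx hy).trans ?_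
      rw [← hCt]
      gcongr
      linarith
    · refine (H.flux_sub_le x y).trans ((c.path_lipschitz (fun z hz => hu1 z (hsubB hz))
        (fun z hz => hu4 z (hsubB hz)) (hsubr hx) (hsubr hy)).trans ?_)
      rw [← mul_assoc]
      gcongr
      linarith

end DomainData

lemma absGrowth_ball_indicator (hs : s ∈ Ioo 0 1) (hρ : 0 < ρ)
    (hM : 0 ≤ M) (hp : ∀ y ∈ ball z ρ, |p y| ≤ M) :
    ∃ C : ℝ≥0, AbsGrowth ((ball z ρ).indicator p) C (m + s) := by
  refine ⟨_, (absGrowth_affine hs.1 hs.2.le one_pos norm_eN.ge (ρ - inner ℝ (eN m) z)).of_le_mul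
    (M := M * ((2 * ρ) ^ (s - 1))⁻¹) (by positivity) fun y => ?_⟩
  rw [abs_of_nonneg (posPow_nonneg _ _)]
  by_cases hy : y ∈ ball z ρ
  · have h1 : |inner ℝ (eN m) (y - z)| < ρ :=
      (abs_real_inner_le_norm _ _).trans_lt (by rw [norm_eN, one_mul]; exact mem_ball_iff_norm.1 hy)
    have h2 : ρ - inner ℝ (eN m) z + inner ℝ (eN m) y = ρ + inner ℝ (eN m) (y - z) := by
      rw [inner_sub_right]; ring
    obtain ⟨h3, h4⟩ := abs_lt.1 h1
    rw [indicator_of_mem hy, h2, posPow_of_pos (by linarith), mul_assoc]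
    refine (hp y hy).trans (le_mul_of_one_le_right hM ?_)
    rw [← div_eq_inv_mul, one_le_div (by positivity)]
    exact rpow_le_rpow_of_nonpos (by linarith) (by linarith) (by linarith [hs.2])
  · rw [indicator_of_notMem hy, abs_zero]
    exact mul_nonneg (by positivity) (posPow_nonneg _ _)

/-- Local `C^{1,τ}` bounds for a function of class `C^τ`. -/
lemma HolderLoc.exists_fderiv_holder (hτ : 1 < τ) {U : Set (Pt m)}
    (hU : IsOpen U) (hf : HolderLoc τ f U) (hz : z ∈ U) :
    ∃ R > 0, ball z R ⊆ U ∧ ∃ M ≥ 0, ∀ x ∈ ball z R, ∀ y ∈ ball z R,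
      ‖fderiv ℝ f x - fderiv ℝ f y‖ ≤ M * ‖x - y‖ ^ min 1 (τ - 1) := by
  obtain ⟨R0, hR0, h₀⟩ := isOpen_iff.1 hU z hz
  rcases le_or_gt τ 2 with h | h
  · obtain ⟨r, hr, C, hC⟩ := hf.2 z hz
    refine ⟨min R0 r, lt_min hR0 hr, (ball_subset_ball (min_le_left _ _)).trans h₀, max C 0,
      le_max_right _ _, fun x hx y hy => ?_⟩
    rw [min_eq_right (by linarith)]
    have hsub := ball_subset_ball (x := z) (min_le_right R0 r)
    refine (HolderSeminormLE.fderiv_le (τ := τ - 1) (by linarith) (by linarith)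
      (by rwa [add_sub_cancel]) (hsub hx) (hsub hy)).trans ?_
    gcongr
    exact le_max_left _ _
  · have h2 := le_hdeg (by exact_mod_cast h)
    have h3 : ContDiffAt ℝ 2 f z := (hf.1.of_le (by exact_mod_cast h2)).contDiffAt (hU.mem_nhds hz)
    obtain ⟨K, t, ht, hK⟩ := (h3.fderiv_right (by norm_num)).exists_lipschitzOnWith
    obtain ⟨r, hr, hrt⟩ := Metric.mem_nhds_iff.1 ht
    refine ⟨min R0 r, lt_min hR0 hr, (ball_subset_ball (min_le_left _ _)).trans h₀, K,
      K.2, fun x hx y hy => ?_⟩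
    rw [min_eq_left (by linarith), rpow_one]
    have hsub := (ball_subset_ball (min_le_right R0 r)).trans hrt
    exact hK.norm_sub_le (hsub hx) (hsub hy)

namespace DomainData

variable (H : DomainData s α δ Ω B d w u)
include H

lemma contDiffOn_dn : ContDiffOn ℝ 1 (dn Ω u) (Ω ∩ B) := by
  have h1 := H.u_mem.1.1
  rw [hdeg_one_add H.δ_mem.1 H.δ_mem.2.le] at h1
  have hl : ContDiff ℝ 1 (lastC : Pt m → ℝ) := by
    have : (lastC : Pt m → ℝ) = inner ℝ (eN m) := funext fun x => (inner_eN x).symm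
    rw [this]
    exact contDiff_const.inner ℝ contDiff_id
  have h2 : ContDiffOn ℝ 1 (flux s d u) (Ω ∩ B) := hl.comp_contDiffOn (by exact_mod_cast h1)
  have h3 : ContDiffOn ℝ 1 d (Ω ∩ B) := H.dist.smooth.of_le (by exact_mod_cast le_top)
  refine (h2.mul (h3.rpow_const_of_ne (p := s - 1) fun x hx => (H.dist.pos x hx.1).ne')).congr
    fun x hx => ?_
  rw [H.dn_eq hx.1, posPow_of_pos (H.dist.pos x hx.1)]

lemma dn_eq_zero {S : Set (Pt m)}
    (hS : ∀ x ∈ Ω, x ∉ S → d x ^ (1 - s) • gradient u x = 0) (hx : x ∉ S) :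
    dn Ω u x = 0 := by
  by_cases h : x ∈ Ω
  · rw [H.dn_eq h, flux, hS x h hx, show lastC 0 = 0 from rfl, zero_mul]
  · exact indicator_of_notMem h _

lemma measurable_dn : Measurable (dn Ω u) := by
  obtain ⟨S, -, hSB, hS⟩ := H.u_mem.2
  have h : dn Ω u = (Ω ∩ B).indicator (dn Ω u) := by
    refine (indicator_eq_self.2 (subset_inter (fun x hx => ?_) fun x hx => hSB ?_)).symm
    · exact by_contra fun h => hx (indicator_of_notMem h _)
    · exact by_contra fun h => hx (H.dn_eq_zero hS h)
  rw [h]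
  exact measurable_indicator_of_continuousOn (H.isOpen.inter H.isOpen_B) H.contDiffOn_dn.continuousOn

/-- The weight is Lipschitz near interior points. -/
lemma exists_dn_lipschitz (hz : z ∈ Ω ∩ B) : ∃ R > 0, ∃ M ≥ 0, ∀ x ∈ ball z R, |dn Ω u x| ≤ M ∧
      ∀ y ∈ ball z R, |dn Ω u y - dn Ω u x| ≤ M * ‖y - x‖ := by
  obtain ⟨K, t, ht, hK⟩ := (H.contDiffOn_dn.contDiffAt
    ((H.isOpen.inter H.isOpen_B).mem_nhds hz)).exists_lipschitzOnWith
  obtain ⟨r, hr, hrt⟩ := Metric.mem_nhds_iff.1 ht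
  have hl : ∀ x ∈ ball z r, ∀ y ∈ ball z r, |dn Ω u y - dn Ω u x| ≤ K * ‖y - x‖ :=
    fun x hx y hy => hK.norm_sub_le (hrt hy) (hrt hx)
  have hz' := mem_ball_self (x := z) hr
  refine ⟨r, hr, K + (|dn Ω u z| + K * r), by positivity, fun x hx => ⟨?_, fun y hy => ?_⟩⟩
  · have h1 := (abs_sub_abs_le_abs_sub _ _).trans (hl z hz' x hx)
    have h2 : K * ‖x - z‖ ≤ K * r := by
      have := (mem_ball_iff_norm.1 hx).le
      gcongr
    linarith
  · refine (hl x hx y hy).trans ?_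
    gcongr
    linarith [show 0 ≤ |dn Ω u z| + K * r by positivity]

lemma exists_growth_dn : ∃ C : ℝ≥0, AbsGrowth (dn Ω u) C (m + s) := by
  obtain ⟨S, hSc, hSB, hS⟩ := H.u_mem.2
  have hpm := H.measurable_dn
  have key : ∃ U : Set (Pt m), S ⊆ U ∧ MeasurableSet U ∧
      ∃ C : ℝ≥0, AbsGrowth (U.indicator (dn Ω u)) C (m + s) := by
    refine hSc.induction_on ?_ ?_ ?_ fun z hz => ?_
    · exact ⟨∅, subset_rfl, .empty, 0, fun x R hR => by simp⟩
    · rintro T T' hT ⟨U, hU, h⟩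
      exact ⟨U, hT.trans hU, h⟩
    · rintro T T' ⟨U, hU, hUm, C, hC⟩ ⟨U', hU', hUm', C', hC'⟩
      refine ⟨U ∪ U', union_subset_union hU hU', hUm.union hUm', C + C',
        .of_le_add (hpm.indicator hUm) hC hC' fun y => ?_⟩
      by_cases h : y ∈ U
      · rw [indicator_of_mem (mem_union_left _ h), indicator_of_mem h]
        exact le_add_of_nonneg_right (abs_nonneg _)
      by_cases h' : y ∈ U'
      · rw [indicator_of_mem (mem_union_right _ h'), indicator_of_mem h']
        exact le_add_of_nonneg_left (abs_nonneg _)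
      · rw [indicator_of_notMem (by simp [h, h']), abs_zero]
        positivity
    · by_cases hzc : z ∈ closure Ω
      · by_cases hzΩ : z ∈ Ω
        · obtain ⟨R, hR, M, hM, h⟩ := H.exists_dn_lipschitz ⟨hzΩ, hSB hz⟩
          exact ⟨_, mem_nhdsWithin_of_mem_nhds (ball_mem_nhds z hR), _, subset_rfl,
            measurableSet_ball,
            absGrowth_ball_indicator H.s_mem hR hM fun y hy => (h y hy).1⟩
        · have hzf : z ∈ frontier Ω ∩ B := ⟨by rw [H.isOpen.frontier_eq]; exact ⟨hzc, hzΩ⟩, hSB hz⟩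
          obtain ⟨c, hcB⟩ := H.exists_chart hzf
          obtain ⟨ρ, C, c1, C1, -, -, -, -, hρ, hg, -⟩ := H.exists_boundaryModel hzf c hcB
          exact ⟨_, mem_nhdsWithin_of_mem_nhds (ball_mem_nhds z hρ), _, subset_rfl,
            measurableSet_ball, hg⟩
      · refine ⟨(closure Ω)ᶜ, mem_nhdsWithin_of_mem_nhds (isClosed_closure.isOpen_compl.mem_nhds hzc),
          _, subset_rfl, isClosed_closure.isOpen_compl.measurableSet, 0, ?_⟩
        have : (closure Ω)ᶜ.indicator (dn Ω u) = 0 := by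
          rw [dn, indicator_indicator, (disjoint_compl_left_iff_subset.2 subset_closure).inter_eq,
            indicator_empty]
          rfl
        rw [this]
        exact fun x R hR => by simp
  obtain ⟨U, hSU, -, C, hC⟩ := key
  refine ⟨C, ?_⟩
  rwa [indicator_eq_self.2 fun x hx => hSU (by_contra fun h => hx (H.dn_eq_zero hS h))] at hC

end DomainData

lemma tendsto_extendFrom {F : Type*} [TopologicalSpace F] [T2Space F] {f : Pt m → F}
    (hz : z ∈ frontier Ω) (h : ∃ l, Tendsto f (𝓝[Ω] z) (𝓝 l)) :
    Tendsto f (𝓝[Ω] z) (𝓝 (extendFrom Ω f z)) := by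
  have := mem_closure_nhdsWithin hz
  exact _root_.tendsto_extendFrom h

/-- Taylor expansion on a ball where the derivative is Hölder continuous. -/
lemma taylor_ball (hM : 0 ≤ M) (hτ : 0 < τ) (hd : ∀ x ∈ ball z R, DifferentiableAt ℝ f x)
    (hH : ∀ x ∈ ball z R, ∀ y ∈ ball z R,
      ‖fderiv ℝ f x - fderiv ℝ f y‖ ≤ M * ‖x - y‖ ^ τ) (hx : x ∈ ball z R)
    (hy : y ∈ ball z R) :
    |f y - f x - inner ℝ (gradient f x) (y - x)| ≤ M * ‖y - x‖ ^ (1 + τ) := by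
  have hseg := (convex_ball z R).segment_subset hx hy
  have h := EpiChart.norm_segment_taylor (H := M * ‖y - x‖ ^ τ)
    (fun p hp => hd p (hseg hp)) fun p hp => (hH p (hseg hp) x hx).trans (by
      gcongr
      exact EpiChart.norm_sub_le_of_mem_segment hp (by simp) le_rfl)
  rw [inner_gradient, ← norm_eq_abs]
  refine h.trans (le_of_eq ?_)
  rcases (norm_nonneg (y - x)).eq_or_lt with h0 | h0
  · rw [← h0, mul_zero, zero_rpow (by positivity), mul_zero]
  · rw [rpow_add h0, rpow_one]; ring

namespace DomainData

variable (H : DomainData s α δ Ω B d w u)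
include H

lemma exists_flux_limit (hz : z ∈ frontier Ω ∩ B) : ∃ l, Tendsto (flux s d u) (𝓝[Ω] z) (𝓝 l) := by
  obtain ⟨c, hcB⟩ := H.exists_chart hz
  have hM := c.one_le_Λ
  obtain ⟨hu1, -, C, hC, -, hu, -⟩ :=
    H.u_mem.1.exists_bounds H.δ_mem.1 H.δ_mem.2.le (H.isOpen.inter H.isOpen_B)
  have hsub : Ω ∩ ball z c.r ⊆ Ω ∩ B := inter_subset_inter_right _ hcB
  have hb := ball_mem_nhds z c.r₁_pos
  obtain ⟨l, hl⟩ := exists_tendsto_of_holder (f := flux s d u)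
    (C := C * (2 * c.Λ + 1)) one_pos (by positivity) (fun x hx y hy => by
      rw [rpow_one, mul_assoc, norm_eq_abs]
      exact (H.flux_sub_le y x).trans (c.path_lipschitz (fun z hz => hu1 z (hsub hz))
        (fun z hz => hu z (hsub hz)) hy hx))
    (mem_closure_iff_nhdsWithin_neBot.2 (by
      rw [nhdsWithin_inter_of_mem' (mem_nhdsWithin_of_mem_nhds hb)]
      exact mem_closure_nhdsWithin hz.1))
  rw [nhdsWithin_inter_of_mem' (mem_nhdsWithin_of_mem_nhds hb)] at hl
  exact ⟨l, hl⟩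

lemma exists_quotient_limit (hz : z ∈ frontier Ω ∩ B) :
    ∃ l, Tendsto (fun z => lastC (gradient u z) / d z ^ (s - 1)) (𝓝[Ω] z) (𝓝 l) :=
  (H.exists_flux_limit hz).imp fun _ hl =>
    hl.congr' (by filter_upwards [self_mem_nhdsWithin] with x hx using H.flux_eq hx)

lemma boundaryTrace (c : EpiChart Ω x0) (hcB : ball x0 c.r ⊆ B) (hρ : ρ ≤ c.r1) (hc1 : 0 < c1)
    (hcomp : ∀ x ∈ Ω ∩ ball x0 ρ, c1 * c.height x ≤ d x ∧ d x ≤ C1 * c.height x) :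
    BoundaryTrace c ρ c1 C1 d (flux s d u)
      (extendFrom Ω fun z => lastC (gradient u z) / d z ^ (s - 1)) (gradient d) (gradient w)
      (extendFrom Ω (gradient w)) := by
  have hsub :=
    (ball_subset_ball hρ).trans c.ball_subset
  have hf : ∀ z ∈ frontier Ω ∩ ball x0 ρ, z ∈ frontier Ω ∩ B :=
    fun z hz => ⟨hz.1, hcB (hsub hz.2)⟩
  have hV : Ω ∩ ball x0 ρ ⊆ Ω ∩ B := inter_subset_inter_right _ (hsub.trans hcB)
  have hVo : IsOpen (Ω ∩ ball x0 ρ) := H.isOpen.inter isOpen_ball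
  have hδ : δ ∈ Ioc 0 1 := ⟨H.δ_mem.1, H.δ_mem.2.le⟩
  have hU := H.isOpen.inter H.isOpen_B
  refine ⟨by linarith [c.r₁_le, c.r₁_pos], hc1, hcomp,
    measurable_indicator_of_continuousOn hVo (H.continuousOn_flux.mono hV),
    measurable_indicator_of_continuousOn hVo ((continuousOn_gradient
      (H.dist.holder.exists_bounds hδ.1 hδ.2 hU).2.1).mono hV),
    fun z hz => ?_, fun z hz => ?_, fun z hz => tendsto_extendFrom hz.1 ?_, fun z hz => ?_⟩
  · refine (tendsto_extendFrom hz.1 (H.exists_quotient_limit (hf z hz))).congr' ?_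
    filter_upwards [self_mem_nhdsWithin] with x hx using (H.flux_eq hx).symm
  · rw [← c.innerNormal_eq H.isOpen (hsub hz.2) hz.1]
    exact (H.dist.boundary hδ H.isOpen H.isOpen_B H.boundary (hf z hz)).2.1
  · exact H.w_mem.2.1.exists_gradient_limit H.α_mem'.1 H.α_mem'.2 H.isOpen H.isOpen_B (hf z hz)
  · obtain ⟨h1, -, h2⟩ := H.dist.boundary hδ H.isOpen H.isOpen_B H.boundary (hf z hz)
    have he : inner ℝ (innerNormal Ω z) c.e = (c.jac (initC (c.A z)))⁻¹ := by
      rw [c.innerNormal_eq H.isOpen (hsub hz.2) hz.1, c.inner_nu_e]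
    rw [← he]
    refine h2 _ (h1.eventually_mem ?_)
    rw [real_inner_comm, he]
    exact inv_pos.2 (c.jac_pos _)

/-- The Hölder exponent of the inner regularity of `w`. -/
lemma exponent :
    min 1 (α + 2 * s) ∈ Ioc 0 1 ∧ 2 * s < 1 + min 1 (α + 2 * s) ∧ α ≤ min 1 (α + 2 * s) ∧
      1 + min 1 (α + 2 * s) ≤ 1 + α + 2 * s := by
  have hs := H.s_mem
  have hα := H.α_mem'
  rcases le_total 1 (α + 2 * s) with h | h
  · rw [min_eq_left h]
    exact ⟨by norm_num, by linarith [hs.2], hα.2, by linarith⟩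
  · rw [min_eq_right h]
    exact ⟨⟨by linarith [hs.1], h⟩, by linarith, by linarith [hs.1], by linarith⟩

/-- Bounds for `w` away from a point. -/
lemma exists_far_bound : ∃ A ≥ 0, ∀ κ > 0, ∀ x ∈ Ω ∩ B,
    ∀ᵐ y, κ ≤ ‖y - x‖ → |w y - w x| ≤ A / κ * ‖y - x‖ := by
  obtain ⟨-, -, C, hC, hw, -⟩ := H.w_mem.2.1.exists_bounds H.α_mem'.1 H.α_mem'.2
    (H.isOpen.inter H.isOpen_B)
  refine ⟨(eLpNorm w ⊤ volume).toReal + C, by positivity, fun κ hκ x hx => ?_⟩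
  have := ae_le_eLpNormEssSup (f := w) (μ := (volume : Measure (Pt m)))
  filter_upwards [this] with y hy hκy
  have h1 : |w y| ≤ (eLpNorm w ⊤ volume).toReal := by
    rw [← eLpNorm_exponent_top] at hy
    have := ENNReal.toReal_mono H.w_bdd.2.ne hy
    rwa [toReal_enorm] at this
  refine ((abs_sub _ _).trans (add_le_add h1 (hw x hx))).trans ?_
  rw [div_mul_eq_mul_div, le_div_iff₀ hκ]
  gcongr

/-- The regularity of `w` near a boundary point. -/
lemma exists_boundaryFunction (c : EpiChart Ω x0)
    (hcB : ball x0 c.r ⊆ B) {C : ℝ} (hρ0 : 0 < ρ) (hρ : ρ ≤ c.r1) (hC : 0 < C)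
    (hC1 : 0 < C1)
    (hcomp : ∀ x ∈ Ω ∩ ball x0 ρ, d x ≤ C1 * infDist x (frontier Ω)) :
    ∃ M k, BoundaryFunction Ω x0 ρ C M (1 + α) (1 + min 1 (α + 2 * s)) k d (dn Ω u) w
      (gradient w) := by
  obtain ⟨hτ, -, hατ, hτ1⟩ := H.exponent
  have hα := H.α_mem'
  have hM := c.one_le_Λ
  set τ := min 1 (α + 2 * s) with hτdef
  obtain ⟨hw1, hw2, Cw, hCw, hw3, hw4, hw5⟩ := H.w_mem.2.1.exists_bounds hα.1 hα.2
    (H.isOpen.inter H.isOpen_B)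
  obtain ⟨A, hA, hfar⟩ := H.exists_far_bound
  obtain ⟨D, hD⟩ := H.w_mem.2.2
  have hsub1 : ball x0 ρ ⊆ ball x0 c.r1 := ball_subset_ball hρ
  have hsubB : Ω ∩ ball x0 c.r ⊆ Ω ∩ B := inter_subset_inter_right _ hcB
  have hV : Ω ∩ ball x0 ρ ⊆ Ω ∩ B :=
    fun x hx => hsubB ⟨hx.1, c.ball_subset (hsub1 hx.2)⟩
  have hhalf : Ω ∩ ball x0 (ρ / 2) ⊆ Ω ∩ ball x0 ρ :=
    inter_subset_inter_right _ (ball_subset_ball (by linarith))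
  have hpΩ : ∀ y, dn Ω u y ≠ 0 → y ∈ Ω := fun y hy => by_contra fun h => hy (indicator_of_notMem h _)
  have hfar' : ∀ x ∈ Ω ∩ ball x0 (ρ / 2), ∀ y ∉ ball x0 ρ, ρ / 2 ≤ ‖y - x‖ := by
    intro x hx y hy
    have h1 := mem_ball_iff_norm.1 hx.2
    have h2 := not_lt.1 fun h => hy (mem_ball_iff_norm.2 h)
    have h3 := norm_sub_le_norm_sub_add_norm_sub y x x0
    linarith
  obtain ⟨M1, hM1⟩ : ∃ M1, M1 = A / (ρ / 2) + Cw * (2 * c.Λ + 1) := ⟨_, rfl⟩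
  have hM₁0 : 0 ≤ M1 := by rw [hM1]; positivity
  have hAρ : 0 ≤ A / (ρ / 2) := by positivity
  have hCc : 0 ≤ Cw * (2 * c.Λ + 1) := by positivity
  have hCτ : 0 ≤ Cw * (2 * c.Λ + 1) ^ (1 + α) := by positivity
  have hF : 0 ≤ (M1 + Cw) * (ρ / 2) ^ (-α) := by positivity
  have hG : 0 ≤ max D 0 * C1⁻¹ ^ (α - τ) := by positivity
  have incr : ∀ x ∈ Ω ∩ ball x0 (ρ / 2), ∀ᵐ y, dn Ω u y ≠ 0 →
      |w y - w x| ≤ M1 * ‖y - x‖ := by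
    intro x hx
    filter_upwards [hfar (ρ / 2) (by positivity) x (hV (hhalf hx))] with y hy hp
    by_cases hyb : y ∈ ball x0 ρ
    · refine (c.path_lipschitz (fun z hz => hw1 z (hsubB hz)) (fun z hz => hw4 z (hsubB hz))
        ⟨hx.1, hsub1 (hhalf hx).2⟩ ⟨hpΩ y hp, hsub1 hyb⟩).trans ?_
      rw [← mul_assoc]
      gcongr
      linarith
    · refine (hy (hfar' x hx y hyb)).trans ?_
      gcongr
      linarith
  have hv : ∀ x ∈ Ω ∩ ball x0 ρ, ‖gradient w x‖ ≤ Cw := fun x hx => by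
    rw [norm_gradient]
    exact hw4 x (hV hx)
  obtain ⟨k, hk⟩ : ∃ k, k = min (min (1 / (4 * C)) (ρ / 2)) (1 / (2 * C1)) := ⟨_, rfl⟩
  have hk0 : 0 < k := by
    rw [hk]
    exact lt_min (lt_min (by positivity) (by positivity)) (by positivity)
  refine ⟨M1 + Cw + Cw * (2 * c.Λ + 1) ^ (1 + α) + (M1 + Cw) * (ρ / 2) ^ (-α) +
      max D 0 * C1⁻¹ ^ (α - τ), k, H.w_bdd.1, by linarith, hk0, hk ▸ min_le_left _ _,
    fun x hx => (hv x hx).trans (by linarith),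
    measurable_indicator_of_continuousOn (H.isOpen.inter isOpen_ball)
      ((continuousOn_gradient hw2).mono hV), fun x hx => ?_, fun x hx => ?_, fun x hx y hy => ?_⟩
  · filter_upwards [incr x hx] with y hy hp
    refine (hy hp).trans ?_
    gcongr
    linarith
  · filter_upwards [incr x hx] with y hy hp
    by_cases hyb : y ∈ ball x0 ρ
    · have := c.path_holder (fun z hz => hw1 z (hsubB hz)) hα.1 hCw
        (fun z hz w hw => hw5 z (hsubB hz) w (hsubB hw)) ⟨hx.1, hsub1 (hhalf hx).2⟩
        ⟨hpΩ y hp, hsub1 hyb⟩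
      rw [norm_eq_abs, ← inner_gradient] at this
      refine this.trans ?_
      gcongr
      linarith
    · have h1 := hfar' x hx y hyb
      have h2 : |inner ℝ (gradient w x) (y - x)| ≤ Cw * ‖y - x‖ := by
        refine (abs_real_inner_le_norm _ _).trans ?_
        gcongr
        exact hv x (hhalf hx)
      have ht : 0 < ‖y - x‖ := by linarith
      calc _ ≤ M1 * ‖y - x‖ + Cw * ‖y - x‖ := (abs_sub _ _).trans (add_le_add (hy hp) h2)
        _ = (M1 + Cw) * (‖y - x‖ ^ (-α) * ‖y - x‖ ^ (1 + α)) := by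
          rw [← rpow_add ht, show -α + (1 + α) = 1 by ring, rpow_one]; ring
        _ ≤ (M1 + Cw) * ((ρ / 2) ^ (-α) * ‖y - x‖ ^ (1 + α)) := by
          have := rpow_le_rpow_of_nonpos (by positivity) h1 (neg_nonpos.2 hα.1.le)
          gcongr
        _ ≤ _ := by
          rw [← mul_assoc]
          gcongr
          linarith
  · have hd := H.dist.pos x hx.1
    obtain ⟨r, hr⟩ : ∃ r, r = infDist x (frontier Ω) := ⟨_, rfl⟩
    have hdr := hr ▸ hcomp x (hhalf hx)
    have hr0 := pos_of_mul_pos_right (hd.trans_le hdr) hC1.le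
    have hrle : r ≤ ‖x - x0‖ := by
      rw [hr, ← dist_eq_norm]
      exact infDist_le_dist_of_mem (c.base_mem_frontier H.isOpen)
    have hx2 := mem_ball_iff_norm.1 hx.2
    have hball : ball x r ⊆ Ω ∩ B := by
      refine subset_inter ?_ fun y hy => hcB (c.ball_subset (hsub1 ?_))
      · refine (convex_ball x r).isPreconnected.subset_of_closure_inter_subset H.isOpen
          ⟨x, mem_ball_self hr0, hx.1⟩ fun y hy => by_contra fun h => ?_
        have h1 := infDist_le_dist_of_mem (x := x)
          (show y ∈ frontier Ω by rw [H.isOpen.frontier_eq]; exact ⟨hy.1, h⟩)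
        have h2 := mem_ball'.1 hy.2
        linarith
      · have h1 := mem_ball_iff_norm.1 hy
        have h2 := norm_sub_le_norm_sub_add_norm_sub y x x0
        exact mem_ball_iff_norm.2 (by linarith)
    have hS := hD (1 + τ) ⟨by linarith, hτ1⟩ x hx.1 r hr hball
    have hkr : k * d x ≤ r / 2 := by
      have h1 := hk ▸ min_le_right _ _
      calc k * d x ≤ 1 / (2 * C1) * (C1 * r) := by gcongr
        _ = r / 2 := by field_simp
    have hsubr : ball x (r / 2) ⊆ Ω ∩ B :=
      (ball_subset_ball (by linarith)).trans hball
    refine (taylor_ball (M := max D 0 * r ^ (α - τ)) (by positivity) hτ.1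
      (fun z hz => hw1 z (hsubr hz)) (fun a ha b hb => ?_) (mem_ball_self (by positivity))
      (mem_ball_iff_norm.2 (hy.trans_le hkr))).trans ?_
    · refine (hS.fderiv_le hτ.1 hτ.2 ha hb).trans ?_
      rw [show 1 + α - (1 + τ) = α - τ by ring]
      gcongr
      exact le_max_left _ _
    · rw [show 1 + α - (1 + τ) = α - τ by ring]
      have h1 : r ^ (α - τ) ≤ C1⁻¹ ^ (α - τ) * d x ^ (α - τ) := by
        rw [← mul_rpow (by positivity) hd.le]
        refine rpow_le_rpow_of_nonpos (by positivity) ?_ (by linarith)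
        rwa [inv_mul_le_iff₀ hC1]
      refine mul_le_mul_of_nonneg_right ((mul_le_mul_of_nonneg_left h1 (le_max_right _ _)).trans ?_)
        (by positivity)
      rw [← mul_assoc]
      gcongr
      linarith

/-- The model near an interior point. -/
lemma exists_interiorModel (hz : z ∈ Ω ∩ B)
    (hg : AbsGrowth (dn Ω u) Cp (m + s)) : ∃ ρ M, ball z ρ ⊆ Ω ∩ B ∧
      InteriorModel z s ρ M (1 + min 1 (α + 2 * s)) Cp (dn Ω u) w (gradient w) := by
  obtain ⟨hτ, -, -, -⟩ := H.exponent
  have hα := H.α_mem'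
  have hU := H.isOpen.inter H.isOpen_B
  obtain ⟨hw1, -, Cw, hCw, -, hw4, -⟩ := H.w_mem.2.1.exists_bounds hα.1 hα.2 hU
  obtain ⟨R1, hR1, M1, hM1, h₁⟩ := H.exists_dn_lipschitz hz
  obtain ⟨R2, hR2, hsub, M2, hM2, h₂⟩ := H.w_mem.1.exists_fderiv_holder
    (by linarith [hα.1, H.s_mem.1]) hU hz
  rw [show 1 + α + 2 * s - 1 = α + 2 * s by ring] at h₂
  obtain ⟨A, hA, hfar⟩ := H.exists_far_bound
  obtain ⟨ρ, hρ⟩ : ∃ ρ, ρ = min R1 R2 / 2 := ⟨_, rfl⟩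
  have hρ0 : 0 < ρ := by rw [hρ]; have := lt_min hR1 hR2; positivity
  have b1 : ball z (2 * ρ) ⊆ ball z R1 :=
    ball_subset_ball (by linarith [min_le_left R1 R2])
  have b2 : ball z (2 * ρ) ⊆ ball z R2 :=
    ball_subset_ball (by linarith [min_le_right R1 R2])
  have b0 : ball z ρ ⊆ ball z (2 * ρ) := ball_subset_ball (by linarith)
  have bxy : ∀ x ∈ ball z ρ, ∀ y, ‖y - x‖ < ρ → y ∈ ball z (2 * ρ) := by
    intro x hx y hy
    have h1 := mem_ball_iff_norm.1 hx
    have h2 := norm_sub_le_norm_sub_add_norm_sub y x z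
    exact mem_ball_iff_norm.2 (by linarith)
  have hAρ : 0 ≤ A / ρ := by positivity
  refine ⟨ρ, M1 + M2 + Cw + A / ρ, (b0.trans b2).trans hsub, hρ0, by positivity, H.w_bdd.1,
    H.measurable_dn, hg, fun y hy => (h₁ y (b1 hy)).1.trans (by linarith), fun x hx y hy => ?_,
    fun x hx => ?_, fun x hx => ?_, fun x hx y hy => ?_⟩
  · refine ((h₁ x (b1 (b0 hx))).2 y (b1 (bxy x hx y hy))).trans ?_
    gcongr
    linarith
  · rw [norm_gradient]
    exact (hw4 x (hsub (b2 (b0 hx)))).trans (by linarith)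
  · filter_upwards [hfar ρ hρ0 x (hsub (b2 (b0 hx)))] with y hy _
    rcases lt_or_ge ‖y - x‖ ρ with h | h
    · refine ((convex_ball z (2 * ρ)).norm_image_sub_le_of_norm_fderiv_le
        (fun p hp => hw1 p (hsub (b2 hp))) (fun p hp => hw4 p (hsub (b2 hp))) (b0 hx)
        (bxy x hx y h)).trans ?_
      gcongr
      linarith
    · refine (hy h).trans ?_
      gcongr
      linarith
  · refine (taylor_ball hM2 hτ.1 (fun p hp => hw1 p (hsub hp)) h₂ (b2 (b0 hx))
      (b2 (bxy x hx y hy))).trans ?_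
    gcongr
    linarith

end DomainData

/-- An additive property of test functions may be checked locally. -/
lemma induction_on_support {P : (Pt m → ℝ) → Prop} {S : Set (Pt m)} (h0 : P fun _ => 0)
    (hadd : ∀ f g : Pt m → ℝ, P f → P g → P fun x => f x + g x)
    (hloc : ∀ z ∈ S, ∃ U ∈ 𝓝 z, ∀ η : Pt m → ℝ, ContDiff ℝ ∞ η → HasCompactSupport η →
      tsupport η ⊆ U → tsupport η ⊆ S → P η) (hη : ContDiff ℝ ∞ η)
    (hc : HasCompactSupport η) (hS : tsupport η ⊆ S) : P η := by
  have key : ∃ U, IsOpen U ∧ tsupport η ⊆ U ∧ ∀ η : Pt m → ℝ, ContDiff ℝ ∞ η →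
      HasCompactSupport η → tsupport η ⊆ U → tsupport η ⊆ S → P η := by
    refine hc.isCompact.induction_on ?_ ?_ ?_ ?_
    · refine ⟨∅, isOpen_empty, subset_rfl, fun η _ _ h _ => ?_⟩
      rwa [tsupport_eq_empty_iff.1 (subset_empty_iff.1 h)]
    · rintro T T' hT ⟨U, h1, h2, h3⟩
      exact ⟨U, h1, hT.trans h2, h3⟩
    · rintro T T' ⟨U, h1, h2, h3⟩ ⟨U', h1', h2', h3'⟩
      refine ⟨U ∪ U', h1.union h1', union_subset_union h2 h2', fun η hη hc hU hS => ?_⟩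
      have hcl := isClosed_tsupport η
      obtain ⟨χ, hχ0, hχ1, -⟩ := exists_contMDiffMap_zero_one_nhds_of_isClosed
        𝓘(ℝ, Pt m) (hcl.sdiff h1) (hcl.sdiff h1')
        (disjoint_left.2 fun x hx hx' => (hU hx.1).elim hx.2 hx'.2)
      have hχ := χ.contMDiff.contDiff
      have e : η = fun x => χ x * η x + (1 - χ x) * η x := by
        funext x
        ring
      have hsub : ∀ {ψ : Pt m → ℝ} {V : Set (Pt m)}, (∀ᶠ x in 𝓝ˢ (tsupport η \ V), ψ x = 0) →
          tsupport (fun x => ψ x * η x) ⊆ V := by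
        intro ψ V h x hx
        by_contra hxV
        refine notMem_tsupport_iff_eventuallyEq.2 ?_ hx
        have hx' : x ∈ tsupport η \ V := ⟨tsupport_mul_subset_right hx, hxV⟩
        filter_upwards [h.filter_mono (nhds_le_nhdsSet hx')] with y hy
        rw [hy, zero_mul, Pi.zero_apply]
      rw [e]
      refine hadd _ _ (h3 _ (hχ.mul hη) hc.mul_left (hsub hχ0) (tsupport_mul_subset_right.trans hS))
        (h3' _ ((contDiff_const.sub hχ).mul hη) hc.mul_left (hsub ?_)
          (tsupport_mul_subset_right.trans hS))
      filter_upwards [hχ1] with x hx using by rw [hx, sub_self]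
    · intro z hz
      obtain ⟨U, hU, h⟩ := hloc z (hS hz)
      exact ⟨interior U, mem_nhdsWithin_of_mem_nhds (interior_mem_nhds.2 hU), interior U,
        isOpen_interior, subset_rfl, fun η h1 h2 h3 => h η h1 h2 (h3.trans interior_subset)⟩
  obtain ⟨U, -, hU, h⟩ := key
  exact h η hη hc hU hS

namespace DomainData

variable (H : DomainData s α δ Ω B d w u)
include H

/-- Green's formula in the domain. -/
theorem green (k : Ker s lam Lam K) (hB1 : MeasurableSet B1) (hsub : B1 ⊆ B) (hη : ContDiff ℝ ∞ η) (hc : HasCompactSupport η) (hS : tsupport η ⊆ B1) :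
    Green Ω B1 K (dn Ω u) w
      (fun x => inner ℝ (ThetaKΩ s K Ω u d x) (extendFrom Ω (gradient w) x)) η := by
  obtain ⟨Cp, hg⟩ := H.exists_growth_dn
  obtain ⟨hτ, h2s, -, -⟩ := H.exponent
  refine induction_on_support (green_zero _ _ _ _ _ _) (fun _ _ h h' => h.add h')
    (fun z hz => ?_) hη hc hS
  by_cases hzc : z ∈ closure Ω
  · by_cases hzΩ : z ∈ Ω
    · obtain ⟨ρ, M, hb, hI⟩ := H.exists_interiorModel ⟨hzΩ, hsub hz⟩ hg
      exact ⟨_, ball_mem_nhds z hI.radius, fun η hη hc h _ =>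
        hI.green k h2s hB1 (disjoint_left.2 fun x hx hx' => by
          rw [H.isOpen.frontier_eq] at hx
          exact hx.2 (hb hx').1) _ hη hc h⟩
    · have hzf : z ∈ frontier Ω ∩ B := ⟨by rw [H.isOpen.frontier_eq]; exact ⟨hzc, hzΩ⟩, hsub hz⟩
      obtain ⟨c, hcB⟩ := H.exists_chart hzf
      obtain ⟨ρ, C, c1, C1, hρ, hc1, hC1, hcomp, hρ0, -, hmodel⟩ := H.exists_boundaryModel hzf c hcB
      have hm := hmodel Cp H.measurable_dn hg
      obtain ⟨M, κ, hf⟩ := H.exists_boundaryFunction c hcB hρ0 hρ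
        (one_pos.trans_le hm.one_le_C) hC1 fun x hx => (hcomp x hx).2.2
      have ht := H.boundaryTrace c hcB hρ hc1 fun x hx => ⟨(hcomp x hx).1, (hcomp x hx).2.1⟩
      exact ⟨_, ball_mem_nhds z (half_pos hρ0), fun η hη hc h h' =>
        hm.green k ⟨H.δ_mem.1, H.δ_mem.2⟩ H.isOpen hf
          ⟨by linarith [H.α_mem.1], by linarith [H.α_mem.2]⟩ h2s ht hB1 hη hc (subset_inter h h')⟩
  · refine ⟨_, isClosed_closure.isOpen_compl.mem_nhds hzc, fun η hη hc h _ =>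
      green_of_weight_eq_zero hB1 (fun x hx => ?_) fun x hx => ?_⟩
    · exact indicator_of_notMem (fun h' => h hx (subset_closure h')) _
    · exact fun h' => h hx (frontier_subset_closure h')

lemma opExists (k : Ker s lam Lam K) (hx : x ∈ Ω ∩ B) : OpExists (kerU Ω u K) w x := by
  obtain ⟨Cp, hg⟩ := H.exists_growth_dn
  obtain ⟨ρ, M, -, hI⟩ := H.exists_interiorModel hx hg
  obtain ⟨_, -, hE⟩ := hI.exists_oddRem_bound k H.exponent.2.1
  exact (hI.opExists k (hE x (mem_ball_self hI.radius)).1).1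

/-- The integration by parts formula in the domain, with all the assertions of convergence. -/
theorem formula (k : Ker s lam Lam K) (hB1 : MeasurableSet B1) (hsub : B1 ⊆ B)
    (hη : ContDiff ℝ ∞ η) (hc : HasCompactSupport η) (hS : tsupport η ⊆ B1) :
    IntegrableOn (fun p : Pt m × Pt m =>
      (w p.1 - w p.2) * (η p.1 - η p.2) * kerU Ω u K p.1 p.2) (Ω ×ˢ Ω) ∧
    (∀ x ∈ Ω ∩ B1, OpExists (kerU Ω u K) w x) ∧
    IntegrableOn (fun x => η x * op (kerU Ω u K) w x) Ω ∧
    (∀ x ∈ frontier Ω ∩ B1, IsInnerNormal Ω x (innerNormal Ω x) ∧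
      (∃ l, Tendsto (fun z => lastC (gradient u z) / d z ^ (s - 1)) (𝓝[Ω] x) (𝓝 l)) ∧
      (∃ l, Tendsto (gradient w) (𝓝[Ω] x) (𝓝 l)) ∧
      IntegrableOn (sphereInt s K (innerNormal Ω x)) (halfSphere (innerNormal Ω x))
        ((volume : Measure (Pt m)).toSphere)) ∧
    IntegrableOn (fun x => η x * inner ℝ (ThetaKΩ s K Ω u d x) (extendFrom Ω (gradient w) x))
      (frontier Ω ∩ B1) μHE[m] ∧
    ∫ x in Ω, ∫ y in Ω, (w x - w y) * (η x - η y) * kerU Ω u K x y =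
      (∫ x in Ω, η x * op (kerU Ω u K) w x) - ∫ x in frontier Ω ∩ B1,
        η x * inner ℝ (ThetaKΩ s K Ω u d x) (extendFrom Ω (gradient w) x) ∂μHE[m] := by
  have hG := H.green k hB1 hsub hη hc hS
  have hdn : ∀ x ∉ Ω, dn Ω u x = 0 := fun x hx => indicator_of_notMem hx _
  have e : ∀ z : Pt m × Pt m, (w z.1 - w z.2) * (η z.1 - η z.2) * kerU Ω u K z.1 z.2 =
      (η z.1 - η z.2) * (w z.1 - w z.2) * (dn Ω u z.1 * dn Ω u z.2 * K (z.1 - z.2)) :=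
    fun z => by rw [kerU]; ring
  have hi : Integrable fun z : Pt m × Pt m =>
      (w z.1 - w z.2) * (η z.1 - η z.2) * kerU Ω u K z.1 z.2 := by
    simp only [e]
    exact hG.energy
  refine ⟨hi.integrableOn, fun x hx => H.opExists k ⟨hx.1, hsub hx.2⟩,
    hG.operator.integrableOn, fun x hx => ?_, hG.boundary, ?_⟩
  · have hx' : x ∈ frontier Ω ∩ B := ⟨hx.1, hsub hx.2⟩
    have h1 := (H.dist.boundary ⟨H.δ_mem.1, H.δ_mem.2.le⟩ H.isOpen H.isOpen_B H.boundary hx').1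
    exact ⟨h1, H.exists_quotient_limit hx',
      H.w_mem.2.1.exists_gradient_limit H.α_mem'.1 H.α_mem'.2 H.isOpen H.isOpen_B hx',
      integrableOn_sphereInt k (norm_pos_iff.1 (h1.1 ▸ one_pos))⟩
  · have h1 : ∀ x, ∫ y in Ω, (w x - w y) * (η x - η y) * kerU Ω u K x y =
        ∫ y, (w x - w y) * (η x - η y) * kerU Ω u K x y := fun x =>
      setIntegral_eq_integral_of_forall_compl_eq_zero fun y hy => by simp [kerU, hdn y hy]
    simp only [h1]
    rw [setIntegral_eq_integral_of_forall_compl_eq_zero fun x hx => by simp [kerU, hdn x hx],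
      setIntegral_eq_integral_of_forall_compl_eq_zero fun x hx => by
        rw [show kerU Ω u K = pairKernel K (dn Ω u) from rfl,
          (op_pairKernel_of_eq_zero (hdn x hx)).2, mul_zero], ← integral_prod _ hi]
    simp only [e]
    exact hG.identity

end DomainData

end WeightedIBP

end

theorem mainTheorem8 (m : ℕ) (s lam Lam α : ℝ) (hs : s ∈ Set.Ioo (0 : ℝ) 1)
    (hlam : 0 < lam) (hLam : lam ≤ Lam) (hα : α ∈ Set.Ioo 0 s)
    (K : WeightedIBP.Pt m → ℝ) (hK : WeightedIBP.IsKernel s lam Lam K)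
    (hKreg : WeightedIBP.HolderOnSphere (5 + 2 * α) K) :
    -- the constant `c_s` and the vector `θ_K` are given by absolutely convergent integrals
    (IntegrableOn (fun p : ℝ × ℝ => p.1 ^ (s - 1) * (p.2 ^ (s - 1) * |p.1 - p.2| ^ (-2 * s)))
        (Set.Ioo (0 : ℝ) 1 ×ˢ Set.Ioi (1 : ℝ)) ∧
      Integrable (fun h' : EuclideanSpace ℝ (Fin m) =>
        K (WeightedIBP.mk h' 1) • WeightedIBP.mk h' 1)) ∧
    -- the half-space
    (∀ γ ∈ Set.Ioo (max 0 (2 * s - 1)) (s + 1), ∀ v : WeightedIBP.Pt m → ℝ,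
      WeightedIBP.HolderLoc γ v Set.univ →
      (∃ C : ℝ, ∀ x, |v x| ≤ C * (1 + ‖x‖ ^ γ)) →
      ∀ η : WeightedIBP.Pt m → ℝ, ContDiff ℝ ∞ η → HasCompactSupport η →
        Integrable (fun p : WeightedIBP.Pt m × WeightedIBP.Pt m =>
          (v p.1 - v p.2) * (η p.1 - η p.2) * WeightedIBP.weight s p.1 * WeightedIBP.weight s p.2
            * K (p.1 - p.2)) ∧
        (∀ x, 0 < WeightedIBP.lastC x →
          WeightedIBP.OpExists (fun x y => K (y - x)) (fun z => WeightedIBP.weight s z * η z) x) ∧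
        IntegrableOn (fun x => v x * WeightedIBP.weight s x *
          WeightedIBP.opL K (fun z => WeightedIBP.weight s z * η z) x)
          {x | 0 < WeightedIBP.lastC x} ∧
        Integrable (fun x' : EuclideanSpace ℝ (Fin m) =>
          inner ℝ (WeightedIBP.thetaK s K) (gradient η (WeightedIBP.mk x' 0))
            * v (WeightedIBP.mk x' 0)) ∧
        ∫ x, ∫ y, (v x - v y) * (η x - η y) * WeightedIBP.weight s x * WeightedIBP.weight s y
            * K (x - y)
          = (∫ x in {x | 0 < WeightedIBP.lastC x}, v x * WeightedIBP.weight s x *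
              WeightedIBP.opL K (fun z => WeightedIBP.weight s z * η z) x)
            - ∫ x' : EuclideanSpace ℝ (Fin m),
                inner ℝ (WeightedIBP.thetaK s K) (gradient η (WeightedIBP.mk x' 0))
                  * v (WeightedIBP.mk x' 0)) ∧
    -- general domains
    (∀ δ ∈ Set.Ioo (max 0 (2 * s - 1)) s, ∀ Ω : Set (WeightedIBP.Pt m), IsOpen Ω →
      WeightedIBP.BoundaryC1Holder δ Ω (Metric.ball 0 2) →
      ∀ d : WeightedIBP.Pt m → ℝ, WeightedIBP.IsRegDist δ Ω (Metric.ball 0 2) d →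
      ∀ w : WeightedIBP.Pt m → ℝ,
      WeightedIBP.HolderWeighted (1 + α + 2 * s) (1 + α) w Ω (Metric.ball 0 2) →
      MemLp w ⊤ volume →
      ∀ u : WeightedIBP.Pt m → ℝ, DifferentiableOn ℝ u Ω →
      WeightedIBP.HolderCompact (1 + δ) (fun x => d x ^ (1 - s) • gradient u x) Ω
        (Metric.ball 0 2) →
      ∀ η : WeightedIBP.Pt m → ℝ, ContDiff ℝ ∞ η → HasCompactSupport η →
        tsupport η ⊆ Metric.ball 0 1 →
        IntegrableOn (fun p : WeightedIBP.Pt m × WeightedIBP.Pt m =>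
          (w p.1 - w p.2) * (η p.1 - η p.2) * WeightedIBP.kerU Ω u K p.1 p.2) (Ω ×ˢ Ω) ∧
        (∀ x ∈ Ω ∩ Metric.ball 0 1, WeightedIBP.OpExists (WeightedIBP.kerU Ω u K) w x) ∧
        IntegrableOn (fun x => η x * WeightedIBP.op (WeightedIBP.kerU Ω u K) w x) Ω ∧
        (∀ x ∈ frontier Ω ∩ Metric.ball 0 1,
          WeightedIBP.IsInnerNormal Ω x (WeightedIBP.innerNormal Ω x) ∧
          (∃ l, Tendsto (fun z => WeightedIBP.lastC (gradient u z) / d z ^ (s - 1))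
            (𝓝[Ω] x) (𝓝 l)) ∧
          (∃ l, Tendsto (gradient w) (𝓝[Ω] x) (𝓝 l)) ∧
          IntegrableOn (WeightedIBP.sphereInt s K (WeightedIBP.innerNormal Ω x))
            (WeightedIBP.halfSphere (WeightedIBP.innerNormal Ω x))
            ((volume : Measure (WeightedIBP.Pt m)).toSphere)) ∧
        IntegrableOn (fun x => η x *
            inner ℝ (WeightedIBP.ThetaKΩ s K Ω u d x) (extendFrom Ω (gradient w) x))
          (frontier Ω ∩ Metric.ball 0 1) μHE[m] ∧
        ∫ x in Ω, ∫ y in Ω, (w x - w y) * (η x - η y) * WeightedIBP.kerU Ω u K x y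
          = (∫ x in Ω, η x * WeightedIBP.op (WeightedIBP.kerU Ω u K) w x)
            - ∫ x in frontier Ω ∩ Metric.ball 0 1, η x *
                inner ℝ (WeightedIBP.ThetaKΩ s K Ω u d x) (extendFrom Ω (gradient w) x) ∂μHE[m]) := by
  have k : WeightedIBP.Ker s lam Lam K := ⟨hs, hlam, hK, hK.measurable hKreg⟩
  refine ⟨⟨WeightedIBP.integrableOn_cs hs, WeightedIBP.integrable_mk_one k⟩,
    fun γ hγ v hv hg η hη hc => WeightedIBP.halfSpace_formula k hγ hv hg hη hc,
    fun δ hδ Ω hΩ hB d hd w hw hwb u _ hu η hη hc hS => ?_⟩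
  have hδ' : δ ∈ Set.Ioo (0 : ℝ) 1 := ⟨(le_max_left _ _).trans_lt hδ.1, hδ.2.trans hs.2⟩
  exact WeightedIBP.DomainData.formula
    ⟨hs, hα, hδ', hΩ, Metric.isOpen_ball, hB, hd, hw, hwb, hu⟩ k
    Metric.isOpen_ball.measurableSet (Metric.ball_subset_ball one_le_two) hη hc hS
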